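/- **Setting.** Let $(\mathbb K,\otimes)$ be a commutative monoid with unit $1$ and absorbing zero $0$, with additive operators $\oplus^i$ ($i\in\iota$) such that every $(\mathbb K,\oplus^i,\otimes)$ is a commutative semiring with the same $0$. Let $\mathcal H=(\mathcal V,\mathcal E)$ be a finite hypergraph with $\mathcal V=\bigcup_{F\in\mathcal E}F$. An ordering $\alpha$ is a sequence of pairs $(a,\odot)$, with $a\in\mathcal V$ and $\odot\in\{\oplus^i\}_{i\in\iota}\cup\{\otimes\}$, in which each attribute occurs at most once; attributes not occurring are output attributes. If $\otimes$ occurs in $\alpha$, assume that $x\otimes x=x$ for all $x\in\mathbb K$. An instance $I$ consists of a non-empty domain $\mathcal D^a$ (of natural numbers) for each attribute $a$, and for each $F\in\mathcal E$ a finite relation $R_F\subseteq\prod_{a\in F}\mathcal D^a$ with an annotation in $\mathbb K$ for each tuple. The annotation of a tuple of the join $\Join_F R_F$ is the $\otimes$-product of the annotations of its projections. The aggregation $(a,\oplus^i)$ replaces each non-empty group of tuples that agree outside $a$ by one tuple annotated with the $\oplus^i$-sum; $(a,\otimes)$ keeps a tuple only if its extensions by all values of $\mathcal D^a$ are present, and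 annotates it with the $\otimes$-product over them. The query is $Q_{\mathcal H,\alpha}(I)=\Sigma_{\alpha_1}\cdots\Sigma_{\alpha_s}\Join_F R_F$. Put $\mathrm{IN}=\sum_F|R_F|$ and $\mathrm{OUT}=|Q_{\mathcal H,\alpha}(I)|$. An ordering $\beta$ is equivalent to $\alpha$ if it is a permutation of $\alpha$ and $Q_{\mathcal H,\alpha}(I)=Q_{\mathcal H,\beta}(I)$ for all instances $I$ (with arbitrary domains). A product partition $P$ partitions, for each attribute $a$ with $(a,\otimes)$ in $\alpha$, the set of hyperedges containing $a$. The hypergraph $\mathcal H_P$ has one copy of such an $a$ for each block, and in each hyperedge $F$ the attribute $a$ is replaced by its copy for the block of $F$; other attributes are unchanged. An AGHD is a triple $(\mathcal T,\chi,P)$ in which $\mathcal T$ is a finite rooted tree and $\chi$ maps its nodes to sets of vertices of $\mathcal H_P$ (bags), such that each hyperedge of $\mathcal H_P$ is contained in a bag and, for each vertex of $\mathcal H_P$, the nodes whose bag contains it form a connected subtree. $TOP(a)$ is the set of the topmost nodes of the copies of $a$. The AGHD is compatible with $\beta$ if for all $a\neq b$ such that some node of $TOP(a)$ is a proper ancestor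 of some node of $TOP(b)$, either $a$ is an output attribute or $a$ occurs before $b$ in $\beta$. For an instance $I$, the width $fhw$ of the AGHD is the maximum over the nodes $t$ of the minimum of $\sum_F x_F\log_{\mathrm{IN}}|R_F|$ over all $x\ge 0$ with $\sum_{F\ni c}x_F\ge1$ for all $c\in\chi(t)$, where $F$ ranges over the hyperedges of $\mathcal H_P$ and $R_F$ is the relation of the hyperedge of $\mathcal H$ from which $F$ arises. (Convention: $\log_{\mathrm{IN}}0=0$, and $\log_{\mathrm{IN}}=0$ if $\mathrm{IN}\le 1$.) **Theorem.** For every such $\mathcal H$, operator set and $\alpha$ there are a word-RAM program and constants $C,k,c$ such that for every instance $I$: 1. among the widths, for $I$, of the AGHDs that are compatible with some ordering equivalent to $\alpha$ there is a smallest one, $w^*$; 2. given $I$ (its relations listed in arbitrary row order, together with the sizes of the relations and of the domains, an infinite domain being marked by $0$), the program halts with a listing of $Q_{\mathcal H,\alpha}(I)$, each tuple once and with its annotation, after at most $$C\,\bigl(\mathrm{IN}+\mathrm{IN}^{w^*}+\mathrm{OUT}\bigr)\,(1+\log\mathrm{IN})^{k}$$ steps, i.e. in time $\widetilde O(\mathrm{IN}+\mathrm{IN}^{w^*}+\mathrm{OUT})$;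 in particular in time $\widetilde O(\mathrm{IN}^{w^*}+\mathrm{OUT})$ whenever $w^*\ge1$. One step is one arithmetic operation on words, one test, one memory access with indirect addressing, or one operation $\oplus^i$, $\otimes$ on annotations, which the program can only move and combine. Words are natural numbers, with arithmetic modulo an arbitrary $W\ge B^{c}$, where $B\geq 2$ is any upper bound for $\mathrm{IN}$, for the attribute values in the relations and for the sizes of the finite domains. -/

import Mathlib

noncomputable section

namespace Ajar

/-! ### Hypergraphs, operators, aggregation orderings -/

/-- A hypergraph with attributes `Fin n` and `m` pairwise distinct hyperedges whose union is
the set of all attributes. -/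
structure Hypergraph (n m : ℕ) where
  edge : Fin m → Finset (Fin n)
  edge_injective : Function.Injective edge
  covered : ∀ a, ∃ j, a ∈ edge j

/-- The (indices of the) hyperedges that contain the attribute `a`. -/
def Hypergraph.star {n m : ℕ} (H : Hypergraph n m) (a : Fin n) : Finset (Fin m) :=
  Finset.univ.filter fun j => a ∈ H.edge j

/-- The additive operators `plus i` of an operator set over `K`: each `(K, plus i, *)` is a
commutative semiring, all of them with the same zero. The laws that involve only `*`, `0`, `1`
are those of `CommMonoidWithZero K`. -/
structure PlusOps (ι K : Type*) [CommMonoidWithZero K] where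
  plus : ι → K → K → K
  comm : ∀ i, Std.Commutative (plus i)
  assoc : ∀ i, Std.Associative (plus i)
  plus_zero : ∀ i x, plus i x 0 = x
  mul_plus : ∀ i x y z, x * plus i y z = plus i (x * y) (x * z)

/-- An aggregation operator: an additive operator of the operator set, or the product. -/
inductive Op (ι : Type*) where
  | plus (i : ι) : Op ι
  | prod : Op ι

/-- A sequence of attribute-operator pairs; the first one is applied last (outermost). -/
abbrev Ordering (n : ℕ) (ι : Type*) := List (Fin n × Op ι)

/-- The aggregated attributes, in order. -/
def Ordering.attrs {n : ℕ} {ι : Type*} (α : Ordering n ι) : List (Fin n) := α.map Prod.fst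

/-- `a` occurs before `b` (the attributes of an ordering occur at most once). -/
def Ordering.Precedes {n : ℕ} {ι : Type*} (α : Ordering n ι) (a b : Fin n) : Prop :=
  [a, b].Sublist α.attrs

/-- The output attributes: those that are not aggregated. -/
abbrev Ordering.Out {n : ℕ} {ι : Type*} (α : Ordering n ι) := {a : Fin n // a ∉ α.attrs}

/-! ### Annotated relations and queries -/

/-- A database instance: for each attribute a non-empty domain, whose values are
represented by natural numbers, and for each hyperedge a finite annotated relation,
as a partial function from tuples to annotations. A listed tuple may have annotation `0`. -/
structure Instance {n m : ℕ} (H : Hypergraph n m) (K : Type*) where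
  dom : Fin n → Set ℕ
  dom_nonempty : ∀ a, (dom a).Nonempty
  rel : (j : Fin m) → ({a // a ∈ H.edge j} → ℕ) → Option K
  finite : ∀ j, {t | (rel j t).isSome}.Finite
  mem_dom : ∀ j t, (rel j t).isSome → ∀ a : {a // a ∈ H.edge j}, t a ∈ dom a

section Query

variable {n m : ℕ} {H : Hypergraph n m} {ι K : Type*}

/-- The tuples listed in the `j`-th relation. -/
abbrev Instance.Rows (I : Instance H K) (j : Fin m) := {t // (I.rel j t).isSome}

/-- The size of the `j`-th relation. -/
def Instance.card (I : Instance H K) (j : Fin m) : ℕ := Nat.card (I.Rows j)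

/-- The input size `IN`. -/
def Instance.inSize (I : Instance H K) : ℕ := ∑ j, I.card j

/-- Relations that occur during the evaluation are partial functions on assignments of all
attributes; the value does not depend on attributes outside the schema of the relation. -/
abbrev Rel (n : ℕ) (K : Type*) := (Fin n → ℕ) → Option K

variable [CommMonoidWithZero K]

/-- The join of all relations of the instance. -/
def Instance.join (I : Instance H K) : Rel n K := fun t =>
  if ∀ j, (I.rel j fun a => t a).isSome then some (∏ j, (I.rel j fun a => t a).getD 1) else none

/-- The values `v` of the attribute `a` for which `t`, with `v` at `a`, is listed in `R`. -/
def group (R : Rel n K) (a : Fin n) (t : Fin n → ℕ) : Set ℕ :=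
  {v | (R (Function.update t a v)).isSome}

/-- The annotation of `t` with `v` at `a`. -/
def annotation (R : Rel n K) (a : Fin n) (t : Fin n → ℕ) (v : ℕ) : K :=
  (R (Function.update t a v)).getD 1

open Classical in
/-- Aggregation of `a` by an additive operator: one tuple for each non-empty group, annotated
by the sum over the group. Groups are finite in every relation that arises from an instance. -/
def aggPlus (O : PlusOps ι K) (i : ι) (a : Fin n) (R : Rel n K) : Rel n K := fun t =>
  haveI := O.comm i
  haveI := O.assoc i
  if h : (group R a t).Finite ∧ (group R a t).Nonempty then
    some (h.1.toFinset.fold (O.plus i) 0 (annotation R a t))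
  else none

open Classical in
/-- Product aggregation of `a` over the domain `D`: a tuple is kept only if all its extensions
by a value of `D` are present. -/
def aggProd (D : Set ℕ) (a : Fin n) (R : Rel n K) : Rel n K := fun t =>
  if h : (group R a t).Finite ∧ D ⊆ group R a t then
    some (∏ v ∈ h.1.toFinset, annotation R a t v)
  else none

/-- Aggregation by an arbitrary operator. -/
def aggregate (O : PlusOps ι K) (I : Instance H K) (x : Fin n × Op ι) (R : Rel n K) : Rel n K :=
  match x.2 with
  | .plus i => aggPlus O i x.1 R
  | .prod => aggProd (I.dom x.1) x.1 R

/-- The query: all relations are joined, then the aggregations are performed, from the last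
one of the ordering to the first one. -/
def query (O : PlusOps ι K) (α : Ordering n ι) (I : Instance H K) : Rel n K :=
  α.foldr (aggregate O I) I.join

/-- The answer of the query as a relation over the output attributes (the value of `query` does
not depend on the aggregated attributes, which are filled up by `0`). -/
def answer (O : PlusOps ι K) (α : Ordering n ι) (I : Instance H K) (s : α.Out → ℕ) :
    Option K :=
  query O α I fun a => if h : a ∉ α.attrs then s ⟨a, h⟩ else 0

/-- The tuples of the answer. -/
abbrev AnswerRows (O : PlusOps ι K) (α : Ordering n ι) (I : Instance H K) :=
  {s : α.Out → ℕ // (answer O α I s).isSome}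

/-- The output size `OUT`. -/
def outSize (O : PlusOps ι K) (α : Ordering n ι) (I : Instance H K) : ℕ :=
  Nat.card (AnswerRows O α I)

/-- Equivalent orderings: they aggregate the same attributes with the same operators, and they
give the same answer on every instance (with arbitrary domains). -/
def Equivalent (H : Hypergraph n m) (O : PlusOps ι K) (α β : Ordering n ι) : Prop :=
  α.Perm β ∧ ∀ I : Instance H K, query O α I = query O β I

end Query

/-! ### Product partitions and aggregating hypertree decompositions -/

section Decomposition

variable {n m : ℕ} {ι : Type*}

/-- A partition of the hyperedges containing `a`, for each attribute `a` with a product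
aggregation; the other attributes have the trivial partition, so they are not duplicated. -/
structure ProductPartition (H : Hypergraph n m) (α : Ordering n ι) where
  block : (a : Fin n) → Finpartition (H.star a)
  block_trivial : ∀ a, (a, Op.prod) ∉ α → (block a).parts = {H.star a}

variable {H : Hypergraph n m} {α : Ordering n ι}

/-- The vertices of the product partition hypergraph: for each attribute `a` one copy `(a, B)`
for each block `B` of its partition. -/
def ProductPartition.copies (P : ProductPartition H α) : Finset (Fin n × Finset (Fin m)) :=
  Finset.univ.filter fun c => c.2 ∈ (P.block c.1).parts

/-- The hyperedges of the product partition hypergraph: in the `j`-th hyperedge each attribute is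
replaced by its copy for the block that contains `j`. -/
def ProductPartition.edge (P : ProductPartition H α) (j : Fin m) :
    Finset (Fin n × Finset (Fin m)) :=
  (H.edge j).image fun a => (a, (P.block a).part j)

/-- An aggregating generalized hypertree decomposition: a rooted tree with bags that is a
generalized hypertree decomposition of a product partition hypergraph. -/
structure AGHD (H : Hypergraph n m) (α : Ordering n ι) where
  partition : ProductPartition H α
  size : ℕ
  tree : SimpleGraph (Fin size)
  isTree : tree.IsTree
  root : Fin size
  bag : Fin size → Finset (Fin n × Finset (Fin m))
  bag_subset : ∀ t, bag t ⊆ partition.copies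
  edge_covered : ∀ j, ∃ t, partition.edge j ⊆ bag t
  running_intersection : ∀ c ∈ partition.copies, (tree.induce {t | c ∈ bag t}).Connected

/-- `u` lies on the path from the root to `v`. -/
def AGHD.AncestorOrSelf (G : AGHD H α) (u v : Fin G.size) : Prop :=
  ∃ p : G.tree.Walk G.root v, p.IsPath ∧ u ∈ p.support

/-- `u` is a (proper) ancestor of `v`. -/
def AGHD.Ancestor (G : AGHD H α) (u v : Fin G.size) : Prop :=
  G.AncestorOrSelf u v ∧ u ≠ v

/-- `t` is the topmost node whose bag contains the copy `c`. -/
def AGHD.IsTop (G : AGHD H α) (c : Fin n × Finset (Fin m)) (t : Fin G.size) : Prop :=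
  c ∈ G.bag t ∧ ∀ t', c ∈ G.bag t' → G.AncestorOrSelf t t'

/-- The set of the topmost nodes of the copies of the attribute `a`. -/
def AGHD.top (G : AGHD H α) (a : Fin n) : Set (Fin G.size) :=
  {t | ∃ c ∈ G.partition.copies, c.1 = a ∧ G.IsTop c t}

/-- Compatibility with an ordering: if a topmost node of `a` is an ancestor of a topmost node of
another attribute `b`, then `a` is an output attribute or `a` occurs before `b`. -/
def AGHD.Compatible (G : AGHD H α) (β : Ordering n ι) : Prop :=
  ∀ a b, a ≠ b → (∃ u ∈ G.top a, ∃ v ∈ G.top b, G.Ancestor u v) →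
    a ∉ β.attrs ∨ β.Precedes a b

variable {K : Type*}

/-- The optimal value of the fractional edge cover program of the bag `t`. -/
def AGHD.coverValue (G : AGHD H α) (I : Instance H K) (t : Fin G.size) : ℝ :=
  sInf {r | ∃ x : Fin m → ℝ, (∀ j, 0 ≤ x j) ∧
    (∀ c ∈ G.bag t, 1 ≤ ∑ j with c ∈ G.partition.edge j, x j) ∧
    r = ∑ j, x j * Real.logb I.inSize (I.card j)}

/-- The fractional hypertree width, for the sizes of the relations of `I`. -/
def AGHD.fhw (G : AGHD H α) (I : Instance H K) : ℝ := ⨆ t, G.coverValue I t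

/-- The widths, for the instance `I`, of the decompositions that are compatible with some
ordering equivalent to `α`. -/
def validWidths [CommMonoidWithZero K] (O : PlusOps ι K) (α : Ordering n ι)
    (I : Instance H K) : Set ℝ :=
  {w | ∃ β : Ordering n ι, Equivalent H O α β ∧
    ∃ G : AGHD H α, G.Compatible β ∧ w = G.fhw I}

end Decomposition

/-! ### A word RAM with unit-cost operations on annotations -/

section Machine

/-- A state: word registers and word arrays, annotation registers and annotation arrays. -/
structure State (K : Type*) where
  reg : ℕ → ℕ
  arr : ℕ → ℕ → ℕ
  ann : ℕ → K
  annArr : ℕ → ℕ → K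

/-- The basic instructions. Words support arithmetic and indirect addressing; annotations can be
moved and combined by the operators, but not inspected. -/
inductive Instr (ι : Type*) where
  | const (r c : ℕ)
  | add (r s t : ℕ)
  | sub (r s t : ℕ)
  | mul (r s t : ℕ)
  | div (r s t : ℕ)
  | load (r k s : ℕ)
  | store (k s r : ℕ)
  | annOne (x : ℕ)
  | annMul (x y z : ℕ)
  | annPlus (i : ι) (x y z : ℕ)
  | annLoad (x k s : ℕ)
  | annStore (k s x : ℕ)

/-- The tests of the control structures, on word registers. -/
inductive Test where
  | eq (r s : ℕ)
  | lt (r s : ℕ)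

/-- Structured programs. -/
inductive Cmd (ι : Type*) where
  | skip
  | instr (c : Instr ι)
  | seq (c d : Cmd ι)
  | ite (b : Test) (c d : Cmd ι)
  | while (b : Test) (c : Cmd ι)

variable {ι K : Type*}

def Test.Holds : Test → State K → Prop
  | .eq r s, σ => σ.reg r = σ.reg s
  | .lt r s, σ => σ.reg r < σ.reg s

def State.setReg (σ : State K) (r v : ℕ) : State K :=
  { σ with reg := Function.update σ.reg r v }

def State.setArr (σ : State K) (k i v : ℕ) : State K :=
  { σ with arr := Function.update σ.arr k (Function.update (σ.arr k) i v) }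

def State.setAnn (σ : State K) (x : ℕ) (v : K) : State K :=
  { σ with ann := Function.update σ.ann x v }

def State.setAnnArr (σ : State K) (k i : ℕ) (v : K) : State K :=
  { σ with annArr := Function.update σ.annArr k (Function.update (σ.annArr k) i v) }

variable [CommMonoidWithZero K]

/-- The effect of an instruction. The results of word arithmetic are reduced modulo `W`. -/
def Instr.run (O : PlusOps ι K) (W : ℕ) : Instr ι → State K → State K
  | .const r c, σ => σ.setReg r (c % W)
  | .add r s t, σ => σ.setReg r ((σ.reg s + σ.reg t) % W)
  | .sub r s t, σ => σ.setReg r ((σ.reg s - σ.reg t) % W)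
  | .mul r s t, σ => σ.setReg r ((σ.reg s * σ.reg t) % W)
  | .div r s t, σ => σ.setReg r ((σ.reg s / σ.reg t) % W)
  | .load r k s, σ => σ.setReg r (σ.arr k (σ.reg s))
  | .store k s r, σ => σ.setArr k (σ.reg s) (σ.reg r)
  | .annOne x, σ => σ.setAnn x 1
  | .annMul x y z, σ => σ.setAnn x (σ.ann y * σ.ann z)
  | .annPlus i x y z, σ => σ.setAnn x (O.plus i (σ.ann y) (σ.ann z))
  | .annLoad x k s, σ => σ.setAnn x (σ.annArr k (σ.reg s))
  | .annStore k s x, σ => σ.setAnnArr k (σ.reg s) (σ.ann x)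

/-- `Exec O W c σ τ T`: with word size `W`, the program `c` started in the state `σ` halts in the
state `τ` after `T` steps; each instruction and each evaluation of a test is one step. -/
inductive Exec (O : PlusOps ι K) (W : ℕ) : Cmd ι → State K → State K → ℕ → Prop
  | skip (σ) : Exec O W .skip σ σ 0
  | instr (c σ) : Exec O W (.instr c) σ (c.run O W σ) 1
  | seq {c d σ τ υ T U} : Exec O W c σ τ T → Exec O W d τ υ U → Exec O W (.seq c d) σ υ (T + U)
  | ite_true {b c d σ τ T} : b.Holds σ → Exec O W c σ τ T → Exec O W (.ite b c d) σ τ (T + 1)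
  | ite_false {b c d σ τ T} : ¬ b.Holds σ → Exec O W d σ τ T → Exec O W (.ite b c d) σ τ (T + 1)
  | while_false {b c σ} : ¬ b.Holds σ → Exec O W (.while b c) σ σ 1
  | while_true {b c σ τ υ T U} : b.Holds σ → Exec O W c σ τ T → Exec O W (.while b c) τ υ U →
      Exec O W (.while b c) σ υ (T + U + 1)

end Machine

/-! ### Input and output conventions -/

section InputOutput

variable {n m : ℕ} {H : Hypergraph n m} {ι K : Type*}

/-- All numbers of the instance are at most `B`. -/
def Instance.FitsIn (I : Instance H K) (B : ℕ) : Prop :=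
  I.inSize ≤ B ∧ (∀ a, (I.dom a).ncard ≤ B) ∧ ∀ j t, (I.rel j t).isSome → ∀ a, t a ≤ B

variable [CommMonoidWithZero K]

/-- `σ` holds the instance `I`, whose relations are listed in an arbitrary order: the value of
attribute `a` in row `i` of relation `j` is in cell `i` of array `j * n + a`, the annotation of
the row is in cell `i` of annotation array `j`; array `m * n` contains the sizes of the relations
and array `m * n + 1` the sizes of the domains (`0` for an infinite one). All other cells and all
registers are `0`. -/
structure IsInput (I : Instance H K) (σ : State K) (row : ∀ j, Fin (I.card j) ≃ I.Rows j) :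
    Prop where
  reg : ∀ r, σ.reg r = 0
  ann : ∀ x, σ.ann x = 0
  column : ∀ (j : Fin m) (a : Fin n) (i : ℕ), σ.arr (j * n + a) i =
    if h : a ∈ H.edge j ∧ i < I.card j then (row j ⟨i, h.2⟩).1 ⟨a, h.1⟩ else 0
  card : ∀ i, σ.arr (m * n) i = if h : i < m then I.card ⟨i, h⟩ else 0
  dom : ∀ i, σ.arr (m * n + 1) i = if h : i < n then (I.dom ⟨i, h⟩).ncard else 0
  arr_rest : ∀ k i, m * n + 1 < k → σ.arr k i = 0
  annotations : ∀ (j : Fin m) (i : ℕ), σ.annArr j i =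
    if h : i < I.card j then (I.rel j (row j ⟨i, h⟩).1).getD 0 else 0
  annArr_rest : ∀ k i, m ≤ k → σ.annArr k i = 0

/-- `τ` holds the answer of the query, each tuple listed exactly once: register `0` contains the
number of tuples, the value of the output attribute `a` in row `i` is in cell `i` of array
`m * n + 2 + a`, and the annotation of the row is in cell `i` of annotation array `m`. -/
def IsOutput (O : PlusOps ι K) (α : Ordering n ι) (I : Instance H K) (τ : State K) : Prop :=
  τ.reg 0 = outSize O α I ∧
  ∃ row : Fin (outSize O α I) ≃ AnswerRows O α I, ∀ i : Fin (outSize O α I),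
    (∀ a : α.Out, τ.arr (m * n + 2 + a.1) i = (row i).1 a) ∧
    some (τ.annArr m i) = answer O α I (row i).1

end InputOutput

end Ajar

end

/-! The query is evaluated by eliminating attributes. For an ordering `β` equivalent to `α` the
attributes of `β` are eliminated from the last one to the first one, and the output attributes come
after them. An additive attribute `b` is eliminated by joining the current relations that contain
`b` and summing over `b`; by distributivity the other relations stay untouched (`aggPlus_joinL`). A
product attribute is eliminated from each relation separately (`aggProd_joinL`). This needs
idempotence, since a relation without the attribute is multiplied by itself once for each domain
value.

The link with decompositions is `AGHD.covers_needs`: if the AGHD is compatible with `β`, each set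
`U` over which a join has to be formed has copies in one common bag. The reason is that the topmost
nodes of two attributes of one schema are comparable in the tree, and compatibility says which of
them is higher.

The tuples of such a join are looked up in the local join over `U`, the set of tuples consistent
with the projections of all input relations. Restricting to it does not change the total join
(`joinL_indicator`), and it depends on the input only. It is built by adding one attribute at a
time, each tuple being extended through the relation that offers the fewest values. By Finner's
inequality (`sum_tups_prod_rpow_le`) the number of extensions is at most `∏ |R_j| ^ x_j` for every
fractional cover `x` of `U` (`stepCost_le`). A cover of the bag by hyperedges of the product
partition hypergraph also covers `U`, so the infimum over covers gives `IN ^ fhw`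
(`AGHD.stepCost_le_rpow`). Only finitely many widths occur, so a smallest one exists
(`exists_isLeast_validWidths`).

The best plan depends on the instance and is unknown to the program. There are finitely many plans,
however, and all of them are part of the program text; equivalence of orderings is never tested at
run time. The program computes local joins over sets of attributes, omits every step that costs more
than a bound `N`, and doubles `N` until all local joins of some plan are present (`searchCmd_tri`).
The costs form a geometric series, and `N` overshoots by at most a factor of two. That plan is then
run (`runCmd_tri`).

Once only output attributes are left, each of them is eliminated by a projection that keeps the
support, and then the tuples are extended back in the reverse order. Every intermediate list is a
projection of the answer, so nothing is listed in vain (`outCmd_tri`).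

On the machine a tuple is a number in base `M`, and tables are addressed directly by these numbers.
Unused memory is zero and represents empty tables, so an access takes constant time without
initialization, and no logarithm appears in the final bound. Correctness and time are proved
together by triples `Tri`, whose time bound is the program size times a common factor. -/

noncomputable section

namespace Ajar

/-! ### Names of arrays, states of the structured language -/

/-- Identifiers of tables. -/
abbrev Key (n : ℕ) := ℕ × ℕ × Finset (Fin n)

/-- Names of arrays: the arrays of the input and output conventions, and those of the tables. -/
inductive Nm (n m : ℕ) where
  | col (j : Fin m) (a : Fin n)
  | card
  | dom
  | out (a : Fin n)
  | inp (j : Fin m)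
  | res
  | tab (k : ℕ) (d : Key n)

instance {n m : ℕ} : DecidableEq (Nm n m) := Classical.decEq _

/-- The numbers of the columns, sizes, domains and output columns are dictated by `IsInput` and
`IsOutput`. Each name stands for a word array and an annotation array; a name used for one kind only
receives a spare number of the other kind, which keeps both numberings total and injective. -/
def Nm.word {n m : ℕ} : Nm n m → ℕ
  | .col j a => j * n + a
  | .card => m * n
  | .dom => m * n + 1
  | .out a => m * n + 2 + a
  | .inp j => m * n + 2 + n + j
  | .res => m * n + 2 + n + m
  | .tab k d => m * n + 3 + n + m + Nat.pair k (Encodable.encode d)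

def Nm.anno {n m : ℕ} : Nm n m → ℕ
  | .inp j => j
  | .res => m
  | .col j a => m + 1 + (j * n + a)
  | .card => m + 1 + m * n
  | .dom => m + 2 + m * n
  | .out a => m + 3 + m * n + a
  | .tab k d => m * n + 3 + n + m + Nat.pair k (Encodable.encode d)

theorem row_major_lt {n m : ℕ} (j : Fin m) (a : Fin n) : (j : ℕ) * n + a < m * n := by
  have h1 : (j : ℕ) + 1 ≤ m := j.2
  have h2 := a.2
  nlinarith

theorem row_major_inj {n m : ℕ} {j j' : Fin m} {a a' : Fin n}
    (h : (j : ℕ) * n + a = j' * n + a') : j = j' ∧ a = a' := by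
  have hn : 0 < n := a.pos
  have h1 : ((j : ℕ) * n + a) / n = j := by
    rw [mul_comm, Nat.mul_add_div hn, Nat.div_eq_of_lt a.2, add_zero]
  have h2 : ((j' : ℕ) * n + a') / n = j' := by
    rw [mul_comm, Nat.mul_add_div hn, Nat.div_eq_of_lt a'.2, add_zero]
  have h3 : (j : ℕ) = j' := by rw [← h1, ← h2, h]
  refine ⟨Fin.ext h3, Fin.ext ?_⟩
  rw [h3] at h
  omega

theorem Nm.word_injective {n m : ℕ} : Function.Injective (Nm.word (n := n) (m := m)) := by
  intro x y h
  rcases x with ⟨j, a⟩ | _ | _ | a | j | _ | ⟨k, d⟩ <;>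
    rcases y with ⟨j', a'⟩ | _ | _ | a' | j' | _ | ⟨k', d'⟩ <;> simp only [Nm.word] at h <;>
    first
      | rfl
      | (obtain ⟨rfl, rfl⟩ := row_major_inj h; rfl)
      | (exfalso; have := row_major_lt j a; omega)
      | (exfalso; have := row_major_lt j' a'; omega)
      | (obtain rfl : a = a' := Fin.ext (by omega); rfl)
      | (obtain rfl : j = j' := Fin.ext (by omega); rfl)
      | (obtain ⟨rfl, h2⟩ := Nat.pair_eq_pair.1 (Nat.add_left_cancel h)
         rw [Encodable.encode_injective h2])
      | (exfalso; omega)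

set_option maxHeartbeats 1000000 in
theorem Nm.anno_injective {n m : ℕ} : Function.Injective (Nm.anno (n := n) (m := m)) := by
  intro x y h
  rcases x with ⟨j, a⟩ | _ | _ | a | j | _ | ⟨k, d⟩ <;>
    rcases y with ⟨j', a'⟩ | _ | _ | a' | j' | _ | ⟨k', d'⟩ <;> simp only [Nm.anno] at h <;>
    first
      | rfl
      | (obtain ⟨rfl, rfl⟩ := row_major_inj (Nat.add_left_cancel h); rfl)
      | (exfalso; have := row_major_lt j a; omega)
      | (exfalso; have := row_major_lt j' a'; omega)
      | (obtain rfl : a = a' := Fin.ext (by omega); rfl)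
      | (obtain rfl : j = j' := Fin.ext (by omega); rfl)
      | (obtain ⟨rfl, h2⟩ := Nat.pair_eq_pair.1 (Nat.add_left_cancel h)
         rw [Encodable.encode_injective h2])
      | (exfalso; omega)

/-- A state of the structured language: local variables, word arrays, annotation arrays. -/
structure HS (n m : ℕ) (K : Type*) where
  loc : ℕ → ℕ
  w : Nm n m → ℕ → ℕ
  k : Nm n m → ℕ → K

/-! ### A structured language over the machine, and a program logic with time bounds. -/

section Language

variable {n m : ℕ} {ι K : Type*}

def HS.setLoc (h : HS n m K) (r v : ℕ) : HS n m K := { h with loc := Function.update h.loc r v }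

def HS.setW (h : HS n m K) (a : Nm n m) (i v : ℕ) : HS n m K :=
  { h with w := Function.update h.w a (Function.update (h.w a) i v) }

def HS.setK (h : HS n m K) (a : Nm n m) (i : ℕ) (v : K) : HS n m K :=
  { h with k := Function.update h.k a (Function.update (h.k a) i v) }

@[simp] theorem HS.setLoc_loc (h : HS n m K) (r v : ℕ) :
    (h.setLoc r v).loc = Function.update h.loc r v := rfl
@[simp] theorem HS.setLoc_w (h : HS n m K) (r v : ℕ) : (h.setLoc r v).w = h.w := rfl
@[simp] theorem HS.setLoc_k (h : HS n m K) (r v : ℕ) : (h.setLoc r v).k = h.k := rfl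
@[simp] theorem HS.setW_loc (h : HS n m K) (a i v) : (h.setW a i v).loc = h.loc := rfl
@[simp] theorem HS.setW_w (h : HS n m K) (a i v) :
    (h.setW a i v).w = Function.update h.w a (Function.update (h.w a) i v) := rfl
@[simp] theorem HS.setW_k (h : HS n m K) (a i v) : (h.setW a i v).k = h.k := rfl
@[simp] theorem HS.setK_loc (h : HS n m K) (a i v) : (h.setK a i v).loc = h.loc := rfl
@[simp] theorem HS.setK_w (h : HS n m K) (a i v) : (h.setK a i v).w = h.w := rfl
@[simp] theorem HS.setK_k (h : HS n m K) (a i v) :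
    (h.setK a i v).k = Function.update h.k a (Function.update (h.k a) i v) := rfl

/-- Word expressions. -/
inductive Exp (n m : ℕ) where
  | lit (c : ℕ)
  | loc (r : ℕ)
  | get (a : Nm n m) (e : Exp n m)
  | add (e f : Exp n m)
  | sub (e f : Exp n m)
  | mul (e f : Exp n m)
  | div (e f : Exp n m)

def Exp.eval (h : HS n m K) : Exp n m → ℕ
  | .lit c => c
  | .loc r => h.loc r
  | .get a e => h.w a (e.eval h)
  | .add e f => e.eval h + f.eval h
  | .sub e f => e.eval h - f.eval h
  | .mul e f => e.eval h * f.eval h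
  | .div e f => e.eval h / f.eval h

/-- No overflow occurs in the evaluation. -/
def Exp.Ok (W : ℕ) (h : HS n m K) : Exp n m → Prop
  | .lit c => c < W
  -- Local variables occupy the registers below `16`; the registers from `16` on are scratch space
  -- for evaluations.
  | .loc r => r < 16 ∧ h.loc r < W
  | .get _ e => e.Ok W h
  | .add e f => e.Ok W h ∧ f.Ok W h ∧ e.eval h + f.eval h < W
  | .sub e f => e.Ok W h ∧ f.Ok W h ∧ e.eval h < W
  | .mul e f => e.Ok W h ∧ f.Ok W h ∧ e.eval h * f.eval h < W
  | .div e f => e.Ok W h ∧ f.Ok W h ∧ e.eval h < W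

/-- The program that evaluates an expression into register `d`, using registers from `d` on. -/
def Exp.code : Exp n m → ℕ → Cmd ι
  | .lit c, d => .instr (.const d c)
  -- The machine has no move instruction, so a register is copied by adding zero.
  | .loc r, d => .seq (.instr (.const d 0)) (.instr (.add d r d))
  | .get a e, d => .seq (e.code d) (.instr (.load d a.word d))
  | .add e f, d => .seq (e.code d) (.seq (f.code (d + 1)) (.instr (.add d d (d + 1))))
  | .sub e f, d => .seq (e.code d) (.seq (f.code (d + 1)) (.instr (.sub d d (d + 1))))
  | .mul e f, d => .seq (e.code d) (.seq (f.code (d + 1)) (.instr (.mul d d (d + 1))))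
  | .div e f, d => .seq (e.code d) (.seq (f.code (d + 1)) (.instr (.div d d (d + 1))))

/-- Annotation expressions. -/
inductive AExp (n m : ℕ) (ι : Type*) where
  | one
  | get (a : Nm n m) (e : Exp n m)
  | mul (x y : AExp n m ι)
  | plus (i : ι) (x y : AExp n m ι)

/-- A machine state represents a state of the structured language. -/
structure Sim (σ : State K) (h : HS n m K) : Prop where
  reg : ∀ r < 16, σ.reg r = h.loc r
  arr : ∀ a : Nm n m, σ.arr a.word = h.w a
  ann : ∀ a : Nm n m, σ.annArr a.anno = h.k a

/-- Two machine states differ at most in registers from `d` on. -/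
structure SameBelow (d : ℕ) (σ τ : State K) : Prop where
  reg : ∀ r < d, τ.reg r = σ.reg r
  arr : τ.arr = σ.arr
  annArr : τ.annArr = σ.annArr

theorem SameBelow.trans {d e : ℕ} {σ τ υ : State K} (h : SameBelow d σ τ) (h' : SameBelow e τ υ)
    (hde : d ≤ e) : SameBelow d σ υ :=
  ⟨fun r hr => (h'.reg r (by omega)).trans (h.reg r hr), h'.arr.trans h.arr,
    h'.annArr.trans h.annArr⟩

theorem SameBelow.mono {d e : ℕ} {σ τ : State K} (h : SameBelow d σ τ) (hde : e ≤ d) :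
    SameBelow e σ τ :=
  ⟨fun r hr => h.reg r (by omega), h.arr, h.annArr⟩

theorem Sim.of_sameBelow {d : ℕ} {σ τ : State K} {h : HS n m K} (hs : Sim σ h)
    (hb : SameBelow d σ τ) (hd : 16 ≤ d) : Sim τ h :=
  ⟨fun r hr => (hb.reg r (by omega)).trans (hs.reg r hr), fun a => by rw [hb.arr, hs.arr],
    fun a => by rw [hb.annArr, hs.ann]⟩

variable [CommMonoidWithZero K] (O : PlusOps ι K) (W : ℕ)

def AExp.eval (h : HS n m K) : AExp n m ι → K
  | .one => 1
  | .get a e => h.k a (e.eval h)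
  | .mul x y => x.eval h * y.eval h
  | .plus i x y => O.plus i (x.eval h) (y.eval h)

def AExp.Ok (h : HS n m K) : AExp n m ι → Prop
  | .one => True
  | .get _ e => e.Ok W h
  | .mul x y => x.Ok h ∧ y.Ok h
  | .plus _ x y => x.Ok h ∧ y.Ok h

def AExp.code : AExp n m ι → ℕ → Cmd ι
  | .one, p => .instr (.annOne p)
  -- Addresses are evaluated from register `17` on, because register `16` may hold the target
  -- address of a pending `annStore`.
  | .get a e, p => .seq (e.code 17) (.instr (.annLoad p a.anno 17))
  | .mul x y, p => .seq (x.code p) (.seq (y.code (p + 1)) (.instr (.annMul p p (p + 1))))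
  | .plus i x y, p => .seq (x.code p) (.seq (y.code (p + 1)) (.instr (.annPlus i p p (p + 1))))

/-- A bound for the number of steps of a program without loops. -/
def Cmd.size : Cmd ι → ℕ
  | .skip => 1
  | .instr _ => 1
  | .seq c d => c.size + d.size
  | .ite _ c d => c.size + d.size + 1
  | .while _ c => c.size + 1

theorem Exp.exec_code (e : Exp n m) {h : HS n m K} {σ : State K} {d : ℕ} (hs : Sim σ h)
    (hd : 16 ≤ d) (ok : e.Ok W h) :
    ∃ τ, Exec O W (e.code d) σ τ (Cmd.size (ι := ι) (e.code d)) ∧ τ.reg d = e.eval h ∧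
      SameBelow d σ τ ∧ τ.ann = σ.ann := by
  induction e generalizing σ d with
  | lit c =>
    refine ⟨_, .instr _ _, ?_, ⟨fun r hr => ?_, rfl, rfl⟩, rfl⟩
    · simpa [Instr.run, State.setReg, Exp.eval] using Nat.mod_eq_of_lt ok
    · simp [Instr.run, State.setReg, Function.update_of_ne hr.ne]
  | loc r =>
    have hr : r ≠ d := by have := ok.1; omega
    refine ⟨_, .seq (.instr _ _) (.instr _ _), ?_, ⟨fun s hs' => ?_, rfl, rfl⟩, rfl⟩
    · simp [Instr.run, State.setReg, Exp.eval, hr, hs.reg r ok.1, Nat.mod_eq_of_lt ok.2]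
    · simp [Instr.run, State.setReg, Function.update_of_ne hs'.ne]
  | get a e ih =>
    obtain ⟨τ, h1, h2, h3, h4⟩ := ih hs hd ok
    refine ⟨_, .seq h1 (.instr _ _), ?_, h3.trans ⟨fun r hr => ?_, rfl, rfl⟩ le_rfl, h4⟩
    · simp [Instr.run, State.setReg, Exp.eval, h2, h3.arr, hs.arr]
    · simp [Instr.run, State.setReg, Function.update_of_ne hr.ne]
  | add e f ihe ihf | sub e f ihe ihf | mul e f ihe ihf | div e f ihe ihf =>
    obtain ⟨τ, h1, h2, h3, h4⟩ := ihe hs hd ok.1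
    obtain ⟨υ, g1, g2, g3, g4⟩ := ihf (hs.of_sameBelow h3 hd) (by omega : 16 ≤ d + 1) ok.2.1
    refine ⟨_, .seq h1 (.seq g1 (.instr _ _)), ?_,
      h3.trans ((g3.mono d.le_succ).trans ⟨fun r hr => ?_, rfl, rfl⟩ le_rfl) le_rfl, g4.trans h4⟩
    · have := ok.2.2
      simp only [Instr.run, State.setReg, Exp.eval, Function.update_self, g2,
        g3.reg d (by omega), h2]
      refine Nat.mod_eq_of_lt (lt_of_le_of_lt ?_ this)
      first
        | exact le_rfl
        | exact Nat.sub_le _ _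
        | exact Nat.div_le_self _ _
    · simp [Instr.run, State.setReg, Function.update_of_ne hr.ne]

theorem AExp.exec_code (x : AExp n m ι) {h : HS n m K} {σ : State K} {p : ℕ} (hs : Sim σ h)
    (ok : x.Ok W h) :
    ∃ τ, Exec O W (x.code p) σ τ (x.code p).size ∧ τ.ann p = x.eval O h ∧
      SameBelow 17 σ τ ∧ ∀ q < p, τ.ann q = σ.ann q := by
  induction x generalizing σ p with
  | one =>
    refine ⟨_, .instr _ _, ?_, ⟨fun r hr => rfl, rfl, rfl⟩, fun q hq => ?_⟩
    · simp [Instr.run, State.setAnn, AExp.eval]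
    · simp [Instr.run, State.setAnn, Function.update_of_ne hq.ne]
  | get a e =>
    obtain ⟨τ, h1, h2, h3, h4⟩ := e.exec_code O W hs (by omega : 16 ≤ 17) ok
    refine ⟨_, .seq h1 (.instr _ _), ?_, ⟨h3.reg, h3.arr, h3.annArr⟩, fun q hq => ?_⟩
    · simp [Instr.run, State.setAnn, AExp.eval, h2, h3.annArr, hs.ann]
    · simp [Instr.run, State.setAnn, Function.update_of_ne hq.ne, h4]
  | mul x y ihx ihy | plus i x y ihx ihy =>
    obtain ⟨τ, h1, h2, h3, h4⟩ := ihx (p := p) hs ok.1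
    obtain ⟨υ, g1, g2, g3, g4⟩ := ihy (p := p + 1) (hs.of_sameBelow h3 (by omega)) ok.2
    have h5 := h3.trans g3 le_rfl
    refine ⟨_, .seq h1 (.seq g1 (.instr _ _)), ?_, ⟨h5.reg, h5.arr, h5.annArr⟩,
      fun q hq => ?_⟩
    · simp [Instr.run, State.setAnn, AExp.eval, g2, g4 p (by omega), h2]
    · simp [Instr.run, State.setAnn, Function.update_of_ne hq.ne, g4 q (by omega), h4 q hq]

/-- Programs without loops. -/
inductive Blk (n m : ℕ) (ι : Type*) where
  | skip
  | loc (r : ℕ) (e : Exp n m)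
  | set (a : Nm n m) (e f : Exp n m)
  | aset (a : Nm n m) (e : Exp n m) (x : AExp n m ι)
  | seq (b c : Blk n m ι)
  | ifEq (e f : Exp n m) (b c : Blk n m ι)

def Blk.run (h : HS n m K) : Blk n m ι → HS n m K
  | .skip => h
  | .loc r e => h.setLoc r (e.eval h)
  | .set a e f => h.setW a (e.eval h) (f.eval h)
  | .aset a e x => h.setK a (e.eval h) (x.eval O h)
  | .seq b c => c.run (b.run h)
  | .ifEq e f b c => if e.eval h = f.eval h then b.run h else c.run h

def Blk.Ok (h : HS n m K) : Blk n m ι → Prop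
  | .skip => True
  | .loc r e => r < 16 ∧ e.Ok W h ∧ e.eval h < W
  | .set _ e f => e.Ok W h ∧ f.Ok W h
  | .aset _ e x => e.Ok W h ∧ x.Ok W h
  | .seq b c => b.Ok h ∧ c.Ok (b.run O h)
  | .ifEq e f b c => e.Ok W h ∧ f.Ok W h ∧
      (e.eval h = f.eval h → b.Ok h) ∧ (e.eval h ≠ f.eval h → c.Ok h)

/-- The program that evaluates two expressions into registers `16` and `17`. -/
def Exp.code₂ (e f : Exp n m) : Cmd ι := .seq (e.code 16) (f.code 17)

def Blk.code : Blk n m ι → Cmd ι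
  | .skip => .skip
  | .loc r e => .seq (e.code 16) (.seq (.instr (.const 17 0)) (.instr (.add r 16 17)))
  | .set a e f => .seq (e.code₂ f) (.instr (.store a.word 16 17))
  | .aset a e x => .seq (e.code 16) (.seq (x.code 0) (.instr (.annStore a.anno 16 0)))
  | .seq b c => .seq b.code c.code
  | .ifEq e f b c => .seq (e.code₂ f) (.ite (.eq 16 17) b.code c.code)

/-- `Tri O W c h X Q`: started in a state that represents `h`, the program `c` halts after at most
`c.size * X` steps in a state that represents some `h'` with `Q h'`. -/
def Tri (c : Cmd ι) (h : HS n m K) (X : ℕ) (Q : HS n m K → Prop) : Prop :=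
  ∀ σ, Sim σ h → ∃ τ t h', Exec O W c σ τ t ∧ t ≤ c.size * X ∧ Sim τ h' ∧ Q h'

variable {O W}

theorem Exp.exec_code₂ (e f : Exp n m) {h : HS n m K} {σ : State K} (hs : Sim σ h)
    (oke : e.Ok W h) (okf : f.Ok W h) :
    ∃ τ, Exec O W (e.code₂ f) σ τ (Cmd.size (ι := ι) (e.code₂ f)) ∧ τ.reg 16 = e.eval h ∧
      τ.reg 17 = f.eval h ∧ SameBelow 16 σ τ := by
  obtain ⟨τ, h1, h2, h3, -⟩ := e.exec_code O W hs le_rfl oke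
  obtain ⟨υ, g1, g2, g3, -⟩ := f.exec_code O W (hs.of_sameBelow h3 le_rfl)
    (by omega : 16 ≤ 17) okf
  exact ⟨υ, .seq h1 g1, (g3.reg 16 (by omega)).trans h2, g2, h3.trans g3 (by omega)⟩

theorem Blk.exec_code (b : Blk n m ι) {h : HS n m K} {σ : State K} (hs : Sim σ h)
    (ok : b.Ok O W h) :
    ∃ τ t, Exec O W b.code σ τ t ∧ t ≤ b.code.size ∧ Sim τ (b.run O h) := by
  induction b generalizing σ h with
  | skip => exact ⟨σ, 0, .skip σ, Nat.zero_le _, hs⟩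
  | loc r e =>
    obtain ⟨τ, h1, h2, h3, -⟩ := e.exec_code O W hs le_rfl ok.2.1
    have hs' := hs.of_sameBelow h3 le_rfl
    refine ⟨_, _, .seq h1 (.seq (.instr _ _) (.instr _ _)), le_rfl, fun s hr => ?_, fun a => ?_,
      fun a => ?_⟩
    · by_cases hsr : s = r
      · subst hsr
        simp [Instr.run, State.setReg, h2, Blk.run, Nat.mod_eq_of_lt ok.2.2]
      · have : s ≠ 17 := by omega
        simp [Instr.run, State.setReg, Blk.run, hsr, this, hs'.reg s hr]
    · simpa [Instr.run, State.setReg, Blk.run] using hs'.arr a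
    · simpa [Instr.run, State.setReg, Blk.run] using hs'.ann a
  | set a e f =>
    obtain ⟨τ, h1, h2, h3, h4⟩ := e.exec_code₂ f hs ok.1 ok.2
    have hs' := hs.of_sameBelow h4 le_rfl
    refine ⟨_, _, .seq h1 (.instr _ _), le_rfl, hs'.reg, fun a' => ?_, hs'.ann⟩
    by_cases ha : a' = a
    · subst ha
      simp [Instr.run, State.setArr, Blk.run, h2, h3, hs'.arr]
    · have : a'.word ≠ a.word := fun h => ha (Nm.word_injective h)
      simp [Instr.run, State.setArr, Blk.run, ha, this, hs'.arr]
  | aset a e x =>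
    obtain ⟨τ, h1, h2, h3, -⟩ := e.exec_code O W hs le_rfl ok.1
    obtain ⟨υ, g1, g2, g3, -⟩ := x.exec_code O W (hs.of_sameBelow h3 le_rfl) (p := 0) ok.2
    have hs' := hs.of_sameBelow (h3.trans g3 (by omega)) le_rfl
    refine ⟨_, _, .seq h1 (.seq g1 (.instr _ _)), le_rfl, hs'.reg, hs'.arr, fun a' => ?_⟩
    by_cases ha : a' = a
    · subst ha
      simp [Instr.run, State.setAnnArr, Blk.run, (g3.reg 16 (by omega)).trans h2, g2, hs'.ann]
    · have : a'.anno ≠ a.anno := fun h => ha (Nm.anno_injective h)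
      simp [Instr.run, State.setAnnArr, Blk.run, ha, this, hs'.ann]
  | seq b c ihb ihc =>
    obtain ⟨τ, t, h1, h2, h3⟩ := ihb hs ok.1
    obtain ⟨υ, u, g1, g2, g3⟩ := ihc h3 ok.2
    exact ⟨υ, _, .seq h1 g1, Nat.add_le_add h2 g2, g3⟩
  | ifEq e f b c ihb ihc =>
    obtain ⟨τ, h1, h2, h3, h4⟩ := e.exec_code₂ f hs ok.1 ok.2.1
    have hs' := hs.of_sameBelow h4 le_rfl
    by_cases hef : e.eval h = f.eval h
    · obtain ⟨υ, u, g1, g2, g3⟩ := ihb hs' (ok.2.2.1 hef)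
      refine ⟨υ, _, .seq h1 (.ite_true (by rwa [Test.Holds, h2, h3]) g1), ?_, ?_⟩
      · simp only [Blk.code, Cmd.size]; omega
      · simpa [Blk.run, hef] using g3
    · obtain ⟨υ, u, g1, g2, g3⟩ := ihc hs' (ok.2.2.2 hef)
      refine ⟨υ, _, .seq h1 (.ite_false (by rwa [Test.Holds, h2, h3]) g1), ?_, ?_⟩
      · simp only [Blk.code, Cmd.size]; omega
      · simpa [Blk.run, hef] using g3

theorem Blk.tri {b : Blk n m ι} {h : HS n m K} {X : ℕ} {Q : HS n m K → Prop} (ok : b.Ok O W h)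
    (hQ : Q (b.run O h)) (hX : 1 ≤ X) : Tri O W b.code h X Q := by
  intro σ hs
  obtain ⟨τ, t, h1, h2, h3⟩ := b.exec_code hs ok
  exact ⟨τ, t, _, h1, h2.trans (Nat.le_mul_of_pos_right _ hX), h3, hQ⟩

theorem Tri.mono {c : Cmd ι} {h : HS n m K} {X Y : ℕ} {Q R : HS n m K → Prop}
    (hc : Tri O W c h X Q) (hXY : X ≤ Y) (hQR : ∀ h', Q h' → R h') : Tri O W c h Y R := by
  intro σ hs
  obtain ⟨τ, t, h', h1, h2, h3, h4⟩ := hc σ hs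
  exact ⟨τ, t, h', h1, h2.trans (Nat.mul_le_mul_left _ hXY), h3, hQR _ h4⟩

/-- Sizes add under composition, so one factor `X` serves both halves. Constants never have to be
tracked: they are absorbed by the size of the fixed program. -/
theorem Tri.seq {c d : Cmd ι} {h : HS n m K} {X : ℕ} {Q R : HS n m K → Prop}
    (hc : Tri O W c h X Q) (hd : ∀ h', Q h' → Tri O W d h' X R) : Tri O W (.seq c d) h X R := by
  intro σ hs
  obtain ⟨τ, t, h', h1, h2, h3, h4⟩ := hc σ hs
  obtain ⟨υ, u, h'', g1, g2, g3, g4⟩ := hd h' h4 τ h3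
  refine ⟨υ, _, h'', .seq h1 g1, ?_, g3, g4⟩
  rw [Cmd.size, add_mul]
  exact Nat.add_le_add h2 g2

theorem Tri.skip {h : HS n m K} {X : ℕ} {Q : HS n m K → Prop} (hQ : Q h) :
    Tri O W .skip h X Q := fun σ hs => ⟨σ, 0, h, .skip σ, Nat.zero_le _, hs, hQ⟩

/-- Branching on a comparison. -/
def cIfLt (e f : Exp n m) (c d : Cmd ι) : Cmd ι := .seq (e.code₂ f) (.ite (.lt 16 17) c d)

/-- Branching on an equation. -/
def cIfEq (e f : Exp n m) (c d : Cmd ι) : Cmd ι := .seq (e.code₂ f) (.ite (.eq 16 17) c d)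

theorem Tri.ite {b : Test} {p : Prop} {e f : Exp n m} {c d : Cmd ι} {h : HS n m K} {X : ℕ}
    {Q : HS n m K → Prop} (oke : e.Ok W h) (okf : f.Ok W h) (hX : 1 ≤ X)
    (hb : ∀ τ : State K, τ.reg 16 = e.eval h → τ.reg 17 = f.eval h → (b.Holds τ ↔ p))
    (hc : p → Tri O W c h X Q) (hd : ¬ p → Tri O W d h X Q) :
    Tri O W (.seq (e.code₂ f) (.ite b c d)) h X Q := by
  intro σ hs
  obtain ⟨τ, h1, h2, h3, h4⟩ := e.exec_code₂ (O := O) f hs oke okf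
  have hs' := hs.of_sameBelow h4 le_rfl
  have h5 := Nat.le_mul_of_pos_right (Cmd.size (ι := ι) (e.code₂ f)) hX
  by_cases hp : p
  · obtain ⟨υ, u, h', g1, g2, g3, g4⟩ := hc hp τ hs'
    refine ⟨υ, _, h', .seq h1 (.ite_true ((hb τ h2 h3).2 hp) g1), ?_, g3, g4⟩
    simp only [Cmd.size, add_mul]; omega
  · obtain ⟨υ, u, h', g1, g2, g3, g4⟩ := hd hp τ hs'
    refine ⟨υ, _, h', .seq h1 (.ite_false (fun h => hp ((hb τ h2 h3).1 h)) g1), ?_, g3, g4⟩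
    simp only [Cmd.size, add_mul]; omega

theorem Tri.ifLt {e f : Exp n m} {c d : Cmd ι} {h : HS n m K} {X : ℕ} {Q : HS n m K → Prop}
    (oke : e.Ok W h) (okf : f.Ok W h) (hX : 1 ≤ X)
    (hc : e.eval h < f.eval h → Tri O W c h X Q) (hd : ¬ e.eval h < f.eval h → Tri O W d h X Q) :
    Tri O W (cIfLt e f c d) h X Q :=
  Tri.ite oke okf hX (fun τ h1 h2 => by rw [Test.Holds, h1, h2]) hc hd

theorem Tri.ifEq {e f : Exp n m} {c d : Cmd ι} {h : HS n m K} {X : ℕ} {Q : HS n m K → Prop}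
    (oke : e.Ok W h) (okf : f.Ok W h) (hX : 1 ≤ X)
    (hc : e.eval h = f.eval h → Tri O W c h X Q) (hd : e.eval h ≠ f.eval h → Tri O W d h X Q) :
    Tri O W (cIfEq e f c d) h X Q :=
  Tri.ite oke okf hX (fun τ h1 h2 => by rw [Test.Holds, h1, h2]) hc hd

/-- A loop that runs as long as `e < f`. -/
def whileLt (e f : Exp n m) (c : Cmd ι) : Cmd ι :=
  .seq (e.code₂ f) (.while (.lt 16 17) (.seq c (e.code₂ f)))

/-- The rule for loops. The first argument of the invariant is a potential, which pays for the
remaining steps. -/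
theorem Tri.whileLt {e f : Exp n m} {c : Cmd ι} {Q : HS n m K → Prop}
    (Inv : ℕ → HS n m K → Prop)
    (step : ∀ p h, Inv p h → e.Ok W h ∧ f.Ok W h ∧
      (e.eval h < f.eval h → ∃ x p', 1 ≤ x ∧ x + p' ≤ p ∧ Tri O W c h x (Inv p')) ∧
      (¬ e.eval h < f.eval h → Q h))
    {p X : ℕ} {h : HS n m K} (hp : Inv p h) (hX : p + 1 ≤ X) : Tri O W (whileLt e f c) h X Q := by
  -- Strong induction on the potential. The two sides of the guard are already in the scratch
  -- registers, since the machine tests registers only.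
  have key : ∀ p h σ, Inv p h → Sim σ h → σ.reg 16 = e.eval h → σ.reg 17 = f.eval h →
      ∃ τ t h', Exec O W (.while (.lt 16 17) (.seq c (e.code₂ f))) σ τ t ∧
        t ≤ (1 + c.size + Cmd.size (ι := ι) (e.code₂ f)) * p + 1 ∧ Sim τ h' ∧ Q h' := by
    intro p
    induction p using Nat.strong_induction_on with
    | _ p ih =>
      intro h σ hp hs h16 h17
      obtain ⟨-, -, h1, h2⟩ := step p h hp
      by_cases hlt : e.eval h < f.eval h
      · obtain ⟨x, p', hx, hxp, htri⟩ := h1 hlt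
        obtain ⟨τ, t, h', a1, a2, a3, a4⟩ := htri σ hs
        obtain ⟨oke, okf, -, -⟩ := step p' h' a4
        obtain ⟨υ, b1, b2, b3, b4⟩ := e.exec_code₂ (O := O) f a3 oke okf
        obtain ⟨φ, u, h'', c1, c2, c3, c4⟩ := ih p' (by omega) h' υ a4
          (a3.of_sameBelow b4 le_rfl) b2 b3
        refine ⟨φ, _, h'', .while_true (by rwa [Test.Holds, h16, h17]) (.seq a1 b1) c1, ?_, c3, c4⟩
        -- A unit of potential pays for the test, the body and the new evaluation of the guard. As
        -- `1 ≤ x`, the `x` units released by an iteration pay for the test and the guard as well as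
        -- for `x` times the body.
        have e1 := Nat.mul_le_mul_left (1 + c.size + Cmd.size (ι := ι) (e.code₂ f)) hxp
        have e2 := Nat.le_mul_of_pos_right (1 + Cmd.size (ι := ι) (e.code₂ f)) hx
        rw [mul_add] at e1
        have e3 : (1 + c.size + Cmd.size (ι := ι) (e.code₂ f)) * x =
          (1 + Cmd.size (ι := ι) (e.code₂ f)) * x + c.size * x := by ring
        omega
      · exact ⟨σ, 1, h, .while_false (by rwa [Test.Holds, h16, h17]), by omega, hs, h2 hlt⟩
  intro σ hs
  obtain ⟨oke, okf, -, -⟩ := step p h hp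
  obtain ⟨τ, h1, h2, h3, h4⟩ := e.exec_code₂ (O := O) f hs oke okf
  obtain ⟨υ, t, h', g1, g2, g3, g4⟩ := key p h τ hp (hs.of_sameBelow h4 le_rfl) h2 h3
  refine ⟨υ, _, h', .seq h1 g1, ?_, g3, g4⟩
  have := Nat.mul_le_mul_left (Ajar.whileLt e f c).size hX
  refine le_trans ?_ this
  simp only [Ajar.whileLt, Cmd.size]
  nlinarith

/-- A loop over the numbers below `e`. -/
def forI (r : ℕ) (e : Exp n m) (c : Cmd ι) : Cmd ι :=
  .seq (Blk.loc (n := n) (m := m) r (.lit 0)).code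
    (Ajar.whileLt (.loc r) e
      (.seq c (Blk.loc (n := n) (m := m) r (.add (.loc r) (.lit 1))).code))

/-- The potential is the sum of the costs of the remaining iterations, so iterations of different
cost add up instead of being bounded by the most expensive one. The condition `1 ≤ cost i` pays for
the counter. -/
theorem Tri.forI {r : ℕ} {e : Exp n m} {c : Cmd ι} {h : HS n m K} {N X : ℕ}
    (Inv : ℕ → HS n m K → Prop) (cost : ℕ → ℕ) (hr : r < 16) (hN : N < W) (h1W : 1 < W)
    (h0 : Inv 0 (h.setLoc r 0))
    (he : ∀ i ≤ N, ∀ h', Inv i h' → e.Ok W h' ∧ e.eval h' = N)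
    (step : ∀ i < N, ∀ h', Inv i h' → h'.loc r = i → 1 ≤ cost i ∧
      Tri O W c h' (cost i) fun h'' => h''.loc r = i ∧ Inv (i + 1) (h''.setLoc r (i + 1)))
    (hX : ∑ i ∈ Finset.range N, cost i + 1 ≤ X) :
    Tri O W (forI r e c) h X (Inv N) := by
  refine Tri.seq (Q := fun h' => Inv 0 h' ∧ h'.loc r = 0) (Blk.tri ⟨hr, ?_, ?_⟩ ⟨h0, ?_⟩
    (by omega)) ?_
  · exact (by omega : 0 < W)
  · exact (by omega : 0 < W)
  · simp [Blk.run, Exp.eval]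
  rintro h' ⟨h1, h2⟩
  refine Tri.whileLt (fun p h => ∃ i ≤ N, Inv i h ∧ h.loc r = i ∧
    p = ∑ i ∈ Finset.Ico i N, cost i) ?_ (p := ∑ i ∈ Finset.range N, cost i)
    ⟨0, Nat.zero_le _, h1, h2, by rw [Finset.range_eq_Ico]⟩ hX
  rintro p h ⟨i, hi, hinv, hloc, rfl⟩
  obtain ⟨ok, hev⟩ := he i hi h hinv
  refine ⟨⟨hr, by omega⟩, ok, ?_, ?_⟩
  · intro hlt
    simp only [Exp.eval, hloc, hev] at hlt
    obtain ⟨hc, htri⟩ := step i hlt h hinv hloc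
    refine ⟨cost i, ∑ i ∈ Finset.Ico (i + 1) N, cost i, hc,
      (Finset.sum_eq_sum_Ico_succ_bot hlt _).ge, Tri.seq htri ?_⟩
    rintro h'' ⟨g1, g2⟩
    have g3 : (Exp.add (.loc r) (.lit 1) : Exp n m).eval h'' = i + 1 := by simp [Exp.eval, g1]
    refine Blk.tri ⟨hr, ⟨⟨hr, by omega⟩, h1W, ?_⟩, ?_⟩ ⟨i + 1, hlt, ?_, ?_, rfl⟩ hc
    · simp only [Exp.eval, g1]; omega
    · rw [g3]; omega
    · rw [Blk.run, g3]; exact g2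
    · rw [Blk.run, g3]; simp
  · intro hge
    simp only [Exp.eval, hloc, hev] at hge
    obtain rfl : i = N := by omega
    exact hinv

end Language

end Ajar

end

noncomputable section

namespace Ajar

/-! ### Tuples and their codes -/

section Tuples

variable {n : ℕ}

abbrev Tup (n : ℕ) := Fin n → ℕ

/-- The tuple `t` with the attributes outside `S` set to `0`. -/
def proj (S : Finset (Fin n)) (t : Tup n) : Tup n := fun a => if a ∈ S then t a else 0

/-- All values of `t` are below `M`. -/
def Bd (M : ℕ) (t : Tup n) : Prop := ∀ a, t a < M

/-- A base `M` number whose digit at position `a` is the value of the attribute `a`. Attributes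
outside a schema have digit `0`, so tuples over all schemas share one coding and a projection just
deletes digits. -/
def enc (M : ℕ) (t : Tup n) : ℕ := ∑ a : Fin n, t a * M ^ (a : ℕ)

theorem proj_apply_of_mem {S : Finset (Fin n)} {a : Fin n} (h : a ∈ S) (t : Tup n) :
    proj S t a = t a := if_pos h

theorem proj_apply_of_notMem {S : Finset (Fin n)} {a : Fin n} (h : a ∉ S) (t : Tup n) :
    proj S t a = 0 := if_neg h

theorem proj_proj (S T : Finset (Fin n)) (t : Tup n) : proj S (proj T t) = proj (S ∩ T) t := by
  ext a
  by_cases h : a ∈ S <;> by_cases h' : a ∈ T <;> simp [proj, h, h']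

theorem proj_proj_of_subset {S T : Finset (Fin n)} (h : S ⊆ T) (t : Tup n) :
    proj S (proj T t) = proj S t := by
  rw [proj_proj, Finset.inter_eq_left.2 h]

theorem proj_eq_proj_iff {S : Finset (Fin n)} {t u : Tup n} :
    proj S t = proj S u ↔ ∀ a ∈ S, t a = u a := by
  constructor
  · intro h a ha
    simpa [proj, ha] using congrFun h a
  · intro h
    ext a
    by_cases ha : a ∈ S <;> simp [proj, ha, h]

theorem proj_eq_self_iff {S : Finset (Fin n)} {t : Tup n} :
    proj S t = t ↔ ∀ a ∉ S, t a = 0 := by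
  constructor
  · intro h a ha
    rw [← h, proj_apply_of_notMem ha]
  · intro h
    ext a
    by_cases ha : a ∈ S <;> simp [proj, ha, h]

theorem proj_update_of_notMem {S : Finset (Fin n)} {c : Fin n} (h : c ∉ S) (t : Tup n) (v : ℕ) :
    proj S (Function.update t c v) = proj S t := by
  rw [proj_eq_proj_iff]
  intro a ha
  rw [Function.update_of_ne]
  rintro rfl
  exact h ha

theorem proj_update_of_mem {S : Finset (Fin n)} {c : Fin n} (h : c ∈ S) (t : Tup n) (v : ℕ) :
    proj S (Function.update t c v) = Function.update (proj S t) c v := by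
  ext a
  by_cases ha : a = c
  · subst ha; simp [proj, h]
  · simp [proj, Function.update_of_ne ha]

theorem proj_erase_update (S : Finset (Fin n)) (c : Fin n) (t : Tup n) (v : ℕ) :
    proj (S.erase c) (Function.update t c v) = proj (S.erase c) t :=
  proj_update_of_notMem (S.notMem_erase c) t v

theorem update_proj_erase {S : Finset (Fin n)} {c : Fin n} (h : c ∈ S) (t : Tup n) :
    Function.update (proj (S.erase c) t) c (t c) = proj S t := by
  ext a
  by_cases ha : a = c
  · subst ha; simp [proj, h]
  · simp [proj, ha]

theorem Bd.proj {M : ℕ} {t : Tup n} (h : Bd M t) (S : Finset (Fin n)) : Bd M (proj S t) := by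
  intro a
  by_cases ha : a ∈ S
  · simpa [Ajar.proj, ha] using h a
  · simpa [Ajar.proj, ha] using (Nat.zero_le _).trans_lt (h a)

theorem Bd.update {M : ℕ} {t : Tup n} (h : Bd M t) {c : Fin n} {v : ℕ} (hv : v < M) :
    Bd M (Function.update t c v) := by
  intro a
  by_cases ha : a = c
  · subst ha; simpa using hv
  · simpa [Function.update_of_ne ha] using h a

theorem enc_eq {M : ℕ} {t : Tup n} (h : Bd M t) :
    enc M t = finFunctionFinEquiv (fun a => (⟨t a, h a⟩ : Fin M)) := by
  rw [finFunctionFinEquiv_apply, enc]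

theorem enc_lt {M : ℕ} {t : Tup n} (h : Bd M t) : enc M t < M ^ n := by
  rw [enc_eq h]; exact Fin.is_lt _

theorem enc_injOn {M : ℕ} {t u : Tup n} (ht : Bd M t) (hu : Bd M u) (h : enc M t = enc M u) :
    t = u := by
  rw [enc_eq ht, enc_eq hu] at h
  have := finFunctionFinEquiv.injective (Fin.ext h)
  ext a
  simpa using congrFun this a

theorem enc_digit {M : ℕ} {t : Tup n} (h : Bd M t) (a : Fin n) :
    enc M t / M ^ (a : ℕ) % M = t a := by
  have := congrFun (finFunctionFinEquiv.symm_apply_apply (fun a => (⟨t a, h a⟩ : Fin M))) a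
  rw [enc_eq h]
  exact congrArg Fin.val this

theorem enc_update {M : ℕ} {t : Tup n} {c : Fin n} (hc : t c = 0) (v : ℕ) :
    enc M (Function.update t c v) = enc M t + v * M ^ (c : ℕ) := by
  rw [enc, enc, ← Finset.add_sum_erase _ _ (Finset.mem_univ c),
    ← Finset.add_sum_erase _ (fun a => t a * M ^ (a : ℕ)) (Finset.mem_univ c), hc]
  simp only [Function.update_self, zero_mul, zero_add]
  rw [add_comm]
  congr 1
  refine Finset.sum_congr rfl fun a ha => ?_
  rw [Function.update_of_ne (Finset.ne_of_mem_erase ha)]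

theorem enc_proj {M : ℕ} (S : Finset (Fin n)) (t : Tup n) :
    enc M (proj S t) = ∑ a ∈ S, t a * M ^ (a : ℕ) := by
  rw [enc, ← Finset.sum_filter_add_sum_filter_not Finset.univ (· ∈ S)]
  rw [Finset.sum_eq_zero (s := Finset.univ.filter (· ∉ S))]
  · rw [add_zero, Finset.filter_mem_eq_inter, Finset.univ_inter]
    exact Finset.sum_congr rfl fun a ha => by rw [proj_apply_of_mem ha]
  · intro a ha
    rw [proj_apply_of_notMem (Finset.mem_filter.1 ha).2, zero_mul]

/-- Distinct tuples have distinct codes below `M ^ n`. This keeps every counter and list index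
within the word size. -/
theorem length_le_of_nodup_of_bd {M : ℕ} {l : List (Tup n)} (hl : l.Nodup)
    (hb : ∀ t ∈ l, Bd M t) : l.length ≤ M ^ n := by
  have h : (l.map (enc M)).Nodup :=
    hl.map_on fun t ht u hu h => enc_injOn (hb t ht) (hb u hu) h
  have h2 : (l.map (enc M)).toFinset ⊆ Finset.range (M ^ n) := by
    intro x hx
    obtain ⟨t, ht, rfl⟩ := List.mem_map.1 (List.mem_toFinset.1 hx)
    exact Finset.mem_range.2 (enc_lt (hb t ht))
  simpa [List.toFinset_card_of_nodup h] using Finset.card_le_card h2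

end Tuples

/-! ### Tables addressed by the codes of tuples. -/

section Tables

variable {n m : ℕ} {ι K : Type*}

/-- The key of the table of the powers of `M`. -/
def baseKey : Key n := (0, 0, ∅)

def pw (i : ℕ) : Exp n m := .get (.tab 1 baseKey) (.lit i)

def cntE (d : Key n) : Exp n m := .get (.tab 0 d) (.lit 0)

/-- The word size suffices for codes and pairs of codes. -/
structure Fit (n m W M : ℕ) : Prop where
  pos : 1 ≤ M
  -- The exponent `2 * n` is that of a pair of codes, such as a group and a position in it; the two
  -- further powers and the factor leave room for literals and small multiples.
  le : (n + m + 8) * M ^ (2 * n + 2) ≤ W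

theorem Fit.small {W M : ℕ} (hf : Fit n m W M) {c : ℕ} (hc : c < n + m + 8) : c < W :=
  hc.trans_le ((Nat.le_mul_of_pos_right _ (Nat.pow_pos hf.pos)).trans hf.le)

theorem Fit.pow_lt {W M : ℕ} (hf : Fit n m W M) {i : ℕ} (hi : i ≤ 2 * n + 2) :
    7 * M ^ i < W := by
  have h1 : M ^ i ≤ M ^ (2 * n + 2) := Nat.pow_le_pow_right hf.pos hi
  have h2 : 0 < M ^ i := Nat.pow_pos hf.pos
  have h3 : 8 * M ^ (2 * n + 2) ≤ (n + m + 8) * M ^ (2 * n + 2) := Nat.mul_le_mul_right _ (by omega)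
  have := hf.le
  omega

theorem Fit.enc_lt {W M : ℕ} (hf : Fit n m W M) {t : Tup n} (h : Bd M t) : enc M t < W := by
  have := Ajar.enc_lt h
  have := hf.pow_lt (i := n) (by omega)
  omega

/-- The table of the powers of `M` is present. -/
def HasPow (M : ℕ) (h : HS n m K) : Prop := ∀ i ≤ n + 1, h.w (.tab 1 baseKey) i = M ^ i

/-- There is no remainder instruction, so the digit is obtained as `q - q / M * M`. The powers of
`M` are read from a table, which makes the extraction of a digit take constant time. -/
def digE (a : Fin n) (e : Exp n m) : Exp n m :=
  .sub (.div e (pw a)) (.mul (.div (.div e (pw a)) (pw 1)) (pw 1))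

def sumE (l : List (Exp n m)) : Exp n m := l.foldr .add (.lit 0)

def projE (S : Finset (Fin n)) (e : Exp n m) : Exp n m :=
  sumE (S.toList.map fun a => .mul (digE a e) (pw a))

theorem sumE_eval (l : List (Exp n m)) (h : HS n m K) :
    (sumE l).eval h = (l.map fun e => e.eval h).sum := by
  induction l with
  | nil => rfl
  | cons e l ih => simpa [sumE, Exp.eval] using ih

theorem sumE_ok {W : ℕ} {l : List (Exp n m)} {h : HS n m K} (hl : ∀ e ∈ l, e.Ok W h)
    (hs : (l.map fun e => e.eval h).sum < W) : (sumE l).Ok W h := by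
  induction l with
  | nil => exact hs
  | cons e l ih =>
    simp only [List.map_cons, List.sum_cons] at hs
    refine ⟨hl e (by simp), ih (fun e he => hl e (by simp [he])) (by omega), ?_⟩
    have := sumE_eval l h
    rw [sumE] at this
    rw [this]; exact hs

theorem pw_ok {W M : ℕ} (hf : Fit n m W M) {i : ℕ} (hi : i ≤ n + 1) (h : HS n m K) :
    (pw i : Exp n m).Ok W h := hf.small (by omega)

theorem pw_eval {M : ℕ} {h : HS n m K} (hp : HasPow M h) {i : ℕ} (hi : i ≤ n + 1) :
    (pw i : Exp n m).eval h = M ^ i := hp i hi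

variable {W M : ℕ} {h : HS n m K} {e : Exp n m} {t : Tup n}

theorem digE_eval (hp : HasPow M h) (ht : Bd M t) (he : e.eval h = enc M t) (a : Fin n) :
    (digE a e).eval h = t a := by
  have ha := a.2
  have h1 := pw_eval (m := m) hp (i := 1) (by omega)
  have h2 := pw_eval (m := m) hp (i := a) (by omega)
  simp only [digE, Exp.eval, h1, h2, he, pow_one]
  rw [← enc_digit ht a]
  have := Nat.div_add_mod (enc M t / M ^ (a : ℕ)) M
  rw [mul_comm] at this
  omega

theorem digE_ok (hf : Fit n m W M) (hp : HasPow M h) (ht : Bd M t) (he : e.eval h = enc M t)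
    (ok : e.Ok W h) (a : Fin n) : (digE a e).Ok W h := by
  have ha := a.2
  have h1 := pw_eval (m := m) hp (i := 1) (by omega)
  have h2 := pw_eval (m := m) hp (i := a) (by omega)
  have h3 := hf.enc_lt ht
  have h4 : enc M t / M ^ (a : ℕ) ≤ enc M t := Nat.div_le_self _ _
  have h5 : enc M t / M ^ (a : ℕ) / M * M ≤ enc M t / M ^ (a : ℕ) := Nat.div_mul_le_self _ _
  have o1 := pw_ok hf (i := 1) (by omega) h
  have o2 := pw_ok hf (i := a) (by omega) h
  simp only [digE, Exp.Ok, Exp.eval, h1, h2, he, pow_one]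
  exact ⟨⟨ok, o2, h3⟩, ⟨⟨⟨ok, o2, h3⟩, o1, by omega⟩, o1, by omega⟩, by omega⟩

theorem projE_eval (hp : HasPow M h) (ht : Bd M t) (he : e.eval h = enc M t)
    (S : Finset (Fin n)) : (projE S e).eval h = enc M (proj S t) := by
  rw [projE, sumE_eval, enc_proj, List.map_map, ← Finset.sum_map_toList]
  congr 1
  refine List.map_congr_left fun a _ => ?_
  have ha := a.2
  simp only [Function.comp, Exp.eval, digE_eval hp ht he a, pw_eval (m := m) hp (i := a) (by omega)]

theorem projE_ok (hf : Fit n m W M) (hp : HasPow M h) (ht : Bd M t) (he : e.eval h = enc M t)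
    (ok : e.Ok W h) (S : Finset (Fin n)) : (projE S e).Ok W h := by
  refine sumE_ok ?_ ?_
  · intro f hfm
    obtain ⟨a, -, rfl⟩ := List.mem_map.1 hfm
    have ha := a.2
    refine ⟨digE_ok hf hp ht he ok a, pw_ok hf (by omega) h, ?_⟩
    rw [digE_eval hp ht he a, pw_eval (m := m) hp (i := a) (by omega)]
    refine lt_of_le_of_lt ?_ (hf.enc_lt ht)
    exact Finset.single_le_sum (f := fun a => t a * M ^ (a : ℕ)) (fun _ _ => Nat.zero_le _)
      (Finset.mem_univ a)
  · have := projE_eval hp ht he S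
    rw [projE, sumE_eval] at this
    rw [this]
    exact hf.enc_lt (ht.proj S)

/-! ### Frames -/

def Nm.InKeys (D : Set (Key n)) : Nm n m → Prop
  | .tab _ d => d ∈ D
  | _ => False

/-- The states agree except possibly on local variables and on tables with keys in `D`. -/
def Frame (D : Set (Key n)) (h h' : HS n m K) : Prop :=
  ∀ a : Nm n m, ¬ a.InKeys D → h'.w a = h.w a ∧ h'.k a = h.k a

theorem Frame.refl (D : Set (Key n)) (h : HS n m K) : Frame D h h := fun _ _ => ⟨rfl, rfl⟩

theorem Nm.InKeys.mono {D E : Set (Key n)} (hDE : D ⊆ E) {a : Nm n m} (h : a.InKeys D) :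
    a.InKeys E := by
  cases a <;> first | exact hDE h | exact h

theorem Frame.mono {D E : Set (Key n)} {h h' : HS n m K} (hF : Frame D h h') (hDE : D ⊆ E) :
    Frame E h h' := fun a ha => hF a fun hD => ha (hD.mono hDE)

theorem Frame.trans {D : Set (Key n)} {h h' h'' : HS n m K} (h1 : Frame D h h')
    (h2 : Frame D h' h'') : Frame D h h'' := fun a ha =>
  ⟨(h2 a ha).1.trans (h1 a ha).1, (h2 a ha).2.trans (h1 a ha).2⟩

theorem Frame.w {D : Set (Key n)} {h h' : HS n m K} (hF : Frame D h h') {d : Key n} (hd : d ∉ D)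
    (k : ℕ) : h'.w (.tab k d) = h.w (.tab k d) := (hF (.tab k d) hd).1

theorem Frame.k {D : Set (Key n)} {h h' : HS n m K} (hF : Frame D h h') {d : Key n} (hd : d ∉ D)
    (k : ℕ) : h'.k (.tab k d) = h.k (.tab k d) := (hF (.tab k d) hd).2

theorem Frame.setLoc {D : Set (Key n)} {h h' : HS n m K} (hF : Frame D h h') (r v : ℕ) :
    Frame D h (h'.setLoc r v) := hF

theorem HasPow.congr {D : Set (Key n)} {h h' : HS n m K} (hp : HasPow M h) (hF : Frame D h h')
    (hd : baseKey ∉ D) : HasPow M h' := fun i hi => by rw [hF.w hd]; exact hp i hi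

/-! ### Tables -/

/-- The table `d` lists the tuples of `l`. -/
structure Lst (M : ℕ) (h : HS n m K) (d : Key n) (l : List (Tup n)) : Prop where
  cnt : h.w (.tab 0 d) 0 = l.length
  list : ∀ i (hi : i < l.length), h.w (.tab 1 d) i = enc M l[i]
  nodup : l.Nodup
  bd : ∀ t ∈ l, Bd M t

/-- The table `d` lists the domain `l` of the partial function `f`, together with a dictionary. -/
structure Tab (M : ℕ) (h : HS n m K) (d : Key n) (l : List (Tup n)) (f : Tup n → Option K) :
    Prop extends Lst M h d l where
  mem : ∀ t, t ∈ l ↔ (f t).isSome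
  -- The flags are addressed by the code itself, and absence is `0`, the content of cells that were
  -- never written.
  flag : ∀ t, Bd M t → h.w (.tab 2 d) (enc M t) = if (f t).isSome then 1 else 0
  val : ∀ t x, f t = some x → h.k (.tab 0 d) (enc M t) = x

theorem Lst.congr {D : Set (Key n)} {h h' : HS n m K} {d : Key n} {l : List (Tup n)}
    (hl : Lst M h d l) (hF : Frame D h h') (hd : d ∉ D) : Lst M h' d l :=
  ⟨by rw [hF.w hd]; exact hl.cnt, by rw [hF.w hd]; exact hl.list, hl.nodup, hl.bd⟩

theorem Tab.congr {D : Set (Key n)} {h h' : HS n m K} {d : Key n} {l : List (Tup n)}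
    {f : Tup n → Option K} (hT : Tab M h d l f) (hF : Frame D h h') (hd : d ∉ D) :
    Tab M h' d l f :=
  ⟨hT.toLst.congr hF hd, hT.mem, by rw [hF.w hd]; exact hT.flag, by rw [hF.k hd]; exact hT.val⟩

theorem Tab.bd_of_isSome {h : HS n m K} {d : Key n} {l : List (Tup n)} {f : Tup n → Option K}
    (hT : Tab M h d l f) {t : Tup n} (ht : (f t).isSome) : Bd M t := hT.bd t ((hT.mem t).2 ht)

theorem Tab.setLoc {h : HS n m K} {d : Key n} {l : List (Tup n)} {f : Tup n → Option K}
    (hT : Tab M h d l f) (r v : ℕ) : Tab M (h.setLoc r v) d l f :=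
  hT.congr ((Frame.refl ∅ h).setLoc r v) (Set.notMem_empty d)

/-- The table `d` has not been used. -/
def Unused (h : HS n m K) (d : Key n) : Prop := ∀ k i, h.w (.tab k d) i = 0

theorem Unused.congr {D : Set (Key n)} {h h' : HS n m K} {d : Key n} (hu : Unused h d)
    (hF : Frame D h h') (hd : d ∉ D) : Unused h' d := fun k i => by rw [hF.w hd]; exact hu k i

/-- Zero cells already represent the empty table. A dictionary with `M ^ n` addresses therefore
costs nothing to create. -/
theorem Unused.tab {h : HS n m K} {d : Key n} (hu : Unused h d) (M : ℕ) :
    Tab M h d [] fun _ => none :=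
  ⟨⟨hu 0 0, by simp, by simp, by simp⟩, by simp, fun t _ => by simpa using hu 2 _, by simp⟩

/-- How the annotations of equal tuples are combined. -/
inductive Comb (ι : Type*) where
  | keep
  | mul
  | plus (i : ι)

def Comb.exp : Comb ι → AExp n m ι → AExp n m ι → AExp n m ι
  | .keep, y, _ => y
  | .mul, y, x => .mul y x
  | .plus i, y, x => .plus i y x

/-- Inserts the tuple with code in local variable `9` into table `d`, with annotation `x`. -/
def upsertB (d : Key n) (x : AExp n m ι) (c : Comb ι) : Blk n m ι :=
  .ifEq (.get (.tab 2 d) (.loc 9)) (.lit 0)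
    (.seq (.set (.tab 1 d) (cntE d) (.loc 9))
      (.seq (.set (.tab 0 d) (.lit 0) (.add (cntE d) (.lit 1)))
        (.seq (.set (.tab 2 d) (.loc 9) (.lit 1)) (.aset (.tab 0 d) (.loc 9) x))))
    (.aset (.tab 0 d) (.loc 9) (c.exp (.get (.tab 0 d) (.loc 9)) x))

variable [CommMonoidWithZero K] {O : PlusOps ι K}

def Comb.op (O : PlusOps ι K) : Comb ι → K → K → K
  | .keep, y, _ => y
  | .mul, y, x => y * x
  | .plus i, y, x => O.plus i y x

theorem Comb.exp_eval (c : Comb ι) (y x : AExp n m ι) (h : HS n m K) :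
    (c.exp y x).eval O h = c.op O (y.eval O h) (x.eval O h) := by cases c <;> rfl

omit [CommMonoidWithZero K] in
theorem Comb.exp_ok (c : Comb ι) {y x : AExp n m ι} {h : HS n m K} (hy : y.Ok W h)
    (hx : x.Ok W h) : (c.exp y x).Ok W h := by
  cases c
  · exact hy
  · exact ⟨hy, hx⟩
  · exact ⟨hy, hx⟩

omit [CommMonoidWithZero K] in
theorem Frame.setW {D : Set (Key n)} {h h' : HS n m K} (hF : Frame D h h') {d : Key n}
    (hd : d ∈ D) (k i v : ℕ) : Frame D h (h'.setW (.tab k d) i v) := by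
  intro a ha
  have : a ≠ .tab k d := by rintro rfl; exact ha hd
  simpa [this] using hF a ha

omit [CommMonoidWithZero K] in
theorem Frame.setK {D : Set (Key n)} {h h' : HS n m K} (hF : Frame D h h') {d : Key n}
    (hd : d ∈ D) (k i : ℕ) (v : K) : Frame D h (h'.setK (.tab k d) i v) := by
  intro a ha
  have : a ≠ .tab k d := by rintro rfl; exact ha hd
  simpa [this] using hF a ha

/-- Inserting `v` at `g` into a partial function. -/
def upd (op : K → K → K) (f : Tup n → Option K) (g : Tup n) (v : K) : Tup n → Option K :=
  Function.update f g (some (match f g with | none => v | some y => op y v))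

/-- The hypothesis on `x` covers all states that differ from `h` only in table `d`, because for a
new tuple the annotation is evaluated after the list, the counter and the flag have been written. -/
theorem upsertB_spec (hf : Fit n m W M) {h : HS n m K} {d : Key n} {l : List (Tup n)}
    {f : Tup n → Option K} (hT : Tab M h d l f) {g : Tup n} (hg : Bd M g)
    (h9 : h.loc 9 = enc M g) {x : AExp n m ι} {v : K}
    (hx : ∀ h', Frame {d} h h' → h'.loc = h.loc → x.Ok W h' ∧ x.eval O h' = v) (c : Comb ι) :
    (upsertB d x c).Ok O W h ∧ Frame {d} h ((upsertB d x c).run O h) ∧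
      ((upsertB d x c).run O h).loc = h.loc ∧
      ∃ l', Tab M ((upsertB d x c).run O h) d l' (upd (c.op O) f g v) ∧
        l'.length ≤ l.length + 1 := by
  have hW := hf.enc_lt hg
  have h0W : 0 < W := by omega
  have h1W : 1 < W := hf.small (by omega)
  have hlen : l.length + 1 < W := by
    have := length_le_of_nodup_of_bd hT.nodup hT.bd
    have := hf.pow_lt (i := n) (by omega)
    have : 0 < M ^ n := Nat.pow_pos hf.pos
    omega
  have ok9 : ∀ h' : HS n m K, h'.loc = h.loc → (Exp.loc 9 : Exp n m).Ok W h' := fun h' hl =>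
    ⟨by omega, by rw [hl, h9]; exact hW⟩
  have hflag := hT.flag g hg
  by_cases hs : (f g).isSome
  · obtain ⟨y, hy⟩ := Option.isSome_iff_exists.1 hs
    have hcond : ¬ (Exp.get (.tab 2 d) (.loc 9) : Exp n m).eval h = (Exp.lit 0 : Exp n m).eval h := by
      simp [Exp.eval, h9, hflag, hs]
    obtain ⟨x1, x2⟩ := hx h (.refl _ _) rfl
    have hrun : (upsertB d x c).run O h = h.setK (.tab 0 d) (enc M g) (c.op O y v) := by
      simp only [upsertB, Blk.run, if_neg hcond, Comb.exp_eval, x2]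
      simp [Exp.eval, AExp.eval, h9, hT.val g y hy]
    rw [hrun]
    refine ⟨⟨ok9 h rfl, h0W, fun h => absurd h hcond, fun _ => ⟨ok9 h rfl,
      c.exp_ok (ok9 h rfl) x1⟩⟩, (Frame.refl _ h).setK (Set.mem_singleton d) _ _ _, rfl, l, ⟨⟨?_, ?_, ?_, ?_⟩,
      ?_, ?_, ?_⟩, by omega⟩
    · exact hT.cnt
    · exact hT.list
    · exact hT.nodup
    · exact hT.bd
    · intro t
      rw [hT.mem]
      by_cases htg : t = g
      · subst htg; simp [upd, hs]
      · simp [upd, htg]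
    · intro t ht
      by_cases htg : t = g
      · subst htg; simp [upd, hflag, hs]
      · simpa [upd, htg] using hT.flag t ht
    · intro t z hz
      by_cases htg : t = g
      · subst htg
        simp only [upd, Function.update_self, hy, Option.some.injEq] at hz
        simp [hz]
      · simp only [upd, Function.update_of_ne htg] at hz
        have hne : enc M t ≠ enc M g := fun he =>
          htg (enc_injOn (hT.bd_of_isSome (by simp [hz])) hg he)
        simpa [hne] using hT.val t z hz
  · have hn : f g = none := by simpa using hs
    have hcond : (Exp.get (.tab 2 d) (.loc 9) : Exp n m).eval h = (Exp.lit 0 : Exp n m).eval h := by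
      simp [Exp.eval, h9, hflag, hs]
    set h1 := h.setW (.tab 1 d) l.length (enc M g) with hh1
    set h2 := h1.setW (.tab 0 d) 0 (l.length + 1) with hh2
    set h3 := h2.setW (.tab 2 d) (enc M g) 1 with hh3
    have F3 : Frame {d} h h3 := (((Frame.refl _ h).setW (Set.mem_singleton d) _ _ _).setW
      (Set.mem_singleton d) _ _ _).setW (Set.mem_singleton d) _ _ _
    obtain ⟨x1, x2⟩ := hx h3 F3 rfl
    have e1 : (Blk.set (.tab 1 d) (cntE d) (.loc 9) : Blk n m ι).run O h = h1 := by
      simp [Blk.run, cntE, Exp.eval, h9, hT.cnt, hh1]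
    have e2 : (Blk.set (.tab 0 d) (.lit 0) (.add (cntE d) (.lit 1)) : Blk n m ι).run O h1 = h2 := by
      simp [Blk.run, cntE, Exp.eval, hh2]
      simp [hh1, hT.cnt]
    have e3 : (Blk.set (.tab 2 d) (.loc 9) (.lit 1) : Blk n m ι).run O h2 = h3 := by
      simp only [Blk.run, Exp.eval, hh3]
      congr 1
    have hrun : (upsertB d x c).run O h = h3.setK (.tab 0 d) (enc M g) v := by
      rw [upsertB, Blk.run, if_pos hcond, Blk.run, e1, Blk.run, e2, Blk.run, e3, Blk.run, x2]
      congr 1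
    rw [hrun]
    refine ⟨⟨ok9 h rfl, h0W, fun _ => ⟨⟨h0W, ok9 h rfl⟩, ?_⟩, fun h => absurd hcond h⟩,
      F3.setK (Set.mem_singleton d) _ _ _, rfl, l ++ [g], ⟨⟨?_, ?_, ?_, ?_⟩, ?_, ?_, ?_⟩, by simp⟩
    · rw [e1]
      refine ⟨⟨h0W, h0W, h1W, ?_⟩, ?_⟩
      · simp only [cntE, Exp.eval]
        simp only [hh1, HS.setW_w, ne_eq, Nm.tab.injEq, zero_ne_one, false_and, not_false_eq_true,
          Function.update_of_ne, hT.cnt]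
        omega
      · rw [e2]
        exact ⟨⟨ok9 h2 rfl, h1W⟩, by rw [e3]; exact ⟨ok9 h3 rfl, x1⟩⟩
    · simp [hh3, hh2]
    · intro i hi
      simp only [List.length_append, List.length_singleton] at hi
      rcases Nat.lt_succ_iff_lt_or_eq.1 hi with hi | rfl
      · have : i ≠ l.length := hi.ne
        simp [hh3, hh2, hh1, this, List.getElem_append_left hi, hT.list i hi]
      · simp [hh3, hh2, hh1]
    · refine List.nodup_append.2 ⟨hT.nodup, by simp, ?_⟩
      intro a ha b hb
      simp only [List.mem_singleton] at hb
      subst hb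
      rintro rfl
      exact hs ((hT.mem a).1 ha)
    · intro t ht
      rcases List.mem_append.1 ht with ht | ht
      · exact hT.bd t ht
      · rw [List.mem_singleton.1 ht]; exact hg
    · intro t
      by_cases htg : t = g
      · subst htg; simp [upd]
      · simp [upd, htg, hT.mem]
    · intro t ht
      by_cases htg : t = g
      · subst htg; simp [upd, hh3]
      · have hne : enc M t ≠ enc M g := fun he => htg (enc_injOn ht hg he)
        simpa [upd, htg, hh3, hne, hh2, hh1] using hT.flag t ht
    · intro t z hz
      by_cases htg : t = g
      · subst htg
        simp only [upd, Function.update_self, hn, Option.some.injEq] at hz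
        simp [hz]
      · simp only [upd, Function.update_of_ne htg] at hz
        have hne : enc M t ≠ enc M g := fun he =>
          htg (enc_injOn (hT.bd_of_isSome (by simp [hz])) hg he)
        simpa [hne, hh3, hh2, hh1] using hT.val t z hz

end Tables

end Ajar

end

noncomputable section

namespace Ajar

section Loops

variable {n m : ℕ} {ι K : Type*} [CommMonoidWithZero K] {O : PlusOps ι K} {W M : ℕ}

/-! ### Loops over tables -/

/-- A loop over the tuples of the table `d`; their codes are in local variable `1`. -/
def forTab (d : Key n) (c : Cmd ι) : Cmd ι :=
  forI (m := m) 0 (cntE d)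
    (.seq (Blk.loc (n := n) (m := m) 1 (.get (.tab 1 d) (.loc 0))).code c)

omit [CommMonoidWithZero K] in
theorem sum_range_getD_map {α : Type*} (l : List α) (cost : α → ℕ) :
    ∑ i ∈ Finset.range l.length, (l.map cost).getD i 1 = (l.map cost).sum := by
  rw [Finset.sum_range, ← Fin.sum_univ_getElem (l.map cost)]
  refine Fintype.sum_equiv (finCongr (by simp)) _ _ fun i => ?_
  simp

/-- The invariant is indexed by the list of tuples already treated. It must ignore the local
variables `0` and `1`, which belong to the loop. -/
theorem Tri.forTab (hf : Fit n m W M) {d : Key n} {l : List (Tup n)} {c : Cmd ι}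
    {h : HS n m K} {X : ℕ} (Inv : List (Tup n) → HS n m K → Prop) (cost : Tup n → ℕ)
    (h0 : Inv [] h) (hl : ∀ pre h', Inv pre h' → Lst M h' d l)
    (hloc : ∀ pre h' r v, r ≤ 1 → Inv pre h' → Inv pre (h'.setLoc r v))
    (hcost : ∀ t, 1 ≤ cost t)
    (step : ∀ pre t post, l = pre ++ t :: post → ∀ h', Inv pre h' → h'.loc 1 = enc M t →
      Tri O W c h' (cost t) fun h'' => h''.loc 0 = h'.loc 0 ∧ Inv (pre ++ [t]) h'')
    (hX : (l.map cost).sum + 1 ≤ X) : Tri O W (forTab (m := m) d c) h X (Inv l) := by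
  have hL := hl _ _ h0
  have hlen : l.length + 1 < W := by
    have := length_le_of_nodup_of_bd hL.nodup hL.bd
    have := hf.pow_lt (i := n) (by omega)
    have : 0 < M ^ n := Nat.pow_pos hf.pos
    omega
  refine Tri.mono (Tri.forI (fun i h' => Inv (l.take i) h') (fun i => (l.map cost).getD i 1)
    (by omega) (N := l.length) (by omega) (by omega) ?_ ?_ ?_ ?_ (X := X)) le_rfl ?_
  · simpa using hloc _ _ 0 0 (by omega) h0
  · intro i _ h' hi
    exact ⟨show (0 : ℕ) < W by omega, (hl _ _ hi).cnt⟩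
  · intro i hi h' hinv hi0
    have hc : (l.map cost).getD i 1 = cost l[i] := by simp [hi]
    rw [hc]
    refine ⟨hcost _, Tri.seq (Q := fun h'' => Inv (l.take i) h'' ∧ h''.loc 1 = enc M l[i] ∧
      h''.loc 0 = i) ?_ ?_⟩
    · have hev : (Exp.get (.tab 1 d) (.loc 0) : Exp n m).eval h' = enc M l[i] := by
        simp [Exp.eval, hi0, (hl _ _ hinv).list i hi]
      refine Blk.tri ⟨by omega, ⟨by omega, by omega⟩, ?_⟩ ⟨?_, ?_, ?_⟩ (hcost _)
      · rw [hev]; exact hf.enc_lt (hL.bd _ (List.getElem_mem hi))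
      · exact hloc _ _ 1 _ le_rfl hinv
      · rw [Blk.run, hev]; simp
      · simpa [Blk.run] using hi0
    · rintro h'' ⟨a1, a2, a3⟩
      refine (step (l.take i) l[i] (l.drop (i + 1)) (by simp) h'' a1 a2).mono
        le_rfl ?_
      rintro g ⟨b1, b2⟩
      refine ⟨b1.trans a3, hloc _ _ 0 _ (by omega) ?_⟩
      rwa [List.take_append_getElem hi] at b2
  · rw [sum_range_getD_map]; exact hX
  · intro h' hi
    simpa using hi

/-! ### Accumulation -/

/-- Runs `b` if all equations of the list hold. -/
def ifAll (L : List (Exp n m × Exp n m)) (b : Blk n m ι) : Blk n m ι :=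
  L.foldr (fun p b => .ifEq p.1 p.2 b .skip) b

open Classical in
theorem ifAll_run (L : List (Exp n m × Exp n m)) (b : Blk n m ι) (h : HS n m K) :
    (ifAll L b).run O h = if ∀ p ∈ L, p.1.eval h = p.2.eval h then b.run O h else h := by
  induction L with
  | nil => simp [ifAll]
  | cons p L ih =>
    by_cases hp : p.1.eval h = p.2.eval h
    · simpa [ifAll, Blk.run, hp] using ih
    · simp [ifAll, Blk.run, hp]

theorem ifAll_ok {L : List (Exp n m × Exp n m)} {b : Blk n m ι} {h : HS n m K}
    (hL : ∀ p ∈ L, p.1.Ok W h ∧ p.2.Ok W h)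
    (hb : (∀ p ∈ L, p.1.eval h = p.2.eval h) → b.Ok O W h) : (ifAll L b).Ok O W h := by
  induction L with
  | nil => exact hb (by simp)
  | cons p L ih =>
    refine ⟨(hL p (by simp)).1, (hL p (by simp)).2, fun hp => ?_, fun _ => trivial⟩
    exact ih (fun q hq => hL q (by simp [hq])) fun hq => hb fun q hq' => by
      rcases List.mem_cons.1 hq' with rfl | hq'
      · exact hp
      · exact hq q hq'

/-- For each tuple `t` of table `d₀` that satisfies the equations `L`, the projection of `t` to
`S` is inserted into table `d` with annotation `x`. -/
def accum (d₀ d : Key n) (S : Finset (Fin n)) (L : List (Exp n m × Exp n m)) (x : AExp n m ι)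
    (c : Comb ι) : Cmd ι :=
  forTab (m := m) d₀ (ifAll L (.seq (.loc 9 (projE S (.loc 1))) (upsertB d x c))).code

open Classical in
/-- The partial function that results from the accumulation over the list `l`. -/
def acc (op : K → K → K) (S : Finset (Fin n)) (P : Tup n → Prop) (v : Tup n → K)
    (l : List (Tup n)) : Tup n → Option K :=
  l.foldl (fun f t => if P t then upd op f (proj S t) (v t) else f) fun _ => none

-- The work for each tuple is a block without loops, so the time is linear in the list that is
-- scanned. The equations and the annotation only need to be correct as long as no table other than
-- `d` changes.
open Classical in
theorem accum_tri (hf : Fit n m W M) {h : HS n m K} (hp : HasPow M h) {d₀ d : Key n}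
    (hd : d₀ ≠ d) (hb : d ≠ baseKey) {l : List (Tup n)} (hl : Lst M h d₀ l)
    (hu : Tab M h d [] fun _ => none) {S : Finset (Fin n)} {L : List (Exp n m × Exp n m)}
    {P : Tup n → Prop} {x : AExp n m ι} {v : Tup n → K} (c : Comb ι)
    (hL : ∀ t ∈ l, ∀ h', Frame {d} h h' → h'.loc 1 = enc M t →
      (∀ p ∈ L, p.1.Ok W h' ∧ p.2.Ok W h') ∧ ((∀ p ∈ L, p.1.eval h' = p.2.eval h') ↔ P t))
    (hx : ∀ t ∈ l, P t → ∀ h', Frame {d} h h' → h'.loc 1 = enc M t →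
      x.Ok W h' ∧ x.eval O h' = v t)
    {X : ℕ} (hX : l.length + 1 ≤ X) :
    Tri O W (accum d₀ d S L x c) h X fun h' => Frame {d} h h' ∧
      ∃ l', Tab M h' d l' (acc (c.op O) S P v l) ∧ l'.length ≤ l.length := by
  refine Tri.forTab hf (fun pre h' => Frame {d} h h' ∧
      ∃ l', Tab M h' d l' (acc (c.op O) S P v pre) ∧ l'.length ≤ pre.length) (fun _ => 1)
    ⟨.refl _ _, [], hu, le_rfl⟩ (fun pre h' hi => hl.congr hi.1 hd)
    (fun pre h' r v _ ⟨h1, l', h2, h3⟩ => ⟨h1, l', h2.setLoc r v, h3⟩)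
    (fun _ => le_rfl) ?_ (by simpa using hX)
  rintro pre t post hpre h' ⟨hF, l', hT, hl'⟩ h1
  have ht : t ∈ l := by rw [hpre]; simp
  have hbt := hl.bd t ht
  obtain ⟨ok, hcond⟩ := hL t ht h' hF h1
  have hp' : HasPow M h' := hp.congr hF (fun hm => hb hm.symm)
  have hloc1 : (Exp.loc 1 : Exp n m).Ok W h' := ⟨by omega, by rw [h1]; exact hf.enc_lt hbt⟩
  have hev := projE_eval (e := .loc 1) hp' hbt h1 S
  have hok := projE_ok (e := .loc 1) hf hp' hbt h1 hloc1 S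
  have hspec := fun hPt : P t => upsertB_spec (O := O) (g := proj S t) (x := x) (v := v t) hf
    (h := h'.setLoc 9 (enc M (proj S t))) (d := d) (l := l') (hT.setLoc _ _) (hbt.proj S) (by simp)
    (fun h'' hF' hloc => hx t ht hPt h'' (hF.trans hF') (by rw [hloc]; simpa using h1)) c
  have hacc : acc (c.op O) S P v (pre ++ [t]) = if P t then
      upd (c.op O) (acc (c.op O) S P v pre) (proj S t) (v t) else acc (c.op O) S P v pre := by
    simp only [acc, List.foldl_append, List.foldl_cons, List.foldl_nil]
  refine Blk.tri (ifAll_ok ok fun hc => ⟨⟨by omega, hok, ?_⟩, ?_⟩) ?_ le_rfl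
  · rw [hev]; exact hf.enc_lt (hbt.proj S)
  · rw [Blk.run, hev]
    exact (hspec (hcond.1 hc)).1
  · rw [ifAll_run]
    by_cases hPt : P t
    · rw [if_pos (hcond.2 hPt), hacc, if_pos hPt, Blk.run, Blk.run, hev]
      obtain ⟨-, s1, s2, l'', s3, s4⟩ := hspec hPt
      refine ⟨by rw [s2]; simp, hF.trans s1, l'', s3, ?_⟩
      simp only [List.length_append, List.length_singleton]
      omega
    · rw [if_neg (fun hc => hPt (hcond.1 hc)), hacc, if_neg hPt]
      refine ⟨rfl, hF, l', hT, ?_⟩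
      simp only [List.length_append, List.length_singleton]
      omega

/-! ### Groups -/

/-- The table `d` groups the tuples of `l` by their projection to `S`, and lists for each group
the values of the attribute `c`. -/
def Ext (M : ℕ) (h : HS n m K) (d : Key n) (S : Finset (Fin n)) (c : Fin n)
    (l : List (Tup n)) : Prop :=
  ∀ g : Tup n, Bd M g → h.w (.tab 3 d) (enc M g) = (l.filter fun t => proj S t = g).length ∧
    ∀ i (hi : i < (l.filter fun t => proj S t = g).length),
      h.w (.tab 4 d) (enc M g * M ^ n + i) = (l.filter fun t => proj S t = g)[i] c

omit [CommMonoidWithZero K] in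
theorem Ext.congr {D : Set (Key n)} {h h' : HS n m K} {d : Key n} {S : Finset (Fin n)} {c : Fin n}
    {l : List (Tup n)} (he : Ext M h d S c l) (hF : Frame D h h') (hd : d ∉ D) :
    Ext M h' d S c l := by
  intro g hg
  rw [hF.w hd, hF.w hd]
  exact he g hg

def degE (d : Key n) (e : Exp n m) : Exp n m := .get (.tab 3 d) e

/-- A two-dimensional array simulated in one: the row of the group `g` starts at `enc M g * M ^ n`,
and the size of the group is the next free position. Rows do not overlap, since a group has at most
`M ^ n` members. -/
def groups (d₀ d : Key n) (S : Finset (Fin n)) (c : Fin n) : Cmd ι :=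
  forTab (m := m) d₀ (Blk.seq (.loc 9 (projE S (.loc 1)))
    (.seq (.set (.tab 4 d) (.add (.mul (.loc 9) (pw n)) (degE d (.loc 9))) (digE c (.loc 1)))
      (.set (.tab 3 d) (.loc 9) (.add (degE d (.loc 9)) (.lit 1)))) : Blk n m ι).code

theorem groups_tri (hf : Fit n m W M) {h : HS n m K} (hp : HasPow M h) {d₀ d : Key n}
    (hd : d₀ ≠ d) (hb : d ≠ baseKey) {l : List (Tup n)} (hl : Lst M h d₀ l)
    (hu : Unused h d) (S : Finset (Fin n)) (c : Fin n) {X : ℕ} (hX : l.length + 1 ≤ X) :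
    Tri O W (groups (m := m) d₀ d S c) h X fun h' => Frame {d} h h' ∧ Ext M h' d S c l := by
  have h1W : 1 < W := hf.small (by omega)
  refine Tri.forTab hf (fun pre h' => Frame {d} h h' ∧ Ext M h' d S c pre) (fun _ => 1)
    ⟨.refl _ _, fun g _ => ⟨by simpa using hu 3 _, by simp⟩⟩ (fun pre h' hi => hl.congr hi.1 hd)
    (fun pre h' r v _ hi => hi) (fun _ => le_rfl) ?_ (by simpa using hX)
  rintro pre t post hpre h' ⟨hF, hE⟩ h1
  have ht : t ∈ l := by rw [hpre]; simp
  have hbt := hl.bd t ht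
  have hp' : HasPow M h' := hp.congr hF (fun hm => hb hm.symm)
  have hloc1 : (Exp.loc 1 : Exp n m).Ok W h' := ⟨by omega, by rw [h1]; exact hf.enc_lt hbt⟩
  have hev := projE_eval (e := .loc 1) hp' hbt h1 S
  have hok := projE_ok (e := .loc 1) hf hp' hbt h1 hloc1 S
  have hbg := hbt.proj S
  have hWg := hf.enc_lt hbg
  set g := proj S t with hg
  set h1 := h'.setLoc 9 (enc M g) with hh1
  have hp1 : HasPow M h1 := hp'
  have hdeg := (hE g hbg).1
  set D := (pre.filter fun t => proj S t = g).length with hD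
  -- Strict, because the current tuple `t` is not yet counted in `pre`; hence the new position still
  -- lies in the row of its group.
  have hDle : D < M ^ n := by
    have e1 : D ≤ pre.length := List.length_filter_le _ _
    have e2 := length_le_of_nodup_of_bd hl.nodup hl.bd
    rw [hpre] at e2
    simp only [List.length_append, List.length_cons] at e2
    omega
  have hgD : enc M g * M ^ n + D < M ^ (2 * n) := by
    have := Ajar.enc_lt hbg
    rw [two_mul, pow_add]
    nlinarith
  have hW2 := hf.pow_lt (i := 2 * n) (by omega)
  have hW3 := hf.pow_lt (i := n) (by omega)
  have epw : (pw n : Exp n m).eval h1 = M ^ n := pw_eval hp1 (by omega)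
  have eaddr : (Exp.add (.mul (.loc 9) (pw n)) (degE d (.loc 9)) : Exp n m).eval h1 =
      enc M g * M ^ n + D := by
    simp only [Exp.eval, epw, degE]
    simp [hh1, hdeg]
  have hloc11 : (Exp.loc 1 : Exp n m).eval h1 = enc M t := by simpa [hh1, Exp.eval] using ‹h'.loc 1 = _›
  have hloc1' : (Exp.loc 1 : Exp n m).Ok W h1 := ⟨by omega, by
    have := hf.enc_lt hbt
    rw [← hloc11] at this; exact this⟩
  have edig := digE_eval hp1 hbt hloc11 c
  have okdig := digE_ok hf hp1 hbt hloc11 hloc1' c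
  have ok9 : ∀ h'' : HS n m K, h''.loc = h1.loc → (Exp.loc 9 : Exp n m).Ok W h'' := fun h'' hl =>
    ⟨by omega, by rw [hl]; simpa [hh1] using hWg⟩
  set h2 := h1.setW (.tab 4 d) (enc M g * M ^ n + D) (t c) with hh2
  have edeg2 : (degE d (.loc 9) : Exp n m).eval h2 = D := by
    simp [Exp.eval, degE, hh2, hh1, hdeg]
  have hrun1 : (Blk.loc 9 (projE S (.loc 1)) : Blk n m ι).run O h' = h1 := by rw [Blk.run, hev]
  have hrun2 : (Blk.set (.tab 4 d) (.add (.mul (.loc 9) (pw n)) (degE d (.loc 9)))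
      (digE c (.loc 1)) : Blk n m ι).run O h1 = h2 := by rw [Blk.run, eaddr, edig]
  have hrun3 : (Blk.set (.tab 3 d) (.loc 9) (.add (degE d (.loc 9)) (.lit 1)) : Blk n m ι).run O h2 =
      h2.setW (.tab 3 d) (enc M g) (D + 1) := by
    rw [Blk.run]
    simp only [Exp.eval, edeg2]
    simp [hh2, hh1]
  refine Blk.tri ⟨⟨by omega, hok, by rw [hev]; exact hWg⟩, ?_⟩ ?_ le_rfl
  · rw [hrun1]
    refine ⟨⟨⟨⟨ok9 _ rfl, pw_ok hf (by omega) _, ?_⟩, ok9 _ rfl, by rw [← Exp.eval, eaddr]; omega⟩,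
      okdig⟩, ?_⟩
    · simp only [Exp.eval, epw]
      simp only [hh1, HS.setLoc_loc, Function.update_self]
      omega
    · rw [hrun2]
      exact ⟨ok9 _ rfl, ok9 _ rfl, h1W, by
        rw [edeg2]
        have : 0 < M ^ n := Nat.pow_pos hf.pos
        simp only [Exp.eval]; omega⟩
  · rw [Blk.run, hrun1, Blk.run, hrun2, hrun3]
    refine ⟨by simp [hh2, hh1], ((hF.setLoc 9 _).setW (Set.mem_singleton d) _ _ _).setW
      (Set.mem_singleton d) _ _ _, ?_⟩
    intro g' hg'
    by_cases hgg : g' = g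
    · rw [hgg]
      have hfil : ((pre ++ [t]).filter fun t => proj S t = g) =
          (pre.filter fun t => proj S t = g) ++ [t] := by simp [List.filter_append, hg]
      rw [hfil]
      refine ⟨by simp [hD], fun i hi => ?_⟩
      simp only [List.length_append, List.length_singleton, ← hD] at hi
      rcases Nat.lt_succ_iff_lt_or_eq.1 hi with hi | rfl
      · have h5 : enc M g * M ^ n + i ≠ enc M g * M ^ n + D := by omega
        have h6 := (hE g hbg).2 i hi
        rw [← Function.update_of_ne h5 (t c) (h'.w (.tab 4 d))] at h6
        simpa [hh2, hh1, List.getElem_append_left, hi, ← hD] using h6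
      · simp [hh2, hh1, hD]
    · have hfil : ((pre ++ [t]).filter fun t => proj S t = g') =
          (pre.filter fun t => proj S t = g') := by
        have : ¬ proj S t = g' := fun he => hgg he.symm
        simp [List.filter_append, this]
      have hne : enc M g' ≠ enc M g := fun he => hgg (enc_injOn hg' hbg he)
      rw [hfil]
      refine ⟨by simpa [hh2, hh1, hne] using (hE g' hg').1, fun i hi => ?_⟩
      have hi' : i < M ^ n := by
        refine hi.trans_le ((List.length_filter_le _ _).trans ?_)
        have e2 := length_le_of_nodup_of_bd hl.nodup hl.bd
        rw [hpre] at e2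
        simp only [List.length_append, List.length_cons] at e2
        omega
      have h5 : enc M g' * M ^ n + i ≠ enc M g * M ^ n + D := by
        intro he
        apply hne
        have hpos : 0 < M ^ n := by omega
        have q1 : (enc M g' * M ^ n + i) / M ^ n = enc M g' := by
          rw [mul_comm, Nat.mul_add_div hpos, Nat.div_eq_of_lt hi', add_zero]
        have q2 : (enc M g * M ^ n + D) / M ^ n = enc M g := by
          rw [mul_comm, Nat.mul_add_div hpos, Nat.div_eq_of_lt hDle, add_zero]
        rw [← q1, he, q2]
      simpa [hh2, hh1, h5] using (hE g' hg').2 i hi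

end Loops

end Ajar

end

noncomputable section

namespace Ajar

/-! ### Extending tuples by an attribute through the smallest group. -/

section Extension

variable {n m : ℕ} {ι K : Type*} [CommMonoidWithZero K] {O : PlusOps ι K} {W M : ℕ}

/-- Runs the program of an element of a list whose key is smallest. -/
def argThen {α : Type*} (key : α → Exp n m) (leaf : α → Cmd ι) : α → List α → Cmd ι
  | a, [] => leaf a
  | a, b :: r => cIfLt (key b) (key a) (argThen key leaf b r) (argThen key leaf a r)

/-- The candidate with the smallest key so far is remembered by the position in the program. The
program text doubles with each candidate, but the list of candidates is fixed. -/
theorem argThen_tri {α : Type*} {key : α → Exp n m} {leaf : α → Cmd ι} {a : α} {r : List α}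
    {h : HS n m K} {X : ℕ} {Q : HS n m K → Prop} (ok : ∀ b ∈ a :: r, (key b).Ok W h)
    (hX : 1 ≤ X) (hl : ∀ b ∈ a :: r, (∀ b' ∈ a :: r, (key b).eval h ≤ (key b').eval h) →
      Tri O W (leaf b) h X Q) : Tri O W (argThen key leaf a r) h X Q := by
  induction r generalizing a with
  | nil => exact hl a (by simp) (by simp)
  | cons b r ih =>
    refine Tri.ifLt (ok b (by simp)) (ok a (by simp)) hX (fun hlt => ?_) fun hge => ?_
    · refine ih (fun c hc => ok c (List.mem_cons_of_mem a hc)) fun c hc hmin => ?_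
      refine hl c (List.mem_cons_of_mem a hc) fun c' hc' => ?_
      rcases List.mem_cons.1 hc' with rfl | hc'
      · exact (hmin b (by simp)).trans hlt.le
      · exact hmin c' hc'
    · have hsub : ∀ c ∈ a :: r, c ∈ a :: b :: r := fun c hc => by
        rcases List.mem_cons.1 hc with rfl | hc <;> simp [*]
      refine ih (fun c hc => ok c (hsub c hc)) fun c hc hmin => ?_
      refine hl c (hsub c hc) fun c' hc' => ?_
      rcases List.mem_cons.1 hc' with rfl | hc'
      · exact hmin c' (by simp)
      rcases List.mem_cons.1 hc' with rfl | hc'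
      · exact (hmin a (by simp)).trans (not_lt.1 hge)
      · exact hmin c' (List.mem_cons_of_mem a hc')

/-- The number of tuples of `l` that agree with `t` on `S`. -/
def grp (S : Finset (Fin n)) (l : List (Tup n)) (t : Tup n) : List (Tup n) :=
  l.filter fun u => proj S u = proj S t

/-- A list of tuples that is grouped in memory: the key, the attributes by which it is grouped,
and the tuples. -/
structure Grouped (n : ℕ) where
  key : Key n
  set : Finset (Fin n)

/-- The size of the group of the tuple in local variable `1`. -/
def Grouped.degE (i : Grouped n) : Exp n m := Ajar.degE i.key (projE i.set (.loc 1))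

structure Grouped.Good (i : Grouped n) (M : ℕ) (h : HS n m K) (c : Fin n) (l : List (Tup n)) :
    Prop where
  ext : Ext M h i.key i.set c l
  bd : ∀ u ∈ l, Bd M u
  nodup : l.Nodup

omit [CommMonoidWithZero K] in
theorem Grouped.Good.congr {i : Grouped n} {D : Set (Key n)} {h h' : HS n m K} {c : Fin n}
    {l : List (Tup n)} (hi : i.Good M h c l) (hF : Frame D h h') (hd : i.key ∉ D) :
    i.Good M h' c l := ⟨hi.ext.congr hF hd, hi.bd, hi.nodup⟩

omit [CommMonoidWithZero K] in
theorem Grouped.Good.degE {i : Grouped n} {h : HS n m K} {c : Fin n} {l : List (Tup n)}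
    (hi : i.Good M h c l) (hf : Fit n m W M) (hp : HasPow M h) {t : Tup n} (ht : Bd M t)
    (h1 : h.loc 1 = enc M t) :
    (i.degE : Exp n m).Ok W h ∧ (i.degE : Exp n m).eval h = (grp i.set l t).length := by
  have hloc1 : (Exp.loc 1 : Exp n m).Ok W h := ⟨by omega, by rw [h1]; exact hf.enc_lt ht⟩
  refine ⟨projE_ok (e := .loc 1) hf hp ht h1 hloc1 _, ?_⟩
  rw [Grouped.degE, Ajar.degE, Exp.eval, projE_eval (e := .loc 1) hp ht h1]
  exact (hi.ext _ (ht.proj _)).1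

theorem grp_length_le {S : Finset (Fin n)} {l : List (Tup n)} (hn : l.Nodup)
    (hb : ∀ u ∈ l, Bd M u) (t : Tup n) : (grp S l t).length ≤ M ^ n :=
  (List.length_filter_le _ _).trans (length_le_of_nodup_of_bd hn hb)

/-- For all tuples `t` of table `d₀`, the extensions of `t` by the values of `c` in the smallest
group that belongs to `t` are inserted into table `d` if they satisfy the equations `L`. -/
def extend (d₀ d : Key n) (c : Fin n) (i₀ : Grouped n) (is : List (Grouped n))
    (L : List (Exp n m × Exp n m)) (x : AExp n m ι) : Cmd ι :=
  -- The inner loop counts in local variable `6`, as `0` and `1` belong to the outer loop. The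
  -- attribute `c` of the tuple has digit `0`, so adding the value times `M ^ c` to the code sets
  -- it.
  forTab (m := m) d₀ (argThen (m := m) Grouped.degE (fun i => forI (m := m) 6 i.degE
    (Blk.seq (.loc 9 (.add (.loc 1) (.mul (.get (.tab 4 i.key)
        (.add (.mul (projE i.set (.loc 1)) (pw n)) (.loc 6))) (pw c))))
      (ifAll L (upsertB d x .keep)) : Blk n m ι).code) i₀ is)

open Classical in
/-- The restriction of `v` to `A` as a partial function. -/
def onSet (A : Set (Tup n)) (v : Tup n → K) : Tup n → Option K :=
  fun t => if t ∈ A then some (v t) else none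

theorem upd_keep_onSet (A : Set (Tup n)) (v : Tup n → K) (g : Tup n) :
    upd (Comb.keep.op O) (onSet A v) g (v g) = onSet (insert g A) v := by
  ext1 t
  by_cases htg : t = g
  · subst htg
    by_cases ht : t ∈ A <;> simp [upd, onSet, ht, Comb.op]
  · by_cases ht : t ∈ A <;> simp [upd, onSet, htg, ht]

-- The relation `G` describes the extensions without reference to a group. Hypothesis `hG` says that
-- every candidate group yields the same extensions once the equations are tested, so the smallest
-- group can be chosen for each tuple separately. Accordingly only smallest groups have to be
-- bounded by `cost`.
open Classical in
theorem extend_tri (hf : Fit n m W M) {h : HS n m K} (hp : HasPow M h) {d₀ d : Key n}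
    (hd : d₀ ≠ d) (hb : d ≠ baseKey) {l : List (Tup n)} (hl : Lst M h d₀ l)
    (hu : Tab M h d [] fun _ => none) {c : Fin n} (hlc : ∀ t ∈ l, t c = 0)
    {i₀ : Grouped n} {is : List (Grouped n)} (ls : Grouped n → List (Tup n))
    (hi : ∀ i ∈ i₀ :: is, i.key ≠ d ∧ i.Good M h c (ls i))
    {L : List (Exp n m × Exp n m)} {x : AExp n m ι} {P : Tup n → Prop} {v : Tup n → K}
    (hL : ∀ t, Bd M t → ∀ h', Frame {d} h h' → h'.loc 9 = enc M t →
      (∀ p ∈ L, p.1.Ok W h' ∧ p.2.Ok W h') ∧ ((∀ p ∈ L, p.1.eval h' = p.2.eval h') ↔ P t))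
    (hx : ∀ t, Bd M t → P t → ∀ h', Frame {d} h h' → h'.loc 9 = enc M t →
      x.Ok W h' ∧ x.eval O h' = v t)
    (G : Tup n → Tup n → Prop)
    (hG : ∀ t ∈ l, ∀ i ∈ i₀ :: is, ∀ t', G t t' ↔
      P t' ∧ ∃ u ∈ grp i.set (ls i) t, t' = Function.update t c (u c))
    (cost : Tup n → ℕ) (hcost : ∀ t ∈ l, ∀ i ∈ i₀ :: is, (∀ i' ∈ i₀ :: is,
      (grp i.set (ls i) t).length ≤ (grp i'.set (ls i') t).length) →
      (grp i.set (ls i) t).length ≤ cost t)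
    {X : ℕ} (hX : (l.map cost).sum + l.length + 1 ≤ X) :
    Tri O W (extend d₀ d c i₀ is L x) h X fun h' => Frame {d} h h' ∧
      ∃ l', Tab M h' d l' (onSet {t' | ∃ t ∈ l, G t t'} v) ∧ l'.length ≤ (l.map cost).sum := by
  refine Tri.forTab hf (fun pre h' => Frame {d} h h' ∧
      ∃ l', Tab M h' d l' (onSet {t' | ∃ t ∈ pre, G t t'} v) ∧ l'.length ≤ (pre.map cost).sum)
    (fun t => cost t + 1) ⟨.refl _ _, [], ?_, by simp⟩
    (fun pre h' hi => hl.congr hi.1 hd)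
    (fun pre h' r v _ ⟨h1, l', h2, h3⟩ => ⟨h1, l', h2.setLoc r v, h3⟩)
    (fun _ => by omega) ?_ ?_
  · convert hu using 1
    ext1 t
    simp [onSet]
  swap
  · rw [List.sum_map_add]
    simpa using hX
  rintro pre t post hpre h' ⟨hF, l', hT, hl'⟩ h1
  have ht : t ∈ l := by rw [hpre]; simp
  have hbt := hl.bd t ht
  have hbk : baseKey ∉ ({d} : Set (Key n)) := fun hm => hb hm.symm
  have hp' : HasPow M h' := hp.congr hF hbk
  have hgood : ∀ i ∈ i₀ :: is, ∀ h', Frame {d} h h' → i.Good M h' c (ls i) :=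
    fun i hm h' hF => (hi i hm).2.congr hF (hi i hm).1
  have hdeg := fun i hm => (hgood i hm h' hF).degE hf hp' hbt h1
  refine argThen_tri (fun i hm => (hdeg i hm).1) (by omega) fun i hm hmin => ?_
  have hle : (grp i.set (ls i) t).length ≤ cost t := hcost t ht i hm fun i' hm' => by
    rw [← (hdeg i hm).2, ← (hdeg i' hm').2]; exact hmin i' hm'
  set q := grp i.set (ls i) t with hq
  have hqle : q.length ≤ M ^ n := grp_length_le (hi i hm).2.nodup (hi i hm).2.bd t
  have hW1 := hf.pow_lt (i := n) (by omega)
  have hW2 := hf.pow_lt (i := 2 * n) (by omega)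
  have hpos : 0 < M ^ n := Nat.pow_pos hf.pos
  set A := {t' | ∃ t ∈ pre, G t t'} with hA
  refine Tri.mono (Tri.forI (fun k h'' => Frame {d} h h'' ∧ h''.loc 1 = enc M t ∧
      h''.loc 0 = h'.loc 0 ∧ ∃ l', Tab M h'' d l' (onSet (A ∪ {t' | P t' ∧ ∃ u ∈ q.take k,
        t' = Function.update t c (u c)}) v) ∧ l'.length ≤ (pre.map cost).sum + k)
    (fun _ => 1) (by omega) (N := q.length) (by omega) (hf.small (by omega)) ?_ ?_ ?_
    (X := cost t + 1) ?_) le_rfl ?_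
  · refine ⟨hF, by simpa using h1, by simp, l', ?_, by simpa using hl'⟩
    convert hT.setLoc 6 0 using 1
    simp
  · rintro k - h'' ⟨F, a1, -, -⟩
    have := (hgood i hm h'' F).degE hf (hp.congr F hbk) hbt a1
    exact ⟨this.1, this.2⟩
  · rintro k hk h'' ⟨F, a1, a0, l'', T, len⟩ hk6
    refine ⟨le_rfl, ?_⟩
    have hp2 : HasPow M h'' := hp.congr F hbk
    set u := q[k] with hu'
    have huq : u ∈ q := List.getElem_mem hk
    have hul : u ∈ ls i := (List.mem_filter.1 huq).1
    have hug : proj i.set u = proj i.set t := by simpa using (List.mem_filter.1 huq).2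
    have hub := (hi i hm).2.bd u hul
    have hloc1 : (Exp.loc 1 : Exp n m).Ok W h'' := ⟨by omega, by rw [a1]; exact hf.enc_lt hbt⟩
    have hpe := projE_eval (e := .loc 1) hp2 hbt a1 i.set
    have hpo := projE_ok (e := .loc 1) hf hp2 hbt a1 hloc1 i.set
    have hbg := hbt.proj i.set
    have hlt := Ajar.enc_lt hbg
    have hc := c.2
    have epn : (pw n : Exp n m).eval h'' = M ^ n := pw_eval hp2 (by omega)
    have epc : (pw c : Exp n m).eval h'' = M ^ (c : ℕ) := pw_eval hp2 (by omega)
    have haddr : enc M (proj i.set t) * M ^ n + k < M ^ (2 * n) := by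
      rw [two_mul, pow_add]
      nlinarith
    have hext := ((hgood i hm h'' F).ext _ hbg).2 k hk
    have eget : (Exp.get (.tab 4 i.key) (.add (.mul (projE i.set (.loc 1)) (pw n)) (.loc 6)) :
        Exp n m).eval h'' = u c := by
      simp only [Exp.eval, hpe, epn, hk6]
      exact hext
    set t' := Function.update t c (u c) with ht'
    have hbt' : Bd M t' := hbt.update (hub c)
    have e9 : (Exp.add (.loc 1) (.mul (.get (.tab 4 i.key)
        (.add (.mul (projE i.set (.loc 1)) (pw n)) (.loc 6))) (pw c)) : Exp n m).eval h'' =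
        enc M t' := by
      have e : ∀ g : Exp n m, (Exp.add (.loc 1) (.mul g (pw c))).eval h'' =
        h''.loc 1 + g.eval h'' * (pw c : Exp n m).eval h'' := fun _ => rfl
      rw [e, eget, epc, a1, ht', enc_update (hlc t ht)]
    have hWt' := hf.enc_lt hbt'
    have hle' : u c * M ^ (c : ℕ) ≤ enc M t' := by
      rw [ht', enc_update (hlc t ht)]; omega
    set h9 := h''.setLoc 9 (enc M t') with hh9
    have F9 : Frame {d} h h9 := F.setLoc 9 _
    obtain ⟨okL, hcond⟩ := hL t' hbt' h9 F9 (by simp [hh9])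
    have hspec := fun hPt : P t' => upsertB_spec (O := O) (g := t') (x := x) (v := v t') hf
      (T.setLoc 9 (enc M t')) hbt' (by simp)
      (fun h3 hF' hloc => hx t' hbt' hPt h3 (F9.trans hF') (by rw [hloc]; simp)) .keep
    rw [upd_keep_onSet] at hspec
    have htake : A ∪ {t' | P t' ∧ ∃ u ∈ q.take (k + 1), t' = Function.update t c (u c)} =
        if P t' then insert t' (A ∪ {t' | P t' ∧ ∃ u ∈ q.take k, t' = Function.update t c (u c)})
        else A ∪ {t' | P t' ∧ ∃ u ∈ q.take k, t' = Function.update t c (u c)} := by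
      have e : q.take (k + 1) = q.take k ++ [u] := (List.take_append_getElem hk).symm
      rw [e]
      split_ifs with hPt
      · ext s
        simp only [Set.mem_union, Set.mem_ofPred_eq, List.mem_append, List.mem_singleton,
          Set.mem_insert_iff]
        constructor
        · rintro (h | ⟨h, u', h' | rfl, rfl⟩)
          · exact Or.inr (Or.inl h)
          · exact Or.inr (Or.inr ⟨h, u', h', rfl⟩)
          · exact Or.inl rfl
        · rintro (rfl | h | ⟨h, u', h', rfl⟩)
          · exact Or.inr ⟨hPt, u, Or.inr rfl, rfl⟩
          · exact Or.inl h
          · exact Or.inr ⟨h, u', Or.inl h', rfl⟩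
      · ext s
        simp only [Set.mem_union, Set.mem_ofPred_eq, List.mem_append, List.mem_singleton]
        constructor
        · rintro (h | ⟨h, u', h' | rfl, rfl⟩)
          · exact Or.inl h
          · exact Or.inr ⟨h, u', h', rfl⟩
          · exact absurd h hPt
        · rintro (h | ⟨h, u', h', rfl⟩)
          · exact Or.inl h
          · exact Or.inr ⟨h, u', Or.inl h', rfl⟩
    refine Blk.tri ⟨⟨by omega, ⟨hloc1, ⟨⟨⟨hpo, pw_ok hf (by omega) _, ?_⟩, ⟨by omega, by omega⟩,
      ?_⟩, pw_ok hf (by omega) _, ?_⟩, ?_⟩, ?_⟩, ?_⟩ ?_ le_rfl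
    · rw [hpe, epn]; omega
    · simp only [Exp.eval, hpe, epn, hk6]; omega
    · rw [eget, epc]; omega
    · have := e9
      rw [Exp.eval] at this
      rw [this]; exact hWt'
    · rw [e9]; exact hWt'
    · rw [Blk.run, e9]
      exact ifAll_ok okL fun hc => (hspec (hcond.1 hc)).1
    · rw [Blk.run, Blk.run, e9, ifAll_run]
      by_cases hPt : P t'
      · rw [if_pos (hcond.2 hPt)]
        rw [if_pos hPt] at htake
        obtain ⟨-, s1, s2, l3, s3, s4⟩ := hspec hPt
        refine ⟨by rw [s2]; simpa [hh9] using hk6, (F9.trans s1).setLoc _ _,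
          by simp [s2, a1], by simp [s2, a0], l3, ?_, by omega⟩
        rw [htake]
        exact s3.setLoc _ _
      · rw [if_neg fun hc => hPt (hcond.1 hc)]
        rw [if_neg hPt] at htake
        refine ⟨by simpa [hh9] using hk6, F9.setLoc _ _,
          by simp [a1], by simp [a0], l'', ?_, by omega⟩
        rw [htake]
        exact (T.setLoc _ _).setLoc _ _
  · simpa using hle
  · rintro h'' ⟨F, -, a0, l'', T, len⟩
    refine ⟨a0, F, l'', ?_, ?_⟩
    · convert T using 2
      ext s
      simp only [Set.mem_ofPred_eq, List.mem_append, List.mem_singleton, List.take_length,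
        Set.mem_union, hA]
      constructor
      · rintro ⟨t₀, h | rfl, hG'⟩
        · exact Or.inl ⟨t₀, h, hG'⟩
        · exact Or.inr ((hG _ ht i hm s).1 hG')
      · rintro (⟨t₀, h, hG'⟩ | h)
        · exact ⟨t₀, Or.inl h, hG'⟩
        · exact ⟨t, Or.inr rfl, (hG _ ht i hm s).2 h⟩
    · simp only [List.map_append, List.sum_append, List.map_cons, List.map_nil, List.sum_cons,
        List.sum_nil]
      omega

/-- Computes the sum of the sizes of the smallest groups into local variable `8`. -/
def costPass (d₀ : Key n) (i₀ : Grouped n) (is : List (Grouped n)) : Cmd ι :=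
  .seq (Blk.loc (n := n) (m := m) 8 (.lit 0)).code (forTab (m := m) d₀
    (argThen (m := m) Grouped.degE (fun i => (Blk.loc (n := n) (m := m) 8
      (.add (.loc 8) i.degE)).code) i₀ is))

/-- Group sizes are stored, so the cost of an extension is found in time linear in the number of
tuples to be extended, without extending them. This allows a step to be rejected before its cost is
paid. -/
theorem costPass_tri (hf : Fit n m W M) {h : HS n m K} (hp : HasPow M h) {d₀ : Key n}
    {l : List (Tup n)} (hl : Lst M h d₀ l) {c : Fin n} {i₀ : Grouped n} {is : List (Grouped n)}
    (ls : Grouped n → List (Tup n)) (hi : ∀ i ∈ i₀ :: is, i.Good M h c (ls i))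
    (cost : Tup n → ℕ) (hcost : ∀ t ∈ l, ∀ i ∈ i₀ :: is, (∀ i' ∈ i₀ :: is,
      (grp i.set (ls i) t).length ≤ (grp i'.set (ls i') t).length) →
      cost t = (grp i.set (ls i) t).length)
    {X : ℕ} (hX : l.length + 1 ≤ X) :
    Tri O W (costPass (ι := ι) (m := m) d₀ i₀ is) h X fun h' =>
      Frame ∅ h h' ∧ h'.loc 8 = (l.map cost).sum := by
  have h0W : 0 < W := hf.small (by omega)
  refine Tri.seq (Q := fun h' => Frame ∅ h h' ∧ h'.loc 8 = 0) (Blk.tri ⟨by omega, h0W, h0W⟩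
    ⟨(Frame.refl _ _).setLoc _ _, by simp [Blk.run, Exp.eval]⟩ (by omega)) ?_
  rintro h1 ⟨F1, h18⟩
  refine Tri.forTab hf (fun pre h' => Frame ∅ h h' ∧ h'.loc 8 = (pre.map cost).sum ∧
      h'.loc 8 ≤ pre.length * M ^ n)
    (fun t => 1) ⟨F1, h18, by omega⟩
    (fun pre h' hi => hl.congr hi.1 (Set.notMem_empty _))
    (fun pre h' r v hr ⟨h1, h2⟩ => ⟨h1, by
      rwa [HS.setLoc_loc, Function.update_of_ne (by omega)]⟩)
    (fun _ => le_rfl) ?_ (by simpa using hX) |>.mono le_rfl fun h' hh => ⟨hh.1, hh.2.1⟩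
  rintro pre t post hpre h' ⟨hF, h8, h8le⟩ hh1
  have ht : t ∈ l := by rw [hpre]; simp
  have hbt := hl.bd t ht
  have hp' : HasPow M h' := hp.congr hF (Set.notMem_empty _)
  have hdeg := fun i hm => ((hi i hm).congr hF (Set.notMem_empty _)).degE hf hp' hbt hh1
  refine argThen_tri (fun i hm => (hdeg i hm).1) le_rfl fun i hm hmin => ?_
  have hc := hcost t ht i hm fun i' hm' => by
    rw [← (hdeg i hm).2, ← (hdeg i' hm').2]; exact hmin i' hm'
  have hqle : (grp i.set (ls i) t).length ≤ M ^ n := grp_length_le (hi i hm).nodup (hi i hm).bd t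
  have hlen : pre.length + 1 ≤ M ^ n := by
    have e2 := length_le_of_nodup_of_bd hl.nodup hl.bd
    rw [hpre] at e2
    simp only [List.length_append, List.length_cons] at e2
    omega
  have hev : (Exp.add (.loc 8) i.degE : Exp n m).eval h' = h'.loc 8 + cost t := by
    rw [Exp.eval, (hdeg i hm).2, hc]; rfl
  have hbound : h'.loc 8 + cost t ≤ (pre.length + 1) * M ^ n := by
    rw [add_mul, one_mul]; omega
  have hlt : h'.loc 8 + cost t < W := by
    have h2 := hf.pow_lt (i := 2 * n) (by omega)
    have h3 := Nat.mul_le_mul_right (M ^ n) hlen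
    rw [two_mul, pow_add] at h2
    omega
  refine Blk.tri ⟨by omega, ⟨⟨by omega, by omega⟩, (hdeg i hm).1, ?_⟩, ?_⟩ ⟨?_, hF.setLoc _ _, ?_⟩
    le_rfl
  · rw [← Exp.eval, hev]; exact hlt
  · rw [hev]; exact hlt
  · simp [Blk.run]
  · rw [Blk.run, hev]
    simpa [← h8] using hbound

end Extension

end Ajar

end

noncomputable section

namespace Ajar

open scoped NNReal

/-! ### The inequality of Finner and the bound for the cost of an extension step -/

/-- Hölder's inequality for exponents of sum at least one. After division by the totals `A j`, the
weighted inequality between geometric and arithmetic mean bounds each product by a convex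
combination of the ratios, and the ratios sum to at most one. -/
theorem sum_prod_rpow_le {α β : Type*} (s : Finset α) (V : Finset β) (a : α → β → ℝ≥0)
    (x : α → ℝ) (hx : ∀ j, 0 ≤ x j) (h1 : 1 ≤ ∑ j ∈ s, x j) :
    ∑ v ∈ V, ∏ j ∈ s, a j v ^ x j ≤ ∏ j ∈ s, (∑ v ∈ V, a j v) ^ x j := by
  set A : α → ℝ≥0 := fun j => ∑ v ∈ V, a j v with hA
  have hle : ∀ j, ∀ v ∈ V, a j v ≤ A j := fun j v hv =>
    Finset.single_le_sum (f := a j) (fun _ _ => zero_le) hv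
  set σ : ℝ := ∑ j ∈ s, x j with hσ
  have hσ0 : 0 < σ := by linarith
  have hp : ∀ j, 0 ≤ x j / σ := fun j => div_nonneg (hx j) hσ0.le
  set p : α → ℝ≥0 := fun j => (x j / σ).toNNReal with hpdef
  have hpc : ∀ j, (p j : ℝ) = x j / σ := fun j => Real.coe_toNNReal _ (hp j)
  have hpsum : ∑ j ∈ s, p j = 1 := by
    apply NNReal.coe_injective
    push_cast
    simp only [hpc]
    rw [← Finset.sum_div, ← hσ, div_self hσ0.ne']
  have hterm : ∀ v ∈ V, ∏ j ∈ s, a j v ^ x j ≤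
      (∑ j ∈ s, p j * (a j v / A j)) * ∏ j ∈ s, A j ^ x j := by
    intro v hv
    have e1 : ∏ j ∈ s, a j v ^ x j = (∏ j ∈ s, (a j v / A j) ^ x j) * ∏ j ∈ s, A j ^ x j := by
      rw [← Finset.prod_mul_distrib]
      refine Finset.prod_congr rfl fun j _ => ?_
      rw [← NNReal.mul_rpow]
      by_cases h0 : A j = 0
      · have := hle j v hv
        rw [h0] at this
        rw [h0, le_antisymm this zero_le]
        simp
      · rw [div_mul_cancel₀ _ h0]
    rw [e1]
    refine mul_le_mul' (le_trans (Finset.prod_le_prod' fun j _ => ?_)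
      (NNReal.geom_mean_le_arith_mean_weighted s p (fun j => a j v / A j) hpsum)) le_rfl
    rw [hpc]
    -- The ratios are at most one, so passing from the exponent `x j` to the normalized exponent `x
    -- j / σ` can only increase the power.
    have hxp : x j / σ ≤ x j := div_le_self (hx j) h1
    rcases eq_or_ne (a j v / A j) 0 with h0 | h0
    · rw [h0]
      rcases (hx j).eq_or_lt with hx0 | hx0
      · simp [← hx0]
      · rw [NNReal.zero_rpow hx0.ne']; exact zero_le
    · refine NNReal.rpow_le_rpow_of_exponent_ge (pos_iff_ne_zero.2 h0) ?_ hxp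
      exact div_le_one_of_le₀ (hle j v hv) zero_le
  refine (Finset.sum_le_sum hterm).trans ?_
  rw [← Finset.sum_mul]
  refine mul_le_of_le_one_left' ?_
  rw [Finset.sum_comm, ← hpsum]
  refine Finset.sum_le_sum fun j _ => ?_
  rw [← Finset.mul_sum, ← Finset.sum_div]
  exact mul_le_of_le_one_right' (div_self_le_one _)

variable {n m : ℕ}

/-- The tuples over the attributes `S` with values below `M`. -/
def tups (M : ℕ) (S : Finset (Fin n)) : Finset (Tup n) :=
  Fintype.piFinset fun a => if a ∈ S then Finset.range M else {0}

theorem mem_tups {M : ℕ} (hM : 1 ≤ M) {S : Finset (Fin n)} {t : Tup n} :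
    t ∈ tups M S ↔ proj S t = t ∧ Bd M t := by
  rw [tups, Fintype.mem_piFinset, proj_eq_self_iff]
  constructor
  · intro h
    refine ⟨fun a ha => by simpa [ha] using h a, fun a => ?_⟩
    by_cases ha : a ∈ S
    · simpa [ha] using h a
    · have : t a = 0 := by simpa [ha] using h a
      omega
  · rintro ⟨h1, h2⟩ a
    by_cases ha : a ∈ S
    · simpa [ha] using h2 a
    · simpa [ha] using h1 a ha

theorem sum_tups_insert {M : ℕ} {S : Finset (Fin n)} {c : Fin n} (hc : c ∉ S)
    {N : Type*} [AddCommMonoid N] (f : Tup n → N) :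
    ∑ t ∈ tups M (insert c S), f t =
      ∑ t ∈ tups M S, ∑ v ∈ Finset.range M, f (Function.update t c v) := by
  rw [← Finset.sum_product']
  refine (Finset.sum_bij' (fun p _ => Function.update p.1 c p.2)
    (fun t _ => (Function.update t c 0, t c)) ?_ ?_ ?_ ?_ ?_).symm
  · rintro ⟨t, v⟩ hp
    simp only [Finset.mem_product, tups, Fintype.mem_piFinset] at hp ⊢
    intro a
    by_cases hac : a = c
    · subst hac; simpa using hp.2
    · simpa [hac] using hp.1 a
  · intro t ht
    simp only [Finset.mem_product, tups, Fintype.mem_piFinset] at ht ⊢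
    refine ⟨fun a => ?_, by simpa using ht c⟩
    by_cases hac : a = c
    · subst hac; simp [hc]
    · simpa [hac] using ht a
  · rintro ⟨t, v⟩ hp
    simp only [Finset.mem_product, tups, Fintype.mem_piFinset] at hp
    have h0 : t c = 0 := by simpa [hc] using hp.1 c
    simp [← h0]
  · intro t _
    simp
  · intro p _
    rfl

/-- Finner's inequality for sums over tuples. -/
theorem sum_tups_prod_rpow_le (M : ℕ) (E : Fin m → Finset (Fin n)) (F : Fin m → Tup n → ℝ≥0)
    (x : Fin m → ℝ) (hx : ∀ j, 0 ≤ x j) (S : Finset (Fin n))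
    (hS : ∀ c ∈ S, 1 ≤ ∑ j with c ∈ E j, x j) :
    ∑ t ∈ tups M S, ∏ j, F j (proj (E j) t) ^ x j ≤
      ∏ j, (∑ g ∈ tups M (S ∩ E j), F j g) ^ x j := by
  induction S using Finset.induction_on generalizing F with
  | empty =>
    have h0 : (tups M ∅ : Finset (Tup n)) = {fun _ => 0} := by
      ext t
      simp [tups, funext_iff]
    have h1 : ∀ S : Finset (Fin n), proj S (fun _ => 0) = fun _ => 0 := fun S => by
      ext a; simp [proj]
    simp [h0, h1]
  | insert c S hc ih =>
    -- The attribute `c` is summed out of every function that depends on it, so that the induction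
    -- hypothesis applies to the remaining attributes.
    set F' : Fin m → Tup n → ℝ≥0 := fun j g =>
      if c ∈ E j then ∑ v ∈ Finset.range M, F j (Function.update g c v) else F j g with hF'
    have hsum : ∀ j, ∑ g ∈ tups M (S ∩ E j), F' j g = ∑ g ∈ tups M (insert c S ∩ E j), F j g := by
      intro j
      by_cases hj : c ∈ E j
      · rw [Finset.insert_inter_of_mem hj, sum_tups_insert (by simp [hc])]
        simp [hF', hj]
      · rw [Finset.insert_inter_of_notMem hj]
        simp [hF', hj]
    rw [sum_tups_insert hc]
    simp only [← hsum]
    refine le_trans (Finset.sum_le_sum fun t _ => ?_)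
      (ih F' fun a ha => hS a (Finset.mem_insert_of_mem ha))
    have hsplit : ∀ v, ∏ j, F j (proj (E j) (Function.update t c v)) ^ x j =
        (∏ j with c ∈ E j, F j (Function.update (proj (E j) t) c v) ^ x j) *
          ∏ j with c ∉ E j, F' j (proj (E j) t) ^ x j := by
      intro v
      rw [← Finset.prod_filter_mul_prod_filter_not Finset.univ (fun j => c ∈ E j)]
      congr 1
      · refine Finset.prod_congr rfl fun j hj => ?_
        rw [proj_update_of_mem (Finset.mem_filter.1 hj).2]
      · refine Finset.prod_congr rfl fun j hj => ?_
        have := (Finset.mem_filter.1 hj).2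
        rw [proj_update_of_notMem this]
        simp [hF', this]
    simp only [hsplit]
    rw [← Finset.sum_mul, ← Finset.prod_filter_mul_prod_filter_not Finset.univ (fun j => c ∈ E j)
      fun j => F' j (proj (E j) t) ^ x j]
    -- Hölder in the single attribute `c`, the others being fixed; the functions of hyperedges
    -- without `c` are constant factors.
    refine mul_le_mul' (le_trans (sum_prod_rpow_le _ _ _ x hx (hS c (by simp))) ?_) le_rfl
    refine le_of_eq (Finset.prod_congr rfl fun j hj => ?_)
    simp [hF', (Finset.mem_filter.1 hj).2]

/-! ### Projections of the relations and their local joins -/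

variable {K : Type*} {H : Hypergraph n m}

instance (I : Instance H K) (j : Fin m) : Finite (I.Rows j) := (I.finite j).to_subtype

instance (I : Instance H K) (j : Fin m) : Fintype (I.Rows j) := Fintype.ofFinite _

/-- A row of a relation as a tuple. -/
def rowTup (I : Instance H K) {j : Fin m} (r : I.Rows j) : Tup n :=
  fun a => if h : a ∈ H.edge j then r.1 ⟨a, h⟩ else 0

/-- The projection of the `j`-th relation to `X`. -/
def prjFin (I : Instance H K) (j : Fin m) (X : Finset (Fin n)) : Finset (Tup n) :=
  Finset.univ.image fun r : I.Rows j => proj X (rowTup I r)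

theorem card_prjFin_le (I : Instance H K) (j : Fin m) (X : Finset (Fin n)) :
    (prjFin I j X).card ≤ I.card j := by
  refine Finset.card_image_le.trans ?_
  rw [Finset.card_univ, Instance.card, Nat.card_eq_fintype_card]

/-- All values in the relations are below `M`. -/
def Instance.Below (I : Instance H K) (M : ℕ) : Prop :=
  ∀ (j : Fin m) (r : I.Rows j), Bd M (rowTup I r)

theorem exists_below (I : Instance H K) : ∃ M, 1 ≤ M ∧ I.Below M := by
  refine ⟨(∑ j, ∑ r : I.Rows j, ∑ a, rowTup I r a) + 1, by omega, fun j r a => ?_⟩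
  refine Nat.lt_succ_of_le ?_
  calc rowTup I r a ≤ ∑ a, rowTup I r a :=
        Finset.single_le_sum (f := rowTup I r) (fun _ _ => Nat.zero_le _) (Finset.mem_univ a)
    _ ≤ ∑ r : I.Rows j, ∑ a, rowTup I r a :=
        Finset.single_le_sum (f := fun r => ∑ a, rowTup I r a) (fun _ _ => Nat.zero_le _)
          (Finset.mem_univ r)
    _ ≤ _ := Finset.single_le_sum (f := fun j => ∑ r : I.Rows j, ∑ a, rowTup I r a)
          (fun _ _ => Nat.zero_le _) (Finset.mem_univ j)

/-- The tuples over `S` that are consistent with the projection of each relation. -/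
def InJoin (I : Instance H K) (S : Finset (Fin n)) (t : Tup n) : Prop :=
  proj S t = t ∧ ∀ j, (S ∩ H.edge j).Nonempty →
    proj (S ∩ H.edge j) t ∈ prjFin I j (S ∩ H.edge j)

theorem InJoin.exists_row {I : Instance H K} {S : Finset (Fin n)} {t : Tup n}
    (h : InJoin I S t) {a : Fin n} (ha : a ∈ S) : ∃ j, ∃ r : I.Rows j, a ∈ H.edge j ∧
      t a = rowTup I r a := by
  obtain ⟨j, hj⟩ := H.covered a
  have haj : a ∈ S ∩ H.edge j := Finset.mem_inter.2 ⟨ha, hj⟩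
  obtain ⟨r, -, hr⟩ := Finset.mem_image.1 (h.2 j ⟨a, haj⟩)
  refine ⟨j, r, hj, ?_⟩
  have := congrFun hr a
  rwa [proj_apply_of_mem haj, proj_apply_of_mem haj, eq_comm] at this

theorem InJoin.bd {I : Instance H K} {S : Finset (Fin n)} {t : Tup n} (h : InJoin I S t)
    {M : ℕ} (hM : 1 ≤ M) (hI : I.Below M) : Bd M t := by
  intro a
  by_cases ha : a ∈ S
  · obtain ⟨j, r, -, e⟩ := h.exists_row ha
    rw [e]; exact hI j r a
  · rw [← h.1, proj_apply_of_notMem ha]; omega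

theorem inJoin_finite (I : Instance H K) (S : Finset (Fin n)) : {t | InJoin I S t}.Finite := by
  obtain ⟨M, hM, hI⟩ := exists_below I
  exact (tups M S).finite_toSet.subset fun t ht => (mem_tups hM).2 ⟨ht.1, ht.bd hM hI⟩

def joinFin (I : Instance H K) (S : Finset (Fin n)) : Finset (Tup n) :=
  (inJoin_finite I S).toFinset

theorem mem_joinFin {I : Instance H K} {S : Finset (Fin n)} {t : Tup n} :
    t ∈ joinFin I S ↔ InJoin I S t := by simp [joinFin]

theorem InJoin.proj_subset {I : Instance H K} {S T : Finset (Fin n)} {t : Tup n}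
    (h : InJoin I S t) (hT : T ⊆ S) : InJoin I T (proj T t) := by
  refine ⟨proj_proj_of_subset le_rfl t, fun j hj => ?_⟩
  have hsub : T ∩ H.edge j ⊆ S ∩ H.edge j := Finset.inter_subset_inter_right hT
  obtain ⟨r, hr, hrt⟩ := Finset.mem_image.1 (h.2 j (hj.mono hsub))
  refine Finset.mem_image.2 ⟨r, hr, ?_⟩
  rw [proj_proj_of_subset Finset.inter_subset_left, ← proj_proj_of_subset hsub t, ← hrt,
    proj_proj_of_subset hsub]

/-- The number of values of `c` that extend `t` within the projection of a relation to `X`. -/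
def deg (I : Instance H K) (j : Fin m) (X : Finset (Fin n)) (c : Fin n) (t : Tup n) : ℕ :=
  ((prjFin I j X).filter fun u => proj (X.erase c) u = proj (X.erase c) t).card

/-- The smallest number of extensions of `t` by a value of `c` within a relation. -/
def minDeg (I : Instance H K) (S : Finset (Fin n)) (c : Fin n) (t : Tup n) : ℕ :=
  sInf {d | ∃ j, c ∈ H.edge j ∧ d = deg I j (S ∩ H.edge j) c t}

theorem minDeg_le {I : Instance H K} {S : Finset (Fin n)} {c : Fin n} {t : Tup n} {j : Fin m}
    (hj : c ∈ H.edge j) : minDeg I S c t ≤ deg I j (S ∩ H.edge j) c t :=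
  Nat.sInf_le ⟨j, hj, rfl⟩

theorem minDeg_eq {I : Instance H K} {S : Finset (Fin n)} {c : Fin n} {t : Tup n} {j : Fin m}
    (hj : c ∈ H.edge j) (h : ∀ j', c ∈ H.edge j' →
      deg I j (S ∩ H.edge j) c t ≤ deg I j' (S ∩ H.edge j') c t) :
    minDeg I S c t = deg I j (S ∩ H.edge j) c t := by
  refine le_antisymm (minDeg_le hj) (le_csInf ⟨_, j, hj, rfl⟩ ?_)
  rintro d ⟨j', hj', rfl⟩
  exact h j' hj'

/-- The cost of the extension of the local join over `S.erase c` to `S`. -/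
def stepCost (I : Instance H K) (S : Finset (Fin n)) (c : Fin n) : ℕ :=
  ∑ t ∈ joinFin I (S.erase c), minDeg I S c t

/-- A positive minimal degree is at most the product of the powers `deg ^ x j` over the hyperedges
containing `c`, because these exponents sum to at least one. Finner's inequality over `S.erase c` is
then applied with degrees on these hyperedges and indicators of the projections on the others.
Degrees summed over groups give at most the size of the projection. -/
theorem stepCost_le (I : Instance H K) {S : Finset (Fin n)} {c : Fin n} (hc : c ∈ S)
    (x : Fin m → ℝ) (hx : ∀ j, 0 ≤ x j) (hS : ∀ a ∈ S, 1 ≤ ∑ j with a ∈ H.edge j, x j) :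
    (stepCost I S c : ℝ≥0) ≤ ∏ j, ((max 1 (I.card j) : ℕ) : ℝ≥0) ^ x j := by
  obtain ⟨M, hM, hI⟩ := exists_below I
  -- A hyperedge disjoint from `S` imposes no condition and receives the constant `1`, even if its
  -- relation is empty. This is why the bound contains `max 1 (I.card j)`.
  set F : Fin m → Tup n → ℝ≥0 := fun j g =>
    if c ∈ H.edge j then (deg I j (S ∩ H.edge j) c g : ℝ≥0)
    else if (S ∩ H.edge j).Nonempty then (if g ∈ prjFin I j (S ∩ H.edge j) then 1 else 0)
    else 1 with hF
  have hFin := sum_tups_prod_rpow_le M H.edge F x hx (S.erase c)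
    fun a ha => hS a (Finset.mem_of_mem_erase ha)
  have hinter : ∀ j, c ∉ H.edge j → S.erase c ∩ H.edge j = S ∩ H.edge j := by
    intro j hj
    ext a
    simp only [Finset.mem_inter, Finset.mem_erase]
    constructor
    · rintro ⟨⟨-, h1⟩, h2⟩; exact ⟨h1, h2⟩
    · rintro ⟨h1, h2⟩; exact ⟨⟨fun h => hj (h ▸ h2), h1⟩, h2⟩
  refine le_trans ?_ (hFin.trans (Finset.prod_le_prod' fun j _ =>
    NNReal.rpow_le_rpow ?_ (hx j)))
  · have hsub : joinFin I (S.erase c) ⊆ tups M (S.erase c) := fun t ht =>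
      (mem_tups hM).2 ⟨(mem_joinFin.1 ht).1, (mem_joinFin.1 ht).bd hM hI⟩
    rw [stepCost, Nat.cast_sum]
    refine le_trans (Finset.sum_le_sum fun t ht => ?_)
      (Finset.sum_le_sum_of_subset hsub)
    have ht' := mem_joinFin.1 ht
    have h1 : ∀ j, c ∉ H.edge j → F j (proj (H.edge j) t) = 1 := by
      intro j hj
      by_cases hne : (S ∩ H.edge j).Nonempty
      · have h2 := ht'.2 j (by rwa [hinter j hj])
        rw [hinter j hj] at h2
        have h3 : proj (H.edge j) t = proj (S ∩ H.edge j) t := by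
          ext a
          by_cases haS : a ∈ S.erase c
          · by_cases hae : a ∈ H.edge j <;> simp [proj, hae, Finset.mem_of_mem_erase haS]
          · have := proj_eq_self_iff.1 ht'.1 a haS
            simp [proj, this]
        simp [hF, hj, hne, h3, h2]
      · simp [hF, hj, hne]
    have h2 : ∀ j, c ∈ H.edge j → F j (proj (H.edge j) t) = deg I j (S ∩ H.edge j) c t := by
      intro j hj
      simp only [hF, hj, if_true, deg]
      rw [proj_proj_of_subset]
      exact (Finset.erase_subset _ _).trans Finset.inter_subset_right
    rw [← Finset.prod_filter_mul_prod_filter_not Finset.univ (fun j => c ∈ H.edge j),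
      Finset.prod_congr (s₁ := Finset.univ.filter fun j => c ∉ H.edge j) rfl
        (fun j hj => by rw [h1 j (Finset.mem_filter.1 hj).2, NNReal.one_rpow]),
      Finset.prod_const_one, mul_one]
    by_cases h0 : minDeg I S c t = 0
    · rw [h0]; simp
    have hge : (1 : ℝ≥0) ≤ minDeg I S c t := by exact_mod_cast Nat.one_le_iff_ne_zero.2 h0
    calc ((minDeg I S c t : ℕ) : ℝ≥0)
        ≤ (minDeg I S c t : ℝ≥0) ^ (∑ j with c ∈ H.edge j, x j) := by
          have := NNReal.rpow_le_rpow_of_exponent_le hge (hS c hc)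
          rwa [NNReal.rpow_one] at this
      _ = ∏ j with c ∈ H.edge j, (minDeg I S c t : ℝ≥0) ^ x j :=
          NNReal.coe_injective (by
            push_cast
            exact Real.rpow_sum_of_nonneg (Nat.cast_nonneg _) fun j _ => hx j)
      _ ≤ _ := Finset.prod_le_prod' fun j hj => by
          have hj' := (Finset.mem_filter.1 hj).2
          rw [h2 j hj']
          exact NNReal.rpow_le_rpow (by exact_mod_cast minDeg_le hj') (hx j)
  · by_cases hj : c ∈ H.edge j
    · simp only [hF, hj, if_true]
      rw [← Nat.cast_sum]
      refine Nat.cast_le.2 (le_trans ?_ ((card_prjFin_le I j (S ∩ H.edge j)).trans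
        (le_max_right _ _)))
      have e1 : (S ∩ H.edge j).erase c = S.erase c ∩ H.edge j := by
        rw [Finset.erase_inter]
      have e2 : ∀ g ∈ tups M (S.erase c ∩ H.edge j), deg I j (S ∩ H.edge j) c g =
          ((prjFin I j (S ∩ H.edge j)).filter
            fun u => proj ((S ∩ H.edge j).erase c) u = g).card := by
        intro g hg
        have := ((mem_tups hM).1 hg).1
        rw [deg, e1, this]
      rw [Finset.sum_congr rfl e2, Finset.sum_card_fiberwise_eq_card_filter]
      exact Finset.card_le_card (Finset.filter_subset _ _)
    · by_cases hne : (S ∩ H.edge j).Nonempty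
      · simp only [hF, hj, if_false, hne, if_true]
        rw [Finset.sum_boole]
        refine Nat.cast_le.2 (le_trans (Finset.card_le_card ?_)
          ((card_prjFin_le I j (S ∩ H.edge j)).trans (le_max_right _ _)))
        intro g hg
        exact (Finset.mem_filter.1 hg).2
      · have h0 : (tups M (S.erase c ∩ H.edge j) : Finset (Tup n)) = {fun _ => 0} := by
          rw [hinter j hj, Finset.not_nonempty_iff_eq_empty.1 hne]
          ext t
          simp [tups, funext_iff]
        rw [h0]
        simp [hF, hj, hne]

end Ajar

end

noncomputable section

namespace Ajar

/-! ### Ancestors in the tree of a decomposition -/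

section Tree

variable {n m : ℕ} {ι : Type*} {H : Hypergraph n m} {α : Ordering n ι} {G : AGHD H α}

theorem AGHD.path_unique {u v : Fin G.size} {p q : G.tree.Walk u v} (hp : p.IsPath)
    (hq : q.IsPath) : p = q :=
  (G.isTree.existsUnique_path u v).unique hp hq

/-- Nodes on the way to a common descendant are comparable. -/
theorem AGHD.AncestorOrSelf.total {u v t : Fin G.size} (hu : G.AncestorOrSelf u t)
    (hv : G.AncestorOrSelf v t) : G.AncestorOrSelf u v ∨ G.AncestorOrSelf v u := by
  obtain ⟨p, hp, hup⟩ := hu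
  obtain ⟨q, hq, hvq⟩ := hv
  obtain rfl := AGHD.path_unique hp hq
  by_cases h : u ∈ (p.takeUntil v hvq).support
  · exact Or.inl ⟨_, hp.takeUntil hvq, h⟩
  · refine Or.inr ⟨_, hp.takeUntil hup, ?_⟩
    have h1 := p.take_spec hvq
    have h2 : u ∈ (p.dropUntil v hvq).support := by
      rw [← h1, SimpleGraph.Walk.mem_support_append_iff] at hup
      exact hup.resolve_left h
    have h3 : p = (((p.takeUntil v hvq).append ((p.dropUntil v hvq).takeUntil u h2)).append
        ((p.dropUntil v hvq).dropUntil u h2)) := by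
      rw [← SimpleGraph.Walk.append_assoc, SimpleGraph.Walk.take_spec, SimpleGraph.Walk.take_spec]
    have h4 : ((p.takeUntil v hvq).append ((p.dropUntil v hvq).takeUntil u h2)).IsPath :=
      (h3 ▸ hp : SimpleGraph.Walk.IsPath _).of_append_left
    rw [AGHD.path_unique (hp.takeUntil hup) h4, SimpleGraph.Walk.mem_support_append_iff]
    exact Or.inl (SimpleGraph.Walk.end_mem_support _)

/-- The root path of `v` is unique and passes through `u`. Comparing distances to the root serves as
antisymmetry of the ancestor relation. -/
theorem AGHD.AncestorOrSelf.length_lt {u v : Fin G.size} (h : G.Ancestor u v) :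
    G.tree.dist G.root u < G.tree.dist G.root v := by
  obtain ⟨⟨p, hp, hup⟩, hne⟩ := h
  obtain ⟨q, hq, hlen⟩ := G.isTree.1.exists_path_of_dist G.root v
  obtain rfl := AGHD.path_unique hp hq
  rw [← hlen]
  exact (SimpleGraph.dist_le _).trans_lt (SimpleGraph.Walk.length_takeUntil_lt_length hup hne)

theorem AGHD.exists_path_within {X : Set (Fin G.size)} (hX : (G.tree.induce X).Connected)
    {s t : Fin G.size} (hs : s ∈ X) (ht : t ∈ X) :
    ∃ q : G.tree.Walk s t, q.IsPath ∧ ∀ z ∈ q.support, z ∈ X := by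
  obtain ⟨q, hq, -⟩ := hX.exists_path_of_dist ⟨s, hs⟩ ⟨t, ht⟩
  refine ⟨q.map (SimpleGraph.Embedding.induce (G := G.tree) X).toHom,
    hq.map (SimpleGraph.Embedding.induce (G := G.tree) X).injective, ?_⟩
  intro z hz
  obtain ⟨y, -, rfl⟩ := List.mem_map.1 ((congrArg (z ∈ ·) (SimpleGraph.Walk.support_map _ q)).mp hz)
  exact y.2

/-- Each copy of an attribute has a topmost node, and its bags contain all nodes between. -/
theorem AGHD.exists_isTop {c : Fin n × Finset (Fin m)} (hc : c ∈ G.partition.copies) :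
    ∃ s, G.IsTop c s ∧ ∀ u t, c ∈ G.bag t → G.AncestorOrSelf s u → G.AncestorOrSelf u t →
      c ∈ G.bag u := by
  have hX := G.running_intersection c hc
  set X : Set (Fin G.size) := {t | c ∈ G.bag t} with hXdef
  obtain ⟨⟨s₀, hs₀⟩⟩ := hX.nonempty
  obtain ⟨s, hs, hmin⟩ := Set.exists_min_image X (fun t => G.tree.dist G.root t) X.toFinite
    ⟨s₀, hs₀⟩
  -- The node `s` is a node of `X` nearest to the root, so the path from the root meets `X` only in
  -- `s`. Followed by a path inside `X` it is again a path, hence the root path of `t`.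
  have key : ∀ t ∈ X, ∃ (p : G.tree.Walk G.root s) (q : G.tree.Walk s t),
      (p.append q).IsPath ∧ p.IsPath ∧ ∀ z ∈ q.support, z ∈ X := by
    intro t ht
    obtain ⟨p, hp, hlen⟩ := G.isTree.1.exists_path_of_dist G.root s
    obtain ⟨q, hq, hqX⟩ := AGHD.exists_path_within hX hs ht
    refine ⟨p, q, ?_, hp, hqX⟩
    rw [SimpleGraph.Walk.isPath_def, SimpleGraph.Walk.support_append]
    have hqn := hq.support_nodup
    rw [← SimpleGraph.Walk.cons_tail_support] at hqn
    refine List.nodup_append.2 ⟨hp.support_nodup, hqn.of_cons, ?_⟩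
    rintro z hz z' hz' rfl
    have hzX : z ∈ X := hqX z (List.mem_of_mem_tail hz')
    by_cases hzs : z = s
    · subst hzs
      exact (List.nodup_cons.1 hqn).1 hz'
    · have h1 := SimpleGraph.Walk.length_takeUntil_lt_length hz hzs
      have h2 := SimpleGraph.dist_le (p.takeUntil z hz)
      have h3 := hmin z hzX
      omega
  refine ⟨s, ⟨hs, fun t ht => ?_⟩, fun u t ht hsu hut => ?_⟩
  · obtain ⟨p, q, hpq, -, -⟩ := key t ht
    exact ⟨_, hpq, SimpleGraph.Walk.mem_support_append_iff _ _ |>.2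
      (Or.inl (SimpleGraph.Walk.end_mem_support _))⟩
  · obtain ⟨p, q, hpq, hp, hqX⟩ := key t ht
    obtain ⟨r, hr, hur⟩ := hut
    obtain rfl := AGHD.path_unique hr hpq
    rcases (SimpleGraph.Walk.mem_support_append_iff _ _).1 hur with h | h
    · by_cases hus : u = s
      · subst hus; exact hs
      · have h1 : G.Ancestor u s := ⟨⟨p, hp, h⟩, hus⟩
        have h2 : G.Ancestor s u := ⟨hsu, fun h => hus h.symm⟩
        exact absurd (AGHD.AncestorOrSelf.length_lt h1)
          (AGHD.AncestorOrSelf.length_lt h2).not_gt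
    · exact hqX u h

end Tree

theorem not_sublist_of_nodup {A : Type*} {l : List A} (hl : l.Nodup) {a b : A}
    (h1 : [a, b].Sublist l) (h2 : [b, a].Sublist l) : False := by
  induction l with
  | nil => cases h1
  | cons x l ih =>
    obtain ⟨hx, hl⟩ := List.nodup_cons.1 hl
    cases h1 with
    | cons _ h1 =>
      cases h2 with
      | cons _ h2 => exact ih hl h1 h2
      | cons_cons _ h2 => exact hx (h1.subset (by simp))
    | cons_cons _ h1 =>
      cases h2 with
      | cons _ h2 => exact hx (h2.subset (by simp))
      | cons_cons _ h2 => exact hx (h2.subset (by simp))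

/-! ### Elimination orders -/

section Elimination

variable {n : ℕ} {ι : Type*}

/-- The union of the schemas that contain `b`. -/
def unionOf (b : Fin n) (L : List (Finset (Fin n))) : Finset (Fin n) :=
  (L.filter (b ∈ ·)).foldr (· ∪ ·) ∅

theorem mem_unionOf {b a : Fin n} {L : List (Finset (Fin n))} :
    a ∈ unionOf b L ↔ ∃ S ∈ L, b ∈ S ∧ a ∈ S := by
  have : ∀ L : List (Finset (Fin n)), a ∈ L.foldr (· ∪ ·) ∅ ↔ ∃ S ∈ L, a ∈ S := by
    intro L
    induction L with
    | nil => simp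
    | cons S L ih => simp [ih]
  rw [unionOf, this]
  simp [and_assoc]

/-- The schemas after the elimination of `b` by joining all relations that contain `b`. -/
def joinStep (b : Fin n) (L : List (Finset (Fin n))) : List (Finset (Fin n)) :=
  L.filter (b ∉ ·) ++ [(unionOf b L).erase b]

/-- The schemas of the joins that are computed when the attributes are eliminated in the given
order; an attribute that is marked is eliminated from each relation separately. -/
def needs : List (Fin n × Bool) → List (Finset (Fin n)) → List (Finset (Fin n))
  | [], _ => []
  | (b, false) :: s, L => unionOf b L :: needs s (joinStep b L)
  | (b, true) :: s, L => needs s (L.map fun S => S.erase b)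

def Op.isProd : Op ι → Bool
  | .plus _ => false
  | .prod => true

def outList (α : Ordering n ι) : List (Fin n) := (List.finRange n).filter (· ∉ α.attrs)

/-- The order of elimination: the aggregated attributes, the last one first, and then the output
attributes. -/
def elimOrder (β : Ordering n ι) (γ : List (Fin n)) : List (Fin n × Bool) :=
  β.reverse.map (fun x => (x.1, x.2.isProd)) ++ γ.map fun a => (a, false)

end Elimination

/-! ### From a compatible decomposition to an order of elimination. -/

section Width

variable {n m : ℕ} {ι : Type*} {H : Hypergraph n m} {α : Ordering n ι} {G : AGHD H α}

/-- The attributes of `S` have copies in a common bag. -/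
def AGHD.Covers (G : AGHD H α) (S : Finset (Fin n)) : Prop :=
  ∃ t, ∀ a ∈ S, ∃ c ∈ G.bag t, c.1 = a

/-- The invariant is that every current schema has copies in one bag. An attribute `b` that is
joined has a single copy, with topmost node `u`. If a schema with `b` lies in the bag of `t` and `v`
is the topmost node of the copy of another attribute there, then `u` and `v` both lie above `t` and
are comparable. The order of elimination forbids `u` strictly above `v`, so `u` lies between `v` and
`t`, and its bag contains that copy. Hence the whole union has copies in the bag of `u`. Different
schemas may use different copies of a product attribute; this is harmless, since such an attribute
is only ever erased. -/
theorem AGHD.covers_needs (s : List (Fin n × Bool)) (L : List (Finset (Fin n)))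
    (hn : (s.map Prod.fst).Nodup)
    (hb : ∀ b, (b, false) ∈ s → (b, Op.prod) ∉ α)
    (hs : ∀ pre b post, s = pre ++ (b, false) :: post → ∀ a ∈ post.map Prod.fst,
      ∀ u ∈ G.top b, ∀ v ∈ G.top a, ¬ G.Ancestor u v)
    (hL : ∀ S ∈ L, G.Covers S ∧ ∀ a ∈ S, a ∈ s.map Prod.fst) :
    ∀ U ∈ needs s L, G.Covers U := by
  induction s generalizing L with
  | nil => simp [needs]
  | cons p s ih =>
    obtain ⟨b, f⟩ := p
    rw [List.map_cons, List.nodup_cons] at hn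
    have ih' := fun L => ih L hn.2 (fun b' hb' => hb b' (List.mem_cons_of_mem _ hb'))
      (fun pre b' post h => hs ((b, f) :: pre) b' post (by rw [h]; rfl))
    cases f with
    | true =>
      refine ih' _ fun S hS => ?_
      obtain ⟨S', hS', rfl⟩ := List.mem_map.1 hS
      obtain ⟨⟨t, ht⟩, h2⟩ := hL S' hS'
      refine ⟨⟨t, fun a ha => ht a (Finset.mem_of_mem_erase ha)⟩, fun a ha => ?_⟩
      have := h2 a (Finset.mem_of_mem_erase ha)
      rw [List.map_cons, List.mem_cons] at this
      exact this.resolve_left (Finset.ne_of_mem_erase ha)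
    | false =>
      have hU : G.Covers (unionOf b L) := by
        by_cases hne : ∃ S ∈ L, b ∈ S
        swap
        · have : Nonempty (Fin G.size) := ⟨G.root⟩
          refine ⟨G.root, fun a ha => ?_⟩
          obtain ⟨S, hS, hbS, -⟩ := mem_unionOf.1 ha
          exact absurd ⟨S, hS, hbS⟩ hne
        have hpart := G.partition.block_trivial b (hb b (by simp))
        have hcopy : ∀ c ∈ G.partition.copies, c.1 = b → c = (b, H.star b) := by
          rintro ⟨a, B⟩ hc rfl
          have h1 : B ∈ (G.partition.block a).parts := (Finset.mem_filter.1 hc).2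
          rw [hpart, Finset.mem_singleton] at h1
          rw [h1]
        have hbc : (b, H.star b) ∈ G.partition.copies := by
          simp [ProductPartition.copies, hpart]
        obtain ⟨u, hu, hbetw⟩ := AGHD.exists_isTop (G := G) hbc
        refine ⟨u, fun a ha => ?_⟩
        obtain ⟨S, hS, hbS, haS⟩ := mem_unionOf.1 ha
        obtain ⟨⟨t, ht⟩, h2⟩ := hL S hS
        obtain ⟨c, hct, rfl⟩ := ht a haS
        obtain ⟨cb, hcbt, hcb⟩ := ht b hbS
        obtain rfl := hcopy cb (G.bag_subset t hcbt) hcb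
        have hcc := G.bag_subset t hct
        by_cases hab : c.1 = b
        · rw [hcopy c hcc hab]
          exact ⟨_, hu.1, rfl⟩
        obtain ⟨v, hv, hbetw'⟩ := AGHD.exists_isTop (G := G) hcc
        have hmem : c.1 ∈ s.map Prod.fst := by
          have := h2 c.1 haS
          rw [List.map_cons, List.mem_cons] at this
          exact this.resolve_left hab
        have hnot := hs [] b s rfl c.1 hmem u ⟨_, hbc, rfl, hu⟩ v ⟨c, hcc, rfl, hv⟩
        refine ⟨c, ?_, rfl⟩
        rcases (hu.2 t hcbt).total (hv.2 t hct) with h | h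
        · by_cases huv : u = v
          · rw [huv]; exact hv.1
          · exact absurd ⟨h, huv⟩ hnot
        · exact hbetw' u t hct h (hu.2 t hcbt)
      intro U hUm
      rcases List.mem_cons.1 hUm with rfl | hUm
      · exact hU
      refine ih' _ (fun S hS => ?_) U hUm
      rcases List.mem_append.1 hS with hS | hS
      · obtain ⟨hS, hbS⟩ := List.mem_filter.1 hS
        have hbS : b ∉ S := by simpa using hbS
        refine ⟨(hL S hS).1, fun a ha => ?_⟩
        have := (hL S hS).2 a ha
        rw [List.map_cons, List.mem_cons] at this
        exact this.resolve_left fun h => hbS (by rw [← show a = b from h]; exact ha)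
      · rw [List.mem_singleton] at hS
        subst hS
        obtain ⟨t, ht⟩ := hU
        refine ⟨⟨t, fun a ha => ht a (Finset.mem_of_mem_erase ha)⟩, fun a ha => ?_⟩
        obtain ⟨S, hS, -, haS⟩ := mem_unionOf.1 (Finset.mem_of_mem_erase ha)
        have := (hL S hS).2 a haS
        rw [List.map_cons, List.mem_cons] at this
        exact this.resolve_left (Finset.ne_of_mem_erase ha)

/-- Output attributes are eliminated by decreasing depth of their topmost nodes. Suppose that `b`
goes before `a` although a topmost node of `b` is an ancestor of one of `a`. If `b` is aggregated,
compatibility puts `b` before `a` in `β`, and the reversal of `β` eliminates `a` first. If `b` is an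
output attribute, so is `a`, and the depths contradict the sorting. -/
theorem AGHD.exists_elimOrder {β : Ordering n ι} (hβ : α.Perm β) (hα : α.attrs.Nodup)
    (hG : G.Compatible β) : ∃ γ, γ.Perm (outList α) ∧
      ∀ U ∈ needs (elimOrder β γ) (List.ofFn H.edge), G.Covers U := by
  classical
  have hattrs : α.attrs.Perm β.attrs := hβ.map _
  have hβn : β.attrs.Nodup := hattrs.nodup_iff.1 hα
  -- Only output attributes matter here. They have the single copy `(a, H.star a)`, so the value `0`
  -- for the other case is never used.
  set depth : Fin n → ℕ := fun a =>
    if h : (a, H.star a) ∈ G.partition.copies then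
      G.tree.dist G.root (AGHD.exists_isTop (G := G) h).choose else 0 with hdepth
  set γ := (outList α).insertionSort (fun a b => depth b ≤ depth a) with hγ
  have hperm : γ.Perm (outList α) := List.perm_insertionSort _ _
  have hmemγ : ∀ a, a ∈ γ ↔ a ∉ α.attrs := fun a => by
    rw [hperm.mem_iff, outList]; simp
  have hsorted : γ.Pairwise (fun a b => depth b ≤ depth a) := by
    have : Std.Total (fun a b : Fin n => depth b ≤ depth a) := ⟨fun a b => le_total _ _⟩
    have : IsTrans (Fin n) (fun a b : Fin n => depth b ≤ depth a) :=
      ⟨fun a b c h1 h2 => le_trans h2 h1⟩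
    exact List.pairwise_insertionSort _ _
  have hfst : (elimOrder β γ).map Prod.fst = β.attrs.reverse ++ γ := by
    simp [elimOrder, Ordering.attrs, Function.comp_def]
  have hnd : ((elimOrder β γ).map Prod.fst).Nodup := by
    rw [hfst]
    refine List.nodup_append.2 ⟨List.nodup_reverse.2 hβn,
      hperm.nodup_iff.2 ((List.nodup_finRange n).filter _), ?_⟩
    rintro a ha b hb rfl
    exact (hmemγ a).1 hb (hattrs.mem_iff.2 (List.mem_reverse.1 ha))
  refine ⟨γ, hperm, AGHD.covers_needs _ _ hnd ?_ ?_ ?_⟩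
  · intro b hb hp
    rw [elimOrder, List.mem_append] at hb
    rcases hb with hb | hb
    · obtain ⟨⟨b', o⟩, hx, hxe⟩ := List.mem_map.1 hb
      obtain ⟨rfl, ho⟩ := Prod.mk.inj hxe
      have h1 : (b', o) ∈ α := hβ.mem_iff.2 (List.mem_reverse.1 hx)
      have h2 := List.inj_on_of_nodup_map hα h1 hp rfl
      obtain ⟨-, rfl⟩ := Prod.mk.inj h2
      cases ho
    · obtain ⟨a, ha, hxe⟩ := List.mem_map.1 hb
      obtain ⟨rfl, -⟩ := Prod.mk.inj hxe
      exact (hmemγ a).1 ha (List.mem_map.2 ⟨_, hp, rfl⟩)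
  · intro pre b post hs a ha u hu v hv hanc
    have hab : b ≠ a := by
      rintro rfl
      rw [hs] at hnd
      simp only [List.map_append, List.map_cons] at hnd
      exact (List.nodup_cons.1 (List.nodup_append.1 hnd).2.1).1 ha
    have hord : β.attrs.reverse ++ γ = pre.map Prod.fst ++ b :: post.map Prod.fst := by
      rw [← hfst, hs]; simp
    have hG' := hG b a hab ⟨u, hu, v, hv, hanc⟩
    have hsub : [b, a].Sublist (β.attrs.reverse ++ γ) := by
      rw [hord]
      exact (List.Sublist.cons_cons b (List.singleton_sublist.2 ha)).trans
        (List.sublist_append_right _ _)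
    by_cases hbβ : b ∈ β.attrs
    · have hprec : [b, a].Sublist β.attrs := hG'.resolve_left (not_not.2 hbβ)
      have haβ : a ∈ β.attrs := hprec.subset (by simp)
      have hrev : [a, b].Sublist β.attrs.reverse := by simpa using hprec.reverse
      have h3 : [a, b].Sublist (β.attrs.reverse ++ γ) := hrev.trans (List.sublist_append_left _ _)
      rw [hfst] at hnd
      exact not_sublist_of_nodup hnd h3 hsub
    · have hbγ : b ∈ γ := (hmemγ b).2 fun h => hbβ (hattrs.mem_iff.1 h)
      have haγ : [b, a].Sublist γ := by
        obtain ⟨l₁, l₂, h1, h2, h3⟩ := List.sublist_append_iff.1 hsub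
        cases l₁ with
        | nil => rwa [h1]
        | cons x l₁ =>
          obtain ⟨rfl, -⟩ := List.cons.inj h1
          exact absurd (List.mem_reverse.1 (h2.subset (by simp))) hbβ
      have hd : depth a ≤ depth b := by
        have := List.pairwise_iff_forall_sublist.1 hsorted haγ
        exact this
      have haα : a ∉ α.attrs := (hmemγ a).1 (haγ.subset (by simp))
      have hbα : b ∉ α.attrs := (hmemγ b).1 hbγ
      have htop : ∀ a, a ∉ α.attrs → ∀ u ∈ G.top a, G.tree.dist G.root u = depth a := by
        rintro a ha u ⟨c, hc, rfl, hu⟩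
        have hpart := G.partition.block_trivial c.1 fun h => ha (List.mem_map.2 ⟨_, h, rfl⟩)
        have h1 : c.2 ∈ (G.partition.block c.1).parts := (Finset.mem_filter.1 hc).2
        rw [hpart, Finset.mem_singleton] at h1
        have h2 : c = (c.1, H.star c.1) := Prod.ext rfl h1
        rw [h2] at hc hu
        have hd : depth c.1 = G.tree.dist G.root (AGHD.exists_isTop (G := G) hc).choose :=
          dif_pos hc
        rw [hd]
        have hs := (AGHD.exists_isTop (G := G) hc).choose_spec.1
        set s := (AGHD.exists_isTop (G := G) hc).choose
        by_contra hne
        have hus : u ≠ s := fun h => hne (by rw [h])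
        have h3 := AGHD.AncestorOrSelf.length_lt (G := G) ⟨hu.2 s hs.1, hus⟩
        have h4 := AGHD.AncestorOrSelf.length_lt (G := G) ⟨hs.2 u hu.1, hus.symm⟩
        omega
      have := AGHD.AncestorOrSelf.length_lt hanc
      rw [htop b hbα u hu, htop a haα v hv] at this
      omega
  · intro S hS
    obtain ⟨j, rfl⟩ := List.mem_ofFn.1 hS
    refine ⟨?_, fun a ha => ?_⟩
    · obtain ⟨t, ht⟩ := G.edge_covered j
      exact ⟨t, fun a ha => ⟨_, ht (Finset.mem_image_of_mem _ ha), rfl⟩⟩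
    · rw [hfst, List.mem_append, List.mem_reverse, hmemγ, hattrs.mem_iff]
      exact em _

end Width

end Ajar

end

noncomputable section

namespace Ajar

/-! ### The smallest width and the cost bound that it gives. -/

section Widths

variable {n m : ℕ} {ι K : Type*} {H : Hypergraph n m} {α : Ordering n ι}

/-- A single bag with all vertices has no proper ancestors and is compatible with every ordering. It
shows that the set of widths is not empty. -/
def AGHD.trivial (H : Hypergraph n m) (α : Ordering n ι) : AGHD H α where
  partition :=
    { block := fun a => Finpartition.indiscrete (a := H.star a) (by
        obtain ⟨j, hj⟩ := H.covered a
        exact Finset.nonempty_iff_ne_empty.1 ⟨j, by simp [Hypergraph.star, hj]⟩)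
      block_trivial := fun _ _ => rfl }
  size := 1
  tree := ⊥
  isTree := SimpleGraph.IsTree.of_subsingleton
  root := 0
  bag := fun _ => ProductPartition.copies _
  bag_subset := fun _ => le_rfl
  edge_covered := fun j => ⟨0, fun c hc => by
    obtain ⟨a, ha, rfl⟩ := Finset.mem_image.1 hc
    refine Finset.mem_filter.2 ⟨Finset.mem_univ _, Finpartition.part_mem _ |>.2 ?_⟩
    simp [Hypergraph.star, ha]⟩
  running_intersection := fun c hc => by
    have : Nonempty ({t : Fin 1 | c ∈ ProductPartition.copies _} : Set (Fin 1)) := ⟨⟨0, hc⟩⟩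
    exact { preconnected := SimpleGraph.Preconnected.of_subsingleton }

theorem AGHD.trivial_compatible (β : Ordering n ι) : (AGHD.trivial H α).Compatible β := by
  rintro a b - ⟨u, -, v, -, -, huv⟩
  exact absurd (Subsingleton.elim (α := Fin 1) u v) huv

variable [CommMonoidWithZero K] (O : PlusOps ι K)

theorem validWidths_nonempty (I : Instance H K) : (validWidths O α I).Nonempty :=
  ⟨_, α, ⟨List.Perm.refl _, fun _ => rfl⟩, _, AGHD.trivial_compatible α, rfl⟩

/-- There are infinitely many trees, but the width depends only on the edges of the product
partition hypergraph and on the set of bags that occur, and there are finitely many of these data.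
-/
theorem validWidths_finite (I : Instance H K) : (validWidths O α I).Finite := by
  refine (Set.finite_range fun p : (Fin m → Finset (Fin n × Finset (Fin m))) ×
    Set (Finset (Fin n × Finset (Fin m))) => sSup ((fun B => sInf {r | ∃ x : Fin m → ℝ,
      (∀ j, 0 ≤ x j) ∧ (∀ c ∈ B, 1 ≤ ∑ j with c ∈ p.1 j, x j) ∧
      r = ∑ j, x j * Real.logb I.inSize (I.card j)}) '' p.2)).subset ?_
  rintro w ⟨β, -, G, -, rfl⟩
  refine ⟨(G.partition.edge, Set.range G.bag), ?_⟩
  simp only [← Set.range_comp]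
  rfl

omit [CommMonoidWithZero K] in
theorem Instance.card_le_inSize (I : Instance H K) (j : Fin m) : I.card j ≤ I.inSize :=
  Finset.single_le_sum (f := fun j => I.card j) (fun _ _ => Nat.zero_le _) (Finset.mem_univ j)

omit [CommMonoidWithZero K] in
/-- The width bounds the cost of the local joins over sets of attributes within a bag. -/
theorem AGHD.stepCost_le_rpow (G : AGHD H α) (I : Instance H K) {U S : Finset (Fin n)}
    (hU : G.Covers U) (hS : S ⊆ U) {c : Fin n} (hc : c ∈ S) :
    (stepCost I S c : ℝ) ≤ max 1 ((I.inSize : ℝ) ^ G.fhw I) := by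
  classical
  obtain ⟨t, ht⟩ := hU
  -- A hyperedge that contains a copy of `a` comes from a hyperedge that contains `a`, so a cover of
  -- the bag covers the attributes of `U` in the original hypergraph.
  have hfeas : ∀ x : Fin m → ℝ, (∀ j, 0 ≤ x j) →
      (∀ c ∈ G.bag t, 1 ≤ ∑ j with c ∈ G.partition.edge j, x j) →
      (stepCost I S c : ℝ) ≤ ∏ j, ((max 1 (I.card j) : ℕ) : ℝ) ^ x j := by
    intro x hx hcov
    have := stepCost_le I hc x hx fun a ha => by
      obtain ⟨d, hd, rfl⟩ := ht a (hS ha)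
      refine (hcov d hd).trans (Finset.sum_le_sum_of_subset_of_nonneg ?_ fun j _ _ => hx j)
      intro j hj
      obtain ⟨b, hb, hbd⟩ := Finset.mem_image.1 (Finset.mem_filter.1 hj).2
      refine Finset.mem_filter.2 ⟨Finset.mem_univ _, ?_⟩
      rw [← hbd]; exact hb
    have h2 := NNReal.coe_le_coe.2 this
    push_cast at h2 ⊢
    exact h2
  -- Blocks are not empty, so every copy lies in a hyperedge and the constant weight `1` is
  -- feasible. Without a feasible point the infimum would be a default value.
  have hx1 : ∀ c ∈ G.bag t, (1 : ℝ) ≤ ∑ j with c ∈ G.partition.edge j, (fun _ => 1) j := by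
    intro d hd
    have hd' : d.2 ∈ (G.partition.block d.1).parts :=
      (Finset.mem_filter.1 (G.bag_subset t hd)).2
    obtain ⟨j, hj⟩ := (G.partition.block d.1).nonempty_of_mem_parts hd'
    have hjs : j ∈ H.star d.1 := (G.partition.block d.1).le hd' hj
    refine Finset.single_le_sum (f := fun _ => (1 : ℝ)) (fun _ _ => zero_le_one) (a := j) ?_
    refine Finset.mem_filter.2 ⟨Finset.mem_univ _, Finset.mem_image.2 ⟨d.1,
      (Finset.mem_filter.1 hjs).2, ?_⟩⟩
    rw [(G.partition.block d.1).part_eq_of_mem hd' hj]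
  rcases Nat.lt_or_ge 1 I.inSize with h2 | h2
  swap
  -- For `IN ≤ 1` the logarithms are zero by convention and carry no information; here all relations
  -- have at most one row, and the product is `1`.
  · refine le_max_of_le_left ((hfeas _ (fun _ => zero_le_one) hx1).trans (le_of_eq ?_))
    refine Finset.prod_eq_one fun j _ => ?_
    have : max 1 (I.card j) = 1 := max_eq_left ((Instance.card_le_inSize I j).trans h2)
    simp [this]
  refine le_max_of_le_right ?_
  have hIN : (1 : ℝ) < I.inSize := by exact_mod_cast h2
  rcases (stepCost I S c).eq_zero_or_pos with h0 | h0
  · rw [h0, Nat.cast_zero]; positivity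
  have hpos : (0 : ℝ) < stepCost I S c := by exact_mod_cast h0
  rw [← Real.logb_le_iff_le_rpow hIN hpos]
  have hle : Real.logb I.inSize (stepCost I S c) ≤ G.coverValue I t := by
    refine le_csInf ⟨_, _, fun _ => zero_le_one, hx1, rfl⟩ ?_
    rintro r ⟨x, hx, hcov, rfl⟩
    rw [Real.logb_le_iff_le_rpow hIN hpos]
    refine (hfeas x hx hcov).trans (le_of_eq ?_)
    rw [Real.rpow_sum_of_pos (by linarith)]
    refine Finset.prod_congr rfl fun j _ => ?_
    -- An empty relation contributes `1` on both sides, through `max 1 0` and through the logarithm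
    -- of `0` being `0`.
    rcases (I.card j).eq_zero_or_pos with hj | hj
    · simp [hj]
    · rw [max_eq_right hj, mul_comm, Real.rpow_mul (by linarith),
        Real.rpow_logb (by linarith) (by linarith) (by exact_mod_cast hj)]
  exact hle.trans (le_ciSup (f := fun t => G.coverValue I t) (Set.finite_range _).bddAbove t)

/-- All local joins for the elimination order cost at most `N`. -/
def PlanCost (H : Hypergraph n m) (I : Instance H K) (s : List (Fin n × Bool)) (N : ℕ) : Prop :=
  ∀ U ∈ needs s (List.ofFn H.edge), ∀ c ∈ U, stepCost I (U.filter (· ≤ c)) c ≤ N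

/-- The smallest width exists, and it bounds the cost of some elimination order. -/
theorem exists_isLeast_validWidths (hα : α.attrs.Nodup) (I : Instance H K) :
    ∃ w, IsLeast (validWidths O α I) w ∧ ∃ (β : Ordering n ι) (γ : List (Fin n)) (N : ℕ),
      Equivalent H O α β ∧ γ.Perm (outList α) ∧ PlanCost H I (elimOrder β γ) N ∧ 1 ≤ N ∧
      (N : ℝ) ≤ max 1 ((I.inSize : ℝ) ^ w) := by
  obtain ⟨w, hw1, hw2⟩ := Set.exists_min_image _ id (validWidths_finite O (α := α) I)
    (validWidths_nonempty O I)
  have hw : IsLeast (validWidths O α I) w := ⟨hw1, hw2⟩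
  refine ⟨w, hw, ?_⟩
  obtain ⟨β, hβ, G, hG, rfl⟩ := hw.1
  obtain ⟨γ, hγ, hU⟩ := AGHD.exists_elimOrder hβ.1 hα hG
  -- Costs are natural numbers, so the real bound may be rounded down; the maximum with `1` gives
  -- the doubling search a positive target.
  refine ⟨β, γ, max 1 ⌊(I.inSize : ℝ) ^ G.fhw I⌋₊, hβ, hγ, fun U hUm c hc => ?_, le_max_left _ _, ?_⟩
  · have := G.stepCost_le_rpow I (hU U hUm) (Finset.filter_subset (· ≤ c) U)
      (Finset.mem_filter.2 ⟨hc, le_rfl⟩)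
    rcases le_max_iff.1 this with h | h
    · exact le_max_of_le_left (by exact_mod_cast h)
    · exact le_max_of_le_right (Nat.le_floor h)
  · push_cast
    exact max_le_max le_rfl (Nat.floor_le (by positivity))

end Widths

end Ajar

end

noncomputable section

namespace Ajar

/-! ### The algebra of joins, aggregations and accumulations. -/

section Semantics

variable {n m : ℕ} {ι K : Type*} [CommMonoidWithZero K]

omit [CommMonoidWithZero K] in
theorem Option.eq_of_getD {x y : Option K} (d : K) (h : x.isSome ↔ y.isSome)
    (h' : x.isSome → y.isSome → x.getD d = y.getD d) : x = y := by
  cases x <;> cases y <;> simp_all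

omit [CommMonoidWithZero K] in
theorem Option.eq_some_getD {x : Option K} (d : K) (h : x.isSome) : x = some (x.getD d) := by
  cases x <;> simp_all

/-! ### Joins of lists of relations -/

open Classical in
/-- The join of a list of relations. -/
def joinL (L : List (Rel n K)) : Rel n K := fun t =>
  if ∀ R ∈ L, (R t).isSome then some (L.map fun R => (R t).getD 1).prod else none

theorem joinL_isSome {L : List (Rel n K)} {t : Tup n} :
    (joinL L t).isSome ↔ ∀ R ∈ L, (R t).isSome := by
  rw [joinL]
  split_ifs with h
  · simpa using h
  · simpa using h

theorem joinL_getD {L : List (Rel n K)} {t : Tup n} (h : ∀ R ∈ L, (R t).isSome) :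
    (joinL L t).getD 1 = (L.map fun R => (R t).getD 1).prod := by
  rw [joinL, if_pos h, Option.getD_some]

theorem joinL_perm {L L' : List (Rel n K)} (h : L.Perm L') : joinL L = joinL L' := by
  ext1 t
  refine Option.eq_of_getD 1 ?_ fun h1 h2 => ?_
  · simp only [joinL_isSome, h.mem_iff]
  · rw [joinL_getD (joinL_isSome.1 h1), joinL_getD (joinL_isSome.1 h2)]
    exact (h.map _).prod_eq

theorem joinL_append (L L' : List (Rel n K)) :
    joinL (L ++ L') = joinL [joinL L, joinL L'] := by
  ext1 t
  refine Option.eq_of_getD 1 ?_ fun h1 h2 => ?_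
  · simp [joinL_isSome, or_imp, forall_and]
  · have h3 := joinL_isSome.1 h2
    rw [joinL_getD (joinL_isSome.1 h1), joinL_getD h3, List.map_append, List.prod_append]
    simp only [List.map_cons, List.map_nil, List.prod_cons, List.prod_nil, mul_one]
    rw [joinL_getD (joinL_isSome.1 (h3 (joinL L) (by simp))),
      joinL_getD (joinL_isSome.1 (h3 (joinL L') (by simp)))]

theorem joinL_cons (R : Rel n K) (L : List (Rel n K)) : joinL (R :: L) = joinL [R, joinL L] := by
  ext1 t
  refine Option.eq_of_getD 1 ?_ fun h1 h2 => ?_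
  · simp [joinL_isSome]
  · have h3 := joinL_isSome.1 h2
    rw [joinL_getD (joinL_isSome.1 h1), joinL_getD h3]
    simp only [List.map_cons, List.map_nil, List.prod_cons, List.prod_nil, mul_one]
    rw [joinL_getD (joinL_isSome.1 (h3 (joinL L) (by simp)))]

theorem joinL_pair_eq_none {R R' : Rel n K} {t : Tup n} (h : R' t = none) :
    joinL [R, R'] t = none := by
  rw [← Option.not_isSome_iff_eq_none, joinL_isSome]
  simp [h]

theorem joinL_pair_some {R R' : Rel n K} {t : Tup n} {y : K} (h : R' t = some y) :
    joinL [R, R'] t = (R t).map (· * y) := by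
  cases h' : R t <;> simp [joinL, h, h']

/-- The relation `R` does not depend on attributes outside `S`. -/
def Dep (S : Finset (Fin n)) (R : Rel n K) : Prop := ∀ t, R (proj S t) = R t

omit [CommMonoidWithZero K] in
theorem Dep.congr {S : Finset (Fin n)} {R : Rel n K} (h : Dep S R) {t u : Tup n}
    (htu : ∀ a ∈ S, t a = u a) : R t = R u := by
  rw [← h t, ← h u, proj_eq_proj_iff.2 htu]

omit [CommMonoidWithZero K] in
theorem Dep.mono {S T : Finset (Fin n)} {R : Rel n K} (h : Dep S R) (hST : S ⊆ T) : Dep T R :=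
  fun t => h.congr fun _ ha => proj_apply_of_mem (hST ha) t

omit [CommMonoidWithZero K] in
theorem Dep.update {S : Finset (Fin n)} {R : Rel n K} (h : Dep S R) {b : Fin n} (hb : b ∉ S)
    (t : Tup n) (v : ℕ) : R (Function.update t b v) = R t := by
  rw [← h, proj_update_of_notMem hb, h]

theorem Dep.joinL {S : Finset (Fin n)} {L : List (Rel n K)} (h : ∀ R ∈ L, Dep S R) :
    Dep S (joinL L) := by
  intro t
  refine Option.eq_of_getD 1 ?_ fun h1 h2 => ?_
  · simp only [joinL_isSome]
    exact forall₂_congr fun R hR => by rw [h R hR]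
  · rw [joinL_getD (joinL_isSome.1 h1), joinL_getD (joinL_isSome.1 h2)]
    exact congrArg List.prod (List.map_congr_left fun R hR => by rw [h R hR])

omit [CommMonoidWithZero K] in
theorem Dep.update_proj {S : Finset (Fin n)} {R : Rel n K} (h : Dep S R) (b : Fin n) (t : Tup n)
    (v : ℕ) : R (Function.update (proj (S.erase b) t) b v) = R (Function.update t b v) :=
  h.congr fun a ha => by
    by_cases hab : a = b
    · subst hab; simp
    · rw [Function.update_of_ne hab, Function.update_of_ne hab,
        proj_apply_of_mem (Finset.mem_erase.2 ⟨hab, ha⟩)]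

omit [CommMonoidWithZero K] in
theorem Dep.group_proj {S : Finset (Fin n)} {R : Rel n K} (h : Dep S R) (b : Fin n) (t : Tup n) :
    group R b (proj (S.erase b) t) = group R b t := by
  ext v
  simp only [group, Set.mem_ofPred_eq, h.update_proj]

theorem Dep.annotation_proj {S : Finset (Fin n)} {R : Rel n K} (h : Dep S R) (b : Fin n)
    (t : Tup n) : annotation R b (proj (S.erase b) t) = annotation R b t := by
  ext1 v
  simp only [annotation, h.update_proj]

/-! ### Aggregation of joins -/

theorem aggPlus_isSome {O : PlusOps ι K} {i : ι} {b : Fin n} {R : Rel n K} {t : Tup n} :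
    (aggPlus O i b R t).isSome ↔ (group R b t).Finite ∧ (group R b t).Nonempty := by
  unfold aggPlus
  split_ifs with h <;> simp [h]

theorem aggPlus_eq_some {O : PlusOps ι K} {i : ι} [Std.Commutative (O.plus i)] [Std.Associative (O.plus i)]
    {b : Fin n} {R : Rel n K} {t : Tup n} {A : Set ℕ} (hA : A.Finite) (h : group R b t = A)
    (hne : A.Nonempty) :
    aggPlus O i b R t = some (hA.toFinset.fold (O.plus i) 0 (annotation R b t)) := by
  unfold aggPlus
  subst h
  rw [dif_pos ⟨hA, hne⟩]

/-- Distributivity. Along a group the relation `E` has one constant annotation, which factors out of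
the sum; if `E` is absent at `t`, the group of the join is empty. -/
theorem aggPlus_join_indep (O : PlusOps ι K) (i : ι) {b : Fin n} {R E : Rel n K}
    (hE : ∀ t v, E (Function.update t b v) = E t) :
    aggPlus O i b (joinL [R, E]) = joinL [aggPlus O i b R, E] := by
  ext1 t
  have := O.comm i
  have := O.assoc i
  rcases hEt : E t with _ | y
  · rw [joinL_pair_eq_none hEt, ← Option.not_isSome_iff_eq_none, aggPlus_isSome]
    rintro ⟨-, v, hv⟩
    have := joinL_isSome.1 hv E (by simp)
    rw [hE, hEt] at this
    cases this
  · rw [joinL_pair_some hEt]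
    have hj : ∀ v, joinL [R, E] (Function.update t b v) =
        (R (Function.update t b v)).map (· * y) := fun v =>
      joinL_pair_some (by rw [hE, hEt])
    have hg : group (joinL [R, E]) b t = group R b t := by
      ext v
      simp [group, hj]
    have ha : ∀ v ∈ group R b t,
        annotation (joinL [R, E]) b t v = annotation R b t v * y := by
      intro v hv
      obtain ⟨z, hz⟩ := Option.isSome_iff_exists.1 hv
      simp [annotation, hj, hz]
    by_cases h : (group R b t).Finite ∧ (group R b t).Nonempty
    · rw [aggPlus_eq_some h.1 rfl h.2, aggPlus_eq_some h.1 hg h.2, Option.map_some,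
        Option.some.injEq]
      have key : ∀ s : Finset ℕ, (∀ v ∈ s, v ∈ group R b t) →
          s.fold (O.plus i) 0 (annotation (joinL [R, E]) b t) =
            s.fold (O.plus i) 0 (annotation R b t) * y := by
        intro s
        induction s using Finset.induction_on with
        | empty => simp
        | insert v s hv ih =>
          intro hs
          rw [Finset.fold_insert hv, Finset.fold_insert hv, ih fun w hw => hs w (by simp [hw]),
            ha v (hs v (by simp)), mul_comm _ y, mul_comm _ y, ← O.mul_plus, mul_comm y]
      exact key _ fun v hv => h.1.mem_toFinset.1 hv
    · have h1 := mt (aggPlus_isSome (O := O) (i := i)).1 h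
      rw [← hg] at h
      have h2 := mt (aggPlus_isSome (O := O) (i := i)).1 h
      rw [Option.not_isSome_iff_eq_none] at h1 h2
      rw [h2, h1, Option.map_none]

theorem aggProd_isSome {D : Set ℕ} {a : Fin n} {R : Rel n K} {t : Tup n} :
    (aggProd D a R t).isSome ↔ (group R a t).Finite ∧ D ⊆ group R a t := by
  unfold aggProd
  split_ifs with h <;> simp [h]

theorem aggProd_eq_some {D : Set ℕ} {a : Fin n} {R : Rel n K} {t : Tup n} {A : Set ℕ}
    (hA : A.Finite) (h : group R a t = A) (hD : D ⊆ A) :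
    aggProd D a R t = some (∏ v ∈ hA.toFinset, annotation R a t v) := by
  unfold aggProd
  subst h
  rw [dif_pos ⟨hA, hD⟩]

theorem aggPlus_congr {O : PlusOps ι K} {i : ι} {b : Fin n} {R R' : Rel n K} {t u : Tup n}
    (h : group R b t = group R' b u) (h' : annotation R b t = annotation R' b u) :
    aggPlus O i b R t = aggPlus O i b R' u := by
  have := O.comm i
  have := O.assoc i
  by_cases hR : (group R b t).Finite ∧ (group R b t).Nonempty
  · rw [aggPlus_eq_some hR.1 rfl hR.2, aggPlus_eq_some hR.1 h.symm hR.2, h']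
  · have h1 := mt (aggPlus_isSome (O := O) (i := i)).1 hR
    rw [h] at hR
    have h2 := mt (aggPlus_isSome (O := O) (i := i)).1 hR
    rw [Option.not_isSome_iff_eq_none] at h1 h2
    rw [h2, h1]

theorem aggProd_congr {D : Set ℕ} {b : Fin n} {R R' : Rel n K} {t u : Tup n}
    (h : group R b t = group R' b u) (h' : annotation R b t = annotation R' b u) :
    aggProd D b R t = aggProd D b R' u := by
  by_cases hR : (group R b t).Finite ∧ D ⊆ group R b t
  · rw [aggProd_eq_some hR.1 rfl hR.2, aggProd_eq_some hR.1 h.symm hR.2, h']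
  · have h1 := mt (aggProd_isSome).1 hR
    rw [h] at hR
    have h2 := mt (aggProd_isSome).1 hR
    rw [Option.not_isSome_iff_eq_none] at h1 h2
    rw [h2, h1]

theorem Dep.aggPlus {S : Finset (Fin n)} {R : Rel n K} (h : Dep S R) (O : PlusOps ι K) (i : ι)
    (b : Fin n) : Dep (S.erase b) (aggPlus O i b R) := by
  exact fun t => aggPlus_congr (h.group_proj b t) (h.annotation_proj b t)

theorem Dep.aggProd {S : Finset (Fin n)} {R : Rel n K} (h : Dep S R) (D : Set ℕ) (b : Fin n) :
    Dep (S.erase b) (aggProd D b R) := by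
  exact fun t => aggProd_congr (h.group_proj b t) (h.annotation_proj b t)

theorem prod_list_map_comm {A B : Type*} (s : Finset A) (V : List B) (f : A → B → K) :
    ∏ v ∈ s, (V.map (f v)).prod = (V.map fun x => ∏ v ∈ s, f v x).prod := by
  induction V with
  | nil => simp
  | cons x V ih => simp [Finset.prod_mul_distrib, ih]

/-- Product aggregation acts on each relation that contains the attribute separately. -/
theorem aggProd_joinL {D : Set ℕ} (hD : D.Nonempty) (hid : ∀ x : K, x * x = x) {a : Fin n}
    {A : Type*} (V : List A) (rel : A → Rel n K) (p : A → Prop) [DecidablePred p]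
    (hind : ∀ x ∈ V, ¬ p x → ∀ t v, rel x (Function.update t a v) = rel x t)
    (hdep : ∀ x ∈ V, p x → ∀ t, group (rel x) a t ⊆ D) (hex : ∃ x ∈ V, p x) :
    aggProd D a (joinL (V.map rel)) =
      joinL (V.map fun x => if p x then aggProd D a (rel x) else rel x) := by
  obtain ⟨v₀, hv₀⟩ := hD
  -- The only use of idempotence: the product over the domain of an annotation that does not depend
  -- on `a`.
  have hpow : ∀ (s : Finset ℕ) (x : K), s.Nonempty → ∏ _v ∈ s, x = x := by
    intro s x hs
    obtain ⟨k, hk⟩ := Nat.exists_eq_succ_of_ne_zero hs.card_pos.ne'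
    rw [Finset.prod_const, hk]
    exact IsIdempotentElem.pow_succ_eq k (hid x)
  ext1 t
  -- Some relation contains `a`, and its values lie in `D`. Hence a group that includes `D` equals
  -- `D`, and `D` is finite.
  have hgrp : group (joinL (V.map rel)) a t ⊆ D := by
    obtain ⟨x, hx, hpx⟩ := hex
    intro v hv
    exact hdep x hx hpx t (joinL_isSome.1 hv _ (List.mem_map_of_mem hx))
  have hsome : ∀ x ∈ V, ((if p x then aggProd D a (rel x) else rel x) t).isSome ↔
      if p x then D.Finite ∧ D ⊆ group (rel x) a t else (rel x t).isSome := by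
    intro x hx
    split_ifs with hp
    · rw [aggProd_isSome]
      constructor
      · rintro ⟨h1, h2⟩; exact ⟨h1.subset h2, h2⟩
      · rintro ⟨h1, h2⟩; exact ⟨h1.subset (hdep x hx hp t), h2⟩
    · rfl
  refine Option.eq_of_getD 1 ?_ fun h1 h2 => ?_
  · rw [aggProd_isSome, joinL_isSome, List.forall_mem_map]
    constructor
    · rintro ⟨hf, hs⟩ x hx
      have hs' : ∀ v ∈ D, (rel x (Function.update t a v)).isSome := fun v hv =>
        joinL_isSome.1 (hs hv) _ (List.mem_map_of_mem hx)
      rw [hsome x hx]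
      split_ifs with hp
      · exact ⟨hf.subset hs, hs'⟩
      · rw [← hind x hx hp t v₀]; exact hs' v₀ hv₀
    · intro h
      have hDf : D.Finite := by
        obtain ⟨x, hx, hpx⟩ := hex
        have := (hsome x hx).1 (h x hx)
        rw [if_pos hpx] at this
        exact this.1
      refine ⟨hDf.subset hgrp, fun v hv => joinL_isSome.2 ?_⟩
      rw [List.forall_mem_map]
      intro x hx
      have := (hsome x hx).1 (h x hx)
      split_ifs at this with hp
      · exact this.2 hv
      · rw [hind x hx hp]; exact this
  · obtain ⟨hf, hs⟩ := aggProd_isSome.1 h1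
    have hDf := hf.subset hs
    have hs' : ∀ x ∈ V, ∀ v ∈ D, (rel x (Function.update t a v)).isSome := fun x hx v hv =>
      joinL_isSome.1 (hs hv) _ (List.mem_map_of_mem hx)
    rw [aggProd_eq_some hDf (hgrp.antisymm hs) subset_rfl, Option.getD_some, joinL_getD (joinL_isSome.1 h2), List.map_map]
    have : ∀ v ∈ hDf.toFinset, annotation (joinL (V.map rel)) a t v =
        (V.map fun x => annotation (rel x) a t v).prod := by
      intro v hv
      rw [annotation, joinL_getD (joinL_isSome.1 (hs (hDf.mem_toFinset.1 hv))), List.map_map]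
      rfl
    rw [Finset.prod_congr rfl this, prod_list_map_comm]
    refine congrArg List.prod (List.map_congr_left fun x hx => ?_)
    simp only [Function.comp]
    split_ifs with hp
    · rw [aggProd_eq_some hDf ((hdep x hx hp t).antisymm fun v hv => hs' x hx v hv) subset_rfl,
        Option.getD_some]
    · simp only [annotation, hind x hx hp]
      exact hpow _ _ ⟨v₀, hDf.mem_toFinset.2 hv₀⟩

/-! ### Filters -/

variable {H : Hypergraph n m}

/-- The tuples of `R` agree on the attributes `V` with a row of each relation. -/
def Filt (I : Instance H K) (V : Finset (Fin n)) (R : Rel n K) : Prop :=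
  ∀ t, (R t).isSome → ∀ j, ∃ r : I.Rows j, ∀ a ∈ H.edge j, a ∈ V → t a = rowTup I r a

open Classical in
/-- The local join over `U` as a relation. -/
def indicator (I : Instance H K) (U : Finset (Fin n)) : Rel n K := fun t =>
  if InJoin I U (proj U t) then some 1 else none

theorem indicator_isSome {I : Instance H K} {U : Finset (Fin n)} {t : Tup n} :
    (indicator I U t).isSome ↔ InJoin I U (proj U t) := by
  rw [indicator]
  split_ifs with h <;> simp [h]

theorem dep_indicator (I : Instance H K) (U : Finset (Fin n)) : Dep U (indicator I U) := by
  intro t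
  rw [indicator, indicator, proj_proj_of_subset subset_rfl]

omit [CommMonoidWithZero K] in
theorem Filt.inJoin {I : Instance H K} {V U : Finset (Fin n)} {R : Rel n K} (h : Filt I V R)
    (hU : U ⊆ V) {t : Tup n} (ht : (R t).isSome) : InJoin I U (proj U t) := by
  refine ⟨proj_proj_of_subset subset_rfl t, fun j _ => ?_⟩
  obtain ⟨r, hr⟩ := h t ht j
  refine Finset.mem_image.2 ⟨r, Finset.mem_univ _, ?_⟩
  rw [proj_proj_of_subset Finset.inter_subset_left, proj_eq_proj_iff]
  intro a ha
  obtain ⟨h1, h2⟩ := Finset.mem_inter.1 ha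
  exact (hr a h2 (hU h1)).symm

/-- Every tuple of the current join still agrees with a row of each input relation on the remaining
attributes, so it survives the local join, whose annotations are `1`. The extra factor bounds the
size of the join about to be formed without changing the result. -/
theorem joinL_indicator {I : Instance H K} {V U : Finset (Fin n)} {L : List (Rel n K)}
    (h : Filt I V (joinL L)) (hU : U ⊆ V) : joinL (indicator I U :: L) = joinL L := by
  ext1 t
  refine Option.eq_of_getD 1 ?_ fun h1 h2 => ?_
  · rw [joinL_isSome, joinL_isSome, List.forall_mem_cons, and_iff_right_iff_imp]
    exact fun h' => indicator_isSome.2 (h.inJoin hU (joinL_isSome.2 h'))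
  · rw [joinL_getD (joinL_isSome.1 h1), joinL_getD (joinL_isSome.1 h2)]
    simp [indicator, h.inJoin hU h2]

omit [CommMonoidWithZero K] in
theorem Filt.of_update {I : Instance H K} {V : Finset (Fin n)} {R R' : Rel n K} {b : Fin n}
    (h : Filt I V R) (h' : ∀ t, (R' t).isSome → ∃ v, (R (Function.update t b v)).isSome) :
    Filt I (V.erase b) R' := by
  intro t ht j
  obtain ⟨v, hv⟩ := h' t ht
  obtain ⟨r, hr⟩ := h _ hv j
  refine ⟨r, fun a ha haV => ?_⟩
  obtain ⟨hab, haV⟩ := Finset.mem_erase.1 haV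
  rw [← hr a ha haV, Function.update_of_ne hab]

/-- The elimination of an attribute by an additive operator. -/
theorem aggPlus_joinL {I : Instance H K} {V U : Finset (Fin n)} {L D E : List (Rel n K)}
    (h : Filt I V (joinL L)) (hU : U ⊆ V) (hL : L.Perm (D ++ E)) (O : PlusOps ι K) (i : ι)
    {b : Fin n} (hE : ∀ R ∈ E, ∀ t v, R (Function.update t b v) = R t) :
    aggPlus O i b (joinL L) = joinL (aggPlus O i b (joinL (indicator I U :: D)) :: E) := by
  rw [← joinL_indicator h hU, joinL_perm (hL.cons (indicator I U)), ← List.cons_append,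
    joinL_append, aggPlus_join_indep, ← joinL_cons]
  intro t v
  refine Option.eq_of_getD 1 ?_ fun h1 h2 => ?_
  · simp only [joinL_isSome]
    exact forall₂_congr fun R hR => by rw [hE R hR]
  · rw [joinL_getD (joinL_isSome.1 h1), joinL_getD (joinL_isSome.1 h2)]
    exact congrArg List.prod (List.map_congr_left fun R hR => by rw [hE R hR])

/-! ### Accumulation -/

omit [CommMonoidWithZero K] in
open Classical in
theorem acc_append (op : K → K → K) (S : Finset (Fin n)) (P : Tup n → Prop) (v : Tup n → K)
    (l : List (Tup n)) (t : Tup n) : acc op S P v (l ++ [t]) =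
      if P t then upd op (acc op S P v l) (proj S t) (v t) else acc op S P v l := by
  simp only [acc, List.foldl_append, List.foldl_cons, List.foldl_nil]

open Classical in
theorem acc_keep (O : PlusOps ι K) (S : Finset (Fin n)) (P : Tup n → Prop) (v v' : Tup n → K)
    (l : List (Tup n)) (hv : ∀ t ∈ l, P t → v t = v' (proj S t)) (g : Tup n) :
    acc (Comb.keep.op O) S P v l g =
      if ∃ t ∈ l, P t ∧ proj S t = g then some (v' g) else none := by
  induction l using List.reverseRecOn with
  | nil => simp [acc]
  | append_singleton l t ih =>
    have ih' := ih fun t ht => hv t (by simp [ht])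
    rw [acc_append]
    by_cases hP : P t
    · rw [if_pos hP]
      by_cases hg : g = proj S t
      · subst hg
        rw [if_pos ⟨t, by simp, hP, rfl⟩]
        simp only [upd, Function.update_self, ih']
        split_ifs with h
        · simp [Comb.op]
        · simp [hv t (by simp) hP]
      · simp only [upd, Function.update_of_ne hg, ih']
        congr 1
        simp only [List.mem_append, List.mem_singleton, eq_iff_iff]
        refine exists_congr fun u => ⟨fun ⟨h1, h2⟩ => ⟨Or.inl h1, h2⟩, ?_⟩
        rintro ⟨h1 | rfl, h2, h3⟩
        · exact ⟨h1, h2, h3⟩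
        · exact absurd h3.symm hg
    · rw [if_neg hP, ih']
      congr 1
      simp only [List.mem_append, List.mem_singleton, eq_iff_iff]
      refine exists_congr fun u => ⟨fun ⟨h1, h2⟩ => ⟨Or.inl h1, h2⟩, ?_⟩
      rintro ⟨h1 | rfl, h2, h3⟩
      · exact ⟨h1, h2, h3⟩
      · exact absurd h2 hP

omit [CommMonoidWithZero K] in
open Classical in
theorem acc_eq_foldl {op : K → K → K} {e : K} (he : ∀ x, op e x = x) (S : Finset (Fin n))
    (P : Tup n → Prop) (v : Tup n → K) (l : List (Tup n)) (g : Tup n) :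
    acc op S P v l g = if (l.filter fun t => P t ∧ proj S t = g) = [] then none else
      some (((l.filter fun t => P t ∧ proj S t = g).map v).foldl op e) := by
  induction l using List.reverseRecOn with
  | nil => simp [acc]
  | append_singleton l t ih =>
    rw [acc_append, List.filter_append]
    by_cases hP : P t
    · rw [if_pos hP]
      by_cases hg : g = proj S t
      · subst hg
        simp only [upd, Function.update_self, ih]
        by_cases h : (l.filter fun u => P u ∧ proj S u = proj S t) = []
        · rw [if_pos h, h]
          simp [hP, he]
        · rw [if_neg h]
          simp [hP]
      · have hg' : ¬ proj S t = g := fun h => hg h.symm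
        simp only [upd, Function.update_of_ne hg, ih]
        simp [hg']
    · rw [if_neg hP, ih]
      simp [hP]

open Classical in
/-- Accumulation computes the aggregation of one attribute. -/
theorem acc_eq_fold {op : K → K → K} {e : K} [hc : Std.Commutative op] [ha : Std.Associative op]
    (he : ∀ x, op e x = x) {T : Finset (Fin n)} {b : Fin n} (hb : b ∈ T) {P : Tup n → Prop}
    {v : Tup n → K} {l : List (Tup n)} (hl : l.Nodup) (hT : ∀ t ∈ l, proj T t = t)
    {R : Rel n K} (hR : Dep T R) (hsome : ∀ t, proj T t = t → ((R t).isSome ↔ t ∈ l ∧ P t))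
    (hv : ∀ t ∈ l, P t → (R t).getD 1 = v t) (t : Tup n) :
    ∃ hf : (group R b t).Finite,
      (l.filter fun u => P u ∧ proj (T.erase b) u = proj (T.erase b) t).length =
        hf.toFinset.card ∧
      acc op (T.erase b) P v l (proj (T.erase b) t) = if (group R b t).Nonempty then
        some (hf.toFinset.fold op e (annotation R b t)) else none := by
  set g := proj (T.erase b) t with hg
  set lg := l.filter fun u => P u ∧ proj (T.erase b) u = g with hlg
  have hself : ∀ w, proj T (Function.update g b w) = Function.update g b w := by
    intro w
    rw [proj_update_of_mem hb, hg, proj_proj, Finset.inter_eq_right.2 (Finset.erase_subset _ _)]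
  have hmem : ∀ w, w ∈ group R b t ↔ ∃ u ∈ lg, u b = w := by
    intro w
    rw [group, Set.mem_ofPred_eq, ← hR.update_proj, hsome _ (hself w)]
    constructor
    · rintro ⟨h1, h2⟩
      refine ⟨_, List.mem_filter.2 ⟨h1, ?_⟩, Function.update_self ..⟩
      simp only [decide_eq_true_eq]
      exact ⟨h2, by rw [proj_erase_update, hg, proj_proj_of_subset subset_rfl]⟩
    · rintro ⟨u, hu, rfl⟩
      obtain ⟨h1, h2⟩ := List.mem_filter.1 hu
      simp only [decide_eq_true_eq] at h2
      rw [← h2.2, update_proj_erase hb, hT u h1]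
      exact ⟨h1, h2.1⟩
  have hup : ∀ u ∈ lg, R (Function.update t b (u b)) = R u := by
    intro u hu
    obtain ⟨h1, h2⟩ := List.mem_filter.1 hu
    simp only [decide_eq_true_eq] at h2
    rw [← hR.update_proj, ← hg, ← h2.2, update_proj_erase hb, hT u h1]
  -- Within a group a tuple is determined by its value at `b`, so folding over the list of tuples is
  -- folding over the set of values.
  have hnd : (lg.map fun u => u b).Nodup := by
    refine (hl.filter _).map_on ?_
    intro u hu u' hu' h
    obtain ⟨h1, h2⟩ := List.mem_filter.1 hu
    obtain ⟨h1', h2'⟩ := List.mem_filter.1 hu'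
    simp only [decide_eq_true_eq] at h2 h2'
    rw [← hT u h1, ← hT u' h1', ← update_proj_erase hb u, ← update_proj_erase hb u', h2.2, h2'.2, h]
  have hf : (group R b t).Finite :=
    (lg.map fun u => u b).toFinset.finite_toSet.subset fun w hw => by
      obtain ⟨u, hu, rfl⟩ := (hmem w).1 hw
      simpa using ⟨u, hu, rfl⟩
  have hset : hf.toFinset = (lg.map fun u => u b).toFinset := by
    ext w
    rw [hf.mem_toFinset, hmem]
    simp
  have hne : (group R b t).Nonempty ↔ lg ≠ [] := by
    constructor
    · rintro ⟨w, hw⟩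
      obtain ⟨u, hu, -⟩ := (hmem w).1 hw
      exact List.ne_nil_of_mem hu
    · intro h
      obtain ⟨u, hu⟩ := List.exists_mem_of_ne_nil _ h
      exact ⟨_, (hmem _).2 ⟨u, hu, rfl⟩⟩
  refine ⟨hf, by rw [hset, List.toFinset_card_of_nodup hnd, List.length_map], ?_⟩
  rw [acc_eq_foldl he]
  by_cases hnil : lg = []
  · rw [if_pos hnil, if_neg fun h => hne.1 h hnil]
  · rw [if_neg hnil, if_pos (hne.2 hnil), hset, Finset.fold, List.toFinset_val, hnd.dedup,
      Multiset.map_coe, Multiset.coe_fold_l, List.map_map]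
    congr 2
    refine List.map_congr_left fun u hu => ?_
    obtain ⟨h1, h2⟩ := List.mem_filter.1 hu
    simp only [decide_eq_true_eq] at h2
    simp only [Function.comp, annotation, hup u hu, hv u h1 h2.1]

-- A condition on the projection keeps or drops whole groups, so it can be imposed after the
-- accumulation. This is the situation of product aggregation, where incomplete groups are dropped.
omit [CommMonoidWithZero K] in
open Classical in
theorem acc_of_proj (op : K → K → K) (S : Finset (Fin n)) (p : Tup n → Prop) (v : Tup n → K)
    (l : List (Tup n)) (g : Tup n) : acc op S (fun u => p (proj S u)) v l g =
      if p g then acc op S (fun _ => True) v l g else none := by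
  induction l using List.reverseRecOn with
  | nil => simp [acc]
  | append_singleton l t ih =>
    rw [acc_append, acc_append, if_pos trivial]
    by_cases hg : g = proj S t
    · subst hg
      by_cases hp : p (proj S t)
      · rw [if_pos hp] at ih ⊢
        rw [if_pos hp]
        simp only [upd, Function.update_self, ih]
      · rw [if_neg hp] at ih ⊢
        rw [if_neg hp, ih]
    · simp only [upd, Function.update_of_ne hg]
      rw [← ih]
      split_ifs with hp
      · rw [Function.update_of_ne hg]
      · rfl

omit [CommMonoidWithZero K] in
open Classical in
theorem acc_eq_none (op : K → K → K) (S : Finset (Fin n)) (P : Tup n → Prop) (v : Tup n → K)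
    (l : List (Tup n)) {g : Tup n} (hg : proj S g ≠ g) : acc op S P v l g = none := by
  induction l using List.reverseRecOn with
  | nil => rfl
  | append_singleton l t ih =>
    have hne : g ≠ proj S t := by
      rintro rfl
      exact hg (proj_proj_of_subset subset_rfl t)
    rw [acc_append]
    split_ifs with hP
    · rw [upd, Function.update_of_ne hne, ih]
    · exact ih

end Semantics

end Ajar

end

noncomputable section

namespace Ajar

/-! ### Relations stored in tables, and single elimination steps. -/

section Factors

variable {n m : ℕ} {ι K : Type*} {H : Hypergraph n m}

/-- A relation that is stored in a table: the key of the table and the schema. -/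
structure Fac (n : ℕ) where
  key : Key n
  sch : Finset (Fin n)

open Classical in
/-- The relation `R` with schema `S` as a partial function on tuples over `S`. -/
def onSch (S : Finset (Fin n)) (R : Rel n K) : Tup n → Option K :=
  fun t => if proj S t = t then R t else none

theorem onSch_of_proj {S : Finset (Fin n)} {R : Rel n K} {t : Tup n} (h : proj S t = t) :
    onSch S R t = R t := if_pos h

theorem onSch_proj {S : Finset (Fin n)} {R : Rel n K} (h : Dep S R) (t : Tup n) :
    onSch S R (proj S t) = R t := by
  rw [onSch_of_proj (proj_proj_of_subset subset_rfl t), h]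

theorem onSch_isSome {S : Finset (Fin n)} {R : Rel n K} {t : Tup n} :
    (onSch S R t).isSome ↔ proj S t = t ∧ (R t).isSome := by
  rw [onSch]
  split_ifs with h <;> simp [h]

/-- The bound `Y` on the length controls the time of a scan. The field `dom` lets product
aggregation recognize a complete group by its size alone. -/
structure Fac.Good (e : Fac n) (I : Instance H K) (M Y : ℕ) (h : HS n m K) (R : Rel n K) :
    Prop where
  dep : Dep e.sch R
  tab : ∃ l, Tab M h e.key l (onSch e.sch R) ∧ l.length ≤ Y
  dom : ∀ t, (R t).isSome → ∀ a ∈ e.sch, t a ∈ I.dom a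

theorem Fac.Good.congr {e : Fac n} {I : Instance H K} {M Y : ℕ} {h h' : HS n m K} {R : Rel n K}
    (he : e.Good I M Y h R) {D : Set (Key n)} (hF : Frame D h h') (hd : e.key ∉ D) :
    e.Good I M Y h' R := by
  obtain ⟨l, h1, h2⟩ := he.tab
  exact ⟨he.dep, ⟨l, h1.congr hF hd, h2⟩, he.dom⟩

/-- The equation that tests whether the tuple in local variable `1` belongs to the relation. -/
def Fac.flagE (e : Fac n) : Exp n m × Exp n m :=
  (.get (.tab 2 e.key) (projE e.sch (.loc 1)), .lit 1)

/-- The product of the annotations of the tuple in local variable `1`. -/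
def valsE (L : List (Fac n)) : AExp n m ι :=
  L.foldr (fun e x => .mul (.get (.tab 0 e.key) (projE e.sch (.loc 1))) x) .one

variable {W M Y : ℕ} {I : Instance H K} {h : HS n m K}

theorem Fac.Good.flagE {e : Fac n} {R : Rel n K} (he : e.Good I M Y h R) (hf : Fit n m W M)
    (hp : HasPow M h) {t : Tup n} (ht : Bd M t) (h1 : h.loc 1 = enc M t) :
    ((e.flagE : Exp n m × Exp n m).1.Ok W h ∧ (e.flagE : Exp n m × Exp n m).2.Ok W h) ∧
      ((e.flagE : Exp n m × Exp n m).1.eval h = (e.flagE : Exp n m × Exp n m).2.eval h ↔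
        (R t).isSome) := by
  obtain ⟨l, hT, -⟩ := he.tab
  have hloc1 : (Exp.loc 1 : Exp n m).Ok W h := ⟨by omega, by rw [h1]; exact hf.enc_lt ht⟩
  have hev := projE_eval (e := .loc 1) hp ht h1 e.sch
  refine ⟨⟨projE_ok (e := .loc 1) hf hp ht h1 hloc1 _, hf.small (by omega)⟩, ?_⟩
  simp only [Fac.flagE, Exp.eval, hev, hT.flag _ (ht.proj _), onSch_proj he.dep]
  split_ifs with h2 <;> simp [h2]

variable [CommMonoidWithZero K] {O : PlusOps ι K}

theorem flags_spec {V : List (Fac n × Rel n K)} (hV : ∀ p ∈ V, p.1.Good I M Y h p.2)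
    (hf : Fit n m W M) (hp : HasPow M h) {t : Tup n} (ht : Bd M t) (h1 : h.loc 1 = enc M t) :
    (∀ p ∈ (V.map Prod.fst).map Fac.flagE, p.1.Ok W h ∧ p.2.Ok W h) ∧
      ((∀ p ∈ (V.map Prod.fst).map (Fac.flagE (m := m)), p.1.eval h = p.2.eval h) ↔
        (joinL (V.map Prod.snd) t).isSome) := by
  simp only [joinL_isSome, List.forall_mem_map]
  exact ⟨fun p hpV => ((hV p hpV).flagE hf hp ht h1).1,
    forall₂_congr fun p hpV => ((hV p hpV).flagE hf hp ht h1).2⟩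

theorem valsE_spec {V : List (Fac n × Rel n K)} (hV : ∀ p ∈ V, p.1.Good I M Y h p.2)
    (hf : Fit n m W M) (hp : HasPow M h) {t : Tup n} (ht : Bd M t) (h1 : h.loc 1 = enc M t)
    (hs : (joinL (V.map Prod.snd) t).isSome) :
    (valsE (V.map Prod.fst) : AExp n m ι).Ok W h ∧
      (valsE (V.map Prod.fst)).eval O h = (joinL (V.map Prod.snd) t).getD 1 := by
  rw [joinL_isSome] at hs
  rw [joinL_getD hs]
  induction V with
  | nil => exact ⟨trivial, rfl⟩
  | cons p V ih =>
    obtain ⟨ih1, ih2⟩ := ih (fun q hq => hV q (by simp [hq])) fun R hR => hs R (by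
      rw [List.map_cons]; exact List.mem_cons_of_mem _ hR)
    have hg := hV p (by simp)
    obtain ⟨l, hT, -⟩ := hg.tab
    have hloc1 : (Exp.loc 1 : Exp n m).Ok W h := ⟨by omega, by rw [h1]; exact hf.enc_lt ht⟩
    have hev := projE_eval (e := .loc 1) hp ht h1 p.1.sch
    refine ⟨⟨projE_ok (e := .loc 1) hf hp ht h1 hloc1 _, ih1⟩, ?_⟩
    have h2 : (p.2 t).isSome := hs p.2 (by simp)
    have h3 := hT.val (proj p.1.sch t) ((p.2 t).getD 1)
      (by rw [onSch_proj hg.dep]; exact Option.eq_some_getD 1 h2)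
    have e1 : (valsE ((p :: V).map Prod.fst)).eval O h =
        h.k (.tab 0 p.1.key) ((projE p.1.sch (.loc 1) : Exp n m).eval h) *
          (valsE (V.map Prod.fst)).eval O h := rfl
    rw [e1, ih2, hev, h3]
    simp

/-- The table of the local join over `U`. -/
def keyJ (U : Finset (Fin n)) : Key n := (3, 0, U)

def JTab (I : Instance H K) (M Y : ℕ) (h : HS n m K) (U : Finset (Fin n)) : Prop :=
  ∃ l, Lst M h (keyJ U) l ∧ (∀ t, t ∈ l ↔ InJoin I U t) ∧ l.length ≤ Y

omit [CommMonoidWithZero K] in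
theorem JTab.congr {U : Finset (Fin n)} {h' : HS n m K} (hJ : JTab I M Y h U) {D : Set (Key n)}
    (hF : Frame D h h') (hd : keyJ U ∉ D) : JTab I M Y h' U := by
  obtain ⟨l, h1, h2, h3⟩ := hJ
  exact ⟨l, h1.congr hF hd, h2, h3⟩

omit [CommMonoidWithZero K] in
theorem InJoin.mem_dom {U : Finset (Fin n)} {t : Tup n} (ht : InJoin I U (proj U t)) {a : Fin n}
    (ha : a ∈ U) : t a ∈ I.dom a := by
  obtain ⟨j, r, hj, e⟩ := ht.exists_row ha
  rw [proj_apply_of_mem ha] at e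
  have := I.mem_dom j r.1 r.2 ⟨a, hj⟩
  rw [e, rowTup, dif_pos hj]
  exact this

theorem joinL_indicator_of_inJoin {U : Finset (Fin n)} {t : Tup n} (ht : InJoin I U (proj U t))
    (L : List (Rel n K)) : joinL (indicator I U :: L) t = joinL L t := by
  have h1 := indicator_isSome.2 ht
  refine Option.eq_of_getD 1 ?_ fun h1 h2 => ?_
  · rw [joinL_isSome, joinL_isSome, List.forall_mem_cons, and_iff_right h1]
  · rw [joinL_getD (joinL_isSome.1 h1), joinL_getD (joinL_isSome.1 h2)]
    simp [indicator, ht]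

/-- The relation of the tuples in the local join over `U` that belong to all relations of `L`,
aggregated by the projection to `S`. -/
def collect (U : Finset (Fin n)) (d : Key n) (S : Finset (Fin n)) (c : Comb ι)
    (L : List (Fac n)) : Cmd ι :=
  accum (m := m) (keyJ U) d S (L.map Fac.flagE) (valsE L) c

theorem collect_tri (hf : Fit n m W M) (hp : HasPow M h) {U S : Finset (Fin n)} {d : Key n}
    (hd : d ≠ baseKey) (hdJ : keyJ U ≠ d) (hu : Unused h d)
    {V : List (Fac n × Rel n K)} (hV : ∀ p ∈ V, p.1.Good I M Y h p.2 ∧ p.1.key ≠ d)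
    {l : List (Tup n)} (hl : Lst M h (keyJ U) l) (c : Comb ι) {X : ℕ} (hX : l.length + 1 ≤ X) :
    Tri O W (collect (m := m) U d S c (V.map Prod.fst)) h X fun h' => Frame {d} h h' ∧
      ∃ l', Tab M h' d l' (acc (c.op O) S (fun t => (joinL (V.map Prod.snd) t).isSome)
        (fun t => (joinL (V.map Prod.snd) t).getD 1) l) ∧ l'.length ≤ l.length := by
  have hV' : ∀ h', Frame {d} h h' → ∀ p ∈ V, p.1.Good I M Y h' p.2 := fun h' hF p hpV =>
    (hV p hpV).1.congr hF (hV p hpV).2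
  have hp' : ∀ h', Frame {d} h h' → HasPow M h' := fun h' hF => hp.congr hF fun h => hd h.symm
  refine accum_tri hf hp hdJ hd hl (hu.tab M) c ?_ ?_ hX
  · intro t ht h' hF h1
    exact flags_spec (hV' h' hF) hf (hp' h' hF) (hl.bd t ht) h1
  · intro t ht hPt h' hF h1
    exact valsE_spec (hV' h' hF) hf (hp' h' hF) (hl.bd t ht) h1 hPt

/-- A tuple of the join restricted by the indicator is a tuple of the local join, so a single scan
of the local join, with a dictionary lookup in each relation, finds the whole join in time `Y`. -/
theorem collect_keep_tri (hf : Fit n m W M) (hp : HasPow M h) {U : Finset (Fin n)} {d : Key n}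
    (hd : d ≠ baseKey) (hdJ : keyJ U ≠ d) (hu : Unused h d)
    {V : List (Fac n × Rel n K)} (hV : ∀ p ∈ V, p.1.Good I M Y h p.2 ∧ p.1.key ≠ d)
    (hS : ∀ p ∈ V, p.1.sch ⊆ U) (hJ : JTab I M Y h U) {X : ℕ} (hX : Y + 1 ≤ X) :
    Tri O W (collect (m := m) U d U .keep (V.map Prod.fst)) h X fun h' => Frame {d} h h' ∧
      (⟨d, U⟩ : Fac n).Good I M Y h' (joinL (indicator I U :: V.map Prod.snd)) := by
  obtain ⟨l, hl, hmem, hlen⟩ := hJ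
  refine (collect_tri hf hp hd hdJ hu hV hl .keep (by omega)).mono le_rfl ?_
  rintro h' ⟨hF, l', hT, hl'⟩
  refine ⟨hF, ?_, ⟨l', ?_, hl'.trans hlen⟩, ?_⟩
  · refine Dep.joinL ?_
    rw [List.forall_mem_cons, List.forall_mem_map]
    exact ⟨dep_indicator I U, fun p hpV => (hV p hpV).1.dep.mono (hS p hpV)⟩
  · convert hT using 1
    ext1 t
    rw [acc_keep O U _ _ (fun t => (joinL (V.map Prod.snd) t).getD 1) l fun t ht _ => by
      rw [((hmem t).1 ht).1]]
    simp only [onSch]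
    by_cases ht : InJoin I U t
    · rw [if_pos ht.1, joinL_indicator_of_inJoin (by rwa [ht.1])]
      by_cases hs : (joinL (V.map Prod.snd) t).isSome
      · rw [if_pos ⟨t, (hmem t).2 ht, hs, ht.1⟩]
        exact Option.eq_some_getD 1 hs
      · rw [if_neg]
        · simpa using hs
        · rintro ⟨u, hu, hs', rfl⟩
          rw [((hmem u).1 hu).1] at hs
          exact hs hs'
    · rw [if_neg (c := ∃ u ∈ l, _)]
      · split_ifs with h1
        · rw [← Option.not_isSome_iff_eq_none, joinL_isSome]
          intro h2
          have := indicator_isSome.1 (h2 _ List.mem_cons_self)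
          rw [h1] at this
          exact ht this
        · rfl
      · rintro ⟨u, hu, -, rfl⟩
        rw [((hmem u).1 hu).1] at ht
        exact ht ((hmem u).1 hu)
  · intro t ht a ha
    exact (indicator_isSome.1 (joinL_isSome.1 ht _ List.mem_cons_self)).mem_dom ha

theorem collect_plus_tri (hf : Fit n m W M) (hp : HasPow M h) {U : Finset (Fin n)} {d : Key n}
    (hd : d ≠ baseKey) (hdJ : keyJ U ≠ d) (hu : Unused h d)
    {V : List (Fac n × Rel n K)} (hV : ∀ p ∈ V, p.1.Good I M Y h p.2 ∧ p.1.key ≠ d)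
    (hS : ∀ p ∈ V, p.1.sch ⊆ U) (hJ : JTab I M Y h U) {b : Fin n} (hb : b ∈ U) (i : ι) {X : ℕ}
    (hX : Y + 1 ≤ X) :
    Tri O W (collect (m := m) U d (U.erase b) (.plus i) (V.map Prod.fst)) h X fun h' =>
      Frame {d} h h' ∧ (⟨d, U.erase b⟩ : Fac n).Good I M Y h'
        (aggPlus O i b (joinL (indicator I U :: V.map Prod.snd))) := by
  obtain ⟨l, hl, hmem, hlen⟩ := hJ
  have hdep : Dep U (joinL (indicator I U :: V.map Prod.snd)) := by
    refine Dep.joinL ?_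
    rw [List.forall_mem_cons, List.forall_mem_map]
    exact ⟨dep_indicator I U, fun p hpV => (hV p hpV).1.dep.mono (hS p hpV)⟩
  have := O.comm i
  have := O.assoc i
  refine (collect_tri hf hp hd hdJ hu hV hl (.plus i) (by omega)).mono le_rfl ?_
  rintro h' ⟨hF, l', hT, hl'⟩
  refine ⟨hF, hdep.aggPlus O i b, ⟨l', ?_, hl'.trans hlen⟩, ?_⟩
  · convert hT using 1
    ext1 t
    by_cases ht : proj (U.erase b) t = t
    · rw [onSch_of_proj ht]
      obtain ⟨hfin, -, hacc⟩ := acc_eq_fold (op := O.plus i) (e := 0)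
        (fun x => by rw [(O.comm i).comm, O.plus_zero]) hb (l := l)
        (P := fun t => (joinL (V.map Prod.snd) t).isSome)
        (v := fun t => (joinL (V.map Prod.snd) t).getD 1)
        hl.nodup (fun t ht => ((hmem t).1 ht).1) hdep (fun t ht => by
          rw [joinL_isSome, List.forall_mem_cons, indicator_isSome, ht, hmem, joinL_isSome])
        (fun t ht _ => by
          have ht := (hmem t).1 ht
          rw [joinL_indicator_of_inJoin (by rwa [ht.1])]) t
      rw [ht] at hacc
      refine Eq.trans ?_ hacc.symm
      split_ifs with hne
      · exact aggPlus_eq_some hfin rfl hne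
      · rw [← Option.not_isSome_iff_eq_none, aggPlus_isSome]
        exact fun h => hne h.2
    · rw [acc_eq_none _ _ _ _ _ ht]
      exact if_neg ht
  · intro t ht a ha
    obtain ⟨-, v, hv⟩ := aggPlus_isSome.1 ht
    have h1 := (indicator_isSome.1 (joinL_isSome.1 hv _ List.mem_cons_self)).mem_dom
      (Finset.mem_of_mem_erase ha)
    rwa [Function.update_of_ne (Finset.ne_of_mem_erase ha)] at h1

/-! ### Product aggregation of a single relation -/

def HasDom (I : Instance H K) (h : HS n m K) : Prop :=
  ∀ a : Fin n, h.w .dom a = (I.dom a).ncard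

omit [CommMonoidWithZero K] in
theorem HasDom.congr {h' : HS n m K} {D : Set (Key n)} (hD : HasDom I h) (hF : Frame D h h') :
    HasDom I h' := fun a => by rw [(hF .dom id).1]; exact hD a

/-- The groups are counted first, and only groups with as many values as the domain are multiplied
out. All values lie in the domain, so for a finite domain equal size means that the group is
complete. -/
def prodFactor (e : Fac n) (a : Fin n) (d d' : Key n) : Cmd ι :=
  .seq (groups (m := m) e.key d' (e.sch.erase a) a)
    (accum (m := m) e.key d (e.sch.erase a)
      [(degE d' (projE (e.sch.erase a) (.loc 1)), .get .dom (.lit a))]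
      (.get (.tab 0 e.key) (.loc 1)) .mul)

open Classical in
theorem prodFactor_tri (hf : Fit n m W M) (hp : HasPow M h) (hD : HasDom I h) {e : Fac n}
    {R : Rel n K} (he : e.Good I M Y h R) {a : Fin n} (ha : a ∈ e.sch) {d d' : Key n}
    (hd : d ≠ baseKey) (hd' : d' ≠ baseKey) (hdd : d' ≠ d) (hed : e.key ≠ d) (hed' : e.key ≠ d')
    (hu : Unused h d) (hu' : Unused h d') {X : ℕ} (hX : Y + 1 ≤ X) :
    Tri O W (prodFactor (m := m) e a d d') h X fun h' => Frame {d, d'} h h' ∧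
      (⟨d, e.sch.erase a⟩ : Fac n).Good I M Y h' (aggProd (I.dom a) a R) := by
  obtain ⟨l, hT, hlen⟩ := he.tab
  refine Tri.seq (groups_tri hf hp hed' hd' hT.toLst hu' _ a (by omega)) ?_
  rintro h1 ⟨F1, hE⟩
  have hp1 : HasPow M h1 := hp.congr F1 fun h => hd' h.symm
  have hT1 : Tab M h1 e.key l (onSch e.sch R) := hT.congr F1 hed'
  have hD1 := hD.congr F1
  have hgrp : ∀ t, group R a t ⊆ I.dom a := by
    intro t v hv
    have := he.dom _ hv a ha
    rwa [Function.update_self] at this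
  set S' := e.sch.erase a with hS'
  refine (accum_tri (O := O) hf hp1 hed hd hT1.toLst ((hu.congr F1 (by
    simpa using hdd.symm)).tab M) .mul (P := fun u => (fun g => (l.filter fun t =>
      proj S' t = g).length = (I.dom a).ncard) (proj S' u))
    (v := fun t => (R t).getD 1) ?_ ?_ (by omega)).mono le_rfl ?_
  · intro t ht h2 F2 h21
    have hbt := hT1.bd t ht
    have hp2 : HasPow M h2 := hp1.congr F2 fun h => hd h.symm
    have hE2 := hE.congr F2 (show d' ∉ ({d} : Set (Key n)) from hdd)
    have hloc1 : (Exp.loc 1 : Exp n m).Ok W h2 := ⟨by omega, by rw [h21]; exact hf.enc_lt hbt⟩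
    have hev := projE_eval (e := .loc 1) hp2 hbt h21 S'
    simp only [List.mem_singleton, forall_eq]
    refine ⟨⟨projE_ok (e := .loc 1) hf hp2 hbt h21 hloc1 _, ?_⟩, ?_⟩
    · exact hf.small (c := a) (by have := a.2; omega)
    · rw [degE, Exp.eval, hev, (hE2 _ (hbt.proj S')).1, Exp.eval, Exp.eval,
        (hD1.congr F2) a]
  · intro t ht _ h2 F2 h21
    have hbt := hT1.bd t ht
    refine ⟨⟨by omega, by rw [h21]; exact hf.enc_lt hbt⟩, ?_⟩
    have hs := (hT1.mem t).1 ht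
    obtain ⟨h3, h4⟩ := onSch_isSome.1 hs
    have := (hT1.congr F2 (show e.key ∉ ({d} : Set (Key n)) from hed)).val t ((R t).getD 1)
      (by rw [onSch_of_proj h3]; exact Option.eq_some_getD 1 h4)
    rw [← this, AExp.eval, Exp.eval, h21]
  · rintro h2 ⟨F2, l', hT2, hl'⟩
    refine ⟨(F1.mono (by simp)).trans (F2.mono (by simp)), he.dep.aggProd _ a,
      ⟨l', ?_, hl'.trans hlen⟩, ?_⟩
    · convert hT2 using 1
      ext1 t
      by_cases ht : proj S' t = t
      · rw [onSch_of_proj ht]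
        refine Eq.trans ?_ (acc_of_proj (Comb.mul.op O) S' (fun g => (l.filter fun t =>
          proj S' t = g).length = (I.dom a).ncard) (fun t => (R t).getD 1) l t).symm
        obtain ⟨hfin, hcard, hacc⟩ := acc_eq_fold (op := Comb.mul.op O) (e := 1)
          (hc := ⟨fun x y => mul_comm x y⟩) (ha := ⟨fun x y z => mul_assoc x y z⟩)
          (fun x => one_mul x) ha (l := l) (P := fun _ => True) (v := fun t => (R t).getD 1)
          hT.nodup (fun t ht => (onSch_isSome.1 ((hT.mem t).1 ht)).1) he.dep (fun t ht => by
            rw [hT.mem, onSch_isSome, ht]; simp)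
          (fun t ht _ => rfl) t
        rw [← hS', ht] at hacc hcard
        simp only [true_and] at hcard
        rw [hacc, hcard, ← Set.ncard_eq_toFinset_card _ hfin]
        by_cases hsub : I.dom a ⊆ group R a t
        · have heq := (hgrp t).antisymm hsub
          rw [if_pos (by rw [heq]), if_pos (by rw [heq]; exact I.dom_nonempty a),
            aggProd_eq_some hfin rfl hsub, Finset.prod_eq_fold]
          rfl
        · have hnone : aggProd (I.dom a) a R t = none := by
            rw [← Option.not_isSome_iff_eq_none, aggProd_isSome]
            exact fun h => hsub h.2
          rw [hnone]
          split_ifs with h3 h4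
          · exfalso
            -- An infinite domain is recorded as `0`, since `ncard` of an infinite set is `0`. A
            -- nonempty group never has this size, so the tuple is correctly dropped.
            rcases (I.dom a).finite_or_infinite with hfd | hfd
            · exact hsub (Set.eq_of_subset_of_ncard_le (hgrp t) h3.ge hfd).ge
            · rw [hfd.ncard, Set.ncard_eq_zero hfin] at h3
              rw [h3] at h4
              exact Set.not_nonempty_empty h4
          · rfl
          · rfl
      · rw [acc_eq_none _ _ _ _ _ ht]
        exact if_neg ht
    · intro t ht b hb
      obtain ⟨v, hv⟩ := I.dom_nonempty a
      have h3 := he.dom _ ((aggProd_isSome.1 ht).2 hv) b (Finset.mem_of_mem_erase hb)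
      rwa [Function.update_of_ne (Finset.ne_of_mem_erase hb)] at h3

end Factors

end Ajar

end

noncomputable section

namespace Ajar

/-! ### Elimination of the aggregated attributes, level by level. -/

section Elimination

variable {n m : ℕ} {ι K : Type*} {H : Hypergraph n m}

/-- The keys of the tables of level `ℓ` of the elimination. -/
def Lvl (ℓ : ℕ) : Set (Key n) := {d | 5 + 3 * ℓ ≤ d.1 ∧ d.1 < 8 + 3 * ℓ}

/-- Keys with first component below `5` belong to the powers, the input tables, the local joins and
the groups. Each elimination writes only to the three components of its own level, so everything
earlier stays intact. -/
def Above (ℓ : ℕ) : Set (Key n) := {d | 5 + 3 * ℓ ≤ d.1}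

theorem Lvl_subset_above (ℓ : ℕ) : (Lvl ℓ : Set (Key n)) ⊆ Above ℓ := fun _ h => h.1

theorem above_succ_subset (ℓ : ℕ) : (Above (ℓ + 1) : Set (Key n)) ⊆ Above ℓ := by
  intro d h
  have h' : 5 + 3 * (ℓ + 1) ≤ d.1 := h
  exact (by omega : 5 + 3 * ℓ ≤ d.1)

variable [CommMonoidWithZero K]

/-- The state between two eliminations: the relations of `V` are stored, and the local joins for
the remaining steps `s` are available. -/
structure ESt (I : Instance H K) (M Y ℓ : ℕ) (h : HS n m K) (V : List (Fac n × Rel n K))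
    (s : List (Fin n × Bool)) : Prop where
  pow : HasPow M h
  dom : HasDom I h
  fresh : ∀ d : Key n, 5 + 3 * ℓ ≤ d.1 → Unused h d
  good : ∀ p ∈ V, p.1.Good I M Y h p.2
  key : ∀ p ∈ V, p.1.key.1 < 5 + 3 * ℓ
  sch : ∀ p ∈ V, p.1.sch ⊆ (s.map Prod.fst).toFinset
  cover : ∀ b ∈ s.map Prod.fst, ∃ p ∈ V, b ∈ p.1.sch
  nodup : (s.map Prod.fst).Nodup
  filt : Filt I (s.map Prod.fst).toFinset (joinL (V.map Prod.snd))
  js : ∀ U ∈ needs s (V.map fun p => p.1.sch), JTab I M Y h U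

theorem toFinset_cons_erase {b : Fin n} {l : List (Fin n)} (h : (b :: l).Nodup) :
    (b :: l).toFinset.erase b = l.toFinset := by
  rw [List.toFinset_cons, Finset.erase_insert]
  rw [List.mem_toFinset]
  exact (List.nodup_cons.1 h).1

/-- The relations without the attribute `b`. -/
def indepOf (b : Fin n) (V : List (Fac n × Rel n K)) : List (Fac n × Rel n K) :=
  V.filter (b ∉ ·.1.sch)

/-- The relations with the attribute `b`. -/
def depOf (b : Fin n) (V : List (Fac n × Rel n K)) : List (Fac n × Rel n K) :=
  V.filter (b ∈ ·.1.sch)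

omit [CommMonoidWithZero K] in
theorem mem_indepOf {b : Fin n} {V : List (Fac n × Rel n K)} {p : Fac n × Rel n K} :
    p ∈ indepOf b V ↔ p ∈ V ∧ b ∉ p.1.sch := by simp [indepOf]

omit [CommMonoidWithZero K] in
theorem mem_depOf {b : Fin n} {V : List (Fac n × Rel n K)} {p : Fac n × Rel n K} :
    p ∈ depOf b V ↔ p ∈ V ∧ b ∈ p.1.sch := by simp [depOf]

omit [CommMonoidWithZero K] in
theorem perm_depOf_indepOf (b : Fin n) (V : List (Fac n × Rel n K)) :
    (V.map Prod.snd).Perm ((depOf b V).map Prod.snd ++ (indepOf b V).map Prod.snd) := by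
  rw [← List.map_append]
  refine List.Perm.map _ ?_
  have := List.filter_append_perm (fun p : Fac n × Rel n K => decide (b ∈ p.1.sch)) V
  refine (this.symm.trans ?_)
  simp [depOf, indepOf]

def unionSch (b : Fin n) (L : List (Fac n)) : Finset (Fin n) := unionOf b (L.map Fac.sch)

variable {W M Y X : ℕ} {I : Instance H K} {h h' : HS n m K} {O : PlusOps ι K}
  {V : List (Fac n × Rel n K)} {b : Fin n} {s : List (Fin n × Bool)} {ℓ : ℕ} {f : Bool}

theorem ESt.congr_good (hE : ESt I M Y ℓ h V s) (hF : Frame (Above ℓ) h h') :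
    ∀ p ∈ V, p.1.Good I M Y h' p.2 := fun p hp =>
  (hE.good p hp).congr hF fun hk => by
    have h1 := hE.key p hp
    have h2 : 5 + 3 * ℓ ≤ p.1.key.1 := hk
    omega

omit [CommMonoidWithZero K] in
theorem baseKey_notMem_above (ℓ : ℕ) : (baseKey : Key n) ∉ Above ℓ := fun h => by
  have : 5 + 3 * ℓ ≤ (baseKey : Key n).1 := h
  simp only [baseKey] at this
  omega

omit [CommMonoidWithZero K] in
theorem keyJ_notMem_above (U : Finset (Fin n)) (ℓ : ℕ) : keyJ U ∉ Above ℓ := fun h => by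
  have : 5 + 3 * ℓ ≤ (keyJ U).1 := h
  simp only [keyJ] at this
  omega

theorem ESt.mem_union (hE : ESt I M Y ℓ h V ((b, f) :: s)) :
    b ∈ unionOf b (V.map fun p => p.1.sch) := by
  obtain ⟨p, hp, hb⟩ := hE.cover b (by simp)
  exact mem_unionOf.2 ⟨_, List.mem_map_of_mem hp, hb, hb⟩

theorem ESt.union_subset (hE : ESt I M Y ℓ h V s) (b : Fin n) :
    unionOf b (V.map fun p => p.1.sch) ⊆ (s.map Prod.fst).toFinset := by
  intro a ha
  obtain ⟨S, hS, -, haS⟩ := mem_unionOf.1 ha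
  obtain ⟨p, hp, rfl⟩ := List.mem_map.1 hS
  exact hE.sch p hp haS

omit [CommMonoidWithZero K] in
theorem sch_subset_union {p : Fac n × Rel n K} (hp : p ∈ depOf b V) :
    p.1.sch ⊆ unionOf b (V.map fun p => p.1.sch) := fun _ ha =>
  mem_unionOf.2 ⟨_, List.mem_map_of_mem (mem_depOf.1 hp).1, (mem_depOf.1 hp).2, ha⟩

/-- The state after the relations that contain `b` have been replaced by one relation. -/
theorem ESt.next (hE : ESt I M Y ℓ h V ((b, false) :: s)) (hF : Frame (Lvl ℓ) h h') {e : Fac n}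
    (hek : e.key ∈ Lvl ℓ) (hes : e.sch = (unionOf b (V.map fun p => p.1.sch)).erase b)
    {R : Rel n K} (he : e.Good I M Y h' R)
    (hfilt : Filt I (s.map Prod.fst).toFinset (joinL ((indepOf b V ++ [(e, R)]).map Prod.snd))) :
    ESt I M Y (ℓ + 1) h' (indepOf b V ++ [(e, R)]) s where
  pow := hE.pow.congr hF fun h => baseKey_notMem_above ℓ h.1
  dom := hE.dom.congr hF
  fresh d hd := (hE.fresh d (by omega)).congr hF fun h => by have := h.2; omega
  good p hp := by
    rcases List.mem_append.1 hp with hp | hp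
    · exact hE.congr_good (hF.mono (Lvl_subset_above ℓ)) p (mem_indepOf.1 hp).1
    · rw [List.mem_singleton.1 hp]; exact he
  key p hp := by
    rcases List.mem_append.1 hp with hp | hp
    · have := hE.key p (mem_indepOf.1 hp).1
      omega
    · rw [List.mem_singleton.1 hp]
      have := hek.2
      simp only
      omega
  sch p hp := by
    have hnd : (b :: s.map Prod.fst).Nodup := hE.nodup
    rw [← toFinset_cons_erase hnd]
    rcases List.mem_append.1 hp with hp | hp
    · obtain ⟨hp, hb⟩ := mem_indepOf.1 hp
      exact fun a ha => Finset.mem_erase.2 ⟨fun h => hb (h ▸ ha), hE.sch p hp ha⟩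
    · rw [List.mem_singleton.1 hp, hes]
      exact Finset.erase_subset_erase _ (hE.union_subset b)
  cover a ha := by
    obtain ⟨p, hp, hpa⟩ := hE.cover a (by simp only [List.map_cons]; exact List.mem_cons_of_mem _ ha)
    have hab : a ≠ b := fun h => (List.nodup_cons.1 hE.nodup).1 (h ▸ ha)
    by_cases hb : b ∈ p.1.sch
    · refine ⟨(e, R), by simp, ?_⟩
      rw [hes]
      exact Finset.mem_erase.2 ⟨hab, sch_subset_union (mem_depOf.2 ⟨hp, hb⟩) hpa⟩
    · exact ⟨p, List.mem_append_left _ (mem_indepOf.2 ⟨hp, hb⟩), hpa⟩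
  nodup := (List.nodup_cons.1 hE.nodup).2
  filt := hfilt
  js U hU := by
    refine (hE.js U ?_).congr hF fun h => keyJ_notMem_above U ℓ h.1
    rw [needs]
    refine List.mem_cons_of_mem _ ?_
    rw [List.map_append, List.map_singleton, hes] at hU
    rwa [joinStep, List.filter_map]

theorem ESt.filt_erase (hE : ESt I M Y ℓ h V ((b, f) :: s)) {R' : Rel n K}
    (hR : ∀ t, (R' t).isSome → ∃ v, (joinL (V.map Prod.snd) (Function.update t b v)).isSome) :
    Filt I (s.map Prod.fst).toFinset R' := by
  have hnd : (b :: s.map Prod.fst).Nodup := hE.nodup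
  rw [← toFinset_cons_erase hnd]
  exact hE.filt.of_update hR

/-- Elimination of `b` by an additive operator. -/
def plusCmd (ℓ : ℕ) (b : Fin n) (i : ι) (L : List (Fac n)) : Cmd ι :=
  collect (m := m) (unionSch b L) (5 + 3 * ℓ, 0, ∅) ((unionSch b L).erase b) (.plus i)
    (L.filter (b ∈ ·.sch))

/-- Keys and schemas evolve independently of the data. Therefore the program of a whole plan can be
written down in advance. -/
def plusFac (ℓ : ℕ) (b : Fin n) (L : List (Fac n)) : List (Fac n) :=
  L.filter (b ∉ ·.sch) ++ [⟨(5 + 3 * ℓ, 0, ∅), (unionSch b L).erase b⟩]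

omit [CommMonoidWithZero K] in
theorem unionSch_map (b : Fin n) (V : List (Fac n × Rel n K)) :
    unionSch b (V.map Prod.fst) = unionOf b (V.map fun p => p.1.sch) := by
  rw [unionSch, List.map_map]
  rfl

omit [CommMonoidWithZero K] in
theorem filter_map_depOf (b : Fin n) (V : List (Fac n × Rel n K)) :
    (V.map Prod.fst).filter (b ∈ ·.sch) = (depOf b V).map Prod.fst := by
  rw [List.filter_map]
  rfl

omit [CommMonoidWithZero K] in
theorem filter_map_indepOf (b : Fin n) (V : List (Fac n × Rel n K)) :
    (V.map Prod.fst).filter (b ∉ ·.sch) = (indepOf b V).map Prod.fst := by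
  rw [List.filter_map]
  rfl

theorem ESt.indep (hE : ESt I M Y ℓ h V s) (b : Fin n) :
    ∀ R ∈ (indepOf b V).map Prod.snd, ∀ t v, R (Function.update t b v) = R t := by
  intro R hR t v
  obtain ⟨p, hp, rfl⟩ := List.mem_map.1 hR
  obtain ⟨hp, hb⟩ := mem_indepOf.1 hp
  exact (hE.good p hp).dep.update hb t v

theorem plusCmd_tri (hf : Fit n m W M) (hE : ESt I M Y ℓ h V ((b, false) :: s)) (i : ι)
    (hX : Y + 1 ≤ X) :
    Tri O W (plusCmd (m := m) ℓ b i (V.map Prod.fst)) h X fun h' => Frame (Above ℓ) h h' ∧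
      ∃ V', V'.map Prod.fst = plusFac ℓ b (V.map Prod.fst) ∧ ESt I M Y (ℓ + 1) h' V' s ∧
        joinL (V'.map Prod.snd) = aggPlus O i b (joinL (V.map Prod.snd)) := by
  set d : Key n := (5 + 3 * ℓ, 0, ∅) with hd
  have hdL : d ∈ Lvl ℓ := ⟨le_rfl, by simp only [hd]; omega⟩
  have hU := hE.mem_union
  rw [plusCmd, plusFac, filter_map_depOf, filter_map_indepOf, unionSch_map]
  set U := unionOf b (V.map fun p => p.1.sch) with hUdef
  refine (collect_plus_tri hf hE.pow (d := d) (fun h => baseKey_notMem_above ℓ (h ▸ hdL.1))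
    (fun h => keyJ_notMem_above U ℓ (h ▸ hdL.1)) (hE.fresh d le_rfl)
    (fun p hp => ⟨hE.good p (mem_depOf.1 hp).1, fun h => ?_⟩) (fun p hp => sch_subset_union hp)
    (hE.js U (by rw [needs]; exact List.mem_cons_self)) hU i hX).mono le_rfl ?_
  · have h1 := hE.key p (mem_depOf.1 hp).1
    rw [h] at h1
    simp only [hd] at h1
    omega
  rintro h' ⟨hF, hg⟩
  have hFL : Frame (Lvl ℓ) h h' := hF.mono (by simpa using hdL)
  have hjoin : joinL ((indepOf b V ++ [((⟨d, U.erase b⟩ : Fac n),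
      aggPlus O i b (joinL (indicator I U :: (depOf b V).map Prod.snd)))]).map Prod.snd) =
      aggPlus O i b (joinL (V.map Prod.snd)) := by
    rw [aggPlus_joinL hE.filt (hE.union_subset b) (perm_depOf_indepOf b V) O i (hE.indep b),
      List.map_append, List.map_singleton]
    exact joinL_perm (List.perm_append_singleton _ _)
  refine ⟨hFL.mono (Lvl_subset_above ℓ), _, ?_, hE.next hFL hdL rfl hg ?_, hjoin⟩
  · rw [List.map_append, List.map_singleton]
  · rw [hjoin]
    exact hE.filt_erase fun t ht => (aggPlus_isSome.1 ht).2

/-! ### Elimination by products -/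

/-- Elimination of `a` by the product, from each relation separately. -/
def prodCmd (ℓ : ℕ) (a : Fin n) : ℕ → List (Fac n) → Cmd ι
  | _, [] => .skip
  | i, e :: L => .seq (if a ∈ e.sch then
      prodFactor (m := m) e a (5 + 3 * ℓ, i, ∅) (6 + 3 * ℓ, i, ∅) else .skip) (prodCmd ℓ a (i + 1) L)

def prodFac (ℓ : ℕ) (a : Fin n) : ℕ → List (Fac n) → List (Fac n)
  | _, [] => []
  | i, e :: L => (if a ∈ e.sch then ⟨(5 + 3 * ℓ, i, ∅), e.sch.erase a⟩ else e) ::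
      prodFac ℓ a (i + 1) L

/-- The running index `i` enters the key, because one level creates a new table for each relation
that contains `a`. -/
def prodRel (I : Instance H K) (ℓ : ℕ) (a : Fin n) :
    ℕ → List (Fac n × Rel n K) → List (Fac n × Rel n K)
  | _, [] => []
  | i, p :: V => (if a ∈ p.1.sch then (⟨(5 + 3 * ℓ, i, ∅), p.1.sch.erase a⟩,
      aggProd (I.dom a) a p.2) else p) :: prodRel I ℓ a (i + 1) V

theorem map_fst_prodRel (a : Fin n) (i : ℕ) (V : List (Fac n × Rel n K)) :
    (prodRel I ℓ a i V).map Prod.fst = prodFac ℓ a i (V.map Prod.fst) := by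
  induction V generalizing i with
  | nil => rfl
  | cons p V ih =>
    simp only [prodRel, prodFac, List.map_cons, ih]
    split_ifs <;> rfl

theorem map_snd_prodRel (a : Fin n) (i : ℕ) (V : List (Fac n × Rel n K)) :
    (prodRel I ℓ a i V).map Prod.snd =
      V.map fun p => if a ∈ p.1.sch then aggProd (I.dom a) a p.2 else p.2 := by
  induction V generalizing i with
  | nil => rfl
  | cons p V ih =>
    simp only [prodRel, List.map_cons, ih]
    split_ifs <;> rfl

theorem map_sch_prodRel (a : Fin n) (i : ℕ) (V : List (Fac n × Rel n K)) :
    ((prodRel I ℓ a i V).map fun p => p.1.sch) =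
      (V.map fun p => p.1.sch).map fun S => S.erase a := by
  induction V generalizing i with
  | nil => rfl
  | cons p V ih =>
    simp only [prodRel, List.map_cons, ih]
    split_ifs with h
    · rfl
    · rw [Finset.erase_eq_of_notMem h]

theorem key_prodRel {a : Fin n} {i : ℕ} {V : List (Fac n × Rel n K)}
    (hV : ∀ p ∈ V, p.1.key.1 < 5 + 3 * ℓ) :
    ∀ p ∈ prodRel I ℓ a i V, p.1.key.1 < 5 + 3 * (ℓ + 1) := by
  induction V generalizing i with
  | nil => simp [prodRel]
  | cons p V ih =>
    rw [prodRel, List.forall_mem_cons]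
    refine ⟨?_, ih fun q hq => hV q (by simp [hq])⟩
    have := hV p (by simp)
    split_ifs
    · simp only; omega
    · omega

/-- The frame records that only tables with index at least `i` change; thus the results of earlier
positions survive the rest of the induction. -/
theorem prodCmd_tri (hf : Fit n m W M) {a : Fin n} (i : ℕ) (V : List (Fac n × Rel n K))
    {h : HS n m K} (hp : HasPow M h) (hD : HasDom I h) (hV : ∀ p ∈ V, p.1.Good I M Y h p.2)
    (hk : ∀ p ∈ V, p.1.key.1 < 5 + 3 * ℓ)
    (hu : ∀ i' ≥ i, Unused h (5 + 3 * ℓ, i', ∅) ∧ Unused h (6 + 3 * ℓ, i', ∅)) (hX : Y + 1 ≤ X) :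
    Tri O W (prodCmd (m := m) ℓ a i (V.map Prod.fst)) h X fun h' =>
      Frame {d | d ∈ Lvl ℓ ∧ i ≤ d.2.1} h h' ∧ ∀ p ∈ prodRel I ℓ a i V, p.1.Good I M Y h' p.2 := by
  induction V generalizing i h with
  | nil => exact Tri.skip ⟨.refl _ _, by simp [prodRel]⟩
  | cons p V ih =>
    rw [List.map_cons, prodCmd]
    have hkp := hk p (by simp)
    refine Tri.seq (Q := fun h1 => Frame {(5 + 3 * ℓ, i, ∅), (6 + 3 * ℓ, i, ∅)} h h1 ∧
      ((if a ∈ p.1.sch then ((⟨(5 + 3 * ℓ, i, ∅), p.1.sch.erase a⟩ : Fac n),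
        aggProd (I.dom a) a p.2) else p) : Fac n × Rel n K).1.Good I M Y h1
        ((if a ∈ p.1.sch then ((⟨(5 + 3 * ℓ, i, ∅), p.1.sch.erase a⟩ : Fac n),
        aggProd (I.dom a) a p.2) else p) : Fac n × Rel n K).2) ?_ ?_
    · split_ifs with ha
      · refine prodFactor_tri hf hp hD (hV p (by simp)) ha ?_ ?_ ?_ ?_ ?_ (hu i le_rfl).1
          (hu i le_rfl).2 hX
        · intro h; have := congrArg Prod.fst h; simp only [baseKey] at this; omega
        · intro h; have := congrArg Prod.fst h; simp only [baseKey] at this; omega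
        · intro h; have := congrArg Prod.fst h; simp only at this; omega
        · intro h; rw [h] at hkp; simp only at hkp; omega
        · intro h; rw [h] at hkp; simp only at hkp; omega
      · exact Tri.skip ⟨.refl _ _, hV p (by simp)⟩
    · rintro h1 ⟨F1, hg1⟩
      refine (ih (i + 1) (h := h1) (hp.congr F1 ?_) (hD.congr F1) ?_ ?_ ?_).mono le_rfl ?_
      · rintro (h | h)
        · have := congrArg Prod.fst h; simp only [baseKey] at this; omega
        · have := congrArg Prod.fst h; simp only [baseKey] at this; omega
      · intro q hq
        have hkq := hk q (by simp [hq])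
        refine (hV q (by simp [hq])).congr F1 ?_
        rintro (h | h)
        · rw [h] at hkq; simp only at hkq; omega
        · rw [h] at hkq; simp only at hkq; omega
      · exact fun q hq => hk q (by simp [hq])
      · intro i' hi'
        refine ⟨(hu i' (by omega)).1.congr F1 ?_, (hu i' (by omega)).2.congr F1 ?_⟩
        · rintro (h | h)
          · have := congrArg (fun d : Key n => d.2.1) h; simp only at this; omega
          · have := congrArg (fun d : Key n => d.2.1) h; simp only at this; omega
        · rintro (h | h)
          · have := congrArg (fun d : Key n => d.2.1) h; simp only at this; omega
          · have := congrArg (fun d : Key n => d.2.1) h; simp only at this; omega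
      · rintro h2 ⟨F2, hg2⟩
        refine ⟨(F1.mono ?_).trans (F2.mono ?_), ?_⟩
        · rintro d (rfl | rfl)
          · exact ⟨⟨le_rfl, by simp only; omega⟩, le_rfl⟩
          · exact ⟨⟨by simp only; omega, by simp only; omega⟩, le_rfl⟩
        · rintro d ⟨hd1, hd2⟩
          exact ⟨hd1, by omega⟩
        · rw [prodRel, List.forall_mem_cons]
          refine ⟨hg1.congr F2 ?_, hg2⟩
          rintro ⟨hd1, hd2⟩
          split_ifs at hd1 hd2 with ha
          · simp only at hd2; omega
          · have := hd1.1; omega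

theorem prodCmd_step (hf : Fit n m W M) (hE : ESt I M Y ℓ h V ((b, true) :: s))
    (hid : ∀ x : K, x * x = x) (hX : Y + 1 ≤ X) :
    Tri O W (prodCmd (m := m) ℓ b 0 (V.map Prod.fst)) h X fun h' => Frame (Above ℓ) h h' ∧
      ∃ V', V'.map Prod.fst = prodFac ℓ b 0 (V.map Prod.fst) ∧ ESt I M Y (ℓ + 1) h' V' s ∧
        joinL (V'.map Prod.snd) = aggProd (I.dom b) b (joinL (V.map Prod.snd)) := by
  refine (prodCmd_tri hf 0 V hE.pow hE.dom hE.good hE.key (fun i' _ =>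
    ⟨hE.fresh _ le_rfl, hE.fresh _ (by simp only; omega)⟩) hX).mono le_rfl ?_
  rintro h' ⟨hF, hg⟩
  have hFL : Frame (Lvl ℓ) h h' := hF.mono fun d hd => hd.1
  have hjoin : joinL ((prodRel I ℓ b 0 V).map Prod.snd) =
      aggProd (I.dom b) b (joinL (V.map Prod.snd)) := by
    rw [map_snd_prodRel]
    refine (aggProd_joinL (I.dom_nonempty b) hid V Prod.snd (fun p => b ∈ p.1.sch) ?_ ?_ ?_).symm
    · exact fun p hp hb t v => (hE.good p hp).dep.update hb t v
    · intro p hp hb t v hv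
      have := (hE.good p hp).dom _ hv b hb
      rwa [Function.update_self] at this
    · exact hE.cover b (by simp)
  have hnd : (b :: s.map Prod.fst).Nodup := hE.nodup
  have hmem : ∀ S : Finset (Fin n), (∃ p ∈ prodRel I ℓ b 0 V, p.1.sch = S) ↔
      ∃ p ∈ V, p.1.sch.erase b = S := by
    intro S
    have := congrArg (S ∈ ·) (map_sch_prodRel (I := I) (ℓ := ℓ) b 0 V)
    simpa [List.mem_map] using this
  refine ⟨hFL.mono (Lvl_subset_above ℓ), _, map_fst_prodRel b 0 V, ?_, hjoin⟩
  refine ⟨hE.pow.congr hFL fun h => baseKey_notMem_above ℓ h.1, hE.dom.congr hFL, ?_, hg,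
    key_prodRel hE.key, ?_, ?_, (List.nodup_cons.1 hE.nodup).2, ?_, ?_⟩
  · exact fun d hd => (hE.fresh d (by omega)).congr hFL fun h => by have := h.2; omega
  · intro p hp
    obtain ⟨q, hq, hqs⟩ := (hmem p.1.sch).1 ⟨p, hp, rfl⟩
    rw [← hqs, ← toFinset_cons_erase hnd]
    exact Finset.erase_subset_erase _ (hE.sch q hq)
  · intro a ha
    obtain ⟨q, hq, hqa⟩ := hE.cover a (by
      simp only [List.map_cons]; exact List.mem_cons_of_mem _ ha)
    have hab : a ≠ b := fun h => (List.nodup_cons.1 hE.nodup).1 (h ▸ ha)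
    obtain ⟨p, hp, hps⟩ := (hmem (q.1.sch.erase b)).2 ⟨q, hq, rfl⟩
    exact ⟨p, hp, by rw [hps]; exact Finset.mem_erase.2 ⟨hab, hqa⟩⟩
  · rw [hjoin]
    exact hE.filt_erase fun t ht => (I.dom_nonempty b).imp fun _ hv => (aggProd_isSome.1 ht).2 hv
  · intro U hU
    rw [map_sch_prodRel] at hU
    exact (hE.js U hU).congr hFL fun h => keyJ_notMem_above U ℓ h.1

/-! ### Elimination of the aggregated attributes -/

def aggCmd : ℕ → List (Fin n × Op ι) → List (Fac n) → Cmd ι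
  | _, [], _ => .skip
  | ℓ, (b, .plus i) :: s, L => .seq (plusCmd (m := m) ℓ b i L) (aggCmd (ℓ + 1) s (plusFac ℓ b L))
  | ℓ, (a, .prod) :: s, L => .seq (prodCmd (m := m) ℓ a 0 L) (aggCmd (ℓ + 1) s (prodFac ℓ a 0 L))

/-- The stored relations after the elimination of the aggregated attributes. -/
def aggFac : ℕ → List (Fin n × Op ι) → List (Fac n) → List (Fac n)
  | _, [], L => L
  | ℓ, (b, .plus _) :: s, L => aggFac (ℓ + 1) s (plusFac ℓ b L)
  | ℓ, (a, .prod) :: s, L => aggFac (ℓ + 1) s (prodFac ℓ a 0 L)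

theorem aggCmd_tri (hf : Fit n m W M) (s₁ : List (Fin n × Op ι))
    (hid : (∃ a, (a, Op.prod) ∈ s₁) → ∀ x : K, x * x = x) (hX : Y + 1 ≤ X)
    {ℓ : ℕ} {h : HS n m K} {V : List (Fac n × Rel n K)}
    (hE : ESt I M Y ℓ h V (s₁.map (fun x => (x.1, x.2.isProd)) ++ s)) :
    Tri O W (aggCmd (m := m) ℓ s₁ (V.map Prod.fst)) h X fun h' => Frame (Above ℓ) h h' ∧
      ∃ V', V'.map Prod.fst = aggFac ℓ s₁ (V.map Prod.fst) ∧
        ESt I M Y (ℓ + s₁.length) h' V' s ∧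
        joinL (V'.map Prod.snd) = s₁.foldl (fun R x => aggregate O I x R) (joinL (V.map Prod.snd)) := by
  induction s₁ generalizing ℓ h V with
  | nil => exact Tri.skip ⟨.refl _ _, V, rfl, hE, rfl⟩
  | cons x s₁ ih =>
    have ih' := fun {ℓ h V} => ih (fun ⟨a, ha⟩ => hid ⟨a, List.mem_cons_of_mem _ ha⟩)
      (ℓ := ℓ) (h := h) (V := V)
    obtain ⟨b, i | _⟩ := x
    · refine Tri.seq (plusCmd_tri hf hE i hX) ?_
      rintro h1 ⟨F1, V1, e1, hE1, j1⟩
      rw [← e1]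
      refine (ih' hE1).mono le_rfl ?_
      rintro h2 ⟨F2, V2, e2, hE2, j2⟩
      refine ⟨F1.trans (F2.mono (above_succ_subset ℓ)), V2, ?_, ?_, ?_⟩
      · rw [e2, e1]; rfl
      · rwa [List.length_cons, ← add_assoc, add_right_comm]
      · rw [j2, j1]; rfl
    · refine Tri.seq (prodCmd_step hf hE (hid ⟨b, by simp⟩) hX) ?_
      rintro h1 ⟨F1, V1, e1, hE1, j1⟩
      rw [← e1]
      refine (ih' hE1).mono le_rfl ?_
      rintro h2 ⟨F2, V2, e2, hE2, j2⟩
      refine ⟨F1.trans (F2.mono (above_succ_subset ℓ)), V2, ?_, ?_, ?_⟩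
      · rw [e2, e1]; rfl
      · rwa [List.length_cons, ← add_assoc, add_right_comm]
      · rw [j2, j1]; rfl

end Elimination

end Ajar

end

noncomputable section

namespace Ajar

/-! ### The join over the output attributes, in time proportional to its size and the tables used.
-/

section Output

variable {n m : ℕ} {ι K : Type*} {H : Hypergraph n m} [CommMonoidWithZero K]
  {W M Y X : ℕ} {I : Instance H K} {h h' : HS n m K} {O : PlusOps ι K}

open Classical in
/-- The projection of `R` that forgets the attribute `b`, with all annotations `1`. -/
def support (b : Fin n) (R : Rel n K) : Rel n K := fun t =>
  if ∃ v, (R (Function.update t b v)).isSome then some 1 else none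

theorem support_isSome {b : Fin n} {R : Rel n K} {t : Tup n} :
    (support b R t).isSome ↔ ∃ v, (R (Function.update t b v)).isSome := by
  rw [support]
  split_ifs with h
  · simpa using h
  · simpa using h

theorem support_getD {b : Fin n} {R : Rel n K} {t : Tup n} : (support b R t).getD 1 = 1 := by
  rw [support]
  split_ifs <;> rfl

open Classical in
theorem Dep.support {S : Finset (Fin n)} {R : Rel n K} (h : Dep S R) (b : Fin n) :
    Dep (S.erase b) (support b R) := by
  intro t
  exact if_congr (exists_congr fun v => by rw [h.update_proj]) rfl rfl

theorem support_tri (hf : Fit n m W M) (hp : HasPow M h) {e : Fac n} {R : Rel n K}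
    (he : e.Good I M Y h R) {b : Fin n} (hb : b ∈ e.sch) {d : Key n} (hd : d ≠ baseKey)
    (hed : e.key ≠ d) (hu : Unused h d) (hX : Y + 1 ≤ X) :
    Tri O W (accum (m := m) e.key d (e.sch.erase b) [] .one .keep) h X fun h' => Frame {d} h h' ∧
      (⟨d, e.sch.erase b⟩ : Fac n).Good I M Y h' (support b R) := by
  classical
  obtain ⟨l, hT, hlen⟩ := he.tab
  refine (accum_tri (O := O) hf hp hed hd hT.toLst (hu.tab M) (x := .one) .keep (P := fun _ => True)
    (v := fun _ => 1) (by simp) (fun _ _ _ _ _ _ => ⟨trivial, rfl⟩) (by omega)).mono le_rfl ?_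
  rintro h' ⟨hF, l', hT', hl'⟩
  refine ⟨hF, he.dep.support b, ⟨l', ?_, hl'.trans hlen⟩, ?_⟩
  · convert hT' using 1
    ext1 t
    rw [acc_keep O _ _ _ (fun _ => 1) l (fun _ _ _ => rfl)]
    simp only [onSch, support, ← ite_and]
    congr 1
    rw [eq_iff_iff]
    constructor
    · rintro ⟨h1, v, hv⟩
      refine ⟨Function.update t b v, (hT.mem _).2 ?_, trivial, ?_⟩
      · rw [onSch_isSome]
        refine ⟨?_, hv⟩
        rw [proj_update_of_mem hb]
        conv_lhs => rw [← h1]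
        rw [proj_proj, Finset.inter_eq_right.2 (Finset.erase_subset _ _), h1]
      · rw [proj_erase_update, h1]
    · rintro ⟨u, hu, -, rfl⟩
      obtain ⟨h1, h2⟩ := onSch_isSome.1 ((hT.mem u).1 hu)
      refine ⟨proj_proj_of_subset subset_rfl u, u b, ?_⟩
      rwa [update_proj_erase hb, h1]
  · intro t ht a ha
    obtain ⟨v, hv⟩ := support_isSome.1 ht
    have h3 := he.dom _ hv a (Finset.mem_of_mem_erase ha)
    rwa [Function.update_of_ne (Finset.ne_of_mem_erase ha)] at h3

/-- The table of the join over the output attributes that are left at level `ℓ`. -/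
def keyZ (ℓ : ℕ) : Key n := (6 + 3 * ℓ, 0, ∅)

/-- Computes the join of the relations with output attributes only: the attributes are
eliminated, and then the tuples are extended in the reverse order. -/
def outCmd : ℕ → List (Fin n) → List (Fac n) → Cmd ι
  | ℓ, [], L => collect (m := m) ∅ (keyZ ℓ) ∅ .keep L
  | ℓ, b :: γ, L =>
    .seq (collect (m := m) (unionSch b L) (5 + 3 * ℓ, 0, ∅) (unionSch b L) .keep
        (L.filter (b ∈ ·.sch)))
      (.seq (accum (m := m) (5 + 3 * ℓ, 0, ∅) (5 + 3 * ℓ, 1, ∅) ((unionSch b L).erase b) [] .one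
          .keep)
        (.seq (groups (m := m) (5 + 3 * ℓ, 0, ∅) (7 + 3 * ℓ, 0, ∅) ((unionSch b L).erase b) b)
          (.seq (outCmd (ℓ + 1) γ
              (L.filter (b ∉ ·.sch) ++ [⟨(5 + 3 * ℓ, 1, ∅), (unionSch b L).erase b⟩]))
            (extend (m := m) (keyZ (ℓ + 1)) (keyZ ℓ) b
              ⟨(7 + 3 * ℓ, 0, ∅), (unionSch b L).erase b⟩ [] []
              -- In the recursive call the relations with `b` are present only through their
              -- support, which has annotation `1`. Their true annotation is multiplied here and is
              -- therefore counted exactly once.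
              (.mul (.get (.tab 0 (keyZ (ℓ + 1))) (projE (Finset.univ.erase b) (.loc 9)))
                (.get (.tab 0 (5 + 3 * ℓ, 0, ∅)) (projE (unionSch b L) (.loc 9))))))))

-- A pair of a tuple `t` and a member `u` of its group can be recovered from the extended tuple: `t`
-- by projection, and `u` because it agrees with `t` outside `b`. So all extensions together are
-- distinct elements of `Z`.
omit [CommMonoidWithZero K] in
theorem sum_grp_le {b : Fin n} {U V : Finset (Fin n)} (hbU : b ∈ U) (hbV : b ∉ V)
    {l lF : List (Tup n)} (hl : l.Nodup) (hlF : lF.Nodup) (hlV : ∀ t ∈ l, proj V t = t)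
    (hlU : ∀ u ∈ lF, proj U u = u) {Z : Finset (Tup n)}
    (hZ : ∀ t ∈ l, ∀ u ∈ grp (U.erase b) lF t, Function.update t b (u b) ∈ Z) :
    (l.map fun t => (grp (U.erase b) lF t).length).sum ≤ Z.card := by
  classical
  rw [← List.sum_toFinset _ hl]
  calc ∑ t ∈ l.toFinset, (grp (U.erase b) lF t).length
      ≤ ∑ t ∈ l.toFinset, (Z.filter fun z => proj V z = t).card := by
        refine Finset.sum_le_sum fun t ht => ?_
        have htl := List.mem_toFinset.1 ht
        have hnd : (grp (U.erase b) lF t).Nodup := hlF.filter _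
        rw [← List.toFinset_card_of_nodup hnd]
        refine Finset.card_le_card_of_injOn (fun u => Function.update t b (u b)) ?_ ?_
        · intro u hu
          have hu := List.mem_toFinset.1 hu
          refine Finset.mem_coe.2 (Finset.mem_filter.2 ⟨hZ t htl u hu, ?_⟩)
          rw [proj_update_of_notMem hbV, hlV t htl]
        · intro u hu u' hu' he
          obtain ⟨h1, h2⟩ := List.mem_filter.1 (List.mem_toFinset.1 hu)
          obtain ⟨h1', h2'⟩ := List.mem_filter.1 (List.mem_toFinset.1 hu')
          simp only [decide_eq_true_eq] at h2 h2'
          have h3 := congrFun he b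
          simp only [Function.update_self] at h3
          rw [← hlU u h1, ← hlU u' h1', ← update_proj_erase hbU u, ← update_proj_erase hbU u', h2,
            h2', h3]
    _ = _ := Finset.sum_card_fiberwise_eq_card_filter _ _ _
    _ ≤ Z.card := Finset.card_le_card (Finset.filter_subset _ _)

/-- The support of the relations with `b` removes exactly the tuples that have no extension. By
induction the recursive result is the projection of `Z`, hence no longer than `Z`, and every value
in a group gives an element of `Z`. -/
theorem outCmd_tri (hf : Fit n m W M) (γ : List (Fin n)) (hX : 2 * Y + 1 ≤ X)
    {ℓ : ℕ} {h : HS n m K} {V : List (Fac n × Rel n K)}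
    (hE : ESt I M Y ℓ h V (γ.map fun a => (a, false))) (hJ : JTab I M Y h ∅)
    {Z : Finset (Tup n)}
    (hZ : ∀ t, t ∈ Z ↔ proj γ.toFinset t = t ∧ (joinL (V.map Prod.snd) t).isSome)
    (hZY : Z.card ≤ Y) :
    Tri O W (outCmd (m := m) ℓ γ (V.map Prod.fst)) h X fun h' => Frame (Above ℓ) h h' ∧
      ∃ l, Tab M h' (keyZ ℓ) l (onSch γ.toFinset (joinL (V.map Prod.snd))) := by
  classical
  have hfst : ∀ γ : List (Fin n), ((γ.map fun a => (a, false)).map Prod.fst) = γ := fun γ => by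
    rw [List.map_map]; exact List.map_id γ
  induction γ generalizing ℓ h V Z with
  | nil =>
    have hkZ : (keyZ ℓ : Key n) ∈ Above ℓ := by
      show 5 + 3 * ℓ ≤ 6 + 3 * ℓ
      omega
    refine (collect_keep_tri hf hE.pow (U := ∅) (fun h => baseKey_notMem_above ℓ (h ▸ hkZ))
      (fun h => keyJ_notMem_above ∅ ℓ (h ▸ hkZ)) (hE.fresh _ hkZ) (fun p hp => ⟨hE.good p hp,
      fun h => ?_⟩) (fun p hp => hE.sch p hp) hJ (by omega)).mono le_rfl ?_
    · have h1 := hE.key p hp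
      rw [h] at h1
      exact absurd hkZ (not_le.2 h1)
    · rintro h' ⟨hF, hg⟩
      obtain ⟨l, hT, -⟩ := hg.tab
      refine ⟨hF.mono (by simpa using hkZ), l, ?_⟩
      rwa [joinL_indicator hE.filt (Finset.empty_subset _)] at hT
  | cons b γ ih =>
    have hE' : ESt I M Y ℓ h V ((b, false) :: γ.map fun a => (a, false)) := hE
    rw [outCmd, filter_map_depOf, filter_map_indepOf, unionSch_map]
    have hbU := hE'.mem_union
    have hUsub := hE'.union_subset b
    set U := unionOf b (V.map fun p => p.1.sch) with hU
    set kF : Key n := (5 + 3 * ℓ, 0, ∅) with hkF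
    set kM : Key n := (5 + 3 * ℓ, 1, ∅) with hkM
    set kG : Key n := (7 + 3 * ℓ, 0, ∅) with hkG
    have lF : kF ∈ Lvl ℓ := ⟨le_rfl, by simp only [hkF]; omega⟩
    have lM : kM ∈ Lvl ℓ := ⟨le_rfl, by simp only [hkM]; omega⟩
    have lG : kG ∈ Lvl ℓ := ⟨by simp only [hkG]; omega, by simp only [hkG]; omega⟩
    have lZ : (keyZ ℓ : Key n) ∈ Lvl ℓ := ⟨by simp only [keyZ]; omega, by simp only [keyZ]; omega⟩
    have nFM : kF ≠ kM := by simp [hkF, hkM]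
    have nFG : kF ≠ kG := by simp [hkF, hkG]
    have nMG : kM ≠ kG := by simp [hkM, hkG]
    have nFZ : kF ≠ keyZ ℓ := by simp [hkF, keyZ]
    have nMZ : kM ≠ keyZ ℓ := by simp [hkM, keyZ]
    have nGZ : kG ≠ keyZ ℓ := by simp [hkG, keyZ]
    have nbase : ∀ d ∈ (Lvl ℓ : Set (Key n)), d ≠ baseKey :=
      fun d hd h => baseKey_notMem_above ℓ (h ▸ hd.1)
    have hnd : (b :: γ).Nodup := by
      have := hE.nodup
      rwa [hfst] at this
    have hbγ : b ∉ γ.toFinset := by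
      rw [List.mem_toFinset]; exact (List.nodup_cons.1 hnd).1
    have hUγ : U.erase b ⊆ γ.toFinset := by
      rw [← toFinset_cons_erase hnd]
      refine Finset.erase_subset_erase _ ?_
      rwa [List.map_cons, hfst] at hUsub
    set RF := joinL (indicator I U :: (depOf b V).map Prod.snd) with hRF
    set RE := joinL ((indepOf b V).map Prod.snd) with hRE
    have hRall : joinL (V.map Prod.snd) = joinL [RF, RE] := by
      rw [← joinL_indicator hE'.filt hUsub,
        joinL_perm ((perm_depOf_indepOf b V).cons (indicator I U)), ← List.cons_append,
        joinL_append]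
    have hREind : ∀ t v, RE (Function.update t b v) = RE t := by
      intro t v
      refine Option.eq_of_getD 1 ?_ fun h1 h2 => ?_
      · simp only [hRE, joinL_isSome]
        exact forall₂_congr fun R hR => by rw [hE'.indep b R hR]
      · rw [hRE, joinL_getD (joinL_isSome.1 h1), joinL_getD (joinL_isSome.1 h2)]
        exact congrArg List.prod (List.map_congr_left fun R hR => by rw [hE'.indep b R hR])
    have hall_some : ∀ t, (joinL (V.map Prod.snd) t).isSome ↔ (RF t).isSome ∧ (RE t).isSome := by
      intro t
      rw [hRall, joinL_isSome]
      simp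
    refine Tri.seq (collect_keep_tri hf hE.pow (nbase _ lF)
      (fun h => keyJ_notMem_above U ℓ (h ▸ lF.1)) (hE.fresh _ lF.1)
      (fun p hp => ⟨hE.good p (mem_depOf.1 hp).1, fun h => ?_⟩) (fun p hp => sch_subset_union hp)
      (hE'.js U (by rw [needs]; exact List.mem_cons_self)) (by omega)) ?_
    · have h1 := hE.key p (mem_depOf.1 hp).1
      rw [h] at h1
      exact absurd lF.1 (not_le.2 h1)
    rintro h1 ⟨F1, g1⟩
    have p1 : HasPow M h1 := hE.pow.congr F1 fun h => nbase _ lF h.symm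
    refine Tri.seq (support_tri hf p1 g1 hbU (nbase _ lM) nFM ((hE.fresh _ lM.1).congr F1 nFM.symm)
      (by omega)) ?_
    rintro h2 ⟨F2, g2⟩
    have p2 : HasPow M h2 := p1.congr F2 fun h => nbase _ lM h.symm
    obtain ⟨listF, TF, lenF⟩ := (g1.congr F2 nFM).tab
    refine Tri.seq (groups_tri hf p2 nFG (nbase _ lG) TF.toLst
      (((hE.fresh _ lG.1).congr F1 nFG.symm).congr F2 nMG.symm) _ b (by omega)) ?_
    rintro h3 ⟨F3, hExt⟩
    have F13 : Frame (Lvl ℓ) h h3 := ((F1.mono (by simpa using lF)).trans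
      (F2.mono (by simpa using lM))).trans (F3.mono (by simpa using lG))
    have hnext_some : ∀ t, (joinL ((indepOf b V ++
        [((⟨kM, U.erase b⟩ : Fac n), support b RF)]).map Prod.snd) t).isSome ↔
        (RE t).isSome ∧ ∃ v, (RF (Function.update t b v)).isSome := by
      intro t
      rw [List.map_append, joinL_append, List.map_singleton, joinL_isSome]
      simp only [List.mem_cons, List.not_mem_nil, or_false, forall_eq_or_imp, forall_eq,
        joinL_isSome, support_isSome]
      rw [hRE, joinL_isSome]
    have hE3 := hE'.next F13 lM rfl (g2.congr F3 nMG) (hE'.filt_erase fun t ht => by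
      obtain ⟨h1, v, hv⟩ := (hnext_some t).1 ht
      exact ⟨v, (hall_some _).2 ⟨hv, by rwa [hREind]⟩⟩)
    set V' := indepOf b V ++ [((⟨kM, U.erase b⟩ : Fac n), support b RF)] with hV'
    have hV'fst : (indepOf b V).map Prod.fst ++ [⟨kM, U.erase b⟩] = V'.map Prod.fst := by
      rw [hV', List.map_append, List.map_singleton]
    have hself : ∀ t, proj (b :: γ).toFinset t = t →
        Function.update (proj γ.toFinset t) b (t b) = t := by
      intro t ht
      have := update_proj_erase (S := (b :: γ).toFinset) (c := b) (by simp) t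
      rwa [toFinset_cons_erase hnd, ht] at this
    have hself' : ∀ t v, proj γ.toFinset t = t →
        proj (b :: γ).toFinset (Function.update t b v) = Function.update t b v := by
      intro t v ht
      rw [proj_eq_self_iff] at ht ⊢
      intro a ha
      simp only [List.toFinset_cons, Finset.mem_insert, not_or] at ha
      rw [Function.update_of_ne ha.1]
      exact ht a ha.2
    have hZ' : ∀ t, t ∈ Z.image (proj γ.toFinset) ↔
        proj γ.toFinset t = t ∧ (joinL (V'.map Prod.snd) t).isSome := by
      intro t
      rw [Finset.mem_image, hnext_some]
      constructor
      · rintro ⟨z, hz, rfl⟩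
        obtain ⟨hz1, hz2⟩ := (hZ z).1 hz
        obtain ⟨hz3, hz4⟩ := (hall_some z).1 hz2
        have := hself z hz1
        refine ⟨proj_proj_of_subset subset_rfl z, ?_, z b, by rwa [this]⟩
        rw [← hREind _ (z b), this]
        exact hz4
      · rintro ⟨h1, h2, v, hv⟩
        refine ⟨Function.update t b v, (hZ _).2 ⟨hself' t v h1, (hall_some _).2 ⟨hv, ?_⟩⟩, ?_⟩
        · rwa [hREind]
        · rw [proj_update_of_notMem hbγ, h1]
    rw [hV'fst]
    refine Tri.seq (ih hE3 (hJ.congr F13 fun h => keyJ_notMem_above _ ℓ h.1) hZ'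
      (Finset.card_image_le.trans hZY)) ?_
    rintro h4 ⟨F4, lZ', TZ'⟩
    have nAb : ∀ d ∈ (Lvl ℓ : Set (Key n)), d ∉ (Above (ℓ + 1) : Set (Key n)) := by
      intro d hd h
      have h1 := hd.2
      have h2 : 5 + 3 * (ℓ + 1) ≤ d.1 := h
      omega
    have p4 : HasPow M h4 := hE3.pow.congr F4 (baseKey_notMem_above _)
    have TF4 : Tab M h4 kF listF (onSch U RF) := (TF.congr F3 nFG).congr F4 (nAb _ lF)
    have hExt4 : Ext M h4 kG (U.erase b) b listF := hExt.congr F4 (nAb _ lG)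
    have hlZ' : ∀ t ∈ lZ', proj γ.toFinset t = t := fun t ht => (onSch_isSome.1 ((TZ'.mem t).1 ht)).1
    have hlF : ∀ u ∈ listF, proj U u = u := fun u hu => (onSch_isSome.1 ((TF4.mem u).1 hu)).1
    have hdepF : Dep U RF := g1.dep
    have hext : ∀ t' : Tup n, (∃ t ∈ lZ', ∃ u ∈ grp (U.erase b) listF t,
        t' = Function.update t b (u b)) ↔ t' ∈ Z := by
      intro t'
      rw [hZ, hall_some]
      constructor
      · rintro ⟨t, ht, u, hu, rfl⟩
        obtain ⟨hu1, hu2⟩ := List.mem_filter.1 hu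
        simp only [decide_eq_true_eq] at hu2
        refine ⟨hself' t _ (hlZ' t ht), ?_, ?_⟩
        · have : RF (Function.update t b (u b)) = RF u := by
            rw [← hdepF.update_proj, ← hu2, update_proj_erase hbU, hdepF]
          rw [this]
          exact (onSch_isSome.1 ((TF4.mem u).1 hu1)).2
        · rw [hREind]
          exact ((hnext_some t).1 (onSch_isSome.1 ((TZ'.mem t).1 ht)).2).1
      · rintro ⟨h1, h2, h3⟩
        refine ⟨proj γ.toFinset t', (TZ'.mem _).2 (onSch_isSome.2
          ((hZ' _).1 (Finset.mem_image_of_mem _ ((hZ _).2 ⟨h1, (hall_some _).2 ⟨h2, h3⟩⟩)))),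
          proj U t', ?_, ?_⟩
        · refine List.mem_filter.2 ⟨(TF4.mem _).2 ?_, ?_⟩
          · rw [onSch_proj hdepF]; exact h2
          · simp only [decide_eq_true_eq]
            rw [proj_proj_of_subset (Finset.erase_subset _ _), proj_proj_of_subset hUγ]
        · rw [proj_apply_of_mem hbU, hself t' h1]
    refine (extend_tri (O := O) hf p4 (d₀ := keyZ (ℓ + 1)) (d := keyZ ℓ) (by simp [keyZ])
      (nbase _ lZ) TZ'.toLst ?_ (c := b) ?_ (fun _ => listF) ?_ (P := fun _ => True)
      (v := fun t => h4.k (.tab 0 (keyZ (ℓ + 1))) (enc M (proj (Finset.univ.erase b) t)) *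
        h4.k (.tab 0 kF) (enc M (proj U t))) (by simp) ?_
      (fun t t' => ∃ u ∈ grp (U.erase b) listF t, t' = Function.update t b (u b)) ?_
      (fun t => (grp (U.erase b) listF t).length) ?_ ?_).mono le_rfl ?_
    · exact ((((hE.fresh _ lZ.1).congr F1 nFZ.symm).congr F2 nMZ.symm).congr F3 nGZ.symm).congr F4
        (nAb _ lZ) |>.tab M
    · intro t ht
      exact proj_eq_self_iff.1 (hlZ' t ht) b hbγ
    · intro i hi
      rw [List.mem_singleton.1 hi]
      exact ⟨nGZ, hExt4, TF4.bd, TF4.nodup⟩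
    · intro t ht _ h5 F5 h59
      have p5 : HasPow M h5 := p4.congr F5 fun h => nbase _ lZ h.symm
      have hloc : (Exp.loc 9 : Exp n m).Ok W h5 := ⟨by omega, by rw [h59]; exact hf.enc_lt ht⟩
      refine ⟨⟨projE_ok (e := .loc 9) hf p5 ht h59 hloc _,
        projE_ok (e := .loc 9) hf p5 ht h59 hloc _⟩, ?_⟩
      simp only [AExp.eval, projE_eval (e := .loc 9) p5 ht h59]
      rw [F5.k (by simp [keyZ]), F5.k (by simpa using nFZ)]
    · intro t ht i hi t'
      rw [List.mem_singleton.1 hi]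
      simp
    · intro t ht i hi _
      rw [List.mem_singleton.1 hi]
    · have h5 : (lZ'.map fun t => (grp (U.erase b) listF t).length).sum ≤ Z.card :=
        sum_grp_le hbU hbγ TZ'.nodup TF4.nodup hlZ' hlF
          fun t ht u hu => (hext _).1 ⟨t, ht, u, hu, rfl⟩
      have h6 : lZ'.length ≤ (Z.image (proj γ.toFinset)).card := by
        rw [← List.toFinset_card_of_nodup TZ'.nodup]
        refine Finset.card_le_card fun t ht => (hZ' t).2 ?_
        exact onSch_isSome.1 ((TZ'.mem t).1 (List.mem_toFinset.1 ht))
      have h7 := (Finset.card_image_le (s := Z) (f := proj γ.toFinset)).trans hZY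
      omega
    · rintro h5 ⟨F5, l, T, -⟩
      refine ⟨((F13.mono (Lvl_subset_above ℓ)).trans (F4.mono (above_succ_subset ℓ))).trans
        (F5.mono (Set.singleton_subset_iff.2 lZ.1)), l, ?_⟩
      convert T using 1
      ext1 t'
      simp only [onSch, onSet, Set.mem_ofPred_eq]
      by_cases ht' : t' ∈ Z
      · obtain ⟨q1, q2⟩ := (hZ t').1 ht'
        rw [if_pos q1, if_pos ((hext t').2 ht')]
        obtain ⟨q3, q4⟩ := (hall_some t').1 q2
        obtain ⟨t, ht, u, hu, htu⟩ := (hext t').2 ht'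
        have hs := onSch_isSome.1 ((TZ'.mem t).1 ht)
        have e1 : proj (Finset.univ.erase b) t' = t := by
          rw [htu, proj_erase_update, proj_eq_self_iff]
          intro a ha
          have : a = b := by simpa using ha
          rw [this]
          exact proj_eq_self_iff.1 (hlZ' t ht) b hbγ
        have e2 := TZ'.val t _ (by
          rw [onSch_of_proj hs.1]; exact Option.eq_some_getD 1 hs.2)
        have e3 := TF4.val (proj U t') ((RF t').getD 1) (by
          rw [onSch_proj hdepF]; exact Option.eq_some_getD 1 q3)
        rw [e1, e2, e3, Option.eq_some_getD 1 q2, Option.some.injEq, hRall]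
        rw [joinL_getD (by simpa using ⟨q3, q4⟩), hV', List.map_append, joinL_append,
          List.map_singleton]
        have q5 := (hnext_some t).1 hs.2
        rw [joinL_getD (by simpa [joinL_isSome, support_isSome, hRE] using q5)]
        have e4 : RE t' = RE t := by rw [htu, hREind]
        have e5 : (joinL [support b RF] t).getD 1 = 1 := by
          rw [joinL_getD (by simpa [support_isSome] using q5.2)]
          simp [support_getD]
        simp only [List.map_cons, List.map_nil, List.prod_cons, List.prod_nil, mul_one, e4, e5]
        rw [mul_comm]
      · rw [if_neg (fun hh => ht' ((hext t').1 hh))]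
        split_ifs with q1
        · rw [← Option.not_isSome_iff_eq_none]
          exact fun q2 => ht' ((hZ t').2 ⟨q1, q2⟩)
        · rfl

end Output

end Ajar

end

noncomputable section

namespace Ajar

/-! ### Conversion of the input into tables of relations, projections and groups. -/

section Conversion

variable {n m : ℕ} {ι K : Type*} {H : Hypergraph n m} [CommMonoidWithZero K]
  {W M B X : ℕ} {I : Instance H K} {row : ∀ j, Fin (I.card j) ≃ I.Rows j} {O : PlusOps ι K}

/-! ### Sequences of programs -/

def seqL {A : Type*} (l : List A) (f : A → Cmd ι) : Cmd ι := l.foldr (fun x c => .seq (f x) c) .skip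

theorem Tri.seqL {A : Type*} {l : List A} {f : A → Cmd ι} (Inv : List A → HS n m K → Prop)
    {h : HS n m K} (h0 : Inv [] h)
    (step : ∀ pre x post, l = pre ++ x :: post → ∀ h', Inv pre h' →
      Tri O W (f x) h' X (Inv (pre ++ [x]))) : Tri O W (seqL l f) h X (Inv l) := by
  have key : ∀ post pre h, l = pre ++ post → Inv pre h → Tri O W (Ajar.seqL post f) h X (Inv l) := by
    intro post
    induction post with
    | nil =>
      intro pre h hl hi
      rw [List.append_nil] at hl
      exact Tri.skip (hl ▸ hi)
    | cons x post ih =>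
      intro pre h hl hi
      exact Tri.seq (step pre x post hl h hi) fun h' hi' =>
        ih (pre ++ [x]) h' (by rw [hl, List.append_assoc]; rfl) hi'
  exact key l [] h rfl h0

/-- Programs that each fill a table of their own. -/
theorem Tri.seqL_tables {A : Type*} {l : List A} (hl : l.Nodup) {f : A → Cmd ι} (key : A → Key n)
    (hkey : Function.Injective key) (Base : HS n m K → Prop) (Post : A → HS n m K → Prop)
    (hB : ∀ x h h', Frame {key x} h h' → Base h → Base h')
    (hP : ∀ x y h h', x ≠ y → Frame {key y} h h' → Post x h → Post x h')
    (step : ∀ x h, Base h → Unused h (key x) →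
      Tri O W (f x) h X fun h' => Frame {key x} h h' ∧ Post x h')
    {h : HS n m K} (hh : Base h) (hu : ∀ x, Unused h (key x)) :
    Tri O W (Ajar.seqL l f) h X fun h' => Frame (Set.range key) h h' ∧ Base h' ∧
      ∀ x ∈ l, Post x h' := by
  refine Tri.mono (Tri.seqL (fun pre h' => Frame (key '' {x | x ∈ pre}) h h' ∧ Base h' ∧
    ∀ x ∈ pre, Post x h') ⟨.refl _ _, hh, by simp⟩ ?_) le_rfl
    fun h' ⟨h1, h2⟩ => ⟨h1.mono (Set.image_subset_range _ _), h2⟩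
  rintro pre x post hpre h' ⟨F, hb, hp⟩
  have hx : x ∉ pre := by
    rw [hpre] at hl
    exact fun hx => (List.nodup_append.1 hl).2.2 x hx x (by simp) rfl
  refine (step x h' hb ((hu x).congr F ?_)).mono le_rfl ?_
  · rintro ⟨y, hy, hyx⟩
    exact hx (hkey hyx ▸ hy)
  · rintro h'' ⟨F', hx'⟩
    refine ⟨(F.mono ?_).trans (F'.mono ?_), hB x _ _ F' hb, ?_⟩
    · exact Set.image_mono fun y (hy : y ∈ pre) => List.mem_append_left _ hy
    · exact Set.singleton_subset_iff.2 ⟨x, by simp, rfl⟩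
    · intro y hy
      rcases List.mem_append.1 hy with hy | hy
      · exact hP y x _ _ (fun h => hx (h ▸ hy)) F' (hp y hy)
      · rw [List.mem_singleton.1 hy]; exact hx'

/-! ### The largest value -/

/-- The input arrays hold the instance. -/
structure Raw (I : Instance H K) (row : ∀ j, Fin (I.card j) ≃ I.Rows j) (h : HS n m K) : Prop where
  col : ∀ j a i (hi : i < I.card j), h.w (.col j a) i = rowTup I (row j ⟨i, hi⟩) a
  card : ∀ j : Fin m, h.w .card j = I.card j
  dom : HasDom I h
  ann : ∀ j i (hi : i < I.card j), h.k (.inp j) i = (I.rel j (row j ⟨i, hi⟩).1).getD 0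

theorem Raw.congr {h h' : HS n m K} (hr : Raw I row h) {D : Set (Key n)} (hF : Frame D h h') :
    Raw I row h' :=
  ⟨fun j a => by rw [(hF (.col j a) id).1]; exact hr.col j a,
    fun j => by rw [(hF .card id).1]; exact hr.card j, hr.dom.congr hF,
    fun j => by rw [(hF (.inp j) id).2]; exact hr.ann j⟩

/-- Raises cell `1` of the table of powers above the values of attribute `a` in relation `j`. -/
def maxCmd (j : Fin m) (a : Fin n) : Cmd ι :=
  forI (n := n) (m := m) 0 (.get .card (.lit j))
    -- Blocks can test equations only; truncated subtraction yields `0` exactly if the value plus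
    -- one does not exceed the current bound.
    (Blk.ifEq (.sub (.add (.get (.col j a) (.loc 0)) (.lit 1)) (pw 1)) (.lit 0) .skip
      (.set (.tab 1 baseKey) (.lit 1) (.add (.get (.col j a) (.loc 0)) (.lit 1))) : Blk n m ι).code

theorem maxCmd_tri (hB : n + m + B + 8 < W) (hIB : I.FitsIn B) {h : HS n m K} (hr : Raw I row h)
    (j : Fin m) (a : Fin n) {v : ℕ} (hv : h.w (.tab 1 baseKey) 1 = v) (hvB : v ≤ B + 1)
    (hX : I.inSize + 1 ≤ X) :
    Tri O W (maxCmd (n := n) (m := m) j a) h X fun h' => Frame {baseKey} h h' ∧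
      ∃ v', h'.w (.tab 1 baseKey) 1 = v' ∧ v ≤ v' ∧ v' ≤ B + 1 ∧
        ∀ i (hi : i < I.card j), rowTup I (row j ⟨i, hi⟩) a < v' := by
  have hcard : I.card j ≤ I.inSize := Instance.card_le_inSize I j
  have hIN := hIB.1
  refine Tri.mono (Tri.forI (fun k h' => Frame {baseKey} h h' ∧
      ∃ v', h'.w (.tab 1 baseKey) 1 = v' ∧ v ≤ v' ∧ v' ≤ B + 1 ∧
        ∀ i (hi : i < I.card j), i < k → rowTup I (row j ⟨i, hi⟩) a < v')
    (fun _ => 1) (by omega) (N := I.card j) (by omega) (by omega)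
    ⟨.refl _ _, v, hv, le_rfl, hvB, by omega⟩ ?_ ?_ (by simpa using by omega : _ ≤ X)) le_rfl ?_
  · rintro i - h' ⟨F, -⟩
    have hj := j.2
    exact ⟨show (j : ℕ) < W by omega, (hr.congr F).card j⟩
  · rintro k hk h' ⟨F, v', e1, e2, e3, e4⟩ h0
    refine ⟨le_rfl, ?_⟩
    have hcol := (hr.congr F).col j a k hk
    have hle : rowTup I (row j ⟨k, hk⟩) a ≤ B := by
      rw [rowTup]
      split_ifs with ha
      · exact hIB.2.2 j _ (row j ⟨k, hk⟩).2 ⟨a, ha⟩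
      · omega
    set u := rowTup I (row j ⟨k, hk⟩) a with hu
    have ev : (Exp.add (.get (.col j a) (.loc 0)) (.lit 1) : Exp n m).eval h' = u + 1 := by
      simp [Exp.eval, h0, hcol]
    have ep : (pw 1 : Exp n m).eval h' = v' := e1
    have okv : (Exp.add (.get (.col j a) (.loc 0)) (.lit 1) : Exp n m).Ok W h' := by
      refine ⟨⟨by omega, by omega⟩, show 1 < W by omega, ?_⟩
      have := ev
      rw [Exp.eval] at this
      omega
    refine Blk.tri ⟨⟨okv, show 1 < W by omega, by rw [ev]; omega⟩, show 0 < W by omega,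
      fun _ => trivial, fun _ => ⟨show 1 < W by omega, okv⟩⟩ ?_ le_rfl
    have es : (Exp.sub (.add (.get (.col j a) (.loc 0)) (.lit 1)) (pw 1) : Exp n m).eval h' =
        u + 1 - v' := by rw [Exp.eval, ev, ep]
    rw [Blk.run, es]
    have hz : (Exp.lit 0 : Exp n m).eval h' = 0 := rfl
    by_cases hc : u + 1 - v' = (Exp.lit 0 : Exp n m).eval h'
    · rw [if_pos hc]
      rw [hz] at hc
      refine ⟨h0, F, v', e1, e2, e3, fun i hi hik => ?_⟩
      rcases Nat.lt_succ_iff_lt_or_eq.1 hik with hik | rfl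
      · exact e4 i hi hik
      · rw [← hu]; omega
    · rw [if_neg hc, Blk.run, ev]
      rw [hz] at hc
      refine ⟨h0, (F.setW (Set.mem_singleton _) _ _ _).setLoc _ _, u + 1, by simp [Exp.eval],
        by omega, by omega, fun i hi hik => ?_⟩
      rcases Nat.lt_succ_iff_lt_or_eq.1 hik with hik | rfl
      · have := e4 i hi hik; omega
      · rw [← hu]; omega
  · rintro h' ⟨F, v', e1, e2, e3, e4⟩
    exact ⟨F, v', e1, e2, e3, fun i hi => e4 i hi hi⟩

/-- Computes the powers of the number in cell `1`. -/
def powCmd : ℕ → Cmd ι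
  | 0 => (Blk.set (.tab 1 baseKey) (.lit 0) (.lit 1) : Blk n m ι).code
  | k + 1 => .seq (powCmd k)
      (Blk.set (.tab 1 baseKey) (.lit (k + 2)) (.mul (pw (k + 1)) (pw 1)) : Blk n m ι).code

theorem powCmd_tri (hf : Fit n m W M) {h : HS n m K} (h1 : h.w (.tab 1 baseKey) 1 = M) (k : ℕ)
    (hk : k ≤ n) (hX : 1 ≤ X) :
    Tri O W (powCmd (n := n) (m := m) k) h X fun h' => Frame {baseKey} h h' ∧
      ∀ i ≤ k + 1, h'.w (.tab 1 baseKey) i = M ^ i := by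
  induction k with
  | zero =>
    have h1W : 1 < W := hf.small (by omega)
    refine Blk.tri ⟨show 0 < W by omega, h1W⟩ ⟨(Frame.refl _ _).setW (Set.mem_singleton _) _ _ _,
      fun i hi => ?_⟩ hX
    interval_cases i
    · simp [Blk.run, Exp.eval]
    · simp [Blk.run, Exp.eval, h1]
  | succ k ih =>
    refine Tri.seq (ih (by omega)) ?_
    rintro h' ⟨F, e⟩
    have ep : ∀ i ≤ k + 1, (pw i : Exp n m).eval h' = M ^ i := fun i hi => e i hi
    have e1 := ep 1 (by omega)
    have e2 := ep (k + 1) le_rfl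
    have hlt := hf.pow_lt (i := k + 2) (by omega)
    have hmul : M ^ (k + 1) * M ^ 1 = M ^ (k + 2) := by rw [← pow_add]
    refine Blk.tri ⟨hf.small (c := k + 2) (by omega), hf.small (c := k + 1) (by omega),
      hf.small (c := 1) (by omega), by rw [e1, e2, hmul]; omega⟩
      ⟨F.setW (Set.mem_singleton _) _ _ _, fun i hi => ?_⟩ hX
    have ev : (Exp.mul (pw (k + 1)) (pw 1) : Exp n m).eval h' = M ^ (k + 2) := by
      rw [Exp.eval, e1, e2, hmul]
    rw [Blk.run, ev]
    by_cases hik : i = k + 2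
    · subst hik; simp [Exp.eval]
    · have : i ≤ k + 1 := by omega
      simp [Exp.eval, hik, e i this]

/-! ### Tables of the relations -/

/-- The `j`-th relation as a relation on assignments of all attributes. -/
def relTup (I : Instance H K) (j : Fin m) : Rel n K := fun t => I.rel j fun a => t a

omit [CommMonoidWithZero K] in
theorem dep_relTup (I : Instance H K) (j : Fin m) : Dep (H.edge j) (relTup I j) := fun t => by
  have : (fun a : {a // a ∈ H.edge j} => proj (H.edge j) t a.1) = fun a => t a.1 :=
    funext fun a => proj_apply_of_mem a.2 t
  rw [relTup, relTup, this]

omit [CommMonoidWithZero K] in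
theorem proj_rowTup {j : Fin m} (r : I.Rows j) : proj (H.edge j) (rowTup I r) = rowTup I r :=
  proj_eq_self_iff.2 fun _ ha => dif_neg ha

omit [CommMonoidWithZero K] in
theorem relTup_rowTup {j : Fin m} (r : I.Rows j) : relTup I j (rowTup I r) = I.rel j r.1 := by
  have : (fun a : {a // a ∈ H.edge j} => rowTup I r a) = r.1 := funext fun a => dif_pos a.2
  rw [relTup, this]

omit [CommMonoidWithZero K] in
theorem exists_rowTup {j : Fin m} {t : Tup n} (ht : proj (H.edge j) t = t)
    (hs : (relTup I j t).isSome) : ∃ r : I.Rows j, rowTup I r = t := by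
  refine ⟨⟨fun a => t a, hs⟩, ?_⟩
  ext a
  by_cases ha : a ∈ H.edge j
  · exact dif_pos ha
  · rw [rowTup, dif_neg ha]
    exact (proj_eq_self_iff.1 ht a ha).symm

def keyR (j : Fin m) : Key n := (1, j, ∅)

/-- Enters the rows of relation `j` into a table. -/
def relCmd (H : Hypergraph n m) (j : Fin m) : Cmd ι :=
  forI (n := n) (m := m) 0 (.get .card (.lit j))
    (Blk.seq (.loc 9 (sumE ((H.edge j).toList.map fun a => .mul (.get (.col j a) (.loc 0)) (pw a))))
      (upsertB (keyR j) (.get (.inp j) (.loc 0)) .keep) : Blk n m ι).code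

theorem relCmd_tri (hf : Fit n m W M) (hIW : I.inSize < W) (hM : I.Below M) {h : HS n m K}
    (hp : HasPow M h) (hr : Raw I row h) (j : Fin m) (hu : Unused h (keyR j))
    (hX : I.inSize + 1 ≤ X) :
    Tri O W (relCmd H j) h X fun h' => Frame {keyR j} h h' ∧
      (⟨keyR j, H.edge j⟩ : Fac n).Good I M I.inSize h' (relTup I j) := by
  have hcard : I.card j ≤ I.inSize := Instance.card_le_inSize I j
  have h1W : 1 < W := hf.small (by omega)
  have hbk : baseKey ∉ ({keyR j} : Set (Key n)) := by
    simp [baseKey, keyR]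
  set v : Tup n → K := fun t => (relTup I j t).getD 0 with hv
  refine Tri.mono (Tri.forI (fun k h' => Frame {keyR j} h h' ∧ ∃ l, Tab M h' (keyR j) l
      (onSet {t | ∃ i, ∃ hi : i < I.card j, i < k ∧ t = rowTup I (row j ⟨i, hi⟩)} v) ∧
      l.length ≤ k)
    (fun _ => 1) (by omega) (N := I.card j) (by omega) h1W ⟨.refl _ _, [], ?_, by simp⟩ ?_ ?_
    (by simpa using by omega : _ ≤ X)) le_rfl ?_
  · convert (hu.tab (K := K) M).setLoc 0 0 using 1
    ext1 t
    simp [onSet]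
  · rintro i - h' ⟨F, -⟩
    exact ⟨hf.small (c := j) (by have := j.2; omega), (hr.congr F).card j⟩
  · rintro k hk h' ⟨F, l, T, len⟩ h0
    refine ⟨le_rfl, ?_⟩
    have hp' := hp.congr F hbk
    have hr' := hr.congr F
    set g := rowTup I (row j ⟨k, hk⟩) with hg
    have hbg : Bd M g := hM j _
    have hgW := hf.enc_lt hbg
    have hl0 : ∀ h'' : HS n m K, h''.loc 0 = k → (Exp.loc 0 : Exp n m).Ok W h'' := fun h'' hh =>
      ⟨by omega, by omega⟩
    have hterm : ∀ a : Fin n, (Exp.mul (.get (.col j a) (.loc 0)) (pw a) : Exp n m).eval h' =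
        g a * M ^ (a : ℕ) := by
      intro a
      have e1 := pw_eval (m := m) hp' (i := a) (by have := a.2; omega)
      rw [Exp.eval, e1, Exp.eval, Exp.eval, h0, hr'.col j a k hk]
    have hev : (sumE ((H.edge j).toList.map fun a =>
        Exp.mul (.get (.col j a) (.loc 0)) (pw a)) : Exp n m).eval h' = enc M g := by
      have e1 := enc_proj (M := M) (H.edge j) g
      rw [proj_rowTup] at e1
      rw [sumE_eval, e1, List.map_map, ← Finset.sum_map_toList]
      exact congrArg List.sum (List.map_congr_left fun a _ => hterm a)
    have hok : (sumE ((H.edge j).toList.map fun a =>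
        Exp.mul (.get (.col j a) (.loc 0)) (pw a)) : Exp n m).Ok W h' := by
      refine sumE_ok ?_ ?_
      · rintro e he
        obtain ⟨a, -, rfl⟩ := List.mem_map.1 he
        refine ⟨hl0 h' h0, pw_ok hf (by have := a.2; omega) _, ?_⟩
        have := hterm a
        rw [Exp.eval] at this
        rw [this]
        exact lt_of_le_of_lt (Finset.single_le_sum (f := fun a => g a * M ^ (a : ℕ))
          (fun _ _ => Nat.zero_le _) (Finset.mem_univ a)) hgW
      · rw [sumE_eval] at hev
        rw [hev]; exact hgW
    have hspec := upsertB_spec (O := O) (g := g) (x := (.get (.inp j) (.loc 0) : AExp n m ι))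
      (v := v g) hf (h := h'.setLoc 9 (enc M g)) (T.setLoc 9 (enc M g)) hbg (by simp)
      (fun h'' F' hloc => by
        have e0 : h''.loc 0 = k := by rw [hloc]; simpa using h0
        refine ⟨hl0 h'' e0, ?_⟩
        rw [AExp.eval, Exp.eval, e0, ((hr.congr ((F.setLoc 9 _).trans F')).ann j k hk)]
        rw [hv, hg]
        simp only [relTup_rowTup]) .keep
    rw [upd_keep_onSet] at hspec
    obtain ⟨s0, s1, s2, l', s3, s4⟩ := hspec
    refine Blk.tri ⟨⟨by omega, hok, by rw [hev]; exact hgW⟩, ?_⟩ ?_ le_rfl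
    · rw [Blk.run, hev]; exact s0
    · rw [Blk.run, Blk.run, hev]
      refine ⟨by rw [s2]; simpa using h0, ((F.setLoc 9 _).trans s1).setLoc _ _, l', ?_, by omega⟩
      convert s3.setLoc 0 (k + 1) using 2
      ext t
      simp only [Set.mem_ofPred_eq, Set.mem_insert_iff]
      constructor
      · rintro ⟨i, hi, hik, rfl⟩
        rcases Nat.lt_succ_iff_lt_or_eq.1 hik with hik | rfl
        · exact Or.inr ⟨i, hi, hik, rfl⟩
        · exact Or.inl rfl
      · rintro (rfl | ⟨i, hi, hik, rfl⟩)
        · exact ⟨k, hk, by omega, rfl⟩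
        · exact ⟨i, hi, by omega, rfl⟩
  · rintro h' ⟨F, l, T, len⟩
    refine ⟨F, dep_relTup I j, ⟨l, ?_, len.trans hcard⟩, ?_⟩
    · convert T using 1
      ext1 t
      by_cases ht : proj (H.edge j) t = t ∧ (relTup I j t).isSome
      · obtain ⟨r, rfl⟩ := exists_rowTup ht.1 ht.2
        have hm : rowTup I r ∈ {t | ∃ i, ∃ hi : i < I.card j, i < I.card j ∧
            t = rowTup I (row j ⟨i, hi⟩)} :=
          ⟨(row j).symm r, ((row j).symm r).2, ((row j).symm r).2, by simp⟩
        rw [onSch_of_proj ht.1, onSet, if_pos hm]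
        exact Option.eq_some_getD 0 ht.2
      · have hm : t ∉ {t | ∃ i, ∃ hi : i < I.card j, i < I.card j ∧
            t = rowTup I (row j ⟨i, hi⟩)} := by
          rintro ⟨i, hi, -, rfl⟩
          exact ht ⟨proj_rowTup _, by rw [relTup_rowTup]; exact (row j ⟨i, hi⟩).2⟩
        rw [onSet, if_neg hm, ← Option.not_isSome_iff_eq_none, onSch_isSome]
        exact ht
    · exact fun t ht a ha => I.mem_dom j _ ht ⟨a, ha⟩

/-! ### Tables of the projections -/

def keyP (p : Fin m × Finset (Fin n)) : Key n := (2, p.1, p.2)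

/-- Relation and attribute share one component by pairing, since a key has only three. -/
def keyG (q : Fin m × Finset (Fin n) × Fin n) : Key n := (4, Nat.pair q.1 q.2.2, q.2.1)

def PrjTab (I : Instance H K) (M : ℕ) (p : Fin m × Finset (Fin n)) (h : HS n m K) : Prop :=
  ∃ l, Tab M h (keyP p) l (onSet ↑(prjFin I p.1 p.2) fun _ => 1) ∧ l.length ≤ I.inSize

def PrjGrp (I : Instance H K) (M : ℕ) (q : Fin m × Finset (Fin n) × Fin n) (h : HS n m K) : Prop :=
  ∃ l : List (Tup n), l.Nodup ∧ (∀ t, t ∈ l ↔ t ∈ prjFin I q.1 q.2.1) ∧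
    Ext M h (keyG q) (q.2.1.erase q.2.2) q.2.2 l

omit [CommMonoidWithZero K] in
theorem onSet_isSome {A : Set (Tup n)} {v : Tup n → K} {t : Tup n} :
    (onSet A v t).isSome ↔ t ∈ A := by
  rw [onSet]
  split_ifs with h <;> simp [h]

/-- The relations and their projections are stored in tables. -/
structure Inp (I : Instance H K) (M : ℕ) (h : HS n m K) : Prop where
  pow : HasPow M h
  dom : HasDom I h
  rel : ∀ j, (⟨keyR j, H.edge j⟩ : Fac n).Good I M I.inSize h (relTup I j)
  prj : ∀ p, PrjTab I M p h
  grp : ∀ q, PrjGrp I M q h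

theorem prj_tri (hf : Fit n m W M) {h : HS n m K} (hp : HasPow M h) (p : Fin m × Finset (Fin n))
    (hrel : (⟨keyR p.1, H.edge p.1⟩ : Fac n).Good I M I.inSize h (relTup I p.1))
    (hu : Unused h (keyP p)) (hX : I.inSize + 1 ≤ X) :
    Tri O W (accum (m := m) (keyR p.1) (keyP p) p.2 [] .one .keep) h X fun h' =>
      Frame {keyP p} h h' ∧ PrjTab I M p h' := by
  classical
  obtain ⟨l, hT, hlen⟩ := hrel.tab
  refine (accum_tri (O := O) hf hp (by simp [keyR, keyP]) (by simp [keyP, baseKey]) hT.toLst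
    (hu.tab M) (x := .one) .keep (P := fun _ => True) (v := fun _ => 1) (by simp)
    (fun _ _ _ _ _ _ => ⟨trivial, rfl⟩) (by omega)).mono le_rfl ?_
  rintro h' ⟨F, l', hT', hl'⟩
  refine ⟨F, l', ?_, hl'.trans hlen⟩
  convert hT' using 1
  ext1 t
  rw [acc_keep O _ _ _ (fun _ => 1) l (fun _ _ _ => rfl), onSet]
  congr 1
  rw [Finset.mem_coe, prjFin, Finset.mem_image, eq_iff_iff]
  constructor
  · rintro ⟨r, -, rfl⟩
    refine ⟨rowTup I r, (hT.mem _).2 ?_, trivial, rfl⟩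
    rw [onSch_isSome, relTup_rowTup]
    exact ⟨proj_rowTup r, r.2⟩
  · rintro ⟨u, hu, -, rfl⟩
    obtain ⟨h1, h2⟩ := onSch_isSome.1 ((hT.mem u).1 hu)
    obtain ⟨r, rfl⟩ := exists_rowTup h1 h2
    exact ⟨r, Finset.mem_univ _, rfl⟩

/-- Converts the input into tables. -/
def inputCmd (H : Hypergraph n m) : Cmd ι :=
  -- Starting the maximum at `1` makes the base `M` positive even if the instance is empty.
  .seq (Blk.set (.tab 1 baseKey) (.lit 1) (.lit 1) : Blk n m ι).code
    (.seq (seqL (Finset.univ : Finset (Fin m × Fin n)).toList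
        fun p => maxCmd (n := n) (m := m) p.1 p.2)
      (.seq (powCmd (n := n) (m := m) n)
        (.seq (seqL (Finset.univ : Finset (Fin m)).toList fun j => relCmd H j)
          (.seq (seqL (Finset.univ : Finset (Fin m × Finset (Fin n))).toList fun p =>
              accum (m := m) (keyR p.1) (keyP p) p.2 [] .one .keep)
            (seqL (Finset.univ : Finset (Fin m × Finset (Fin n) × Fin n)).toList fun q =>
              groups (m := m) (keyP (q.1, q.2.1)) (keyG q) (q.2.1.erase q.2.2) q.2.2)))))

-- All projections of all relations, grouped by each attribute, are prepared in advance. Their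
-- number depends on the hypergraph only, so this takes time linear in `IN`. The base satisfies `M ≤
-- B + 1`, being one more than a value that occurs, or `1`.
set_option maxHeartbeats 1000000 in
theorem inputCmd_tri (hB : 1 ≤ B) (hIB : I.FitsIn B)
    (hW : ∀ M, 1 ≤ M → M ≤ B + 1 → Fit n m W M) (hBW : n + m + B + 8 < W)
    {h : HS n m K} (hr : Raw I row h) (hu : ∀ d, Unused h d) (hX : I.inSize + 1 ≤ X) :
    Tri O W (inputCmd H) h X fun h' => ∃ M, 1 ≤ M ∧ M ≤ B + 1 ∧ I.Below M ∧ Inp I M h' ∧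
      ∀ d : Key n, d.1 = 3 ∨ 5 ≤ d.1 → Unused h' d := by
  have hIN := hIB.1
  refine Tri.seq (Q := fun h1 => Frame {baseKey} h h1 ∧ h1.w (.tab 1 baseKey) 1 = 1)
    (Blk.tri ⟨show 1 < W by omega, show 1 < W by omega⟩
      ⟨(Frame.refl _ _).setW (Set.mem_singleton _) _ _ _, by simp [Blk.run, Exp.eval]⟩ (by omega)) ?_
  rintro h1 ⟨F1, e1⟩
  refine Tri.seq (Tri.seqL (fun pre h' => Frame {baseKey} h h' ∧ ∃ v,
    h'.w (.tab 1 baseKey) 1 = v ∧ 1 ≤ v ∧ v ≤ B + 1 ∧ ∀ p ∈ pre, ∀ i (hi : i < I.card p.1),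
      rowTup I (row p.1 ⟨i, hi⟩) p.2 < v) ⟨F1, 1, e1, le_rfl, by omega, by simp⟩ ?_) ?_
  · rintro pre p post - h' ⟨F, v, a1, a2, a3, a4⟩
    refine (maxCmd_tri hBW hIB (hr.congr F) p.1 p.2 a1 a3 hX).mono le_rfl ?_
    rintro h'' ⟨F', v', b1, b2, b3, b4⟩
    refine ⟨F.trans F', v', b1, by omega, b3, fun q hq i hi => ?_⟩
    rcases List.mem_append.1 hq with hq | hq
    · exact (a4 q hq i hi).trans_le b2
    · rw [List.mem_singleton] at hq
      subst hq
      exact b4 i hi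
  rintro h2 ⟨F2, M, e2, hM1, hMB, hMv⟩
  have hf := hW M hM1 hMB
  have hbelow : I.Below M := by
    intro j r a
    have := hMv (j, a) (by simp) ((row j).symm r) ((row j).symm r).2
    simpa using this
  refine Tri.seq (powCmd_tri hf e2 n le_rfl (by omega)) ?_
  rintro h3 ⟨F3, e3⟩
  have F03 := F2.trans F3
  have hp3 : HasPow M h3 := e3
  have hu3 : ∀ d : Key n, d.1 ≠ 0 → Unused h3 d := fun d hd => (hu d).congr F03 fun h => hd (by
    rw [Set.mem_singleton_iff.1 h]; rfl)
  have kR : ∀ j : Fin m, (keyR j : Key n) ≠ baseKey := fun j => by simp [keyR, baseKey]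
  have kP : ∀ p : Fin m × Finset (Fin n), keyP p ≠ baseKey := fun p => by simp [keyP, baseKey]
  have kG : ∀ q : Fin m × Finset (Fin n) × Fin n, keyG q ≠ baseKey :=
    fun q => by simp [keyG, baseKey]
  refine Tri.seq (Tri.seqL_tables (Finset.nodup_toList _) keyR (fun i j h => by
      simpa [keyR, Fin.ext_iff] using h) (fun h => HasPow M h ∧ Raw I row h)
    (fun j h => (⟨keyR j, H.edge j⟩ : Fac n).Good I M I.inSize h (relTup I j))
    (fun j h h' F hb => ⟨hb.1.congr F (kR j).symm, hb.2.congr F⟩)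
    (fun i j h h' hij F hg => hg.congr F fun h => hij (by simpa [keyR, Fin.ext_iff] using h))
    (fun j h hb hu => relCmd_tri hf (by omega) hbelow hb.1 hb.2 j hu hX)
    ⟨hp3, hr.congr F03⟩ fun j => hu3 _ (by simp [keyR])) ?_
  rintro h4 ⟨F4, ⟨hp4, hr4⟩, hrel4⟩
  have hu4 : ∀ d : Key n, d.1 ≠ 0 → d.1 ≠ 1 → Unused h4 d := fun d hd hd1 =>
    (hu3 d hd).congr F4 (by rintro ⟨j, rfl⟩; exact hd1 rfl)
  refine Tri.seq (Tri.seqL_tables (Finset.nodup_toList _) keyP (fun p q h => by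
      simp only [keyP, Prod.mk.injEq, true_and] at h
      exact Prod.ext (Fin.ext h.1) h.2)
    (fun h => HasPow M h ∧ HasDom I h ∧
      ∀ j, (⟨keyR j, H.edge j⟩ : Fac n).Good I M I.inSize h (relTup I j)) (PrjTab I M)
    (fun p h h' F hb => ⟨hb.1.congr F (kP p).symm, hb.2.1.congr F, fun j => (hb.2.2 j).congr F
      (by simp [keyR, keyP])⟩)
    (fun p q h h' hpq F hg => ?_)
    (fun p h hb hu => prj_tri hf hb.1 p (hb.2.2 p.1) hu hX)
    ⟨hp4, hr4.dom, fun j => hrel4 j (by simp)⟩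
    fun p => hu4 _ (by simp [keyP]) (by simp [keyP])) ?_
  · obtain ⟨l, T, len⟩ := hg
    refine ⟨l, T.congr F fun h => hpq ?_, len⟩
    simp only [keyP, Set.mem_singleton_iff, Prod.mk.injEq, true_and] at h
    exact Prod.ext (Fin.ext h.1) h.2
  rintro h5 ⟨F5, ⟨hp5, hd5, hrel5⟩, hprj5⟩
  have hu5 : ∀ d : Key n, d.1 ≠ 0 → d.1 ≠ 1 → d.1 ≠ 2 → Unused h5 d := fun d hd hd1 hd2 =>
    (hu4 d hd hd1).congr F5 (by rintro ⟨j, rfl⟩; exact hd2 rfl)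
  have kGinj : ∀ p q : Fin m × Finset (Fin n) × Fin n, keyG p = keyG q → p = q := by
    intro p q h
    simp only [keyG, Prod.mk.injEq, true_and, Nat.pair_eq_pair] at h
    exact Prod.ext (Fin.ext h.1.1) (Prod.ext h.2 (Fin.ext h.1.2))
  refine (Tri.seqL_tables (Finset.nodup_toList _) keyG (fun p q h => kGinj p q h)
    (fun h => HasPow M h ∧ HasDom I h ∧
      (∀ j, (⟨keyR j, H.edge j⟩ : Fac n).Good I M I.inSize h (relTup I j)) ∧
      ∀ p, PrjTab I M p h) (PrjGrp I M)
    (fun p h h' F hb => ⟨hb.1.congr F (kG p).symm, hb.2.1.congr F, fun j => (hb.2.2.1 j).congr F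
      (by simp [keyR, keyG]), fun q => ?_⟩)
    (fun p q h h' hpq F hg => ?_)
    (fun q h hb hu => ?_)
    ⟨hp5, hd5, hrel5, fun p => hprj5 p (by simp)⟩
    fun p => hu5 _ (by simp [keyG]) (by simp [keyG]) (by simp [keyG])).mono le_rfl ?_
  · obtain ⟨l, T, len⟩ := hb.2.2.2 q
    exact ⟨l, T.congr F (by simp [keyP, keyG]), len⟩
  · obtain ⟨l, h1, h2, h3⟩ := hg
    exact ⟨l, h1, h2, h3.congr F fun h => hpq (kGinj p q h)⟩
  · obtain ⟨l, T, len⟩ := hb.2.2.2 (q.1, q.2.1)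
    refine (groups_tri hf hb.1 (by simp [keyP, keyG]) (kG q) T.toLst hu _ _ (by omega)).mono
      le_rfl ?_
    rintro h' ⟨F, hE⟩
    refine ⟨F, l, T.nodup, fun t => ?_, hE⟩
    rw [T.mem, onSet_isSome, Finset.mem_coe]
  · rintro h6 ⟨F6, ⟨hp6, hd6, hrel6, hprj6⟩, hgrp6⟩
    refine ⟨M, hM1, hMB, hbelow, ⟨hp6, hd6, hrel6, hprj6, fun q => hgrp6 q (by simp)⟩,
      fun d hd => (hu5 d (by omega) (by omega) (by omega)).congr F6 ?_⟩
    rintro ⟨q, rfl⟩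
    simp only [keyG] at hd
    omega

end Conversion

end Ajar

end

noncomputable section

namespace Ajar

/-! ### One step in the computation of the local joins. -/

section LocalJoins

variable {n m : ℕ} {ι K : Type*} {H : Hypergraph n m} [CommMonoidWithZero K]
  {W M N X : ℕ} {I : Instance H K} {O : PlusOps ι K}

theorem keyG_injective : Function.Injective (keyG : Fin m × Finset (Fin n) × Fin n → Key n) := by
  intro p q h
  simp only [keyG, Prod.mk.injEq, true_and, Nat.pair_eq_pair] at h
  exact Prod.ext (Fin.ext h.1.1) (Prod.ext h.2 (Fin.ext h.1.2))

/-- The key of the flag of the local join over `S`. -/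
def keyD (S : Finset (Fin n)) : Key n := (3, 1, S)

/-- The key of the current bound for the costs. -/
def keyN : Key n := (3, 2, ∅)

def Done (h : HS n m K) (S : Finset (Fin n)) : Prop := h.w (.tab 0 (keyD S)) 0 = 1

/-- The state of the computation of the local joins: each join is either stored or not begun. -/
structure JSt (I : Instance H K) (M N : ℕ) (h : HS n m K) : Prop where
  inp : Inp I M h
  cell : h.w (.tab 0 keyN) 0 = N
  join : ∀ S, Done h S → JTab I M N h S
  free : ∀ S, ¬ Done h S → h.w (.tab 0 (keyD S)) 0 = 0 ∧ Unused h (keyJ S)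
  empty : Done h ∅
  fresh : ∀ d : Key n, 5 ≤ d.1 → Unused h d

def grpOf (H : Hypergraph n m) (S : Finset (Fin n)) (c : Fin n) (j : Fin m) : Grouped n :=
  ⟨keyG (j, S ∩ H.edge j, c), (S ∩ H.edge j).erase c⟩

def grpsOf (H : Hypergraph n m) (S : Finset (Fin n)) (c : Fin n) : List (Grouped n) :=
  (H.star c).toList.map (grpOf H S c)

theorem mem_grpsOf {S : Finset (Fin n)} {c : Fin n} {i : Grouped n} :
    i ∈ grpsOf H S c ↔ ∃ j, c ∈ H.edge j ∧ i = grpOf H S c j := by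
  simp [grpsOf, Hypergraph.star, eq_comm]

/-- The equations that test whether a tuple is consistent with all relations. -/
def fitsL (H : Hypergraph n m) (S : Finset (Fin n)) : List (Exp n m × Exp n m) :=
  ((Finset.univ : Finset (Fin m)).filter fun j => (S ∩ H.edge j).Nonempty).toList.map fun j =>
    (.get (.tab 2 (keyP (j, S ∩ H.edge j))) (projE (S ∩ H.edge j) (.loc 9)), .lit 1)

/-- Computes the local join over `S` from that over `S.erase c`, if it is cheap enough. -/
def stepCmd (H : Hypergraph n m) (S : Finset (Fin n)) (c : Fin n) : Cmd ι :=
  match grpsOf H S c with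
  | [] => .skip
  | i₀ :: is =>
    -- Three reasons to do nothing: the join is already stored, its predecessor is missing, or the
    -- step costs more than the current bound. The last test precedes any writing, so a rejected
    -- join stays unused.
    cIfEq (cntE (m := m) (keyD S)) (.lit 0)
      (cIfEq (cntE (m := m) (keyD (S.erase c))) (.lit 1)
        (.seq (costPass (m := m) (keyJ (S.erase c)) i₀ is)
          (cIfLt (cntE (n := n) (m := m) keyN) (.loc 8) .skip
            (.seq (extend (keyJ (S.erase c)) (keyJ S) c i₀ is (fitsL H S) .one)
              (Blk.set (.tab 0 (keyD S)) (.lit 0) (.lit 1) : Blk n m ι).code)))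
        .skip)
      .skip

theorem fitsL_spec (hf : Fit n m W M) {h : HS n m K} (hp : HasPow M h)
    (hprj : ∀ p, PrjTab I M p h) {t : Tup n} (ht : Bd M t) (h9 : h.loc 9 = enc M t)
    (S : Finset (Fin n)) :
    (∀ p ∈ fitsL H S, p.1.Ok W h ∧ p.2.Ok W h) ∧
      ((∀ p ∈ fitsL H S, p.1.eval h = p.2.eval h) ↔ ∀ j, (S ∩ H.edge j).Nonempty →
        proj (S ∩ H.edge j) t ∈ prjFin I j (S ∩ H.edge j)) := by
  have hloc : (Exp.loc 9 : Exp n m).Ok W h := ⟨by omega, by rw [h9]; exact hf.enc_lt ht⟩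
  constructor
  · intro p hpL
    obtain ⟨j, -, rfl⟩ := List.mem_map.1 hpL
    exact ⟨projE_ok (e := .loc 9) hf hp ht h9 hloc _, hf.small (c := 1) (by omega)⟩
  · simp only [fitsL, List.forall_mem_map, Finset.mem_toList, Finset.mem_filter, Finset.mem_univ,
      true_and]
    refine forall₂_congr fun j hj => ?_
    obtain ⟨l, T, -⟩ := hprj (j, S ∩ H.edge j)
    simp only [Exp.eval]
    rw [projE_eval (e := .loc 9) hp ht h9, T.flag _ (ht.proj _)]
    simp only [onSet_isSome, Finset.mem_coe]
    split_ifs with h <;> simp [h]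

omit [CommMonoidWithZero K] in
theorem length_filter_eq_deg {j : Fin m} {S : Finset (Fin n)} {c : Fin n} {l : List (Tup n)}
    (hl : l.Nodup) (hm : ∀ t, t ∈ l ↔ t ∈ prjFin I j (S ∩ H.edge j)) (t : Tup n) :
    (grp ((S ∩ H.edge j).erase c) l t).length = deg I j (S ∩ H.edge j) c t := by
  classical
  rw [grp, deg, ← List.toFinset_card_of_nodup (hl.filter _)]
  congr 1
  ext u
  simp [hm]

omit [CommMonoidWithZero K] in
theorem Bd.of_mem_prjFin (hM : I.Below M) {j : Fin m} {X : Finset (Fin n)} {t : Tup n}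
    (ht : t ∈ prjFin I j X) : Bd M t := by
  obtain ⟨r, -, rfl⟩ := Finset.mem_image.1 ht
  exact (hM j r).proj X

omit [CommMonoidWithZero K] in
theorem card_le_pow_of_bd {s : Finset (Tup n)} (hs : ∀ t ∈ s, Bd M t) : s.card ≤ M ^ n := by
  rw [← Finset.length_toList]
  exact length_le_of_nodup_of_bd (Finset.nodup_toList s) fun t ht => hs t (Finset.mem_toList.1 ht)

-- A bound by pairs of codes: at most `M ^ n` tuples with at most `M ^ n` extensions each. It
-- guarantees that costs, and the doubled bound of the search, fit into a word.
omit [CommMonoidWithZero K] in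
theorem stepCost_le_pow (hM1 : 1 ≤ M) (hM : I.Below M) (S : Finset (Fin n)) (c : Fin n) :
    stepCost I S c ≤ M ^ (2 * n) := by
  obtain ⟨j, hj⟩ := H.covered c
  have h1 : ∀ t ∈ joinFin I (S.erase c), minDeg I S c t ≤ M ^ n := fun t _ =>
    (minDeg_le hj).trans (card_le_pow_of_bd fun u hu =>
      Bd.of_mem_prjFin hM (Finset.mem_filter.1 hu).1)
  refine (Finset.sum_le_card_nsmul _ _ _ h1).trans ?_
  rw [two_mul, pow_add, smul_eq_mul]
  exact Nat.mul_le_mul_right _ (card_le_pow_of_bd fun t ht => (mem_joinFin.1 ht).bd hM1 hM)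

omit [CommMonoidWithZero K] in
/-- Extending a tuple in the way of one relation is the same for all relations. -/
theorem extends_iff {S : Finset (Fin n)} {c : Fin n} (hcS : c ∈ S) {j : Fin m} (hj : c ∈ H.edge j)
    {l : List (Tup n)} (hm : ∀ t, t ∈ l ↔ t ∈ prjFin I j (S ∩ H.edge j)) {t t' : Tup n} :
    ((∀ j, (S ∩ H.edge j).Nonempty → proj (S ∩ H.edge j) t' ∈ prjFin I j (S ∩ H.edge j)) ∧
      ∃ v, t' = Function.update t c v) ↔
    ((∀ j, (S ∩ H.edge j).Nonempty → proj (S ∩ H.edge j) t' ∈ prjFin I j (S ∩ H.edge j)) ∧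
      ∃ u ∈ grp ((S ∩ H.edge j).erase c) l t, t' = Function.update t c (u c)) := by
  have hc : c ∈ S ∩ H.edge j := Finset.mem_inter.2 ⟨hcS, hj⟩
  refine and_congr_right fun hP => ⟨?_, fun ⟨u, _, h⟩ => ⟨_, h⟩⟩
  rintro ⟨v, rfl⟩
  refine ⟨proj (S ∩ H.edge j) (Function.update t c v), List.mem_filter.2
    ⟨(hm _).2 (hP j ⟨c, hc⟩), ?_⟩, ?_⟩
  · rw [decide_eq_true_eq, proj_proj_of_subset (Finset.erase_subset _ _), proj_erase_update]
  · rw [proj_apply_of_mem hc, Function.update_self]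

-- Projections of consistent tuples are consistent, so the local join over `S` consists of
-- extensions of the one over `S.erase c` that pass the tests for `S`.
omit [CommMonoidWithZero K] in
theorem inJoin_iff_exists {S : Finset (Fin n)} {c : Fin n} (hcS : c ∈ S) {t' : Tup n} :
    InJoin I S t' ↔ ∃ t, InJoin I (S.erase c) t ∧
      (∀ j, (S ∩ H.edge j).Nonempty → proj (S ∩ H.edge j) t' ∈ prjFin I j (S ∩ H.edge j)) ∧
      ∃ v, t' = Function.update t c v := by
  constructor
  · intro h
    refine ⟨proj (S.erase c) t', h.proj_subset (Finset.erase_subset _ _), h.2, t' c, ?_⟩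
    rw [update_proj_erase hcS, h.1]
  · rintro ⟨t, ht, h2, v, rfl⟩
    refine ⟨?_, h2⟩
    rw [proj_eq_self_iff]
    intro a ha
    have hac : a ≠ c := fun h => ha (h ▸ hcS)
    rw [Function.update_of_ne hac]
    exact proj_eq_self_iff.1 ht.1 a fun h => ha (Finset.mem_of_mem_erase h)

omit [CommMonoidWithZero K] in
theorem Done.congr {h h' : HS n m K} {D : Set (Key n)} (hF : Frame D h h') {S : Finset (Fin n)}
    (hS : keyD S ∉ D) : Done h' S ↔ Done h S := by rw [Done, Done, hF.w hS]

theorem Inp.congr {h h' : HS n m K} (hi : Inp I M h) {D : Set (Key n)} (hF : Frame D h h')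
    (hD : ∀ d : Key n, d.1 ≤ 2 ∨ d.1 = 4 → d ∉ D) : Inp I M h' := by
  refine ⟨hi.pow.congr hF (hD _ (Or.inl (Nat.zero_le _))), hi.dom.congr hF,
    fun j => (hi.rel j).congr hF (hD _ (Or.inl (by simp [keyR]))), fun p => ?_, fun q => ?_⟩
  · obtain ⟨l, h1, h2⟩ := hi.prj p
    exact ⟨l, h1.congr hF (hD _ (Or.inl (by simp [keyP]))), h2⟩
  · obtain ⟨l, h1, h2, h3⟩ := hi.grp q
    exact ⟨l, h1, h2, h3.congr hF (hD _ (Or.inr rfl))⟩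

theorem JSt.congr {h h' : HS n m K} (hs : JSt I M N h) (hF : Frame ∅ h h') : JSt I M N h' := by
  have hd : ∀ S, Done h' S ↔ Done h S := fun S => Done.congr hF (Set.notMem_empty _)
  refine ⟨hs.inp.congr hF fun _ _ => Set.notMem_empty _,
    by rw [hF.w (Set.notMem_empty _)]; exact hs.cell,
    fun S h => (hs.join S ((hd S).1 h)).congr hF (Set.notMem_empty _), fun S h => ?_,
    (hd ∅).2 hs.empty, fun d h => (hs.fresh d h).congr hF (Set.notMem_empty _)⟩
  obtain ⟨h1, h2⟩ := hs.free S fun h3 => h ((hd S).2 h3)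
  exact ⟨by rw [hF.w (Set.notMem_empty _)]; exact h1, h2.congr hF (Set.notMem_empty _)⟩

/-- The result of a step. -/
def StepPost (I : Instance H K) (M N : ℕ) (h : HS n m K) (S : Finset (Fin n)) (c : Fin n)
    (h' : HS n m K) : Prop :=
  JSt I M N h' ∧ Frame {keyJ S, keyD S} h h' ∧ (Done h S → Done h' S) ∧
    (Done h (S.erase c) → stepCost I S c ≤ N → Done h' S)

set_option maxHeartbeats 1000000 in
theorem stepCmd_tri (hf : Fit n m W M) (hM : I.Below M) (hN1 : 1 ≤ N)
    {h : HS n m K} (hs : JSt I M N h) {S : Finset (Fin n)} {c : Fin n} (hcS : c ∈ S)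
    (hX : 2 * N + 1 ≤ X) : Tri O W (stepCmd H S c) h X (StepPost I M N h S c) := by
  classical
  have h1W : 1 < W := hf.small (by omega)
  obtain ⟨j₀, hj₀⟩ := H.covered c
  have hg₀ : grpOf H S c j₀ ∈ grpsOf H S c := mem_grpsOf.2 ⟨j₀, hj₀, rfl⟩
  rw [stepCmd]
  rcases hgr : grpsOf H S c with _ | ⟨i₀, is⟩
  · rw [hgr] at hg₀; cases hg₀
  choose lq lq1 lq2 lq3 using hs.inp.grp
  -- The list belonging to a group is recovered from its key alone; the empty list for other keys is
  -- never used.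
  set ls : Grouped n → List (Tup n) := fun i => Function.extend keyG lq (fun _ => []) i.key with hls
  have hlsj : ∀ j, ls (grpOf H S c j) = lq (j, S ∩ H.edge j, c) := fun j => by
    show Function.extend keyG lq (fun _ => []) (keyG (j, S ∩ H.edge j, c)) = _
    exact keyG_injective.extend_apply lq (fun _ => []) (j, S ∩ H.edge j, c)
  have hmem : ∀ i ∈ i₀ :: is, ∃ j, c ∈ H.edge j ∧ i = grpOf H S c j := fun i hi =>
    mem_grpsOf.1 (by rw [hgr]; exact hi)
  have hmem' : ∀ j, c ∈ H.edge j → grpOf H S c j ∈ i₀ :: is := fun j hj => by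
    rw [← hgr]; exact mem_grpsOf.2 ⟨j, hj, rfl⟩
  have hlen : ∀ j t, (grp (grpOf H S c j).set (ls (grpOf H S c j)) t).length =
      deg I j (S ∩ H.edge j) c t := fun j t => by
    rw [hlsj]
    exact length_filter_eq_deg (lq1 (j, S ∩ H.edge j, c)) (lq2 (j, S ∩ H.edge j, c)) t
  have hgood : ∀ h' : HS n m K, ∀ D : Set (Key n), Frame D h h' → (∀ q : Fin m × Finset (Fin n) × Fin n, keyG q ∉ D) →
      ∀ i ∈ i₀ :: is, i.Good M h' c (ls i) := by
    intro h' D hF hD i hi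
    obtain ⟨j, hj, rfl⟩ := hmem i hi
    rw [hlsj]
    exact ⟨(lq3 (j, S ∩ H.edge j, c)).congr hF (hD _),
      fun u hu => Bd.of_mem_prjFin hM ((lq2 (j, S ∩ H.edge j, c) u).1 hu), lq1 (j, S ∩ H.edge j, c)⟩
  -- The candidates are exactly the relations that contain `c`, so the smallest group has size
  -- `minDeg`, the quantity bounded by Finner's inequality.
  have hmin : ∀ t, ∀ i ∈ i₀ :: is, (∀ i' ∈ i₀ :: is,
      (grp i.set (ls i) t).length ≤ (grp i'.set (ls i') t).length) →
      minDeg I S c t = (grp i.set (ls i) t).length := by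
    intro t i hi hle
    obtain ⟨j, hj, rfl⟩ := hmem i hi
    rw [hlen]
    refine minDeg_eq hj fun j' hj' => ?_
    have := hle _ (hmem' j' hj')
    rwa [hlen, hlen] at this
  have hne : S.erase c ≠ S := fun h => Finset.notMem_erase c S (by rw [h]; exact hcS)
  have skip : ∀ h', Frame ∅ h h' → (Done h S ∨ ¬ Done h (S.erase c) ∨ N < stepCost I S c) →
      StepPost I M N h S c h' := by
    intro h' hF hor
    have hd : ∀ S, Done h' S ↔ Done h S := fun S => Done.congr hF (Set.notMem_empty _)
    refine ⟨hs.congr hF, hF.mono (Set.empty_subset _), (hd S).2, fun h1 h2 => ?_⟩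
    rcases hor with h3 | h3 | h3
    · exact (hd S).2 h3
    · exact absurd h1 h3
    · omega
  refine Tri.ifEq (show 0 < W by omega) (show 0 < W by omega) (by omega) (fun e1 => ?_)
    fun e1 => Tri.skip (skip h (.refl _ _) (Or.inl (by_contra fun h3 => e1 (hs.free S h3).1)))
  refine Tri.ifEq (show 0 < W by omega) h1W (by omega) (fun e2 => ?_)
    fun e2 => Tri.skip (skip h (.refl _ _) (Or.inr (Or.inl e2)))
  have hnS : ¬ Done h S := fun h3 => by
    have e1' : h.w (.tab 0 (keyD S)) 0 = 0 := e1
    rw [Done, e1'] at h3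
    omega
  have hdone : Done h (S.erase c) := e2
  obtain ⟨l, hl, hlm, hlN⟩ := hs.join _ hdone
  have hsum : (l.map (minDeg I S c)).sum = stepCost I S c := by
    rw [stepCost, ← List.sum_toFinset _ hl.nodup]
    refine Finset.sum_congr ?_ fun _ _ => rfl
    ext t
    rw [List.mem_toFinset, hlm, mem_joinFin]
  have hcW : stepCost I S c < W := by
    have := stepCost_le_pow hf.pos hM S c
    have := hf.pow_lt (i := 2 * n) (by omega)
    omega
  refine Tri.seq (costPass_tri hf hs.inp.pow hl ls (hgood h ∅ (.refl _ _) fun _ => id)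
    (minDeg I S c) (fun t _ i hi hle => hmin t i hi hle) (by omega)) ?_
  rintro h1 ⟨F1, h18⟩
  rw [hsum] at h18
  have hs1 := hs.congr F1
  refine Tri.ifLt (show 0 < W by omega) ⟨by omega, by rw [h18]; exact hcW⟩ (by omega)
    (fun e3 => Tri.skip (skip h1 F1 (Or.inr (Or.inr ?_)))) fun e3 => ?_
  · have : h1.w (.tab 0 keyN) 0 < h1.loc 8 := e3
    rwa [hs1.cell, h18] at this
  have hle : stepCost I S c ≤ N := by
    have : ¬ h1.w (.tab 0 keyN) 0 < h1.loc 8 := e3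
    rw [hs1.cell, h18] at this
    omega
  have hkne : (keyJ (S.erase c) : Key n) ≠ keyJ S := fun h => hne (by simpa [keyJ] using h)
  have hfree := (hs.free S hnS).2.congr F1 (Set.notMem_empty _)
  have hlc : ∀ t ∈ l, t c = 0 := fun t ht =>
    proj_eq_self_iff.1 ((hlm t).1 ht).1 c (Finset.notMem_erase c S)
  refine Tri.seq (extend_tri hf hs1.inp.pow hkne (by simp [keyJ, baseKey])
    (hl.congr F1 (Set.notMem_empty _)) (hfree.tab M) hlc ls
    (fun i hi => ⟨?_, hgood h1 ∅ F1 (fun _ => id) i hi⟩)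
    (P := fun t' => ∀ j, (S ∩ H.edge j).Nonempty →
      proj (S ∩ H.edge j) t' ∈ prjFin I j (S ∩ H.edge j)) (v := fun _ => 1) (x := .one)
    (fun t ht h' hF h9 => ?_) (fun _ _ _ _ _ _ => ⟨trivial, rfl⟩)
    (fun t t' => (∀ j, (S ∩ H.edge j).Nonempty →
      proj (S ∩ H.edge j) t' ∈ prjFin I j (S ∩ H.edge j)) ∧ ∃ v, t' = Function.update t c v)
    (fun t ht i hi t' => ?_) (minDeg I S c) (fun t ht i hi hle => (hmin t i hi hle).ge)
    (by rw [hsum]; omega)) ?_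
  · obtain ⟨j, -, rfl⟩ := hmem i hi
    simp [grpOf, keyG, keyJ]
  · have hin : Inp I M h' := hs1.inp.congr hF (by rintro d hd rfl; simp [keyJ] at hd)
    exact fitsL_spec hf hin.pow hin.prj ht h9 S
  · obtain ⟨j, hj, rfl⟩ := hmem i hi
    rw [hlsj]
    exact extends_iff hcS hj (lq2 (j, S ∩ H.edge j, c))
  rintro h2 ⟨F2, l', T, len⟩
  rw [hsum] at len
  refine Blk.tri ⟨show 0 < W by omega, h1W⟩ ?_ (by omega)
  set h3 := (Blk.set (.tab 0 (keyD S)) (.lit 0) (.lit 1) : Blk n m ι).run O h2 with hh3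
  have F3 : Frame {keyD S} h2 h3 := (Frame.refl _ _).setW (Set.mem_singleton _) _ _ _
  have F : Frame {keyJ S, keyD S} h h3 := ((F1.mono (Set.empty_subset _)).trans
    (F2.mono (by simp))).trans (F3.mono (by simp))
  have hd3 : Done h3 S := by
    show (Function.update h2.w _ _) _ _ = _
    simp [Exp.eval]
  have hdo : ∀ S', S' ≠ S → (Done h3 S' ↔ Done h S') := fun S' hS' =>
    Done.congr F (by simpa [keyD, keyJ] using hS')
  have hnot : ∀ d : Key n, d.1 ≠ 3 → d ∉ ({keyJ S, keyD S} : Set (Key n)) := by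
    rintro d hd (rfl | rfl) <;> exact hd rfl
  refine ⟨⟨hs.inp.congr F fun d hd => hnot d (by omega), ?_, fun S' hS' => ?_, fun S' hS' => ?_, ?_,
    fun d hd => (hs.fresh d hd).congr F (hnot d (by omega))⟩, F, fun _ => hd3, fun _ _ => hd3⟩
  · rw [F.w (by simp [keyN, keyJ, keyD])]; exact hs.cell
  · by_cases hSS : S' = S
    · subst hSS
      refine ⟨l', T.toLst.congr F3 (by simp [keyJ, keyD]), fun t => ?_, len.trans hle⟩
      rw [T.mem, onSet_isSome, inJoin_iff_exists hcS]
      simp only [Set.mem_ofPred_eq, hlm]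
    · exact (hs.join S' ((hdo S' hSS).1 hS')).congr F (by simpa [keyD, keyJ] using hSS)
  · have hSS : S' ≠ S := fun h => hS' (h ▸ hd3)
    obtain ⟨a1, a2⟩ := hs.free S' fun h => hS' ((hdo S' hSS).2 h)
    exact ⟨by rw [F.w (by simpa [keyD, keyJ] using hSS)]; exact a1,
      a2.congr F (by simpa [keyD, keyJ] using hSS)⟩
  · have : (∅ : Finset (Fin n)) ≠ S := by rintro rfl; cases hcS
    exact (hdo ∅ this).2 hs.empty

end LocalJoins

end Ajar

end

noncomputable section

namespace Ajar

/-! ### Doubling the bound until the local joins of some plan are present. -/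

section Doubling

variable {n m : ℕ} {ι K : Type*} {H : Hypergraph n m} [CommMonoidWithZero K]
  {W M N X : ℕ} {I : Instance H K} {O : PlusOps ι K}

/-- The steps of the computation of all local joins, by increasing size. -/
def stepList (n : ℕ) : List (Finset (Fin n) × Fin n) :=
  ((Finset.univ : Finset (Finset (Fin n) × Fin n)).filter fun p => p.2 ∈ p.1).toList.insertionSort
    fun p q => p.1.card ≤ q.1.card

theorem mem_stepList {p : Finset (Fin n) × Fin n} : p ∈ stepList n ↔ p.2 ∈ p.1 := by
  simp [stepList, List.mem_insertionSort]

theorem pairwise_stepList :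
    (stepList n).Pairwise fun p q => p.1.card ≤ q.1.card := by
  have : IsTrans (Finset (Fin n) × Fin n) fun p q => p.1.card ≤ q.1.card :=
    ⟨fun _ _ _ => le_trans⟩
  have : Std.Total (α := Finset (Fin n) × Fin n) fun p q => p.1.card ≤ q.1.card :=
    ⟨fun _ _ => le_total _ _⟩
  exact List.pairwise_insertionSort _ _

/-- Computes all local joins that are cheap enough. -/
def passCmd (H : Hypergraph n m) : Cmd ι := seqL (stepList n) fun p => stepCmd H p.1 p.2

def JKeys : Set (Key n) := {d | d.1 = 3 ∧ d.2.1 ≤ 1}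

/-- Steps are ordered by the size of the set, so the predecessor `S.erase c` is settled before `S`
is treated. Hence the closure property holds with reference to the final state: a cheap step from a
present join leads to a present join. -/
theorem passCmd_tri (hf : Fit n m W M) (hM : I.Below M) (hN1 : 1 ≤ N)
    {h : HS n m K} (hs : JSt I M N h) (hX : 2 * N + 1 ≤ X) :
    Tri O W (passCmd H) h X fun h' => JSt I M N h' ∧ Frame JKeys h h' ∧
      ∀ S c, c ∈ S → Done h' (S.erase c) → stepCost I S c ≤ N → Done h' S := by
  refine (Tri.seqL (fun pre h' => JSt I M N h' ∧ Frame JKeys h h' ∧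
    ∀ p ∈ pre, Done h' (p.1.erase p.2) → stepCost I p.1 p.2 ≤ N → Done h' p.1)
    ⟨hs, .refl _ _, by simp⟩ ?_).mono le_rfl fun h' ⟨a, b, c⟩ =>
      ⟨a, b, fun S c' hc => c (S, c') (mem_stepList.2 hc)⟩
  rintro pre ⟨S, c⟩ post hpre h' ⟨hs', F, hd⟩
  have hcS : c ∈ S := mem_stepList.1 (show (S, c) ∈ stepList n by rw [hpre]; simp)
  have hsort : ∀ p ∈ pre, p.1.card ≤ S.card := fun p hp => by
    have := pairwise_stepList (n := n)
    rw [hpre] at this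
    exact (List.pairwise_append.1 this).2.2 p hp (S, c) (by simp)
  refine (stepCmd_tri hf hM hN1 hs' hcS hX).mono le_rfl ?_
  rintro h'' ⟨hs'', F', hmono, hstep⟩
  have hdo : ∀ S', S' ≠ S → (Done h'' S' ↔ Done h' S') := fun S' hS' =>
    Done.congr F' (by simpa [keyD, keyJ] using hS')
  -- Predecessors of sets treated so far are strictly smaller than `S`, so the current step does not
  -- change whether they are present.
  have hless : ∀ (S' : Finset (Fin n)) (a : Fin n), a ∈ S' → S'.card ≤ S.card → S'.erase a ≠ S := by
    rintro S' a ha hle rfl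
    have := Finset.card_erase_lt_of_mem ha
    omega
  refine ⟨hs'', F.trans (F'.mono ?_), fun p hp h1 h2 => ?_⟩
  · rintro d (rfl | rfl)
    · exact ⟨rfl, Nat.zero_le _⟩
    · exact ⟨rfl, le_rfl⟩
  · rcases List.mem_append.1 hp with hp | hp
    · have hpm : p.2 ∈ p.1 := mem_stepList.1 (by rw [hpre]; simp [hp])
      rw [hdo _ (hless _ _ hpm (hsort p hp))] at h1
      have := hd p hp h1 h2
      by_cases hpS : p.1 = S
      · rw [hpS] at this ⊢; exact hmono this
      · exact (hdo _ hpS).2 this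
    · rw [List.mem_singleton] at hp
      subst hp
      exact hstep ((hdo _ (hless S c hcS le_rfl)).1 h1) h2

-- The set `U` is built up by adding its attributes in increasing order. The intermediate sets are
-- the initial segments `U.filter (· ≤ c)`, the same sets that appear in `PlanCost`.
omit [CommMonoidWithZero K] in
theorem done_of_filter {h : HS n m K} (h0 : Done h ∅)
    (hd : ∀ S c, c ∈ S → Done h (S.erase c) → stepCost I S c ≤ N → Done h S) (U : Finset (Fin n))
    (hU : ∀ c ∈ U, stepCost I (U.filter (· ≤ c)) c ≤ N) : Done h U := by
  induction U using Finset.induction_on_max with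
  | empty => exact h0
  | insert a s has ih =>
    have hns : a ∉ s := fun h => lt_irrefl a (has a h)
    refine hd _ a (Finset.mem_insert_self a s) ?_ ?_
    · rw [Finset.erase_insert hns]
      refine ih fun c hc => ?_
      have := hU c (Finset.mem_insert_of_mem hc)
      rwa [Finset.filter_insert, if_neg (not_le.2 (has c hc))] at this
    · have := hU a (Finset.mem_insert_self a s)
      rwa [Finset.filter_true_of_mem fun x hx => ?_] at this
      rcases Finset.mem_insert.1 hx with rfl | hx
      · exact le_rfl
      · exact (has x hx).le

/-- Branching on the presence of the local joins over all sets in a list. -/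
def ifDone (m : ℕ) (L : List (Finset (Fin n))) (c d : Cmd ι) : Cmd ι :=
  L.foldr (fun S r => cIfEq (cntE (m := m) (keyD S)) (.lit 1) r d) c

theorem ifDone_tri {L : List (Finset (Fin n))} {c d : Cmd ι} {h : HS n m K}
    {Q : HS n m K → Prop} (h1W : 1 < W) (hX : 1 ≤ X)
    (hc : (∀ S ∈ L, Done h S) → Tri O W c h X Q) (hd : ¬ (∀ S ∈ L, Done h S) → Tri O W d h X Q) :
    Tri O W (ifDone m L c d) h X Q := by
  induction L with
  | nil => exact hc (by simp)
  | cons S L ih =>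
    refine Tri.ifEq (show 0 < W by omega) h1W hX (fun hS => ih (fun hL => hc ?_) fun hL => hd ?_)
      fun hS => hd fun hL => hS (hL S (by simp))
    · exact fun S' hS' => (List.mem_cons.1 hS').elim (fun h => h ▸ hS) (hL S')
    · exact fun h => hL fun S' hS' => h S' (List.mem_cons_of_mem _ hS')

/-- Runs the program of the first plan whose local joins are present. -/
def firstDone {A : Type*} (m : ℕ) (need : A → List (Finset (Fin n))) (leaf : A → Cmd ι)
    (l : List A) : Cmd ι := l.foldr (fun a r => ifDone m (need a) (leaf a) r) .skip

theorem firstDone_tri {A : Type*} {need : A → List (Finset (Fin n))} {leaf : A → Cmd ι}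
    {l : List A} {h : HS n m K} {Q : HS n m K → Prop} (h1W : 1 < W) (hX : 1 ≤ X)
    (hl : ∀ a ∈ l, (∀ S ∈ need a, Done h S) → Tri O W (leaf a) h X Q)
    (hn : (∀ a ∈ l, ¬ ∀ S ∈ need a, Done h S) → Q h) :
    Tri O W (firstDone m need leaf l) h X Q := by
  induction l with
  | nil => exact Tri.skip (hn (by simp))
  | cons a l ih =>
    refine ifDone_tri h1W hX (hl a (by simp)) fun ha =>
      ih (fun b hb => hl b (List.mem_cons_of_mem a hb)) fun hb => hn fun b hbl => ?_
    rcases List.mem_cons.1 hbl with rfl | hbl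
    · exact ha
    · exact hb b hbl

/-- The key of the flag that ends the search. -/
def keyF : Key n := (3, 3, ∅)

/-- Computes local joins, doubling the bound for their costs until those for some plan are
present. -/
def searchCmd {A : Type*} (H : Hypergraph n m) (need : A → List (Finset (Fin n))) (l : List A) :
    Cmd ι :=
  .seq (Blk.seq (.set (.tab 0 (keyJ ∅)) (.lit 0) (.lit 1))
      (.seq (.set (.tab 0 (keyD ∅)) (.lit 0) (.lit 1))
        (.set (.tab 0 keyN) (.lit 0) (.lit 1))) : Blk n m ι).code
    (whileLt (cntE (n := n) (m := m) keyF) (.lit 1)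
      (.seq (Blk.set (.tab 0 keyN) (.lit 0) (.mul (cntE keyN) (.lit 2)) : Blk n m ι).code
        (.seq (passCmd H) (firstDone m need
          (fun _ => (Blk.set (.tab 0 keyF) (.lit 0) (.lit 1) : Blk n m ι).code) l))))

theorem JSt.mono {N' : ℕ} {h h' : HS n m K} (hs : JSt I M N h) (hN : N ≤ N')
    (hF : Frame {keyN} h h') (hc : h'.w (.tab 0 keyN) 0 = N') : JSt I M N' h' := by
  have hd : ∀ S, Done h' S ↔ Done h S := fun S => Done.congr hF (by simp [keyD, keyN])
  have hJ : ∀ S, keyJ S ∉ ({keyN} : Set (Key n)) := fun S => by simp [keyJ, keyN]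
  refine ⟨hs.inp.congr hF (by rintro d hd rfl; simp [keyN] at hd), hc, fun S h => ?_, fun S h => ?_,
    (hd ∅).2 hs.empty, fun d h => (hs.fresh d h).congr hF (by rintro rfl; simp [keyN] at h)⟩
  · obtain ⟨l, h1, h2, h3⟩ := (hs.join S ((hd S).1 h)).congr hF (hJ S)
    exact ⟨l, h1, h2, h3.trans hN⟩
  · obtain ⟨h1, h2⟩ := hs.free S fun h3 => h ((hd S).2 h3)
    exact ⟨by rw [hF.w (by simp [keyD, keyN])]; exact h1, h2.congr hF (hJ S)⟩

/-- The local join over the empty set consists of the zero tuple, even if some relation is empty,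
because only relations that meet the set are tested. Its code is `0`, so only the counter has to be
written. -/
theorem jst_init (hf : Fit n m W M) {h h' : HS n m K} (hi : Inp I M h)
    (hu : ∀ d : Key n, d.1 = 3 ∨ 5 ≤ d.1 → Unused h d)
    (hF : Frame {keyJ ∅, keyD ∅, keyN} h h')
    (hw : h'.w (.tab 0 (keyJ ∅)) 0 = 1) (hw1 : h'.w (.tab 1 (keyJ ∅)) 0 = 0)
    (hD : h'.w (.tab 0 (keyD ∅)) 0 = 1) (hN : h'.w (.tab 0 keyN) 0 = 1) : JSt I M 1 h' := by
  have hk : ∀ d : Key n, d.1 ≠ 3 → d ∉ ({keyJ ∅, keyD ∅, keyN} : Set (Key n)) := by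
    rintro d hd (rfl | rfl | rfl) <;> exact hd rfl
  have hdn : ∀ S, S ≠ ∅ → h'.w (.tab 0 (keyD S)) 0 = 0 := fun S hS => by
    rw [hF.w (by simpa [keyD, keyJ, keyN] using hS)]
    exact hu _ (Or.inl rfl) 0 0
  refine ⟨hi.congr hF fun d hd => hk d (by omega), hN, fun S hS => ?_, fun S hS => ?_, hD,
    fun d hd => (hu d (Or.inr hd)).congr hF (hk d (by omega))⟩
  · by_cases hSe : S = ∅
    · subst hSe
      have h0 : ∀ t : Tup n, proj ∅ t = fun _ => 0 := fun t => funext fun a => if_neg (by simp)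
      refine ⟨[fun _ => 0], ⟨hw, fun i hi => ?_, by simp, fun t ht a => ?_⟩, fun t => ?_, le_rfl⟩
      · have : i = 0 := by simpa using hi
        subst this
        simp [hw1, enc]
      · rw [List.mem_singleton] at ht
        subst ht
        exact hf.pos
      · rw [List.mem_singleton, InJoin, h0]
        simp [eq_comm]
    · rw [Done, hdn S hSe] at hS
      omega
  · have hSe : S ≠ ∅ := by rintro rfl; exact hS hD
    exact ⟨hdn S hSe, (hu _ (Or.inl rfl)).congr hF (by simpa [keyD, keyJ, keyN] using hSe)⟩

/-- A pass with a bound of at least `N₀` completes the given plan, unless another plan is found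
earlier. So the final bound is at most `2 * N₀`, and the passes cost a geometric series dominated by
its last term. -/
theorem searchCmd_tri {A : Type*} {need : A → List (Finset (Fin n))} {l : List A}
    (hf : Fit n m W M) (hM : I.Below M) {N₀ : ℕ} (hN : 1 ≤ N₀)
    (hplan : ∃ a ∈ l, ∀ U ∈ need a, ∀ c ∈ U, stepCost I (U.filter (· ≤ c)) c ≤ N₀)
    {h : HS n m K} (hi : Inp I M h) (hu : ∀ d : Key n, d.1 = 3 ∨ 5 ≤ d.1 → Unused h d)
    (hX : 12 * N₀ + 1 ≤ X) :
    Tri O W (searchCmd H need l) h X fun h' => ∃ N, JSt I M N h' ∧ N ≤ 2 * N₀ ∧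
      ∃ a ∈ l, ∀ S ∈ need a, Done h' S := by
  have h1W : 1 < W := hf.small (by omega)
  have h2W : 2 < W := hf.small (by omega)
  have h0W : 0 < W := by omega
  -- the costs are bounded by the number of pairs of codes
  wlog hNM : N₀ ≤ M ^ (2 * n) generalizing N₀
  · refine (this (N₀ := M ^ (2 * n)) (Nat.pow_pos hf.pos) ?_ (by omega) le_rfl).mono le_rfl ?_
    · obtain ⟨a, ha, -⟩ := hplan
      exact ⟨a, ha, fun U _ c _ => stepCost_le_pow hf.pos hM _ c⟩
    · rintro h' ⟨N, h1, h2, h3⟩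
      exact ⟨N, h1, by omega, h3⟩
  have hNW : 7 * N₀ < W := by
    have := hf.pow_lt (i := 2 * n) (by omega)
    omega
  refine Tri.seq (Q := fun h' => JSt I M 1 h' ∧ h'.w (.tab 0 keyF) 0 = 0)
    (Blk.tri ⟨⟨h0W, h1W⟩, ⟨h0W, h1W⟩, h0W, h1W⟩ ⟨jst_init hf hi hu ?_ ?_ ?_ ?_ ?_, ?_⟩ (by omega)) ?_
  · exact (((Frame.refl _ _).setW (by simp) _ _ _).setW (by simp) _ _ _).setW (by simp) _ _ _
  · simp [Blk.run, Exp.eval, keyJ, keyD, keyN]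
  · simpa [Blk.run, Exp.eval, keyJ, keyD, keyN] using hu (keyJ ∅) (Or.inl rfl) 1 0
  · simp [Blk.run, Exp.eval, keyJ, keyD, keyN]
  · simp [Blk.run, Exp.eval, keyJ, keyD, keyN]
  · simpa [Blk.run, Exp.eval, keyJ, keyD, keyN, keyF] using hu keyF (Or.inl rfl) 0 0
  rintro h0 ⟨hs0, hf0⟩
  -- While the search goes on, the potential is `12 * N₀ - 6 * N` with `N ≤ N₀`; once the flag is
  -- set, nothing remains to be paid.
  refine Tri.whileLt (fun p h => ∃ N, JSt I M N h ∧ 1 ≤ N ∧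
    ((h.w (.tab 0 keyF) 0 = 0 ∧ N ≤ N₀ ∧ p + 6 * N = 12 * N₀) ∨
      (h.w (.tab 0 keyF) 0 = 1 ∧ N ≤ 2 * N₀ ∧ ∃ a ∈ l, ∀ S ∈ need a, Done h S))) ?_
    (p := 12 * N₀ - 6) ⟨1, hs0, le_rfl, Or.inl ⟨hf0, hN, by omega⟩⟩ (by omega)
  rintro p h1 ⟨N, hs, hN1, hor⟩
  refine ⟨h0W, h1W, fun hlt => ?_, fun hge => ?_⟩
  swap
  · rcases hor with ⟨h2, -⟩ | ⟨-, h3, h4⟩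
    · exact absurd (show h1.w (.tab 0 keyF) 0 < 1 by omega) hge
    · exact ⟨N, hs, h3, h4⟩
  have hflag : h1.w (.tab 0 keyF) 0 < 1 := hlt
  rcases hor with ⟨h2, hNN, hp⟩ | ⟨h2, -⟩
  swap
  · omega
  -- A pass with the bound `2 * N` needs the factor `2 * (2 * N) + 1 ≤ 5 * N`, while doubling `N`
  -- releases `6 * N` units of potential.
  refine ⟨5 * N, 12 * N₀ - 12 * N, by omega, by omega, ?_⟩
  have ev : (Exp.mul (cntE keyN) (.lit 2) : Exp n m).eval h1 = N * 2 := by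
    show h1.w (.tab 0 keyN) 0 * 2 = _
    rw [hs.cell]
  refine Tri.seq (Q := fun h' => JSt I M (2 * N) h' ∧ h'.w (.tab 0 keyF) 0 = 0)
    (Blk.tri ⟨h0W, h0W, h2W, ?_⟩ ?_ (by omega)) ?_
  · show h1.w (.tab 0 keyN) 0 * 2 < W
    rw [hs.cell]
    omega
  · rw [Blk.run, ev]
    refine ⟨hs.mono (by omega) ((Frame.refl _ _).setW (Set.mem_singleton _) _ _ _) ?_, ?_⟩
    · simp [Exp.eval, mul_comm]
    · simpa [Exp.eval, keyF, keyN] using h2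
  rintro h3 ⟨hs3, hf3⟩
  refine Tri.seq (passCmd_tri hf hM (by omega) hs3 (by omega)) ?_
  rintro h4 ⟨hs4, F4, hd4⟩
  have hf4 : h4.w (.tab 0 keyF) 0 = 0 := by
    rw [F4.w fun h => absurd h.2 (by simp [keyF])]
    exact hf3
  refine firstDone_tri h1W (by omega) (fun a ha had => ?_) fun hnone => ?_
  · have F5 := (Frame.refl ({keyF} : Set (Key n)) h4).setW (Set.mem_singleton _) 0 0 1
    have hk : ∀ d : Key n, d.1 ≠ 3 → d ∉ ({keyF} : Set (Key n)) := by
      rintro d hd rfl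
      exact hd rfl
    have hd5 : ∀ S, Done (h4.setW (.tab 0 keyF) 0 1) S ↔ Done h4 S := fun S =>
      Done.congr F5 (by simp [keyD, keyF])
    refine Blk.tri ⟨h0W, h1W⟩ ⟨2 * N, ?_, by omega,
      Or.inr ⟨by simp [Blk.run, Exp.eval], by omega, a, ha, fun S hS => (hd5 S).2 (had S hS)⟩⟩
      (by omega)
    refine ⟨hs4.inp.congr F5 fun d hd => hk d (by omega), ?_, fun S hS => ?_, fun S hS => ?_,
      (hd5 ∅).2 hs4.empty, fun d hd => (hs4.fresh d hd).congr F5 (hk d (by omega))⟩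
    · rw [Blk.run, Exp.eval, Exp.eval, F5.w (by simp [keyN, keyF])]
      exact hs4.cell
    · exact (hs4.join S ((hd5 S).1 hS)).congr F5 (by simp [keyJ, keyF])
    · obtain ⟨a1, a2⟩ := hs4.free S fun h => hS ((hd5 S).2 h)
      exact ⟨by rw [Blk.run, Exp.eval, Exp.eval, F5.w (by simp [keyD, keyF])]; exact a1,
        a2.congr F5 (by simp [keyJ, keyF])⟩
  · refine ⟨2 * N, hs4, by omega, Or.inl ⟨hf4, ?_, by omega⟩⟩
    -- If `2 * N` exceeded `N₀`, the pass just finished would have completed the given plan, and the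
    -- flag would have been set.
    by_contra hlt2
    obtain ⟨a, ha, hcost⟩ := hplan
    exact hnone a ha fun U hU => done_of_filter hs4.empty hd4 U fun c hc =>
      (hcost U hU c hc).trans (by omega)

end Doubling

end Ajar

end

noncomputable section

namespace Ajar

/-! ### Writing the answer in the output format. -/

section Output

variable {n m : ℕ} {ι K : Type*} {H : Hypergraph n m} [CommMonoidWithZero K]
  {W M X : ℕ} {I : Instance H K} {O : PlusOps ι K} {α : Ordering n ι}

/-- The states have the same tables. -/
def SameTabs (h h' : HS n m K) : Prop :=
  ∀ k d, h'.w (.tab k d) = h.w (.tab k d) ∧ h'.k (.tab k d) = h.k (.tab k d)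

/-- Writes the tuple listed in table `d` at the position in local variable `0` to the output. -/
def rowB (d : Key n) (L : List (Fin n)) : Blk n m ι :=
  L.foldr (fun a b => .seq (.set (.out a) (.loc 0) (digE a (.get (.tab 1 d) (.loc 0)))) b)
    (.aset .res (.loc 0) (.get (.tab 0 d) (.get (.tab 1 d) (.loc 0))))

/-- Writes table `d` to the output. -/
def writeCmd (m : ℕ) (d : Key n) : Cmd ι :=
  .seq (forI (m := m) 0 (cntE d) (rowB (m := m) d (List.finRange n)).code)
    (Blk.loc (m := m) 0 (cntE d)).code

theorem rowB_spec (hf : Fit n m W M) {h : HS n m K} (hp : HasPow M h) {d : Key n} {k : ℕ}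
    (hk : k < W) {t : Tup n} (ht : Bd M t) (e1 : h.w (.tab 1 d) k = enc M t) {x : K}
    (ex : h.k (.tab 0 d) (enc M t) = x) (L : List (Fin n)) {h' : HS n m K} (hs : SameTabs h h')
    (h0 : h'.loc 0 = k) :
    (rowB d L : Blk n m ι).Ok O W h' ∧ SameTabs h ((rowB d L).run O h') ∧
      ((rowB d L).run O h').loc = h'.loc ∧
      (∀ a i, ((rowB d L).run O h').w (.out a) i =
        if a ∈ L ∧ i = k then t a else h'.w (.out a) i) ∧
      ∀ i, ((rowB d L).run O h').k .res i = if i = k then x else h'.k .res i := by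
  have hloc : ∀ h' : HS n m K, h'.loc 0 = k → (Exp.loc 0 : Exp n m).Ok W h' := fun h' e =>
    ⟨by omega, by omega⟩
  have hget : ∀ h' : HS n m K, SameTabs h h' → h'.loc 0 = k →
      (Exp.get (.tab 1 d) (.loc 0) : Exp n m).eval h' = enc M t := fun h' hs e => by
    rw [Exp.eval, Exp.eval, e, (hs 1 d).1, e1]
  induction L generalizing h' with
  | nil =>
    refine ⟨⟨hloc h' h0, hloc h' h0⟩,
      fun k' d' => by simpa [rowB, Blk.run] using hs k' d', rfl, fun a i => by simp [rowB, Blk.run], fun i => ?_⟩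
    show Function.update h'.k Nm.res _ Nm.res i = _
    have : (AExp.get (.tab 0 d) (.get (.tab 1 d) (.loc 0)) : AExp n m ι).eval O h' = x := by
      rw [AExp.eval, hget h' hs h0, (hs 0 d).2, ex]
    rw [Function.update_self, this, Exp.eval, h0, Function.update_apply]
  | cons b L ih =>
    have hp' : HasPow M h' := fun i hi => by rw [(hs 1 baseKey).1]; exact hp i hi
    have ed := digE_eval hp' ht (hget h' hs h0) b
    have okd := digE_ok hf hp' ht (hget h' hs h0) (hloc h' h0) b
    set h1 := h'.setW (.out b) k (t b) with hh1
    have hrun : (Blk.set (.out b) (.loc 0) (digE b (.get (.tab 1 d) (.loc 0))) :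
        Blk n m ι).run O h' = h1 := by
      rw [Blk.run, ed, Exp.eval, h0]
    have hs1 : SameTabs h h1 := fun k' d' => by
      simpa [hh1] using hs k' d'
    obtain ⟨a1, a2, a3, a4, a5⟩ := ih hs1 (by simpa [hh1] using h0)
    have hrun2 : (rowB d (b :: L) : Blk n m ι).run O h' = (rowB d L).run O h1 := by
      rw [← hrun]; rfl
    rw [hrun2]
    refine ⟨⟨⟨hloc h' h0, okd⟩, by rw [hrun]; exact a1⟩, a2, a3, fun a i => ?_, fun i => ?_⟩
    · rw [a4]
      by_cases hab : a = b
      · subst hab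
        by_cases hik : i = k
        · simp [hh1, hik]
        · simp [hh1, hik]
      · simp [hh1, hab]
    · rw [a5]; rfl

theorem writeCmd_tri (hf : Fit n m W M) {h : HS n m K} (hp : HasPow M h) {d : Key n}
    {l : List (Tup n)} {f : Tup n → Option K} (hT : Tab M h d l f) (hX : l.length + 1 ≤ X) :
    Tri O W (writeCmd m d) h X fun h' => h'.loc 0 = l.length ∧
      ∀ i (hi : i < l.length), (∀ a, h'.w (.out a) i = l[i] a) ∧
        some (h'.k .res i) = f l[i] := by
  have h1W : 1 < W := hf.small (by omega)
  have hlW : l.length < W := by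
    have h1 := length_le_of_nodup_of_bd hT.nodup hT.bd
    have := hf.pow_lt (i := n) (by omega)
    omega
  refine Tri.seq (Tri.forI (fun k h' => SameTabs h h' ∧
    ∀ i (hi : i < l.length), i < k → (∀ a, h'.w (.out a) i = l[i] a) ∧
      some (h'.k .res i) = f l[i]) (fun _ => 1) (by omega) hlW h1W ⟨fun _ _ => ⟨rfl, rfl⟩, by simp⟩
    (fun i _ h' hs => ⟨show 0 < W by omega, ?_⟩) ?_ (by simpa using hX)) ?_
  · show h'.w (.tab 0 d) 0 = _
    rw [(hs.1 0 d).1]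
    exact hT.cnt
  · rintro k hk h' ⟨hs, hw⟩ h0
    obtain ⟨x, hx⟩ := Option.isSome_iff_exists.1 ((hT.mem l[k]).1 (List.getElem_mem hk))
    obtain ⟨a1, a2, a3, a4, a5⟩ := rowB_spec (O := O) hf hp (by omega) (hT.bd _ (List.getElem_mem hk))
      (hT.list k hk) (hT.val _ x hx) (List.finRange n) hs h0
    refine ⟨le_rfl, Blk.tri a1 ⟨by rw [a3, h0], a2, fun i hi hik => ?_⟩ le_rfl⟩
    rw [HS.setLoc_w, HS.setLoc_k]
    simp only [a4, a5, List.mem_finRange, true_and]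
    by_cases hik' : i = k
    · subst hik'
      simp [hx]
    · simpa [hik'] using hw i hi (by omega)
  · rintro h' ⟨hs, hw⟩
    have ec : (cntE d : Exp n m).eval h' = l.length := by
      show h'.w (.tab 0 d) 0 = _
      rw [(hs 0 d).1]
      exact hT.cnt
    refine Blk.tri ⟨by omega, show 0 < W by omega, by rw [ec]; exact hlW⟩ ⟨?_, fun i hi => ?_⟩
      (by omega)
    · rw [Blk.run, ec]; simp
    · rw [Blk.run]; exact hw i hi hi

/-! ### The answer as a set of tuples -/

def outSet (α : Ordering n ι) : Finset (Fin n) := Finset.univ.filter (· ∉ α.attrs)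

open Classical in
/-- The rows of the answer, filled up by `0`, are the tuples over the output attributes. -/
def answerEquiv (O : PlusOps ι K) (α : Ordering n ι) (I : Instance H K) :
    AnswerRows O α I ≃ {t : Tup n // proj (outSet α) t = t ∧ (query O α I t).isSome} where
  toFun s := ⟨fun a => if h : a ∉ α.attrs then s.1 ⟨a, h⟩ else 0,
    proj_eq_self_iff.2 fun a ha => dif_neg fun h => ha (by simpa [outSet] using h), s.2⟩
  invFun t := ⟨fun a => t.1 a, by
    have : (fun a => if h : a ∉ α.attrs then t.1 a else 0) = t.1 := by
      ext a
      by_cases ha : a ∉ α.attrs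
      · exact dif_pos ha
      · rw [dif_neg ha]
        exact (proj_eq_self_iff.1 t.2.1 a (by simpa [outSet] using ha)).symm
    rw [answer]
    convert t.2.2 using 3⟩
  left_inv s := by
    ext a
    exact dif_pos a.2
  right_inv t := by
    ext a
    by_cases ha : a ∉ α.attrs
    · exact dif_pos ha
    · exact (dif_neg ha).trans (proj_eq_self_iff.1 t.2.1 a (by simpa [outSet] using ha)).symm

theorem answerEquiv_apply (s : AnswerRows O α I) :
    query O α I (answerEquiv O α I s).1 = answer O α I s.1 := by
  rw [answer]
  rfl

theorem isOutput_of_list {l : List (Tup n)} (hl : l.Nodup)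
    (hm : ∀ t, t ∈ l ↔ proj (outSet α) t = t ∧ (query O α I t).isSome) {h : HS n m K}
    {τ : State K} (hs : Sim τ h) (h0 : h.loc 0 = l.length)
    (hw : ∀ i (hi : i < l.length), (∀ a, h.w (.out a) i = l[i] a) ∧
      some (h.k .res i) = query O α I l[i]) : IsOutput O α I τ := by
  have hcard : outSize O α I = l.length := by
    rw [outSize, Nat.card_congr (answerEquiv O α I),
      Nat.card_congr ((Equiv.subtypeEquivRight fun t => (hm t)).symm.trans
        (hl.getEquiv).symm), Nat.card_fin]
  refine ⟨by rw [hs.reg 0 (by omega), h0, hcard], (finCongr hcard).trans ((hl.getEquiv l).trans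
    ((Equiv.subtypeEquivRight hm).trans (answerEquiv O α I).symm)), fun i => ?_⟩
  have hi : (i : ℕ) < l.length := hcard ▸ i.2
  obtain ⟨h1, h2⟩ := hw i hi
  refine ⟨fun a => ?_, ?_⟩
  · have := congrFun (hs.arr (.out a.1)) i
    rw [h1] at this
    exact this
  · have := congrFun (hs.ann .res) i
    rw [← answerEquiv_apply, Equiv.trans_apply, Equiv.trans_apply, Equiv.trans_apply,
      Equiv.apply_symm_apply]
    refine (congrArg some this).trans h2

end Output

/-! ### Running a plan whose local joins are available. -/

section Plan

variable {n m : ℕ} {ι K : Type*} {H : Hypergraph n m} [CommMonoidWithZero K]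
  {W M N X Y : ℕ} {I : Instance H K} {O : PlusOps ι K} {α : Ordering n ι}

/-- The tables of the relations. -/
def inFac (H : Hypergraph n m) : List (Fac n) := List.ofFn fun j => ⟨keyR j, H.edge j⟩

def inRel (I : Instance H K) : List (Fac n × Rel n K) :=
  List.ofFn fun j => (⟨keyR j, H.edge j⟩, relTup I j)

theorem joinL_inRel (I : Instance H K) : joinL ((inRel I).map Prod.snd) = I.join := by
  ext1 t
  have e : (inRel I).map Prod.snd = List.ofFn (relTup I) := by
    rw [inRel, List.map_ofFn]; rfl
  rw [e]
  refine Option.eq_of_getD 1 ?_ fun h1 h2 => ?_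
  · rw [joinL_isSome, Instance.join]
    split_ifs with h
    · simpa [List.mem_ofFn, relTup] using h
    · simpa [List.mem_ofFn, relTup] using h
  · rw [joinL_isSome] at h1
    have h3 : ∀ j, (I.rel j fun a => t a).isSome := fun j => h1 _ (List.mem_ofFn.2 ⟨j, rfl⟩)
    rw [joinL_getD h1, Instance.join, if_pos h3, List.map_ofFn, List.prod_ofFn]
    rfl

/-- Eliminates the attributes in the order of a plan and writes the answer. -/
def runCmd (H : Hypergraph n m) (p : Ordering n ι × List (Fin n)) : Cmd ι :=
  .seq (aggCmd (m := m) 0 p.1.reverse (inFac H))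
    (.seq (outCmd (m := m) (0 + p.1.reverse.length) p.2 (aggFac 0 p.1.reverse (inFac H)))
      (writeCmd (n := n) m (keyZ (0 + p.1.reverse.length))))

/-- The sets over which a plan needs the local joins. -/
def needOf (H : Hypergraph n m) (p : Ordering n ι × List (Fin n)) : List (Finset (Fin n)) :=
  needs (elimOrder p.1 p.2) (List.ofFn H.edge)

omit [CommMonoidWithZero K] in
theorem Fac.Good.mono {e : Fac n} {h : HS n m K} {R : Rel n K} {Y' : ℕ} (he : e.Good I M Y h R)
    (hY : Y ≤ Y') : e.Good I M Y' h R := by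
  obtain ⟨l, h1, h2⟩ := he.tab
  exact ⟨he.dep, ⟨l, h1, h2.trans hY⟩, he.dom⟩

omit [CommMonoidWithZero K] in
theorem elimOrder_fst (β : Ordering n ι) (γ : List (Fin n)) :
    (elimOrder β γ).map Prod.fst = β.attrs.reverse ++ γ := by
  simp [elimOrder, Ordering.attrs, Function.comp_def]

theorem est_init {h : HS n m K} (hs : JSt I M N h) (hIY : I.inSize ≤ Y) (hNY : N ≤ Y)
    {β : Ordering n ι} {γ : List (Fin n)} (hβ : α.Perm β) (hγ : γ.Perm (outList α))
    (hα : α.attrs.Nodup) (hd : ∀ S ∈ needOf H (β, γ), Done h S) :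
    ESt I M Y 0 h (inRel I) (elimOrder β γ) := by
  have hfst := elimOrder_fst β γ
  have hattr : ∀ a, a ∈ β.attrs ↔ a ∈ α.attrs := fun a => ((hβ.map Prod.fst).mem_iff).symm
  have hall : ∀ a, a ∈ (elimOrder β γ).map Prod.fst := fun a => by
    rw [hfst, List.mem_append, List.mem_reverse, hattr, hγ.mem_iff, outList]
    simp [em]
  have hmem : ∀ p ∈ inRel I, ∃ j, p = (⟨keyR j, H.edge j⟩, relTup I j) := fun p hp => by
    obtain ⟨j, rfl⟩ := List.mem_ofFn.1 hp
    exact ⟨j, rfl⟩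
  refine ⟨hs.inp.pow, hs.inp.dom, fun d hd => hs.fresh d (by omega), fun p hp => ?_, fun p hp => ?_,
    fun p hp a _ => List.mem_toFinset.2 (hall a), fun b _ => ?_, ?_, ?_, fun U hU => ?_⟩
  · obtain ⟨j, rfl⟩ := hmem p hp
    exact (hs.inp.rel j).mono hIY
  · obtain ⟨j, rfl⟩ := hmem p hp
    simp [keyR]
  · obtain ⟨j, hj⟩ := H.covered b
    exact ⟨_, List.mem_ofFn.2 ⟨j, rfl⟩, hj⟩
  · rw [hfst]
    refine List.nodup_append.2 ⟨List.nodup_reverse.2 ((hβ.map Prod.fst).nodup_iff.1 hα),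
      hγ.nodup_iff.2 ((List.nodup_finRange n).filter _), ?_⟩
    rintro a ha b hb rfl
    rw [List.mem_reverse, hattr] at ha
    have := hγ.mem_iff.1 hb
    simp [outList] at this
    exact this ha
  · intro t ht j
    rw [joinL_isSome] at ht
    refine ⟨⟨fun a => t a, ht (relTup I j) ?_⟩, fun a ha _ => by rw [rowTup, dif_pos ha]⟩
    exact List.mem_map.2 ⟨_, List.mem_ofFn.2 ⟨j, rfl⟩, rfl⟩
  · have e : (inRel I).map (fun p => p.1.sch) = List.ofFn H.edge := by
      rw [inRel, List.map_ofFn]; rfl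
    rw [e] at hU
    obtain ⟨l, h1, h2, h3⟩ := hs.join U (hd U hU)
    exact ⟨l, h1, h2, h3.trans hNY⟩

theorem runCmd_tri (hf : Fit n m W M) {h : HS n m K} (hs : JSt I M N h)
    {p : Ordering n ι × List (Fin n)} (hβ : Equivalent H O α p.1) (hγ : p.2.Perm (outList α))
    (hα : α.attrs.Nodup) (hidem : (∃ a, (a, Op.prod) ∈ α) → ∀ x : K, x * x = x)
    (hd : ∀ S ∈ needOf H p, Done h S)
    (hX : 2 * (I.inSize + N + outSize O α I) + 1 ≤ X) :
    Tri O W (runCmd H p) h X fun h' => ∀ τ, Sim τ h' → IsOutput O α I τ := by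
  obtain ⟨β, γ⟩ := p
  set Y := I.inSize + N + outSize O α I with hY
  have hE := est_init (Y := Y) hs (by omega) (by omega) hβ.1 hγ hα hd
  have hfac : (inRel I).map Prod.fst = inFac H := by
    rw [inRel, List.map_ofFn]; rfl
  have hagg := aggCmd_tri (O := O) (W := W) (X := X) hf β.reverse (fun ⟨a, ha⟩ => hidem ⟨a, hβ.1.mem_iff.2
    (List.mem_reverse.1 ha)⟩) (by omega) hE
  rw [hfac] at hagg
  refine Tri.seq hagg ?_
  rintro h1 ⟨F1, V, hV, hE1, hq⟩
  rw [joinL_inRel, List.foldl_reverse] at hq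
  have hq' : joinL (V.map Prod.snd) = query O α I := by
    -- The eliminations evaluate the query of `β`; equivalence turns this into the answer for `α`.
    rw [hβ.2 I, hq]; rfl
  have hset : γ.toFinset = outSet α := by
    ext a
    rw [List.mem_toFinset, hγ.mem_iff]
    simp [outList, outSet]
  obtain ⟨l₀, j1, j2, j3⟩ := hs.join ∅ hs.empty
  have hJ : JTab I M Y h1 ∅ := JTab.congr ⟨l₀, j1, j2, by omega⟩ F1 (keyJ_notMem_above ∅ 0)
  have hfst : (γ.map fun a => (a, false)).map Prod.fst = γ := by
    rw [List.map_map]; exact List.map_id γ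
  -- Answer tuples agree on the output attributes with a row of each relation, so they lie in a
  -- local join, which is finite. Only then does `Nat.card` in `outSize` give the true number of
  -- rows.
  have hfin : {t | proj (outSet α) t = t ∧ (query O α I t).isSome}.Finite := by
    refine (joinFin I (outSet α)).finite_toSet.subset fun t ht => ?_
    rw [Finset.mem_coe, mem_joinFin]
    refine ⟨ht.1, fun j _ => ?_⟩
    have h2 := hE1.filt t (by rw [hq']; exact ht.2) j
    rw [hfst, hset] at h2
    obtain ⟨r, hr⟩ := h2
    refine Finset.mem_image.2 ⟨r, Finset.mem_univ _, proj_eq_proj_iff.2 fun a ha => ?_⟩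
    exact (hr a (Finset.mem_inter.1 ha).2 (Finset.mem_inter.1 ha).1).symm
  have hcard : hfin.toFinset.card = outSize O α I := by
    rw [outSize, Nat.card_congr (answerEquiv O α I), ← Set.ncard_eq_toFinset_card _ hfin]
    rfl
  rw [← hV]
  have hout := outCmd_tri (O := O) (W := W) (X := X) hf γ (by omega) hE1 hJ (Z := hfin.toFinset)
    (fun t => by rw [hset, hq']; simp) (by omega)
  refine Tri.seq hout ?_
  rintro h2 ⟨F2, l, hT⟩
  rw [hset, hq'] at hT
  have hm : ∀ t, t ∈ l ↔ proj (outSet α) t = t ∧ (query O α I t).isSome := fun t => by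
    rw [hT.mem, onSch_isSome]
  have hlen : l.length = outSize O α I := by
    rw [← hcard, ← List.toFinset_card_of_nodup hT.nodup]
    congr 1
    ext t
    simp [hm]
  refine (writeCmd_tri hf (hE1.pow.congr F2 (baseKey_notMem_above _)) hT (by omega)).mono le_rfl ?_
  rintro h3 ⟨a1, a2⟩ τ hτ
  refine isOutput_of_list hT.nodup hm hτ a1 fun i hi => ⟨(a2 i hi).1, ?_⟩
  rw [(a2 i hi).2, onSch_of_proj ((hm _).1 (List.getElem_mem hi)).1]

end Plan

end Ajar

end

noncomputable section

namespace Ajar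

/-! ### The complete program and the word size. -/

section Main

variable {n m : ℕ} {ι K : Type*} {H : Hypergraph n m} [CommMonoidWithZero K]
  {W B X : ℕ} {I : Instance H K} {O : PlusOps ι K} {α : Ordering n ι}

open Classical in
/-- The orders of elimination that compute the query. -/
def plans (H : Hypergraph n m) (O : PlusOps ι K) (α : Ordering n ι) :
    List (Ordering n ι × List (Fin n)) :=
  -- This list is formed outside the machine. The program depends on the hypergraph, the operators
  -- and `α`, so no decision procedure for equivalence is needed.
  (α.permutations.filter fun β => Equivalent H O α β) ×ˢ (outList α).permutations

open Classical in
theorem mem_plans {p : Ordering n ι × List (Fin n)} :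
    p ∈ plans H O α ↔ Equivalent H O α p.1 ∧ p.2.Perm (outList α) := by
  rw [plans, List.mem_product, List.mem_filter, List.mem_permutations, List.mem_permutations,
    decide_eq_true_eq]
  exact and_congr_left fun _ => ⟨fun h => h.2, fun h => ⟨h.1.symm, h⟩⟩

/-- The program that evaluates the query. -/
def queryCmd (H : Hypergraph n m) (O : PlusOps ι K) (α : Ordering n ι) : Cmd ι :=
  .seq (inputCmd H) (.seq (searchCmd H (needOf H) (plans H O α))
    (firstDone m (needOf H) (runCmd H) (plans H O α)))

theorem queryCmd_tri (hB : 1 ≤ B) (hIB : I.FitsIn B)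
    (hW : ∀ M, 1 ≤ M → M ≤ B + 1 → Fit n m W M) (hBW : n + m + B + 8 < W)
    {row : ∀ j, Fin (I.card j) ≃ I.Rows j}
    {h : HS n m K} (hr : Raw I row h) (hu : ∀ d, Unused h d)
    (hα : α.attrs.Nodup) (hidem : (∃ a, (a, Op.prod) ∈ α) → ∀ x : K, x * x = x)
    {β : Ordering n ι} {γ : List (Fin n)} {N : ℕ} (hβ : Equivalent H O α β)
    (hγ : γ.Perm (outList α)) (hN : 1 ≤ N) (hplan : PlanCost H I (elimOrder β γ) N)
    (hX : 2 * I.inSize + 16 * N + 2 * outSize O α I + 1 ≤ X) :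
    Tri O W (queryCmd H O α) h X fun h' => ∀ τ, Sim τ h' → IsOutput O α I τ := by
  refine Tri.seq (inputCmd_tri hB hIB hW hBW hr hu (by omega)) ?_
  rintro h1 ⟨M, hM1, hMB, hM, hi, hu1⟩
  have hf := hW M hM1 hMB
  refine Tri.seq (searchCmd_tri (need := needOf H) hf hM hN ⟨(β, γ), mem_plans.2 ⟨hβ, hγ⟩, hplan⟩ hi hu1 (by omega)) ?_
  rintro h2 ⟨N', hs, hN', p, hp, hd⟩
  -- The plan that is run need not be the optimal one: any plan all of whose local joins are stored
  -- has tables of length at most `N'`, and `N' ≤ 2 * N`.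
  refine firstDone_tri (hf.small (by omega)) (by omega) (fun q hq hdq => ?_)
    fun hnone => absurd hd (hnone p hp)
  obtain ⟨hq1, hq2⟩ := mem_plans.1 hq
  exact runCmd_tri hf hs hq1 hq2 hα hidem hdq (by omega)

/-- The state of the structured language that is represented by a machine state. -/
def State.toHS (n m : ℕ) (σ : State K) : HS n m K :=
  ⟨σ.reg, fun a => σ.arr a.word, fun a => σ.annArr a.anno⟩

theorem IsInput.raw {row : ∀ j, Fin (I.card j) ≃ I.Rows j} {σ : State K} (hσ : IsInput I σ row) :
    Raw I row (σ.toHS n m) := by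
  refine ⟨fun j a i hi => ?_, fun j => ?_, fun a => ?_, fun j i hi => ?_⟩
  · refine (hσ.column j a i).trans ?_
    rw [rowTup]
    by_cases ha : a ∈ H.edge j
    · rw [dif_pos ⟨ha, hi⟩, dif_pos ha]
    · rw [dif_neg fun h => ha h.1, dif_neg ha]
  · exact (hσ.card j).trans (dif_pos j.2)
  · exact (hσ.dom a).trans (dif_pos a.2)
  · exact (hσ.annotations j i).trans (dif_pos hi)

/-- The base satisfies `M ≤ B + 1 ≤ B ^ 2`, which doubles the exponent `2 * n + 2`, and the constant
factor `n + m + 8` is below `2 ^ (n + m + 8)`. -/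
theorem fit_of_pow_le {M : ℕ} (hB : 2 ≤ B) (hW : B ^ (n + m + 8 + 2 * (2 * n + 2)) ≤ W)
    (hM1 : 1 ≤ M) (hM : M ≤ B + 1) : Fit n m W M := by
  refine ⟨hM1, le_trans ?_ hW⟩
  have hMB : M ≤ B ^ 2 := by nlinarith
  rw [pow_add B, pow_mul B 2]
  refine Nat.mul_le_mul ?_ (Nat.pow_le_pow_left hMB _)
  exact (Nat.lt_two_pow_self).le.trans (Nat.pow_le_pow_left hB _)

theorem lt_of_pow_le (hB : 2 ≤ B) (hW : B ^ (n + m + 8 + 2 * (2 * n + 2)) ≤ W) :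
    n + m + B + 8 < W := by
  refine lt_of_lt_of_le ?_ ((Nat.pow_le_pow_right (by omega) (by omega :
    n + m + 8 + 1 ≤ n + m + 8 + 2 * (2 * n + 2))).trans hW)
  have h1 : n + m + 8 < B ^ (n + m + 8) :=
    (Nat.lt_two_pow_self).trans_le (Nat.pow_le_pow_left hB _)
  rw [pow_succ]
  nlinarith

omit [CommMonoidWithZero K] in
theorem AGHD.fhw_eq_zero (G : AGHD H α) (hI : I.inSize = 0) : G.fhw I = 0 := by
  have : ∀ t, G.coverValue I t = 0 := fun t => by
    rw [AGHD.coverValue]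
    refine le_antisymm (Real.sInf_nonpos ?_) (Real.sInf_nonneg ?_) <;>
    · rintro r ⟨x, -, -, rfl⟩
      simp [hI, Real.logb]
  simp [AGHD.fhw, this]

/-- Absorbs the additive constants of the running time. For the empty input every width is `0`, and
`0 ^ 0 = 1` supplies the unit. -/
theorem one_le_inSize_add_rpow {w : ℝ} (hw : w ∈ validWidths O α I) :
    1 ≤ (I.inSize : ℝ) + (I.inSize : ℝ) ^ w := by
  rcases Nat.eq_zero_or_pos I.inSize with h0 | h0
  · obtain ⟨β, -, G, -, rfl⟩ := hw
    simp [G.fhw_eq_zero h0]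
  · have h1 : (1 : ℝ) ≤ I.inSize := by exact_mod_cast h0
    have h2 : 0 ≤ (I.inSize : ℝ) ^ w := by positivity
    linarith

end Main

end Ajar

end

theorem mainTheorem11 {n m : ℕ} (H : Ajar.Hypergraph n m) {ι K : Type*} [CommMonoidWithZero K]
    (O : Ajar.PlusOps ι K) (α : Ajar.Ordering n ι) (hα : α.attrs.Nodup)
    (hidem : (∃ a, (a, Ajar.Op.prod) ∈ α) → ∀ x : K, x * x = x) :
    ∃ (P : Ajar.Cmd ι) (C : ℝ) (k c : ℕ), ∀ I : Ajar.Instance H K,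
      ∃ w : ℝ, IsLeast (Ajar.validWidths O α I) w ∧
        ∀ B W : ℕ, 2 ≤ B → I.FitsIn B → B ^ c ≤ W →
          ∀ (row : ∀ j, Fin (I.card j) ≃ I.Rows j) (σ : Ajar.State K), Ajar.IsInput I σ row →
            ∃ (τ : Ajar.State K) (T : ℕ), Ajar.Exec O W P σ τ T ∧ Ajar.IsOutput O α I τ ∧
              (T : ℝ) ≤ C * ((I.inSize : ℝ) + (I.inSize : ℝ) ^ w + (Ajar.outSize O α I : ℝ)) *
                (1 + Real.log I.inSize) ^ k := by
  -- By `N ≤ 1 + IN ^ w` the factor is at most `2 IN + 16 IN ^ w + 2 OUT + 17`. The constant `17` is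
  -- at most `17 (IN + IN ^ w)`, and `16 + 17 = 33`. The exponent of the logarithm is `0`, thanks to
  -- direct addressing.
  refine ⟨Ajar.queryCmd H O α, (Ajar.queryCmd H O α).size * 33, 0,
    n + m + 8 + 2 * (2 * n + 2), fun I => ?_⟩
  obtain ⟨w, hw, β, γ, N, hβ, hγ, hplan, hN, hNw⟩ := Ajar.exists_isLeast_validWidths O hα I
  refine ⟨w, hw, fun B W hB hIB hW row σ hσ => ?_⟩
  obtain ⟨τ, T, h', h1, h2, h3, h4⟩ := Ajar.queryCmd_tri (O := O) (by omega) hIB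
    (fun M hM1 hMB => Ajar.fit_of_pow_le hB hW hM1 hMB) (Ajar.lt_of_pow_le hB hW) hσ.raw
    (fun d k i => hσ.arr_rest _ i (by simp only [Ajar.Nm.word]; omega)) hα hidem hβ hγ hN hplan le_rfl σ
    ⟨fun _ _ => rfl, fun _ => rfl, fun _ => rfl⟩
  refine ⟨τ, T, h1, h4 τ h3, ?_⟩
  have hone := Ajar.one_le_inSize_add_rpow hw.1
  have hpos : 0 ≤ (I.inSize : ℝ) ^ w := by positivity
  have hN' : (N : ℝ) ≤ 1 + (I.inSize : ℝ) ^ w := hNw.trans (max_le (by linarith) (by linarith))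
  have hout : (0 : ℝ) ≤ Ajar.outSize O α I := Nat.cast_nonneg _
  have hin : (0 : ℝ) ≤ I.inSize := Nat.cast_nonneg _
  have hT : (T : ℝ) ≤ (Ajar.queryCmd H O α).size *
      (2 * I.inSize + 16 * N + 2 * Ajar.outSize O α I + 1) := by exact_mod_cast h2
  rw [pow_zero, mul_one, mul_assoc]
  refine hT.trans (mul_le_mul_of_nonneg_left ?_ (Nat.cast_nonneg _))
  linarith
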